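/- Let $k$ be a field. All algebras are associative $k$-algebras, not necessarily unital, non-zero and non-degenerate (left and right multiplication by an element determine it); $M(R)$ is the multiplier algebra of $R$, i.e. the pairs $(l,r)$ of linear maps $R\to R$ with $a\,l(b)=r(a)\,b$, and $\otimes=\otimes_k$. A regular multiplier Hopf algebra is an algebra $A$ with a coassociative non-degenerate homomorphism $\Delta:A\to M(A\otimes A)$ such that $a\otimes b\mapsto \Delta(a)(1\otimes b)$, $(a\otimes 1)\Delta(b)$, $\Delta(a)(b\otimes 1)$, $(1\otimes a)\Delta(b)$ induce bijections of $A\otimes A$; it has a counit $\varepsilon$ and a bijective antipode $S$. It is an algebraic quantum group if there is a functional $\varphi\ne0$ with $(\iota\otimes\varphi)(\Delta(a)(b\otimes1))=\varphi(a)b$ for all $a,b\in A$ ($\varphi$ is then called left invariant). Let $(A,\Delta)$ be an algebraic quantum group, $\varphi\neq0$ a left invariant functional, $\psi=\varphi\circ S$, and $(X,\alpha)$ a right $A$-Galois object: $\alpha:X\to M(X\otimes A)$ is an injective homomorphism with $\alpha(X)(1\otimes A)\subseteq X\otimes A$, $(1\otimes A)\alpha(X)\subseteq X\otimes A$, $(X\otimes1)\alpha(X)\subseteq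 X\otimes A$ and $(\alpha\otimes\iota)\alpha=(\iota\otimes\Delta)\alpha$; the only $f\in M(X)$ with $\alpha(f)=f\otimes1$ are the scalars; and $V:X\otimes X\to X\otimes A$, $x\otimes y\mapsto(x\otimes1)\alpha(y)$, is bijective. We write $\alpha(x)=x_{(0)}\otimes x_{(1)}$. Then the following objects exist and are determined by the stated identities. (1) $W:X\otimes X\to X\otimes A$, $x\otimes y\mapsto\alpha(x)(y\otimes1)$, is bijective, and for $a\in A$ there is $\beta(a)\in M(X\otimes X)$ with $(x\otimes1)\beta(a)=V^{-1}(x\otimes a)$ and $\beta(a)(1\otimes y)=W^{-1}(y\otimes S(a))$. There is a faithful functional $\varphi_X$ on $X$ with $(\iota\otimes\varphi)\alpha(x)=\varphi_X(x)1$, and an algebra automorphism $\sigma_X$ of $X$ with $\varphi_X(y\,\sigma_X(x))=\varphi_X(xy)$. Put $\hat A=\{\varphi(\,\cdot\,a)\mid a\in A\}$ and $\hat X=\{\varphi_X(\,\cdot\,x)\mid x\in X\}$. Then $b\mapsto\psi(b\,\cdot\,)$ is a bijection $A\to\hat A$; put $\hat\varphi(\psi(b\,\cdot\,))=\varepsilon(b)$.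 The modular element of $\hat A$ is the functional $\hat\delta$ on $A$ with $\hat\varphi(\omega_1(\,\cdot\,a))=\hat\varphi(\omega_1)\hat\delta(a)$ for $\omega_1\in\hat A$, $a\in A$; one has $\hat\delta\cdot x:=(\iota\otimes\hat\delta)\alpha(x)\in X$, and we put $\theta_X(x)=\sigma_X(\hat\delta\cdot x)$. (2) $(\omega\cdot\omega_1)(x)=(\omega\otimes\omega_1)(\alpha(x))$ defines a right action of $\hat A$ on $\hat X$; $\hat S(\omega_1)=\omega_1\circ S$ is a bijection of $\hat A$, and we put $\omega_1\cdot\omega:=\omega\cdot\hat S^{-1}(\omega_1)$; $[\omega,\omega']_{\hat A}(a)=(\omega\otimes\omega')(\beta(a))$ defines a $k$-bilinear form $\hat X\times\hat X\to\hat A$; and $\theta_X(\omega):=\omega\circ\theta_X$ defines a bijection of $\hat X$. (3) Let $[\omega,\omega']_B$ be the operator $\omega''\mapsto\omega\cdot[\omega',\omega'']_{\hat A}$ on $\hat X$. The span $B$ of these operators is an algebra under composition, and $\omega\otimes\omega'\mapsto[\omega,\omega']_B$ induces a linear bijection $\hat X\otimes_{\hat A}\hat X\to B$, where $\hat X\otimes_{\hat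 A}\hat X$ is the quotient of $\hat X\otimes\hat X$ by the span of the elements $\omega\cdot\omega_1\otimes\omega'-\omega\otimes\omega_1\cdot\omega'$. (4) There is a comultiplication $\Delta_B:B\to M(B\otimes B)$ with $$\Delta_B([\omega,\omega']_B)=[\omega^{(1)},\omega'^{(2)}]_B\otimes[\omega^{(2)},\omega'^{(1)}]_B ,$$ where $\omega^{(1)}\otimes\omega^{(2)}$ denotes the functional $x\otimes y\mapsto\omega(xy)$ on $X\otimes X$. That is, $\Delta_B([\omega,\omega']_B)$ acts on $\hat X\otimes\hat X$ by the operator $\omega''\otimes\omega'''\mapsto\omega^{(1)}\cdot[\omega'^{(2)},\omega'']_{\hat A}\otimes\omega^{(2)}\cdot[\omega'^{(1)},\omega''']_{\hat A}$, whose value at $x\otimes y$ is $\omega(x_{(0)}y_{(0)})\,\omega'(J_{\omega'''}(y_{(1)})J_{\omega''}(x_{(1)}))$ with $J_{\omega}(a)=(\iota\otimes\omega)(\beta(a))\in X$. (5) $(B,\Delta_B)$ is an algebraic quantum group. Its counit is $\varepsilon_B([\omega,\omega']_B)=\omega(1)\omega'(1)$, where $\omega(1):=\varphi_X(x)$ for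 $\omega=\varphi_X(\,\cdot\,x)$; its antipode is $S_B([\omega,\omega']_B)=[\theta_X(\omega'),\omega]_B$. (6) There is a non-zero functional $\psi_X$ on $X$ with $(\psi_X\otimes\iota)\alpha(x)=\psi_X(x)1$ for all $x\in X$. For every such $\psi_X$, the map $x\mapsto\psi_X(\,\cdot\,x)$ is a bijection $X\to\hat X$, and $\varphi_B([\omega',\psi_X(\,\cdot\,x)]_B)=\omega'(x)$ defines a non-zero left invariant functional $\varphi_B$ on $B$. -/

import Mathlib

open scoped TensorProduct

namespace GaloisReflection

noncomputable section

universe u v w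

/-! ### Non-degenerate algebras and multipliers

Algebras over the field `k` are associative and need not have a unit. -/

/-- Left and right multiplication operators determine the element. -/
structure IsNondegenerate (R : Type*) [NonUnitalRing R] : Prop where
  left : ∀ a : R, (∀ b : R, a * b = 0) → a = 0
  right : ∀ b : R, (∀ a : R, a * b = 0) → b = 0

/-- The multiplier algebra `M(R)`: couples `(l, r)` of linear maps with `a * l b = r a * b`.
The product is `(l, r) (l', r') = (l ∘ l', r' ∘ r)`, which is why the second factor carries the
opposite product. -/
def multiplierAlgebra (k : Type u) [Field k] (R : Type v) [NonUnitalRing R] [Module k R]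
    [IsScalarTower k R R] [SMulCommClass k R R] :
    Subalgebra k (Module.End k R × (Module.End k R)ᵐᵒᵖ) where
  carrier := {m | ∀ a b : R, a * m.1 b = m.2.unop a * b}
  mul_mem' := by
    intro m n hm hn a b
    simp only [Prod.fst_mul, Prod.snd_mul, MulOpposite.unop_mul, Module.End.mul_apply]
    rw [hm, hn]
  add_mem' := by
    intro m n hm hn a b
    simp only [Prod.fst_add, Prod.snd_add, MulOpposite.unop_add, LinearMap.add_apply,
      mul_add, add_mul]
    rw [hm, hn]
  algebraMap_mem' := by
    intro c a b
    simp [Module.algebraMap_end_apply, mul_smul_comm, smul_mul_assoc]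

/-- `M(R)` as a unital algebra. -/
abbrev Mult (k : Type u) [Field k] (R : Type v) [NonUnitalRing R] [Module k R]
    [IsScalarTower k R R] [SMulCommClass k R R] : Type v :=
  ↥(multiplierAlgebra k R)

namespace Mult

variable {k : Type u} [Field k]
  {R : Type v} [NonUnitalRing R] [Module k R] [IsScalarTower k R R] [SMulCommClass k R R]
  {T : Type w} [NonUnitalRing T] [Module k T] [IsScalarTower k T T] [SMulCommClass k T T]

/-- `x ↦ m x`. -/
def lmul (m : Mult k R) : R →ₗ[k] R := m.1.1

/-- `x ↦ x m`. -/
def rmul (m : Mult k R) : R →ₗ[k] R := m.1.2.unop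

/-- The canonical homomorphism `R → M(R)`. -/
def of (k : Type u) [Field k] {R : Type v} [NonUnitalRing R] [Module k R]
    [IsScalarTower k R R] [SMulCommClass k R R] (a : R) : Mult k R :=
  ⟨(LinearMap.mulLeft k a, MulOpposite.op (LinearMap.mulRight k a)), fun x y => by
    simp [mul_assoc]⟩

/-- The multiplier `m ⊗ n` of `R ⊗ T`. -/
def tmul (m : Mult k R) (n : Mult k T) : Mult k (R ⊗[k] T) :=
  ⟨(TensorProduct.map m.lmul n.lmul, MulOpposite.op (TensorProduct.map m.rmul n.rmul)), by
    intro x y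
    simp only [MulOpposite.unop_op]
    induction x with
    | zero => simp
    | add x x' hx hx' => rw [add_mul, map_add, add_mul, hx, hx']
    | tmul a b =>
      induction y with
      | zero => simp
      | add y y' hy hy' => rw [map_add, mul_add, mul_add, hy, hy']
      | tmul c d =>
        simp only [TensorProduct.map_tmul, Algebra.TensorProduct.tmul_mul_tmul]
        rw [show a * m.lmul c = m.rmul a * c from m.2 a c,
          show b * n.lmul d = n.rmul b * d from n.2 b d]⟩

end Mult

section Slices

variable {k : Type u} [Field k] {M : Type v} [AddCommGroup M] [Module k M]
  {N : Type w} [AddCommGroup N] [Module k N]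

/-- `f ⊗ ι : M ⊗ N → N`. -/
def sliceL (f : Module.Dual k M) : M ⊗[k] N →ₗ[k] N :=
  (TensorProduct.lid k N).toLinearMap ∘ₗ f.rTensor N

/-- `ι ⊗ g : M ⊗ N → M`. -/
def sliceR (g : Module.Dual k N) : M ⊗[k] N →ₗ[k] M :=
  (TensorProduct.rid k M).toLinearMap ∘ₗ g.lTensor M

end Slices

/-- The map `u ↦ f(· u)` from `R` to its dual. -/
def rightTwist {k : Type u} [Field k] {R : Type v} [NonUnitalRing R] [Module k R]
    [IsScalarTower k R R] [SMulCommClass k R R] (f : Module.Dual k R) :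
    R →ₗ[k] Module.Dual k R :=
  (LinearMap.mul k R).flip.compr₂ f

/-! ### Regular multiplier Hopf algebras and algebraic quantum groups -/

/-- A regular multiplier Hopf algebra structure on `A`. The four linear bijections are the maps
induced by the comultiplication, and are determined by it. -/
structure RegularMultiplierHopfAlgebra (k : Type u) [Field k] (A : Type v) [NonUnitalRing A]
    [Module k A] [IsScalarTower k A A] [SMulCommClass k A A] where
  nontrivial : Nontrivial A
  nondegenerate : IsNondegenerate A
  /-- The comultiplication `Δ`. -/
  comul : A →ₙₐ[k] Mult k (A ⊗[k] A)
  /-- `Δ(A)(A ⊗ A) = A ⊗ A`. -/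
  comul_left : Submodule.span k {t | ∃ a s, t = (comul a).lmul s} = ⊤
  /-- `(A ⊗ A)Δ(A) = A ⊗ A`. -/
  comul_right : Submodule.span k {t | ∃ a s, t = (comul a).rmul s} = ⊤
  /-- `a ⊗ b ↦ Δ(a)(1 ⊗ b)`. -/
  TΔ2 : A ⊗[k] A ≃ₗ[k] A ⊗[k] A
  TΔ2_spec : ∀ a b, Mult.of k (TΔ2 (a ⊗ₜ b)) = comul a * Mult.tmul 1 (Mult.of k b)
  /-- `a ⊗ b ↦ (a ⊗ 1)Δ(b)`. -/
  T1Δ : A ⊗[k] A ≃ₗ[k] A ⊗[k] A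
  T1Δ_spec : ∀ a b, Mult.of k (T1Δ (a ⊗ₜ b)) = Mult.tmul (Mult.of k a) 1 * comul b
  /-- `a ⊗ b ↦ Δ(a)(b ⊗ 1)`. -/
  TΔ1 : A ⊗[k] A ≃ₗ[k] A ⊗[k] A
  TΔ1_spec : ∀ a b, Mult.of k (TΔ1 (a ⊗ₜ b)) = comul a * Mult.tmul (Mult.of k b) 1
  /-- `a ⊗ b ↦ (1 ⊗ a)Δ(b)`. -/
  T2Δ : A ⊗[k] A ≃ₗ[k] A ⊗[k] A
  T2Δ_spec : ∀ a b, Mult.of k (T2Δ (a ⊗ₜ b)) = Mult.tmul 1 (Mult.of k a) * comul b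
  /-- Coassociativity in covered form:
  `(a ⊗ 1 ⊗ 1) (Δ ⊗ ι)(Δ(b)(1 ⊗ c)) = (ι ⊗ Δ)((a ⊗ 1)Δ(b)) (1 ⊗ 1 ⊗ c)`. -/
  coassoc : ∀ a b c : A,
    T1Δ.toLinearMap.rTensor A ((TensorProduct.assoc k A A A).symm (a ⊗ₜ TΔ2 (b ⊗ₜ c))) =
      (TensorProduct.assoc k A A A).symm
        (TΔ2.toLinearMap.lTensor A (TensorProduct.assoc k A A A (T1Δ (a ⊗ₜ b) ⊗ₜ c)))

namespace RegularMultiplierHopfAlgebra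

variable {k : Type u} [Field k] {A : Type v} [NonUnitalRing A] [Module k A]
  [IsScalarTower k A A] [SMulCommClass k A A] (H : RegularMultiplierHopfAlgebra k A)

/-- `(ι ⊗ φ)(Δ(a)(b ⊗ 1)) = φ(a) b`. -/
def IsLeftInvariant (φ : Module.Dual k A) : Prop :=
  ∀ a b, sliceR φ (H.TΔ1 (a ⊗ₜ b)) = φ a • b

/-- A regular multiplier Hopf algebra is an algebraic quantum group if it has a non-zero left
invariant functional. -/
def IsAlgebraicQuantumGroup : Prop :=
  ∃ φ : Module.Dual k A, φ ≠ 0 ∧ H.IsLeftInvariant φ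

/-- The counit: `(ε ⊗ ι)(Δ(a)(1 ⊗ b)) = ab` and `(ι ⊗ ε)((a ⊗ 1)Δ(b)) = ab`. -/
structure IsCounit (ε : A →ₙₐ[k] k) : Prop where
  left : ∀ a b, sliceL (ε : A →ₗ[k] k) (H.TΔ2 (a ⊗ₜ b)) = a * b
  right : ∀ a b, sliceR (ε : A →ₗ[k] k) (H.T1Δ (a ⊗ₜ b)) = a * b

/-- The antipode, relative to the counit `ε`: a bijective anti-homomorphism with
`m((S ⊗ ι)(Δ(a)(1 ⊗ b))) = ε(a) b` and `m((ι ⊗ S)((a ⊗ 1)Δ(b))) = ε(b) a`. -/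
structure IsAntipode (ε : A →ₙₐ[k] k) (S : A ≃ₗ[k] A) : Prop where
  map_mul : ∀ a b, S (a * b) = S b * S a
  left : ∀ a b, LinearMap.mul' k A (S.toLinearMap.rTensor A (H.TΔ2 (a ⊗ₜ b))) = ε a • b
  right : ∀ a b, LinearMap.mul' k A (S.toLinearMap.lTensor A (H.T1Δ (a ⊗ₜ b))) = ε b • a

end RegularMultiplierHopfAlgebra

/-! ### Coactions and Galois objects -/

/-- A right coaction of `A` on `X`. The maps `T1`, `T2` are determined by `α`. -/
structure RightCoaction {k : Type u} [Field k] {A : Type v} [NonUnitalRing A] [Module k A]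
    [IsScalarTower k A A] [SMulCommClass k A A] (H : RegularMultiplierHopfAlgebra k A)
    (X : Type w) [NonUnitalRing X] [Module k X] [IsScalarTower k X X] [SMulCommClass k X X] where
  nontrivial : Nontrivial X
  nondegenerate : IsNondegenerate X
  /-- The coaction `α : X → M(X ⊗ A)`. -/
  α : X →ₙₐ[k] Mult k (X ⊗[k] A)
  injective : Function.Injective α
  /-- `x ⊗ a ↦ α(x)(1 ⊗ a)`. -/
  T1 : X ⊗[k] A →ₗ[k] X ⊗[k] A
  T1_spec : ∀ x a, Mult.of k (T1 (x ⊗ₜ a)) = α x * Mult.tmul 1 (Mult.of k a)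
  /-- `x ⊗ a ↦ (1 ⊗ a)α(x)`. -/
  T2 : X ⊗[k] A →ₗ[k] X ⊗[k] A
  T2_spec : ∀ x a, Mult.of k (T2 (x ⊗ₜ a)) = Mult.tmul 1 (Mult.of k a) * α x
  /-- `(α ⊗ ι)α = (ι ⊗ Δ)α`, covered on the right by `1 ⊗ Δ(a)(1 ⊗ b)`; these elements span
  `1 ⊗ A ⊗ A`. On the right, `(ι ⊗ Δ)(α(x)) (1 ⊗ Δ(a)(1 ⊗ b)) = (ι ⊗ Δ)(α(x)(1 ⊗ a)) (1 ⊗ 1 ⊗ b)`;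
  on the left, `(α ⊗ ι)(α(x)) (1 ⊗ p ⊗ q)` is obtained from `x ⊗ p ⊗ q` by applying `T1` to the
  legs one and three, and then to the legs one and two. -/
  coassoc : ∀ (x : X) (a b : A),
    T1.rTensor A (TensorProduct.rightComm k X A A (T1.rTensor A
        (TensorProduct.rightComm k X A A
          ((TensorProduct.assoc k X A A).symm (x ⊗ₜ H.TΔ2 (a ⊗ₜ b)))))) =
      (TensorProduct.assoc k X A A).symm
        (H.TΔ2.toLinearMap.lTensor X (TensorProduct.assoc k X A A (T1 (x ⊗ₜ a) ⊗ₜ b)))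

/-- `α(f) = f ⊗ 1` for `f ∈ M(X)`, where `α` is extended to `M(X)` by
`α(f x) = α(f) α(x)` and `α(x f) = α(x) α(f)`. -/
def RightCoaction.IsCoinvariant {k : Type u} [Field k] {A : Type v} [NonUnitalRing A]
    [Module k A] [IsScalarTower k A A] [SMulCommClass k A A]
    {H : RegularMultiplierHopfAlgebra k A}
    {X : Type w} [NonUnitalRing X] [Module k X] [IsScalarTower k X X] [SMulCommClass k X X]
    (C : RightCoaction H X) (f : Mult k X) : Prop :=
  ∀ x : X, C.α (f.lmul x) = Mult.tmul f 1 * C.α x ∧ C.α (f.rmul x) = C.α x * Mult.tmul f 1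

/-- A right Galois object: the coinvariants are the scalars, the coaction is reduced, and the
Galois map `V : x ⊗ y ↦ (x ⊗ 1)α(y)` is a bijection `X ⊗ X → X ⊗ A`. -/
structure GaloisObject {k : Type u} [Field k] {A : Type v} [NonUnitalRing A] [Module k A]
    [IsScalarTower k A A] [SMulCommClass k A A] (H : RegularMultiplierHopfAlgebra k A)
    (X : Type w) [NonUnitalRing X] [Module k X] [IsScalarTower k X X] [SMulCommClass k X X]
    extends RightCoaction H X where
  coinvariant_scalar : ∀ f : Mult k X, toRightCoaction.IsCoinvariant f →
    ∃ c : k, f = algebraMap k (Mult k X) c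
  V : X ⊗[k] X ≃ₗ[k] X ⊗[k] A
  V_spec : ∀ x y, Mult.of k (V (x ⊗ₜ y)) = Mult.tmul (Mult.of k x) 1 * α y

variable {k : Type u} [Field k] {A : Type v} [NonUnitalRing A] [Module k A]
  [IsScalarTower k A A] [SMulCommClass k A A] {H : RegularMultiplierHopfAlgebra k A}
  {X : Type w} [NonUnitalRing X] [Module k X] [IsScalarTower k X X] [SMulCommClass k X X]

/-- An invariant functional on `X`: `(f ⊗ ι)α(x) = f(x) 1` in `M(A)`. -/
def RightCoaction.IsInvariant (C : RightCoaction H X) (f : Module.Dual k X) : Prop :=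
  ∀ (x : X) (a : A), sliceL f (C.T1 (x ⊗ₜ a)) = f x • a ∧ sliceL f (C.T2 (x ⊗ₜ a)) = f x • a

/-- The space `{f(· u) | u ∈ R}` of functionals on `R`. -/
def RestrictedDual {k : Type u} [Field k] {R : Type v} [NonUnitalRing R] [Module k R]
    [IsScalarTower k R R] [SMulCommClass k R R] (f : Module.Dual k R) : Type (max u v) :=
  ↥(LinearMap.range (rightTwist f))

namespace RestrictedDual

variable {R : Type v} [NonUnitalRing R] [Module k R] [IsScalarTower k R R] [SMulCommClass k R R]

instance (f : Module.Dual k R) : AddCommGroup (RestrictedDual f) :=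
  inferInstanceAs (AddCommGroup ↥(LinearMap.range (rightTwist f)))

instance (f : Module.Dual k R) : Module k (RestrictedDual f) :=
  inferInstanceAs (Module k ↥(LinearMap.range (rightTwist f)))

/-- The inclusion into the full dual. -/
def incl (f : Module.Dual k R) : RestrictedDual f →ₗ[k] Module.Dual k R :=
  (LinearMap.range (rightTwist f)).subtype

/-- The surjection `u ↦ f(· u)`. -/
def mk (f : Module.Dual k R) : R →ₗ[k] RestrictedDual f :=
  (rightTwist f).rangeRestrict

instance (f : Module.Dual k R) : CoeFun (RestrictedDual f) (fun _ => R → k) :=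
  ⟨fun ω => ⇑(incl f ω)⟩

end RestrictedDual

/-- The underlying space of the dual, `{φ(· a) | a ∈ A}`. -/
abbrev Ahat (φ : Module.Dual k A) : Type (max u v) := RestrictedDual φ

/-- `a ↦ φ(· a)` as a map onto the dual. -/
abbrev toAhat (φ : Module.Dual k A) : A →ₗ[k] Ahat φ := RestrictedDual.mk φ

/-! ### The structure maps of a Galois object -/

/-- The structure maps of `A`, its dual and `X` that enter the construction. Every field that is
not a proof is uniquely determined by the Galois object and `φ` through the identities listed. -/
structure StructureMaps (G : GaloisObject H X) (φ : Module.Dual k A) where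
  /-- The counit of `A`. -/
  ε : A →ₙₐ[k] k
  counit : H.IsCounit ε
  /-- The antipode of `A`. -/
  S : A ≃ₗ[k] A
  antipode : H.IsAntipode ε S
  /-- `W(x ⊗ y) = α(x)(y ⊗ 1)`. -/
  W : X ⊗[k] X ≃ₗ[k] X ⊗[k] A
  W_spec : ∀ x y, Mult.of k (W (x ⊗ₜ y)) = G.α x * Mult.tmul (Mult.of k y) 1
  /-- `β(a) ∈ M(X ⊗ X)` with `(x ⊗ 1)β(a) = V⁻¹(x ⊗ a)` and `β(a)(1 ⊗ y) = W⁻¹(y ⊗ S(a))`. -/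
  β : A →ₗ[k] Mult k (X ⊗[k] X)
  β_left : ∀ x a, Mult.tmul (Mult.of k x) 1 * β a = Mult.of k (G.V.symm (x ⊗ₜ a))
  β_right : ∀ y a, β a * Mult.tmul 1 (Mult.of k y) = Mult.of k (W.symm (y ⊗ₜ S a))
  /-- The functional `φ_X` with `(ι ⊗ φ)α(x) = φ_X(x) 1` in `M(X)`. -/
  φX : Module.Dual k X
  φX_left : ∀ x z, sliceR φ (W (x ⊗ₜ z)) = φX x • z
  φX_right : ∀ x z, sliceR φ (G.V (z ⊗ₜ x)) = φX x • z
  /-- `φ_X` is faithful. -/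
  φX_faithful_left : ∀ x, (∀ y, φX (x * y) = 0) → x = 0
  φX_faithful_right : ∀ x, (∀ y, φX (y * x) = 0) → x = 0
  /-- The modular automorphism of `φ_X`. -/
  σX : X ≃ₗ[k] X
  σX_mul : ∀ x y, σX (x * y) = σX x * σX y
  σX_spec : ∀ x y, φX (y * σX x) = φX (x * y)
  /-- The bijection `b ↦ ψ(b ·)` from `A` onto its dual, with `ψ = φ ∘ S`. -/
  psiHat : A ≃ₗ[k] Ahat φ
  psiHat_spec : ∀ b x, psiHat b x = φ (S (b * x))
  /-- The modular element of the dual, as a functional on `A`: if `φ̂` denotes the left invariant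
  functional `ψ(b ·) ↦ ε(b)` on the dual, then `(φ̂ ⊗ ι)Δ̂(ω) = φ̂(ω) δ̂`, that is,
  `φ̂(ω(· a)) = φ̂(ω) δ̂(a)`. Here `ω = φ(· c)`, so that `ω(· a) = φ(· ac)`. -/
  δhat : Module.Dual k A
  δhat_spec : ∀ a c, ε (psiHat.symm (toAhat φ (a * c))) = ε (psiHat.symm (toAhat φ c)) * δhat a
  /-- The action `x ↦ δ̂ · x = (ι ⊗ δ̂)α(x)`. -/
  δact : X →ₗ[k] X
  δact_spec : ∀ z x, z * δact x = sliceR δhat (G.V (z ⊗ₜ x))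

namespace StructureMaps

variable {G : GaloisObject H X} {φ : Module.Dual k A} (D : StructureMaps G φ)

/-- `θ_X(x) = σ_X(δ̂ · x)`. -/
def θX : X →ₗ[k] X := D.σX.toLinearMap ∘ₗ D.δact

/-- The restricted dual `{φ_X(· u) | u ∈ X}`. -/
abbrev Xhat : Type (max u w) := RestrictedDual D.φX

/-- `u ↦ φ_X(· u)` as a map onto the restricted dual. -/
abbrev hat : X →ₗ[k] D.Xhat := RestrictedDual.mk D.φX

/-- `(x, r) ↦ (ω ⊗ ι)α(x) ∈ A` with `ω = φ_X(· r)`. -/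
def leg : X →ₗ[k] X →ₗ[k] A :=
  (TensorProduct.mk k X X).compr₂ (sliceL D.φX ∘ₗ D.W.toLinearMap)

/-- `J u a = (ι ⊗ ω)(β(a)) ∈ X` with `ω = φ_X(· u)`, so that `(ω' ⊗ ω)(β(a)) = ω'(J u a)`
for every functional `ω'` on `X`. -/
def J (u : X) : A →ₗ[k] X :=
  sliceR D.φX ∘ₗ D.W.symm.toLinearMap ∘ₗ TensorProduct.mk k X A u ∘ₗ D.S.toLinearMap

/-- With `ω = φ_X(· p)`, the number `ω(x₍₀₎ y₍₀₎) ω'(J v y₍₁₎ * J u x₍₁₎)`. Writing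
`ω'' = φ_X(· u)`, `ω''' = φ_X(· v)` and letting `ω⁽¹⁾ ⊗ ω⁽²⁾` stand for the functional
`x ⊗ y ↦ ω(x y)`, this is
`(ω⁽¹⁾ · [ω'⁽²⁾, ω''])(x) (ω⁽²⁾ · [ω'⁽¹⁾, ω'''])(y)`, with the brackets in the dual of `A`.
Here `W(y ⊗ p) = y₍₀₎ p ⊗ y₍₁₎`, and `leg x r = φ_X(x₍₀₎ r) x₍₁₎`. -/
def comulValue (p : X) (ω' : D.Xhat) (u v x y : X) : k :=
  ω' (TensorProduct.lift
    ((LinearMap.mul k X).flip.compl₁₂ (D.J u ∘ₗ D.leg x) (D.J v)) (D.W (y ⊗ₜ p)))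

end StructureMaps

/-- The dual of `A` acting on the restricted dual of `X`, and the form with values in the dual
of `A`. Every field that is not a proof is uniquely determined by the identities listed. -/
structure DualStructure {G : GaloisObject H X} {φ : Module.Dual k A}
    (D : StructureMaps G φ) where
  /-- The right action `(ω · ω₁)(x) = (ω ⊗ ω₁)(α(x))`; with `ω₁ = φ(· a)` this is
  `(ω ⊗ φ)(α(x)(1 ⊗ a))`. -/
  act : D.Xhat →ₗ[k] Ahat φ →ₗ[k] D.Xhat
  act_spec : ∀ (ω : D.Xhat) (a : A) (x : X),
    act ω (toAhat φ a) x = ω (sliceR φ (G.T1 (x ⊗ₜ a)))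
  /-- The form `[ω, ω'](a) = (ω ⊗ ω')(β(a))`; with `ω' = φ_X(· u)` this is
  `(ω ⊗ φ_X)(β(a)(1 ⊗ u))`. -/
  form : D.Xhat →ₗ[k] D.Xhat →ₗ[k] Ahat φ
  form_spec : ∀ (ω : D.Xhat) (u : X) (a : A) (t : X ⊗[k] X),
    Mult.of k t = D.β a * Mult.tmul 1 (Mult.of k u) →
      form ω (D.hat u) a = ω (sliceR D.φX t)
  /-- The antipode of the dual of `A`, `Ŝ(ω₁) = ω₁ ∘ S`. -/
  Shat : Ahat φ ≃ₗ[k] Ahat φ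
  Shat_spec : ∀ (ω₁ : Ahat φ) (a : A),
    Shat ω₁ a = ω₁ (D.S a)
  /-- `θ_X` on the restricted dual, `θ_X(ω) = ω ∘ θ_X`. -/
  θhat : D.Xhat ≃ₗ[k] D.Xhat
  θhat_spec : ∀ (ω : D.Xhat) (x : X),
    θhat ω x = ω (D.θX x)

namespace DualStructure

variable {G : GaloisObject H X} {φ : Module.Dual k A} {D : StructureMaps G φ}
  (E : DualStructure D)

/-- The left action `ω₁ · ω = ω · Ŝ⁻¹(ω₁)`. -/
def leftAct (ω₁ : Ahat φ) (ω : D.Xhat) : D.Xhat := E.act ω (E.Shat.symm ω₁)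

/-- The operator `[ω, ω']_B : ω'' ↦ ω · [ω', ω'']` on the restricted dual. -/
def bracket (ω ω' : D.Xhat) : Module.End k D.Xhat := E.act ω ∘ₗ E.form ω'

/-- The kernel of `X̂ ⊗ X̂ → X̂ ⊗_Â X̂`. -/
def balancing : Submodule k (D.Xhat ⊗[k] D.Xhat) :=
  Submodule.span k {t | ∃ (ω ω' : D.Xhat) (ω₁ : Ahat φ),
    t = E.act ω ω₁ ⊗ₜ[k] ω' - ω ⊗ₜ[k] E.leftAct ω₁ ω'}

end DualStructure

/-- The space `B` spanned by the operators `[ω, ω']_B`, as an algebra of operators on the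
restricted dual, together with its identification with `X̂ ⊗_Â X̂`. -/
structure ReflectedAlgebra {G : GaloisObject H X} {φ : Module.Dual k A}
    {D : StructureMaps G φ} (E : DualStructure D) where
  B : NonUnitalSubalgebra k (Module.End k D.Xhat)
  B_eq_span : B.toSubmodule =
    Submodule.span k (Set.range fun p : D.Xhat × D.Xhat => E.bracket p.1 p.2)
  π : ((D.Xhat ⊗[k] D.Xhat) ⧸ E.balancing) ≃ₗ[k] B
  π_spec : ∀ ω ω' : D.Xhat,
    (π (Submodule.Quotient.mk (ω ⊗ₜ[k] ω')) : Module.End k D.Xhat) = E.bracket ω ω'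

namespace ReflectedAlgebra

variable {G : GaloisObject H X} {φ : Module.Dual k A} {D : StructureMaps G φ}
  {E : DualStructure D} (R : ReflectedAlgebra E)

/-- `[ω, ω']_B` as an element of `B`. -/
def br (ω ω' : D.Xhat) : R.B := R.π (Submodule.Quotient.mk (ω ⊗ₜ[k] ω'))

/-- The inclusion of `B` in the operators on the restricted dual. -/
def incl : R.B →ₗ[k] Module.End k D.Xhat := R.B.toSubmodule.subtype

/-- The action of `B ⊗ B` on `X̂ ⊗ X̂`. -/
def act₂ : R.B ⊗[k] R.B →ₗ[k] Module.End k (D.Xhat ⊗[k] D.Xhat) :=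
  TensorProduct.lift (((TensorProduct.mapBilinear (.id k) D.Xhat D.Xhat D.Xhat D.Xhat).compl₁₂
    R.incl R.incl))

/-- The number `ξ(x ⊗ y)` for `ξ ∈ X̂ ⊗ X̂`. -/
def eval₂ (D : StructureMaps G φ) (ξ : D.Xhat ⊗[k] D.Xhat) (x y : X) : k :=
  TensorProduct.dualDistrib k X X
    (TensorProduct.map (RestrictedDual.incl D.φX) (RestrictedDual.incl D.φX) ξ) (x ⊗ₜ y)

/-- The formula `Δ_B([ω, ω']_B) = [ω⁽¹⁾, ω'⁽²⁾]_B ⊗ [ω⁽²⁾, ω'⁽¹⁾]_B`. A multiplier `m` of `B ⊗ B`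
acts on `X̂ ⊗ X̂` by an operator `N` with `N (t · ξ) = (m t) · ξ`; for the multiplier
on the right of the formula this operator is
`N (ω'' ⊗ ω''') = ω⁽¹⁾ · [ω'⁽²⁾, ω''] ⊗ ω⁽²⁾ · [ω'⁽¹⁾, ω''']`, evaluated on `x ⊗ y` below. -/
def ComulFormula (HB : RegularMultiplierHopfAlgebra k R.B) : Prop :=
  ∀ (p : X) (ω' : D.Xhat), ∃ N : Module.End k (D.Xhat ⊗[k] D.Xhat),
    (∀ t : R.B ⊗[k] R.B,
      R.act₂ ((HB.comul (R.br (D.hat p) ω')).lmul t) = N ∘ₗ R.act₂ t) ∧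
    ∀ u v x y : X, eval₂ D (N (D.hat u ⊗ₜ D.hat v)) x y =
      D.comulValue p ω' u v x y

end ReflectedAlgebra

end

end GaloisReflection

open scoped TensorProduct

namespace GaloisReflection

noncomputable section

set_option linter.unusedSectionVars false

/-! ### Slices and separation of points -/

section Separation

variable {k : Type*} [Field k] {M N M' N' : Type*} [AddCommGroup M] [Module k M]
  [AddCommGroup N] [Module k N] [AddCommGroup M'] [Module k M'] [AddCommGroup N'] [Module k N']

/-! Multipliers are handled through covered products: an identity in M(X ⊗ A) is tested after
multiplying a leg by an element or slicing it by a functional, and the test is undone by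
non-degeneracy, by faithfulness of an invariant functional, or by bijectivity of a canonical map.

The classical part builds what the statement presupposes. The counit is read off from m ∘ `TΔ2`⁻¹,
and the antipode is defined by strong left invariance, S((ι ⊗ φ)(Δ(a)(1 ⊗ b))) = (ι ⊗ φ)((1 ⊗
a)Δ(b)). Then φ is faithful and unique up to a scalar, and it has a modular automorphism. The
modular element of the dual is a character of A and therefore acts on X. For a Galois object, (ι ⊗
φ)α(x) is a coinvariant multiplier, hence a scalar φ_X(x). The identity (ι ⊗ φ)(α(x)W(q ⊗ r)) =
φ_X(xq) r (`Frame.phi_lmul_W`) carries the properties of φ over to φ_X. The relation between θ_X and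
the two kinds of slices of the coaction is `Frame.theta_slice`.

For the reflection, X̂ is identified with X by u ↦ φ_X(· u), so that B becomes the algebra of
operators on X spanned by `op p q`, the coordinate form of [φ_X(· p), φ_X(q ·)]. Let G(u ⊗ v) =
α(v)(u ⊗ 1), a bijection X ⊗ X → X ⊗ A. The comultiplication is Δ_B(b) = G⁻¹(b ⊗ 1)G
(`GaloisIntegral.amp`). It is visibly multiplicative, it is coassociative by the pentagon relation
`Frame.gW_W`, and its matrix coefficients give the stated formula (`GaloisIntegral.pair_amp_op`).
Explicit calculation puts Δ_B(a)(1 ⊗ b) and Δ_B(a)(b ⊗ 1) in B ⊗ B (`Reflection.act_liftT`,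
`Reflection.act_liftU`), and bijectivity of V and W makes these two maps surjective. The antipode is
the adjoint with respect to φ_X(xu), which stays in B because of θ_X. With it the two maps are
injective and the two remaining canonical maps can be written down (`LeftHopfData`).

The operator [ω, ω']_B determines its class in X̂ ⊗_Â X̂: `GaloisIntegral.balance` replaces a tensor
by an equivalent one that depends on the operator alone. Finally an invariant ψ_X is φ_X composed
with a bijective left module map ρ, and ρ transports evaluation to a left invariant functional on B.
-/

@[simp] lemma sliceL_tmul (f : Module.Dual k M) (m : M) (n : N) :
    sliceL f (m ⊗ₜ[k] n) = f m • n := by simp [sliceL]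

@[simp] lemma sliceR_tmul (g : Module.Dual k N) (m : M) (n : N) :
    sliceR g (m ⊗ₜ[k] n) = g n • m := by simp [sliceR]

lemma sliceR_rTensor (g : Module.Dual k N) (f : M →ₗ[k] M') (t : M ⊗[k] N) :
    sliceR g (f.rTensor N t) = f (sliceR g t) := by
  induction t with
  | zero => simp
  | add x y hx hy => simp only [map_add, hx, hy]
  | tmul m n => simp

lemma sliceL_lTensor (g : Module.Dual k M) (f : N →ₗ[k] N') (t : M ⊗[k] N) :
    sliceL g (f.lTensor M t) = f (sliceL g t) := by
  induction t with
  | zero => simp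
  | add x y hx hy => simp only [map_add, hx, hy]
  | tmul m n => simp

lemma sliceR_lTensor (g : Module.Dual k N') (f : N →ₗ[k] N') (t : M ⊗[k] N) :
    sliceR g (f.lTensor M t) = sliceR (g ∘ₗ f) t := by
  induction t with
  | zero => simp
  | add x y hx hy => simp only [map_add, hx, hy]
  | tmul m n => simp

lemma sliceL_rTensor (g : Module.Dual k M') (f : M →ₗ[k] M') (t : M ⊗[k] N) :
    sliceL g (f.rTensor N t) = sliceL (g ∘ₗ f) t := by
  induction t with
  | zero => simp
  | add x y hx hy => simp only [map_add, hx, hy]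
  | tmul m n => simp

lemma apply_sliceR (f : Module.Dual k M) (g : Module.Dual k N) (t : M ⊗[k] N) :
    f (sliceR g t) = g (sliceL f t) := by
  induction t with
  | zero => simp
  | add x y hx hy => simp only [map_add, hx, hy]
  | tmul m n => simp [mul_comm]

/-- The slices by the coordinate functionals of a basis of N are the coordinates of t. This is where
k being a field enters. -/
lemma eq_zero_of_sliceR {t : M ⊗[k] N} (h : ∀ g : Module.Dual k N, sliceR g t = 0) : t = 0 := by
  classical
  let b := Module.Basis.ofVectorSpace k N
  apply (TensorProduct.equivFinsuppOfBasisRight (M := M) b).injective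
  ext i
  rw [TensorProduct.equivFinsuppOfBasisRight_apply, map_zero]
  exact h (b.coord i)

lemma eq_zero_of_sliceL {t : M ⊗[k] N} (h : ∀ f : Module.Dual k M, sliceL f t = 0) : t = 0 := by
  apply eq_zero_of_sliceR
  intro g
  rw [← Module.forall_dual_apply_eq_zero_iff k]
  intro f
  rw [apply_sliceR, h, map_zero]

/-- A family of functionals separating the points of `N` separates `M ⊗ N` over `M`. -/
lemma eq_of_sliceR_family {ι : Sort*} (F : ι → Module.Dual k N)
    (hF : ∀ n, (∀ i, F i n = 0) → n = 0) {s t : M ⊗[k] N}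
    (h : ∀ i, sliceR (F i) s = sliceR (F i) t) : s = t := by
  rw [← sub_eq_zero]
  apply eq_zero_of_sliceL
  intro f
  apply hF
  intro i
  rw [← apply_sliceR, map_sub, h, sub_self, map_zero]

lemma eq_of_sliceL_family {ι : Sort*} (F : ι → Module.Dual k M)
    (hF : ∀ n, (∀ i, F i n = 0) → n = 0) {s t : M ⊗[k] N}
    (h : ∀ i, sliceL (F i) s = sliceL (F i) t) : s = t := by
  rw [← sub_eq_zero]
  apply eq_zero_of_sliceR
  intro f
  apply hF
  intro i
  rw [apply_sliceR, map_sub, h, sub_self, map_zero]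

/-- A jointly injective family of linear maps on `N` stays jointly injective on `M ⊗ N`. -/
lemma eq_of_lTensor {ι : Sort*} {P : ι → Type*} [∀ i, AddCommGroup (P i)] [∀ i, Module k (P i)]
    (F : ∀ i, N →ₗ[k] P i) (hF : ∀ n n', (∀ i, F i n = F i n') → n = n') {s t : M ⊗[k] N}
    (h : ∀ i, (F i).lTensor M s = (F i).lTensor M t) : s = t := by
  rw [← sub_eq_zero]
  apply eq_zero_of_sliceL
  intro f
  rw [map_sub, sub_eq_zero]
  apply hF
  intro i
  rw [← sliceL_lTensor, h, sliceL_lTensor]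

lemma eq_of_rTensor {ι : Sort*} {P : ι → Type*} [∀ i, AddCommGroup (P i)] [∀ i, Module k (P i)]
    (F : ∀ i, M →ₗ[k] P i) (hF : ∀ n n', (∀ i, F i n = F i n') → n = n') {s t : M ⊗[k] N}
    (h : ∀ i, (F i).rTensor N s = (F i).rTensor N t) : s = t := by
  rw [← sub_eq_zero]
  apply eq_zero_of_sliceR
  intro f
  rw [map_sub, sub_eq_zero]
  apply hF
  intro i
  rw [← sliceR_rTensor, h, sliceR_rTensor]

/-- If the functionals `F i` annihilate a leg of `t`, so does every map vanishing on their common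
kernel. -/
lemma lTensor_eq_zero_of_family {ι : Sort*} (F : ι → Module.Dual k N) (g : N →ₗ[k] N')
    (hg : ∀ n, (∀ i, F i n = 0) → g n = 0) {t : M ⊗[k] N} (h : ∀ i, sliceR (F i) t = 0) :
    g.lTensor M t = 0 := by
  apply eq_zero_of_sliceL
  intro f
  rw [sliceL_lTensor]
  apply hg
  intro i
  rw [← apply_sliceR, h, map_zero]

/-- Two linear maps on a tensor product agree if they agree on pure tensors. -/
lemma tensor_ext {f g : M ⊗[k] N →ₗ[k] M'} (h : ∀ m n, f (m ⊗ₜ n) = g (m ⊗ₜ n)) (t : M ⊗[k] N) :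
    f t = g t :=
  LinearMap.congr_fun (TensorProduct.ext' h) t

lemma exists_dual_eq_one {m : M} (hm : m ≠ 0) : ∃ f : Module.Dual k M, f m = 1 := by
  by_contra hcon
  push Not at hcon
  apply hm
  rw [← Module.forall_dual_apply_eq_zero_iff k]
  intro f
  by_contra hf
  exact hcon ((f m)⁻¹ • f) (by simp [hf])

lemma exists_eq_one_of_ne_zero {f : Module.Dual k M} (hf : f ≠ 0) : ∃ m, f m = 1 := by
  by_contra hcon
  push Not at hcon
  apply hf
  ext m
  by_contra hm
  exact hcon ((f m)⁻¹ • m) (by simpa using inv_mul_cancel₀ hm)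

lemma sliceR_surjective {g : Module.Dual k N} (hg : g ≠ 0) :
    Function.Surjective (sliceR (M := M) g) := by
  obtain ⟨n, hn⟩ := exists_eq_one_of_ne_zero hg
  exact fun m => ⟨m ⊗ₜ n, by simp [hn]⟩

lemma sliceL_surjective {g : Module.Dual k M} (hg : g ≠ 0) :
    Function.Surjective (sliceL (N := N) g) := by
  obtain ⟨n, hn⟩ := exists_eq_one_of_ne_zero hg
  exact fun m => ⟨n ⊗ₜ m, by simp [hn]⟩

lemma tmul_right_cancel {m : M} (hm : m ≠ 0) {n n' : N} (h : m ⊗ₜ[k] n = m ⊗ₜ n') : n = n' := by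
  obtain ⟨f, hf⟩ := exists_dual_eq_one (k := k) hm
  simpa [hf] using congrArg (sliceL f) h

lemma tmul_left_cancel {m m' : M} {n : N} (hn : n ≠ 0) (h : m ⊗ₜ[k] n = m' ⊗ₜ n) : m = m' := by
  obtain ⟨f, hf⟩ := exists_dual_eq_one (k := k) hn
  simpa [hf] using congrArg (sliceR f) h

/-- A linear map vanishing on the kernel of a surjection factors through it. -/
lemma exists_factor_of_ker_le (f : M →ₗ[k] N) (hf : Function.Surjective f) (g : M →ₗ[k] M')
    (h : ∀ m, f m = 0 → g m = 0) : ∃ e : N →ₗ[k] M', ∀ m, e (f m) = g m := by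
  obtain ⟨s, hs⟩ := f.exists_rightInverse_of_surjective (LinearMap.range_eq_top.2 hf)
  refine ⟨g ∘ₗ s, fun m => ?_⟩
  rw [← sub_eq_zero, LinearMap.comp_apply, ← map_sub]
  apply h
  rw [map_sub, show f (s (f m)) = f m from LinearMap.congr_fun hs _, sub_self]

end Separation

/-! ### One-sided multiplications on the legs of a tensor product -/

section Legs

variable {k : Type*} [Field k] {R : Type*} [NonUnitalRing R] [Module k R] [IsScalarTower k R R]
  [SMulCommClass k R R] {M : Type*} [AddCommGroup M] [Module k M]

/-- `t ↦ t (a ⊗ 1)`. -/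
def mulR1 (a : R) : R ⊗[k] M →ₗ[k] R ⊗[k] M := (LinearMap.mulRight k a).rTensor M
/-- `t ↦ (a ⊗ 1) t`. -/
def mulL1 (a : R) : R ⊗[k] M →ₗ[k] R ⊗[k] M := (LinearMap.mulLeft k a).rTensor M
/-- `t ↦ t (1 ⊗ a)`. -/
def mulR2 (a : R) : M ⊗[k] R →ₗ[k] M ⊗[k] R := (LinearMap.mulRight k a).lTensor M
/-- `t ↦ (1 ⊗ a) t`. -/
def mulL2 (a : R) : M ⊗[k] R →ₗ[k] M ⊗[k] R := (LinearMap.mulLeft k a).lTensor M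

@[simp] lemma mulR1_tmul (a b : R) (m : M) : mulR1 a (b ⊗ₜ[k] m) = (b * a) ⊗ₜ m := by simp [mulR1]
@[simp] lemma mulL1_tmul (a b : R) (m : M) : mulL1 a (b ⊗ₜ[k] m) = (a * b) ⊗ₜ m := by simp [mulL1]
@[simp] lemma mulR2_tmul (a b : R) (m : M) : mulR2 a (m ⊗ₜ[k] b) = m ⊗ₜ (b * a) := by simp [mulR2]
@[simp] lemma mulL2_tmul (a b : R) (m : M) : mulL2 a (m ⊗ₜ[k] b) = m ⊗ₜ (a * b) := by simp [mulL2]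

lemma sliceR_mulR1 (g : Module.Dual k M) (a : R) (t : R ⊗[k] M) :
    sliceR g (mulR1 a t) = sliceR g t * a := sliceR_rTensor _ _ _
lemma sliceR_mulL1 (g : Module.Dual k M) (a : R) (t : R ⊗[k] M) :
    sliceR g (mulL1 a t) = a * sliceR g t := sliceR_rTensor _ _ _
lemma sliceL_mulR2 (g : Module.Dual k M) (a : R) (t : M ⊗[k] R) :
    sliceL g (mulR2 a t) = sliceL g t * a := sliceL_lTensor _ _ _
lemma sliceL_mulL2 (g : Module.Dual k M) (a : R) (t : M ⊗[k] R) :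
    sliceL g (mulL2 a t) = a * sliceL g t := sliceL_lTensor _ _ _

lemma eq_of_mulR1 (hR : IsNondegenerate R) {s t : R ⊗[k] M}
    (h : ∀ a, mulR1 a s = mulR1 a t) : s = t := by
  rw [← sub_eq_zero]
  apply eq_zero_of_sliceR
  intro g
  apply hR.left
  intro a
  rw [← sliceR_mulR1, map_sub, h, sub_self, map_zero]

lemma eq_of_mulL1 (hR : IsNondegenerate R) {s t : R ⊗[k] M}
    (h : ∀ a, mulL1 a s = mulL1 a t) : s = t := by
  rw [← sub_eq_zero]
  apply eq_zero_of_sliceR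
  intro g
  apply hR.right
  intro a
  rw [← sliceR_mulL1, map_sub, h, sub_self, map_zero]

lemma eq_of_mulR2 (hR : IsNondegenerate R) {s t : M ⊗[k] R}
    (h : ∀ a, mulR2 a s = mulR2 a t) : s = t := by
  rw [← sub_eq_zero]
  apply eq_zero_of_sliceL
  intro g
  apply hR.left
  intro a
  rw [← sliceL_mulR2, map_sub, h, sub_self, map_zero]

lemma eq_of_mulL2 (hR : IsNondegenerate R) {s t : M ⊗[k] R}
    (h : ∀ a, mulL2 a s = mulL2 a t) : s = t := by
  rw [← sub_eq_zero]
  apply eq_zero_of_sliceL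
  intro g
  apply hR.right
  intro a
  rw [← sliceL_mulL2, map_sub, h, sub_self, map_zero]

lemma IsNondegenerate.eq_of_mul_right (hR : IsNondegenerate R) {a b : R}
    (h : ∀ c, a * c = b * c) : a = b := by
  rw [← sub_eq_zero]
  exact hR.left _ fun c => by rw [sub_mul, h, sub_self]

lemma IsNondegenerate.eq_of_mul_left (hR : IsNondegenerate R) {a b : R}
    (h : ∀ c, c * a = c * b) : a = b := by
  rw [← sub_eq_zero]
  exact hR.right _ fun c => by rw [mul_sub, h, sub_self]

lemma mulR1_mul (a b : R) (t : R ⊗[k] M) : mulR1 (a * b) t = mulR1 b (mulR1 a t) := by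
  induction t with
  | zero => simp
  | add x y hx hy => simp only [map_add, hx, hy]
  | tmul m n => simp [mul_assoc]

lemma mulR2_mul (a b : R) (t : M ⊗[k] R) : mulR2 (a * b) t = mulR2 b (mulR2 a t) := by
  induction t with
  | zero => simp
  | add x y hx hy => simp only [map_add, hx, hy]
  | tmul m n => simp [mul_assoc]

lemma mulL1_mulR1 (a b : R) (t : R ⊗[k] M) : mulL1 a (mulR1 b t) = mulR1 b (mulL1 a t) := by
  induction t with
  | zero => simp
  | add x y hx hy => simp only [map_add, hx, hy]
  | tmul m n => simp [mul_assoc]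

lemma mulL2_mulR2 (a b : R) (t : M ⊗[k] R) : mulL2 a (mulR2 b t) = mulR2 b (mulL2 a t) := by
  induction t with
  | zero => simp
  | add x y hx hy => simp only [map_add, hx, hy]
  | tmul m n => simp [mul_assoc]

variable {T : Type*} [NonUnitalRing T] [Module k T] [IsScalarTower k T T] [SMulCommClass k T T]

lemma mulR1_mulR2 (a : R) (b : T) (t : R ⊗[k] T) :
    mulR1 a (mulR2 b t) = mulR2 b (mulR1 a t) := by
  induction t with
  | zero => simp
  | add x y hx hy => simp only [map_add, hx, hy]
  | tmul m n => simp

lemma mulR1_mulL2 (a : R) (b : T) (t : R ⊗[k] T) :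
    mulR1 a (mulL2 b t) = mulL2 b (mulR1 a t) := by
  induction t with
  | zero => simp
  | add x y hx hy => simp only [map_add, hx, hy]
  | tmul m n => simp

lemma mulL1_mulR2 (a : R) (b : T) (t : R ⊗[k] T) :
    mulL1 a (mulR2 b t) = mulR2 b (mulL1 a t) := by
  induction t with
  | zero => simp
  | add x y hx hy => simp only [map_add, hx, hy]
  | tmul m n => simp

lemma mulL1_mulL2 (a : R) (b : T) (t : R ⊗[k] T) :
    mulL1 a (mulL2 b t) = mulL2 b (mulL1 a t) := by
  induction t with
  | zero => simp
  | add x y hx hy => simp only [map_add, hx, hy]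
  | tmul m n => simp

lemma mul_tmul_eq (t : R ⊗[k] T) (a : R) (b : T) : t * (a ⊗ₜ b) = mulR2 b (mulR1 a t) := by
  induction t with
  | zero => simp
  | add x y hx hy => simp only [map_add, add_mul, hx, hy]
  | tmul m n => simp

lemma tmul_mul_eq (t : R ⊗[k] T) (a : R) (b : T) : (a ⊗ₜ b) * t = mulL2 b (mulL1 a t) := by
  induction t with
  | zero => simp
  | add x y hx hy => simp only [map_add, mul_add, hx, hy]
  | tmul m n => simp

lemma mul_mulR1 (s t : R ⊗[k] T) (a : R) : mulR1 a (s * t) = s * mulR1 a t := by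
  induction t with
  | zero => simp
  | add x y hx hy => simp only [map_add, mul_add, hx, hy]
  | tmul m n => simp [mul_tmul_eq, mulR1_mulR2, mulR1_mul]

lemma IsNondegenerate.tensor (hR : IsNondegenerate R) (hT : IsNondegenerate T) :
    IsNondegenerate (R ⊗[k] T) where
  left t h := by
    apply eq_of_mulR1 hR
    intro a
    apply eq_of_mulR2 hT
    intro b
    rw [← mul_tmul_eq, h]
    simp
  right t h := by
    apply eq_of_mulL1 hR
    intro a
    apply eq_of_mulL2 hT
    intro b
    rw [← tmul_mul_eq, h]
    simp

end Legs

/-! ### Multipliers -/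

namespace Mult

variable {k : Type*} [Field k] {R : Type*} [NonUnitalRing R] [Module k R] [IsScalarTower k R R]
  [SMulCommClass k R R] {T : Type*} [NonUnitalRing T] [Module k T] [IsScalarTower k T T]
  [SMulCommClass k T T]

lemma mul_lmul (m : Mult k R) (a b : R) : a * m.lmul b = m.rmul a * b := m.2 a b

@[simp] lemma lmul_mul_apply (m n : Mult k R) (a : R) : (m * n).lmul a = m.lmul (n.lmul a) := rfl
@[simp] lemma rmul_mul_apply (m n : Mult k R) (a : R) : (m * n).rmul a = n.rmul (m.rmul a) := rfl
@[simp] lemma lmul_of (a b : R) : (of k a).lmul b = a * b := rfl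
@[simp] lemma rmul_of (a b : R) : (of k a).rmul b = b * a := rfl
@[simp] lemma lmul_one (a : R) : (1 : Mult k R).lmul a = a := rfl
@[simp] lemma rmul_one (a : R) : (1 : Mult k R).rmul a = a := rfl
@[simp] lemma lmul_tmul (m : Mult k R) (n : Mult k T) :
    (tmul m n).lmul = TensorProduct.map m.lmul n.lmul := rfl
@[simp] lemma rmul_tmul (m : Mult k R) (n : Mult k T) :
    (tmul m n).rmul = TensorProduct.map m.rmul n.rmul := rfl

/-- The compatibility of the two halves of a multiplier forces the left half to be a right module
map. -/
lemma lmul_mul_right (hR : IsNondegenerate R) (m : Mult k R) (a b : R) :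
    m.lmul (a * b) = m.lmul a * b := by
  apply hR.eq_of_mul_left
  intro c
  rw [mul_lmul, ← mul_assoc, ← mul_lmul, mul_assoc]

lemma ext' {m n : Mult k R} (h : m.lmul = n.lmul) (h' : m.rmul = n.rmul) : m = n :=
  Subtype.ext (Prod.ext h (MulOpposite.unop_injective h'))

/-- By non-degeneracy the left half determines the right half, so equality of multipliers is always
checked on left products. -/
lemma ext_lmul (hR : IsNondegenerate R) {m n : Mult k R} (h : ∀ a, m.lmul a = n.lmul a) :
    m = n := by
  refine ext' (LinearMap.ext h) (LinearMap.ext fun a => hR.eq_of_mul_right fun b => ?_)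
  rw [← mul_lmul, ← mul_lmul, h]

lemma of_injective (hR : IsNondegenerate R) {a b : R} (h : of k a = of k b) : a = b :=
  hR.eq_of_mul_right fun c => by rw [← lmul_of (k := k) a, h, lmul_of]

lemma of_lmul (hR : IsNondegenerate R) (m : Mult k R) (a : R) : of k (m.lmul a) = m * of k a :=
  ext_lmul hR fun b => by simp [lmul_mul_right hR]

lemma of_rmul (hR : IsNondegenerate R) (m : Mult k R) (a : R) : of k (m.rmul a) = of k a * m :=
  ext_lmul hR fun b => by simp [mul_lmul]

lemma of_mul (hR : IsNondegenerate R) (a b : R) : of k (a * b) = of k a * of k b :=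
  ext_lmul hR fun c => by simp [mul_assoc]

lemma inl_mul_inr (m : Mult k R) (n : Mult k T) :
    (tmul m 1 : Mult k (R ⊗[k] T)) * tmul 1 n = tmul 1 n * tmul m 1 := by
  apply ext'
  · ext; rfl
  · ext; rfl

lemma inl_of_mul (hR : IsNondegenerate R) (hT : IsNondegenerate T) (a b : R) :
    (tmul (of k (a * b)) 1 : Mult k (R ⊗[k] T)) =
    tmul (of k a) 1 * tmul (of k b) 1 := by
  apply ext_lmul (hR.tensor hT)
  intro t
  induction t with
  | zero => simp
  | add x y hx hy => rw [map_add, map_add, hx, hy]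
  | tmul m n => simp [mul_assoc]

lemma inr_of_mul (hR : IsNondegenerate R) (hT : IsNondegenerate T) (a b : T) :
    (tmul 1 (of k (a * b)) : Mult k (R ⊗[k] T)) =
    tmul 1 (of k a) * tmul 1 (of k b) := by
  apply ext_lmul (hR.tensor hT)
  intro t
  induction t with
  | zero => simp
  | add x y hx hy => rw [map_add, map_add, hx, hy]
  | tmul m n => simp [mul_assoc]

lemma of_mulR1 (hR : IsNondegenerate R) (hT : IsNondegenerate T) (a : R) (t : R ⊗[k] T) :
    of k (mulR1 a t) = of k t * tmul (of k a) 1 :=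
  of_rmul (hR.tensor hT) (tmul (of k a) 1) t
lemma of_mulL1 (hR : IsNondegenerate R) (hT : IsNondegenerate T) (a : R) (t : R ⊗[k] T) :
    of k (mulL1 a t) = tmul (of k a) 1 * of k t :=
  of_lmul (hR.tensor hT) (tmul (of k a) 1) t
lemma of_mulR2 (hR : IsNondegenerate R) (hT : IsNondegenerate T) (a : T) (t : R ⊗[k] T) :
    of k (mulR2 a t) = of k t * tmul 1 (of k a) :=
  of_rmul (hR.tensor hT) (tmul 1 (of k a)) t
lemma of_mulL2 (hR : IsNondegenerate R) (hT : IsNondegenerate T) (a : T) (t : R ⊗[k] T) :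
    of k (mulL2 a t) = tmul 1 (of k a) * of k t :=
  of_lmul (hR.tensor hT) (tmul 1 (of k a)) t

lemma of_tmul (a : R) (b : T) :
    of k (a ⊗ₜ[k] b) = tmul (of k a) 1 * tmul 1 (of k b) := by
  apply ext'
  · ext c d
    simp
  · ext c d
    simp

end Mult

end

end GaloisReflection

/-! ### Coactions with a bijective Galois map -/

open scoped TensorProduct

namespace GaloisReflection

noncomputable section

set_option linter.unusedSectionVars false

variable {k : Type*} [Field k] {A : Type*} [NonUnitalRing A] [Module k A]
  [IsScalarTower k A A] [SMulCommClass k A A] {X : Type*} [NonUnitalRing X] [Module k X]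
  [IsScalarTower k X X] [SMulCommClass k X X]

/-- `a ↦ Δ(a) s`. -/
def RegularMultiplierHopfAlgebra.lΔ (H : RegularMultiplierHopfAlgebra k A) :
    A ⊗[k] A →ₗ[k] A →ₗ[k] A ⊗[k] A :=
  LinearMap.mk₂ k (fun s a => (H.comul a).lmul s) (fun _ _ _ => map_add _ _ _)
    (fun _ _ _ => map_smul _ _ _) (fun _ _ _ => by rw [map_add]; rfl)
    (fun _ _ _ => by rw [map_smul]; rfl)

/-- `a ↦ s Δ(a)`. -/
def RegularMultiplierHopfAlgebra.rΔ (H : RegularMultiplierHopfAlgebra k A) :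
    A ⊗[k] A →ₗ[k] A →ₗ[k] A ⊗[k] A :=
  LinearMap.mk₂ k (fun s a => (H.comul a).rmul s) (fun _ _ _ => map_add _ _ _)
    (fun _ _ _ => map_smul _ _ _) (fun _ _ _ => by rw [map_add]; rfl)
    (fun _ _ _ => by rw [map_smul]; rfl)

/-- The first part of the data of a coaction with bijective Galois map; it makes sense for a Galois
object and for the Hopf algebra coacting on itself. Coassociativity is covered by the Galois map. -/
structure PreFrame (H : RegularMultiplierHopfAlgebra k A) (X : Type*) [NonUnitalRing X]
    [Module k X] [IsScalarTower k X X] [SMulCommClass k X X] where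
  nontrivial : Nontrivial X
  nondegenerate : IsNondegenerate X
  α : X →ₙₐ[k] Mult k (X ⊗[k] A)
  T1 : X ⊗[k] A →ₗ[k] X ⊗[k] A
  T1_spec : ∀ x a, Mult.of k (T1 (x ⊗ₜ a)) = α x * Mult.tmul 1 (Mult.of k a)
  T2 : X ⊗[k] A →ₗ[k] X ⊗[k] A
  T2_spec : ∀ x a, Mult.of k (T2 (x ⊗ₜ a)) = Mult.tmul 1 (Mult.of k a) * α x
  V : X ⊗[k] X ≃ₗ[k] X ⊗[k] A
  V_spec : ∀ x y, Mult.of k (V (x ⊗ₜ y)) = Mult.tmul (Mult.of k x) 1 * α y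
  coassoc : ∀ (x y : X) (d : A),
    TensorProduct.assoc k X A A
        ((V.toLinearMap ∘ₗ TensorProduct.mk k X X y).rTensor A (T1 (x ⊗ₜ d))) =
      (H.TΔ2.toLinearMap ∘ₗ (TensorProduct.mk k A A).flip d).lTensor X (V (y ⊗ₜ x))

variable {H : RegularMultiplierHopfAlgebra k A}

/-- The Hopf algebra coacting on itself by its comultiplication. -/
def RegularMultiplierHopfAlgebra.self (H : RegularMultiplierHopfAlgebra k A) : PreFrame H A where
  nontrivial := H.nontrivial
  nondegenerate := H.nondegenerate
  α := H.comul
  T1 := H.TΔ2.toLinearMap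
  T1_spec := H.TΔ2_spec
  T2 := H.T2Δ.toLinearMap ∘ₗ (TensorProduct.comm k A A).toLinearMap
  T2_spec x a := H.T2Δ_spec a x
  V := H.T1Δ
  V_spec := H.T1Δ_spec
  coassoc x y d := by
    have h := congrArg (TensorProduct.assoc k A A A) (H.coassoc y x d)
    rw [LinearEquiv.apply_symm_apply] at h
    convert h using 1
    · congr 1
      generalize H.TΔ2 (x ⊗ₜ[k] d) = t
      induction t with
      | zero => simp
      | add a b ha hb => simp only [map_add, TensorProduct.tmul_add, *] at *
      | tmul a b => simp
    · generalize H.T1Δ (y ⊗ₜ[k] x) = t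
      induction t with
      | zero => simp
      | add a b ha hb => simp only [map_add, TensorProduct.add_tmul]; rw [ha, hb]
      | tmul a b => simp

namespace PreFrame

variable (F : PreFrame H X)

/-- `x ↦ α(x) s`. -/
def lα : X ⊗[k] A →ₗ[k] X →ₗ[k] X ⊗[k] A :=
  LinearMap.mk₂ k (fun s a => (F.α a).lmul s) (fun _ _ _ => map_add _ _ _)
    (fun _ _ _ => map_smul _ _ _) (fun _ _ _ => by rw [map_add]; rfl)
    (fun _ _ _ => by rw [map_smul]; rfl)

/-- `x ↦ s α(x)`. -/
def rα : X ⊗[k] A →ₗ[k] X →ₗ[k] X ⊗[k] A :=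
  LinearMap.mk₂ k (fun s a => (F.α a).rmul s) (fun _ _ _ => map_add _ _ _)
    (fun _ _ _ => map_smul _ _ _) (fun _ _ _ => by rw [map_add]; rfl)
    (fun _ _ _ => by rw [map_smul]; rfl)

lemma ndXA (F : PreFrame H X) : IsNondegenerate (X ⊗[k] A) := F.nondegenerate.tensor H.nondegenerate

-- This rule and the ones that follow are associativity in M(X ⊗ A): both sides are the same product
-- of multipliers, and X ⊗ A embeds in its multiplier algebra.
open Mult in
lemma mulR1_T1 (x y : X) (a : A) : mulR1 y (F.T1 (x ⊗ₜ a)) = (F.α x).lmul (y ⊗ₜ a) := by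
  apply of_injective (k := k) F.ndXA
  rw [of_mulR1 F.nondegenerate H.nondegenerate, F.T1_spec, of_lmul F.ndXA, of_tmul, mul_assoc,
    inl_mul_inr]

open Mult in
lemma mulL1_T2 (x y : X) (a : A) : mulL1 y (F.T2 (x ⊗ₜ a)) = (F.α x).rmul (y ⊗ₜ a) := by
  apply of_injective (k := k) F.ndXA
  rw [of_mulL1 F.nondegenerate H.nondegenerate, F.T2_spec, of_rmul F.ndXA, of_tmul, ← mul_assoc]

open Mult in
lemma mulL2_V (x y : X) (a : A) : mulL2 a (F.V (y ⊗ₜ x)) = (F.α x).rmul (y ⊗ₜ a) := by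
  apply of_injective (k := k) F.ndXA
  rw [of_mulL2 F.nondegenerate H.nondegenerate, F.V_spec, of_rmul F.ndXA, of_tmul, ← mul_assoc,
    inl_mul_inr]

open Mult in
lemma lmul_T1 (x y : X) (a : A) : (F.α x).lmul (F.T1 (y ⊗ₜ a)) = F.T1 ((x * y) ⊗ₜ a) := by
  apply of_injective (k := k) F.ndXA
  rw [of_lmul F.ndXA, T1_spec, T1_spec, map_mul, mul_assoc]

open Mult in
lemma rmul_V (x y z : X) : (F.α x).rmul (F.V (z ⊗ₜ y)) = F.V (z ⊗ₜ (y * x)) := by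
  apply of_injective (k := k) F.ndXA
  rw [of_rmul F.ndXA, V_spec, V_spec, map_mul, mul_assoc]

open Mult in
lemma mulL1_T1 (x y : X) (a : A) : mulL1 y (F.T1 (x ⊗ₜ a)) = mulR2 a (F.V (y ⊗ₜ x)) := by
  apply of_injective (k := k) F.ndXA
  rw [of_mulL1 F.nondegenerate H.nondegenerate, of_mulR2 F.nondegenerate H.nondegenerate,
    F.T1_spec, V_spec, mul_assoc]

open Mult in
lemma mulL2_T1 (x : X) (a b : A) : mulL2 b (F.T1 (x ⊗ₜ a)) = mulR2 a (F.T2 (x ⊗ₜ b)) := by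
  apply of_injective (k := k) F.ndXA
  rw [of_mulL2 F.nondegenerate H.nondegenerate, of_mulR2 F.nondegenerate H.nondegenerate,
    F.T1_spec, T2_spec, mul_assoc]

open Mult in
lemma T1_mul (x : X) (a b : A) : F.T1 (x ⊗ₜ (a * b)) = mulR2 b (F.T1 (x ⊗ₜ a)) := by
  apply of_injective (k := k) F.ndXA
  rw [of_mulR2 F.nondegenerate H.nondegenerate, T1_spec, T1_spec,
    inr_of_mul F.nondegenerate H.nondegenerate, mul_assoc]

open Mult in
lemma V_mul (x y z : X) : F.V ((z * y) ⊗ₜ x) = mulL1 z (F.V (y ⊗ₜ x)) := by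
  apply of_injective (k := k) F.ndXA
  rw [of_mulL1 F.nondegenerate H.nondegenerate, V_spec, V_spec,
    inl_of_mul F.nondegenerate H.nondegenerate, mul_assoc]

lemma lmul_mulR1 (x y : X) (t : X ⊗[k] A) :
    (F.α x).lmul (mulR1 y t) = mulR1 y ((F.α x).lmul t) := by
  apply F.ndXA.eq_of_mul_left
  intro s
  rw [Mult.mul_lmul, ← mul_mulR1, ← mul_mulR1, Mult.mul_lmul]

/-- Coassociativity for `T2`. -/
lemma coassoc_T2 (x y : X) (d : A) :
    TensorProduct.assoc k X A A
        ((F.V.toLinearMap ∘ₗ TensorProduct.mk k X X y).rTensor A (F.T2 (x ⊗ₜ d))) =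
      (H.T2Δ.toLinearMap ∘ₗ TensorProduct.mk k A A d).lTensor X (F.V (y ⊗ₜ x)) := by
  -- A factor e on the right of the last leg trades (1 ⊗ d)α(x) for α(x)(1 ⊗ e) with d on the left,
  -- where coassociativity is available.
  apply eq_of_lTensor (fun e : A => mulR2 (k := k) (M := A) e)
    (fun n n' h => eq_of_mulR2 H.nondegenerate h)
  intro e
  have h1 : ∀ t : X ⊗[k] A, (mulR2 (k := k) (M := A) e).lTensor X (TensorProduct.assoc k X A A
      ((F.V.toLinearMap ∘ₗ TensorProduct.mk k X X y).rTensor A t)) =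
      TensorProduct.assoc k X A A
      ((F.V.toLinearMap ∘ₗ TensorProduct.mk k X X y).rTensor A (mulR2 e t)) := by
    intro t
    induction t with
    | zero => simp
    | add a b ha hb => simp only [map_add, ha, hb]
    | tmul a b =>
      simp only [LinearMap.rTensor_tmul, LinearMap.comp_apply, TensorProduct.mk_apply, mulR2_tmul]
      generalize F.V.toLinearMap (y ⊗ₜ[k] a) = s
      induction s with
      | zero => simp
      | add a b ha hb => simp only [map_add, TensorProduct.add_tmul, ha, hb]
      | tmul a b => simp
  have h2 : ∀ t : X ⊗[k] A, TensorProduct.assoc k X A A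
      ((F.V.toLinearMap ∘ₗ TensorProduct.mk k X X y).rTensor A (mulL2 d t)) =
      (mulL2 (k := k) (M := A) d).lTensor X (TensorProduct.assoc k X A A
      ((F.V.toLinearMap ∘ₗ TensorProduct.mk k X X y).rTensor A t)) := by
    intro t
    induction t with
    | zero => simp
    | add a b ha hb => simp only [map_add, ha, hb]
    | tmul a b =>
      simp only [LinearMap.rTensor_tmul, LinearMap.comp_apply, TensorProduct.mk_apply, mulL2_tmul]
      generalize F.V.toLinearMap (y ⊗ₜ[k] a) = s
      induction s with
      | zero => simp
      | add a b ha hb => simp only [map_add, TensorProduct.add_tmul, ha, hb]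
      | tmul a b => simp
  rw [h1, ← mulL2_T1, h2, coassoc, ← LinearMap.comp_apply, ← LinearMap.comp_apply,
    ← LinearMap.lTensor_comp, ← LinearMap.lTensor_comp]
  congr 2
  ext a
  exact H.self.mulL2_T1 a e d

/-- `x ↦ (ι ⊗ Δ)(α(x)) (1 ⊗ s)`, obtained by applying `T1` twice. -/
def dbl (x : X) : A ⊗[k] A →ₗ[k] X ⊗[k] (A ⊗[k] A) :=
  TensorProduct.lift (((TensorProduct.assoc k X A A).toLinearMap.compRight k ∘ₗ
    LinearMap.rTensorHom A ∘ₗ (TensorProduct.curry F.T1).flip).compl₂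
      (F.T1 ∘ₗ TensorProduct.mk k X A x))

lemma dbl_tmul (x : X) (p q : A) : F.dbl x (p ⊗ₜ q) = TensorProduct.assoc k X A A
    ((F.T1 ∘ₗ (TensorProduct.mk k X A).flip p).rTensor A (F.T1 (x ⊗ₜ q))) := by
  simp [dbl]
  rfl

/-- `x ↦ (1 ⊗ s) (ι ⊗ Δ)(α(x))`, obtained by applying `T2` twice. -/
def dbl2 (x : X) : A ⊗[k] A →ₗ[k] X ⊗[k] (A ⊗[k] A) :=
  TensorProduct.lift (((TensorProduct.assoc k X A A).toLinearMap.compRight k ∘ₗ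
    LinearMap.rTensorHom A ∘ₗ (TensorProduct.curry F.T2).flip).compl₂
      (F.T2 ∘ₗ TensorProduct.mk k X A x))

lemma dbl2_tmul (x : X) (p q : A) : F.dbl2 x (p ⊗ₜ q) = TensorProduct.assoc k X A A
    ((F.T2 ∘ₗ (TensorProduct.mk k X A).flip p).rTensor A (F.T2 (x ⊗ₜ q))) := by
  simp [dbl2]
  rfl

/-- Coassociativity replaces the two successive coactions by one coaction followed by Δ.
Multiplication rules for Δ thereby apply to `dbl`. -/
lemma mulL1_dbl (x y : X) (s : A ⊗[k] A) :
    mulL1 y (F.dbl x s) = (H.lΔ s).lTensor X (F.V (y ⊗ₜ x)) := by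
  induction s with
  | zero => simp
  | add s t hs ht =>
    rw [map_add, map_add, hs, ht, map_add, LinearMap.lTensor_add, LinearMap.add_apply]
  | tmul p q =>
    rw [dbl_tmul]
    have h1 : ∀ t : X ⊗[k] A, mulL1 y (TensorProduct.assoc k X A A
        ((F.T1 ∘ₗ (TensorProduct.mk k X A).flip p).rTensor A t)) =
        (mulR1 (k := k) p).lTensor X (TensorProduct.assoc k X A A
        ((F.V.toLinearMap ∘ₗ TensorProduct.mk k X X y).rTensor A t)) := by
      intro t
      induction t with
      | zero => simp
      | add a b ha hb => simp only [map_add, ha, hb]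
      | tmul a b =>
        have h2 : ∀ (s : X ⊗[k] A), mulL1 y (TensorProduct.assoc k X A A (s ⊗ₜ b)) =
            TensorProduct.assoc k X A A (mulL1 y s ⊗ₜ b) := by
          intro s
          induction s with
          | zero => simp
          | add a b ha hb => simp only [map_add, TensorProduct.add_tmul, ha, hb]
          | tmul a b => simp
        have h3 : ∀ (s : X ⊗[k] A), TensorProduct.assoc k X A A (mulR2 p s ⊗ₜ b) =
            (mulR1 p).lTensor X (TensorProduct.assoc k X A A (s ⊗ₜ b)) := by
          intro s
          induction s with
          | zero => simp
          | add a b ha hb => simp only [map_add, TensorProduct.add_tmul, ha, hb]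
          | tmul a b => simp
        simp only [LinearMap.rTensor_tmul, LinearMap.comp_apply, TensorProduct.mk_apply,
          LinearMap.flip_apply]
        rw [h2, mulL1_T1, h3]
        rfl
    rw [h1, coassoc, ← LinearMap.comp_apply, ← LinearMap.lTensor_comp]
    congr 2
    ext a
    exact H.self.mulR1_T1 a p q

lemma mulL1_dbl2 (x y : X) (s : A ⊗[k] A) :
    mulL1 y (F.dbl2 x s) = (H.rΔ s).lTensor X (F.V (y ⊗ₜ x)) := by
  induction s with
  | zero => simp
  | add s t hs ht =>
    rw [map_add, map_add, hs, ht, map_add, LinearMap.lTensor_add, LinearMap.add_apply]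
  | tmul p q =>
    rw [dbl2_tmul]
    have h1 : ∀ t : X ⊗[k] A, mulL1 y (TensorProduct.assoc k X A A
        ((F.T2 ∘ₗ (TensorProduct.mk k X A).flip p).rTensor A t)) =
        (mulL1 (k := k) p).lTensor X (TensorProduct.assoc k X A A
        ((F.V.toLinearMap ∘ₗ TensorProduct.mk k X X y).rTensor A t)) := by
      intro t
      induction t with
      | zero => simp
      | add a b ha hb => simp only [map_add, ha, hb]
      | tmul a b =>
        have h2 : ∀ (s : X ⊗[k] A), mulL1 y (TensorProduct.assoc k X A A (s ⊗ₜ b)) =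
            TensorProduct.assoc k X A A (mulL1 y s ⊗ₜ b) := by
          intro s
          induction s with
          | zero => simp
          | add a b ha hb => simp only [map_add, TensorProduct.add_tmul, ha, hb]
          | tmul a b => simp
        have h3 : ∀ (s : X ⊗[k] A), TensorProduct.assoc k X A A (mulL2 p s ⊗ₜ b) =
            (mulL1 p).lTensor X (TensorProduct.assoc k X A A (s ⊗ₜ b)) := by
          intro s
          induction s with
          | zero => simp
          | add a b ha hb => simp only [map_add, TensorProduct.add_tmul, ha, hb]
          | tmul a b => simp
        simp only [LinearMap.rTensor_tmul, LinearMap.comp_apply, TensorProduct.mk_apply,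
          LinearMap.flip_apply]
        rw [h2, mulL1_T2, ← mulL2_V, h3]
        rfl
    rw [h1, coassoc_T2, ← LinearMap.comp_apply, ← LinearMap.lTensor_comp]
    congr 2
    ext a
    rw [LinearMap.comp_apply]
    exact H.self.mulL1_T2 a p q

end PreFrame

/-- The coaction of a Galois object. -/
def GaloisObject.toPreFrame (G : GaloisObject H X) : PreFrame H X where
  nontrivial := G.nontrivial
  nondegenerate := G.nondegenerate
  α := G.α
  T1 := G.T1
  T1_spec := G.T1_spec
  T2 := G.T2
  T2_spec := G.T2_spec
  V := G.V
  V_spec := G.V_spec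
  coassoc x y d := by
    have hXA := G.nondegenerate.tensor (k := k) H.nondegenerate
    have mulL1_T1 : ∀ (x y : X) (a : A), mulL1 y (G.T1 (x ⊗ₜ a)) = mulR2 a (G.V (y ⊗ₜ x)) := by
      intro x y a
      apply Mult.of_injective (k := k) hXA
      rw [Mult.of_mulL1 G.nondegenerate H.nondegenerate,
        Mult.of_mulR2 G.nondegenerate H.nondegenerate, G.T1_spec, G.V_spec, mul_assoc]
    -- both sides of coassociativity, as maps of the element covering the last two legs
    let f1 : A ⊗[k] A →ₗ[k] X ⊗[k] (A ⊗[k] A) := TensorProduct.lift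
      (((LinearMap.lTensorHom X ∘ₗ LinearMap.rTensorHom A ∘ₗ (LinearMap.mul k A).flip).compl₂
        ((TensorProduct.assoc k X A A).toLinearMap ∘ₗ
          (G.V.toLinearMap ∘ₗ TensorProduct.mk k X X y).rTensor A ∘ₗ
            G.T1 ∘ₗ TensorProduct.mk k X A x)))
    let f2 : A ⊗[k] A →ₗ[k] X ⊗[k] (A ⊗[k] A) :=
      { toFun := fun s => (H.lΔ s).lTensor X (G.V (y ⊗ₜ x))
        map_add' := fun s t => by
          rw [map_add, LinearMap.lTensor_add, LinearMap.add_apply]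
        map_smul' := fun c s => by
          rw [map_smul, LinearMap.lTensor_smul, LinearMap.smul_apply]; rfl }
    have f1_tmul : ∀ p q : A, f1 (p ⊗ₜ q) = (mulR1 (k := k) p).lTensor X
        (TensorProduct.assoc k X A A
          ((G.V.toLinearMap ∘ₗ TensorProduct.mk k X X y).rTensor A (G.T1 (x ⊗ₜ q)))) :=
      fun p q => rfl
    have key : ∀ s, f1 s = mulL1 y (TensorProduct.assoc k X A A (G.T1.rTensor A
        (TensorProduct.rightComm k X A A (G.T1.rTensor A
        (TensorProduct.rightComm k X A A
          ((TensorProduct.assoc k X A A).symm (x ⊗ₜ s))))))) := by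
      intro s
      induction s with
      | zero => simp
      | add s t hs ht => simp only [map_add, TensorProduct.tmul_add, hs, ht]
      | tmul p q =>
        rw [f1_tmul]
        simp only [TensorProduct.assoc_symm_tmul, TensorProduct.rightComm_tmul,
          LinearMap.rTensor_tmul]
        generalize G.T1 (x ⊗ₜ[k] q) = t
        induction t with
        | zero => simp
        | add a b ha hb => simp only [map_add, TensorProduct.add_tmul, ha, hb]
        | tmul a b =>
          have h2 : ∀ (s : X ⊗[k] A), mulL1 y (TensorProduct.assoc k X A A (s ⊗ₜ b)) =
              TensorProduct.assoc k X A A (mulL1 y s ⊗ₜ b) := by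
            intro s
            induction s with
            | zero => simp
            | add a b ha hb => simp only [map_add, TensorProduct.add_tmul, ha, hb]
            | tmul a b => simp
          have h3 : ∀ (s : X ⊗[k] A), TensorProduct.assoc k X A A (mulR2 p s ⊗ₜ b) =
              (mulR1 p).lTensor X (TensorProduct.assoc k X A A (s ⊗ₜ b)) := by
            intro s
            induction s with
            | zero => simp
            | add a b ha hb => simp only [map_add, TensorProduct.add_tmul, ha, hb]
            | tmul a b => simp
          simp only [LinearMap.rTensor_tmul, LinearMap.comp_apply, TensorProduct.mk_apply,
            TensorProduct.rightComm_tmul]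
          rw [h2, mulL1_T1, h3]
          rfl
    -- Coassociativity is given only for s = Δ(a)(1 ⊗ b). These elements span A ⊗ A, so s = e ⊗ d is
    -- allowed as well, and the factor e is cancelled afterwards.
    have hf : ∀ s, f1 s = f2 s := by
      intro s
      obtain ⟨s, rfl⟩ := H.TΔ2.surjective s
      induction s with
      | zero => simp
      | add s t hs ht => rw [map_add, map_add, map_add, hs, ht]
      | tmul a b =>
        rw [key, G.coassoc, LinearEquiv.apply_symm_apply]
        have h4 : ∀ t : X ⊗[k] A, mulL1 y (H.TΔ2.toLinearMap.lTensor X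
            (TensorProduct.assoc k X A A (t ⊗ₜ b))) = H.TΔ2.toLinearMap.lTensor X
            (TensorProduct.assoc k X A A (mulL1 y t ⊗ₜ b)) := by
          intro t
          induction t with
          | zero => simp
          | add a b ha hb => simp only [map_add, TensorProduct.add_tmul, ha, hb]
          | tmul a b => simp
        rw [h4, mulL1_T1]
        change _ = (H.lΔ (H.TΔ2 (a ⊗ₜ[k] b))).lTensor X (G.V (y ⊗ₜ x))
        generalize G.V (y ⊗ₜ x) = t
        induction t with
        | zero => simp
        | add a b ha hb => simp only [map_add, TensorProduct.add_tmul, ha, hb]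
        | tmul z c =>
          simp only [mulR2_tmul, TensorProduct.assoc_tmul, LinearMap.lTensor_tmul]
          congr 1
          exact (H.self.lmul_T1 c a b).symm
    apply eq_of_lTensor (fun e : A => mulR1 (k := k) (M := A) e)
      (fun n n' h => eq_of_mulR1 H.nondegenerate h)
    intro e
    have h5 := hf (e ⊗ₜ d)
    rw [f1_tmul] at h5
    rw [h5]
    change (H.lΔ (e ⊗ₜ[k] d)).lTensor X (G.V (y ⊗ₜ x)) = _
    rw [← LinearMap.comp_apply, ← LinearMap.lTensor_comp]
    congr 2
    ext a
    exact (H.self.mulR1_T1 a e d).symm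

end

end GaloisReflection

/-! ### Coactions whose canonical maps are all bijective -/

open scoped TensorProduct

namespace GaloisReflection

noncomputable section

set_option linter.unusedSectionVars false

section Toolkit

variable {k : Type*} [Field k] {R : Type*} [NonUnitalRing R] [Module k R] [IsScalarTower k R R]
  [SMulCommClass k R R] {M N L : Type*} [AddCommGroup M] [Module k M] [AddCommGroup N] [Module k N]
  [AddCommGroup L] [Module k L]

lemma mulL1_lTensor (f : M →ₗ[k] N) (a : R) (t : R ⊗[k] M) :
    mulL1 a (f.lTensor R t) = f.lTensor R (mulL1 a t) :=
  tensor_ext (f := mulL1 a ∘ₗ f.lTensor R) (g := f.lTensor R ∘ₗ mulL1 a) (by simp) t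

lemma mulR1_lTensor (f : M →ₗ[k] N) (a : R) (t : R ⊗[k] M) :
    mulR1 a (f.lTensor R t) = f.lTensor R (mulR1 a t) :=
  tensor_ext (f := mulR1 a ∘ₗ f.lTensor R) (g := f.lTensor R ∘ₗ mulR1 a) (by simp) t

lemma mulR2_rTensor (f : M →ₗ[k] N) (a : R) (t : M ⊗[k] R) :
    mulR2 a (f.rTensor R t) = f.rTensor R (mulR2 a t) :=
  tensor_ext (f := mulR2 a ∘ₗ f.rTensor R) (g := f.rTensor R ∘ₗ mulR2 a) (by simp) t

lemma mulL1_assoc (a : R) (t : (R ⊗[k] M) ⊗[k] N) :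
    mulL1 a (TensorProduct.assoc k R M N t) =
      TensorProduct.assoc k R M N ((mulL1 a).rTensor N t) := by
  refine LinearMap.congr_fun (f := mulL1 a ∘ₗ (TensorProduct.assoc k R M N).toLinearMap)
    (g := (TensorProduct.assoc k R M N).toLinearMap ∘ₗ (mulL1 a).rTensor N) ?_ t
  ext
  simp

lemma mulR1_assoc (a : R) (t : (R ⊗[k] M) ⊗[k] N) :
    mulR1 a (TensorProduct.assoc k R M N t) =
      TensorProduct.assoc k R M N ((mulR1 a).rTensor N t) := by
  refine LinearMap.congr_fun (f := mulR1 a ∘ₗ (TensorProduct.assoc k R M N).toLinearMap)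
    (g := (TensorProduct.assoc k R M N).toLinearMap ∘ₗ (mulR1 a).rTensor N) ?_ t
  ext
  simp

lemma lTensor_sliceR_assoc (g : Module.Dual k L) (t : (M ⊗[k] N) ⊗[k] L) :
    (sliceR g).lTensor M (TensorProduct.assoc k M N L t) = sliceR g t := by
  refine LinearMap.congr_fun (f := (sliceR g).lTensor M ∘ₗ
    (TensorProduct.assoc k M N L).toLinearMap) (g := sliceR g) ?_ t
  ext
  simp

lemma lTensor_sliceL_assoc (g : Module.Dual k N) (t : (M ⊗[k] N) ⊗[k] L) :
    (sliceL g).lTensor M (TensorProduct.assoc k M N L t) = (sliceR g).rTensor L t := by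
  refine LinearMap.congr_fun (f := (sliceL g).lTensor M ∘ₗ
    (TensorProduct.assoc k M N L).toLinearMap) (g := (sliceR g).rTensor L) ?_ t
  ext
  simp [TensorProduct.tmul_smul, TensorProduct.smul_tmul]

lemma sliceL_assoc (g : Module.Dual k M) (t : (M ⊗[k] N) ⊗[k] L) :
    sliceL g (TensorProduct.assoc k M N L t) = (sliceL g).rTensor L t := by
  refine LinearMap.congr_fun (f := sliceL g ∘ₗ
    (TensorProduct.assoc k M N L).toLinearMap) (g := (sliceL g).rTensor L) ?_ t
  ext
  simp [TensorProduct.smul_tmul']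

lemma lTensor_smul_const (g : Module.Dual k N) (l : L) (f : N →ₗ[k] L) (h : ∀ n, f n = g n • l)
    (t : M ⊗[k] N) : f.lTensor M t = sliceR g t ⊗ₜ l := by
  induction t with
  | zero => simp
  | add a b ha hb => simp only [map_add, TensorProduct.add_tmul, ha, hb]
  | tmul a b => simp [h, TensorProduct.smul_tmul']

lemma rTensor_smul_const (g : Module.Dual k M) (l : L) (f : M →ₗ[k] L) (h : ∀ n, f n = g n • l)
    (t : M ⊗[k] N) : f.rTensor N t = l ⊗ₜ sliceL g t := by
  induction t with
  | zero => simp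
  | add a b ha hb => simp only [map_add, TensorProduct.tmul_add, ha, hb]
  | tmul a b => simp [h, TensorProduct.smul_tmul']

variable (ε : R →ₙₐ[k] k)

lemma sliceL_char_mulR1 (b : R) (t : R ⊗[k] M) :
    sliceL (ε : R →ₗ[k] k) (mulR1 b t) = ε b • sliceL (ε : R →ₗ[k] k) t := by
  induction t with
  | zero => simp
  | add a b ha hb => simp only [map_add, ha, hb, smul_add]
  | tmul a m => simp [mul_smul, smul_comm (ε a)]

lemma sliceL_char_mulL1 (b : R) (t : R ⊗[k] M) :
    sliceL (ε : R →ₗ[k] k) (mulL1 b t) = ε b • sliceL (ε : R →ₗ[k] k) t := by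
  induction t with
  | zero => simp
  | add a b ha hb => simp only [map_add, ha, hb, smul_add]
  | tmul a m => simp [mul_smul]

lemma sliceR_char_mulR2 (b : R) (t : M ⊗[k] R) :
    sliceR (ε : R →ₗ[k] k) (mulR2 b t) = ε b • sliceR (ε : R →ₗ[k] k) t := by
  induction t with
  | zero => simp
  | add a b ha hb => simp only [map_add, ha, hb, smul_add]
  | tmul a m => simp [mul_smul, smul_comm (ε m)]

lemma sliceR_char_mulL2 (b : R) (t : M ⊗[k] R) :
    sliceR (ε : R →ₗ[k] k) (mulL2 b t) = ε b • sliceR (ε : R →ₗ[k] k) t := by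
  induction t with
  | zero => simp
  | add a b ha hb => simp only [map_add, ha, hb, smul_add]
  | tmul a m => simp [mul_smul]

end Toolkit

variable {k : Type*} [Field k] {A : Type*} [NonUnitalRing A] [Module k A]
  [IsScalarTower k A A] [SMulCommClass k A A] {X : Type*} [NonUnitalRing X] [Module k X]
  [IsScalarTower k X X] [SMulCommClass k X X] {H : RegularMultiplierHopfAlgebra k A}

/-- A coaction for which all canonical maps are bijective. -/
structure Frame (H : RegularMultiplierHopfAlgebra k A) (X : Type*) [NonUnitalRing X]
    [Module k X] [IsScalarTower k X X] [SMulCommClass k X X] extends PreFrame H X where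
  T1_bijective : Function.Bijective T1
  W : X ⊗[k] X ≃ₗ[k] X ⊗[k] A
  W_spec : ∀ x y, Mult.of k (W (x ⊗ₜ y)) = α x * Mult.tmul (Mult.of k y) 1

/-- The Hopf algebra coacting on itself. -/
def RegularMultiplierHopfAlgebra.frame (H : RegularMultiplierHopfAlgebra k A) : Frame H A where
  toPreFrame := H.self
  T1_bijective := H.TΔ2.bijective
  W := H.TΔ1
  W_spec := H.TΔ1_spec

namespace PreFrame

variable (F : PreFrame H X)

/-- `t ↦ (y ⊗ 1 ⊗ 1)(α ⊗ ι)(t)`. -/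
def gV (y : X) : X ⊗[k] A →ₗ[k] X ⊗[k] (A ⊗[k] A) :=
  (TensorProduct.assoc k X A A).toLinearMap ∘ₗ
    (F.V.toLinearMap ∘ₗ TensorProduct.mk k X X y).rTensor A

lemma gV_tmul (y x : X) (a : A) :
    F.gV y (x ⊗ₜ a) = TensorProduct.assoc k X A A (F.V (y ⊗ₜ x) ⊗ₜ a) := rfl

/-- Coassociativity as an intertwining relation between `T1` and `TΔ2`. In this form it can be
applied to preimages under `T1`. -/
lemma gV_T1 (y : X) (s : X ⊗[k] A) : F.gV y (F.T1 s) = H.TΔ2.toLinearMap.lTensor X (F.gV y s) := by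
  induction s with
  | zero => simp
  | add a b ha hb => simp only [map_add, ha, hb]
  | tmul x d =>
    rw [gV_tmul]
    refine (F.coassoc x y d).trans ?_
    generalize F.V (y ⊗ₜ[k] x) = t
    induction t with
    | zero => simp
    | add a b ha hb => simp only [map_add, TensorProduct.add_tmul, ha, hb]
    | tmul a b => simp

/-- Multiplicativity of Δ: (c ⊗ 1)Δ(a)Δ(x₍₁₎) = (c ⊗ 1)Δ(a x₍₁₎). -/
lemma dbl2_P (x : X) (c a : A) : F.dbl2 x (H.T1Δ (c ⊗ₜ a)) =
    (H.T1Δ.toLinearMap ∘ₗ TensorProduct.mk k A A c).lTensor X (F.T2 (x ⊗ₜ a)) := by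
  apply eq_of_mulL1 F.nondegenerate
  intro y
  rw [mulL1_dbl2, mulL1_lTensor, mulL1_T2, ← mulL2_V]
  refine tensor_ext (f := (H.rΔ (H.T1Δ (c ⊗ₜ[k] a))).lTensor X)
    (g := (H.T1Δ.toLinearMap ∘ₗ TensorProduct.mk k A A c).lTensor X ∘ₗ mulL2 a) ?_ _
  intro z d
  simp only [LinearMap.lTensor_tmul, LinearMap.comp_apply, mulL2_tmul]
  congr 1
  exact H.self.rmul_V d a c

end PreFrame

namespace Frame

variable (F : Frame H X)

open Mult in
lemma mulR2_W (x y : X) (a : A) : mulR2 a (F.W (x ⊗ₜ y)) = (F.α x).lmul (y ⊗ₜ a) := by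
  apply of_injective (k := k) F.ndXA
  rw [of_mulR2 F.nondegenerate H.nondegenerate, F.W_spec, of_lmul F.ndXA, of_tmul, mul_assoc]

lemma mulR1_T1_eq (x y : X) (a : A) : mulR1 y (F.T1 (x ⊗ₜ a)) = mulR2 a (F.W (x ⊗ₜ y)) := by
  rw [mulR2_W, F.mulR1_T1]

open Mult in
lemma lmul_W (x y z : X) : (F.α x).lmul (F.W (y ⊗ₜ z)) = F.W ((x * y) ⊗ₜ z) := by
  apply of_injective (k := k) F.ndXA
  rw [of_lmul F.ndXA, W_spec, W_spec, map_mul, mul_assoc]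

open Mult in
lemma mulL2_W (x y : X) (a : A) : mulL2 a (F.W (x ⊗ₜ y)) = mulR1 y (F.T2 (x ⊗ₜ a)) := by
  apply of_injective (k := k) F.ndXA
  rw [of_mulL2 F.nondegenerate H.nondegenerate, of_mulR1 F.nondegenerate H.nondegenerate,
    F.T2_spec, W_spec, mul_assoc]

open Mult in
lemma mulL1_W (x y z : X) : mulL1 z (F.W (x ⊗ₜ y)) = mulR1 y (F.V (z ⊗ₜ x)) := by
  apply of_injective (k := k) F.ndXA
  rw [of_mulL1 F.nondegenerate H.nondegenerate, of_mulR1 F.nondegenerate H.nondegenerate,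
    F.V_spec, W_spec, mul_assoc]

open Mult in
lemma W_mul (x y z : X) : F.W (x ⊗ₜ (y * z)) = mulR1 z (F.W (x ⊗ₜ y)) := by
  apply of_injective (k := k) F.ndXA
  rw [of_mulR1 F.nondegenerate H.nondegenerate, W_spec, W_spec,
    inl_of_mul F.nondegenerate H.nondegenerate, mul_assoc]

/-- `t ↦ (α ⊗ ι)(t)(y ⊗ 1 ⊗ 1)`. -/
def gW (y : X) : X ⊗[k] A →ₗ[k] X ⊗[k] (A ⊗[k] A) :=
  (TensorProduct.assoc k X A A).toLinearMap ∘ₗ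
    (F.W.toLinearMap ∘ₗ (TensorProduct.mk k X X).flip y).rTensor A

lemma gW_tmul (y x : X) (a : A) :
    F.gW y (x ⊗ₜ a) = TensorProduct.assoc k X A A (F.W (x ⊗ₜ y) ⊗ₜ a) := rfl

lemma mulL1_gW (y z : X) (s : X ⊗[k] A) : mulL1 z (F.gW y s) = mulR1 y (F.gV z s) := by
  induction s with
  | zero => simp
  | add a b ha hb => simp only [map_add, ha, hb]
  | tmul x a =>
    rw [gW_tmul, F.gV_tmul, mulL1_assoc, mulR1_assoc, LinearMap.rTensor_tmul,
      LinearMap.rTensor_tmul, mulL1_W]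

lemma gW_T1 (y : X) (s : X ⊗[k] A) : F.gW y (F.T1 s) = H.TΔ2.toLinearMap.lTensor X (F.gW y s) := by
  apply eq_of_mulL1 F.nondegenerate
  intro z
  rw [mulL1_gW, F.gV_T1, mulR1_lTensor, mulL1_lTensor, mulL1_gW]

lemma dbl_U (x : X) (b c : A) : F.dbl x (H.TΔ1 (b ⊗ₜ c)) =
    (H.TΔ1.toLinearMap ∘ₗ (TensorProduct.mk k A A).flip c).lTensor X (F.T1 (x ⊗ₜ b)) := by
  apply eq_of_mulL1 F.nondegenerate
  intro y
  rw [F.mulL1_dbl, mulL1_lTensor, F.mulL1_T1]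
  refine tensor_ext (f := (H.lΔ (H.TΔ1 (b ⊗ₜ[k] c))).lTensor X)
    (g := (H.TΔ1.toLinearMap ∘ₗ (TensorProduct.mk k A A).flip c).lTensor X ∘ₗ mulR2 b) ?_ _
  intro z d
  simp only [LinearMap.lTensor_tmul, LinearMap.comp_apply, mulR2_tmul]
  congr 1
  exact H.frame.lmul_W d b c

end Frame

/-! ### Existence of the counit and the antipode -/

namespace RegularMultiplierHopfAlgebra

variable (H)

lemma mulL1_T (a b c : A) : mulL1 c (H.TΔ2 (a ⊗ₜ b)) = mulR2 b (H.T1Δ (c ⊗ₜ a)) :=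
  H.self.mulL1_T1 a c b
lemma mulL2_T (a b c : A) : mulL2 c (H.TΔ2 (a ⊗ₜ b)) = mulR2 b (H.T2Δ (c ⊗ₜ a)) :=
  H.self.mulL2_T1 a b c
lemma mulR1_T (a b c : A) : mulR1 c (H.TΔ2 (a ⊗ₜ b)) = mulR2 b (H.TΔ1 (a ⊗ₜ c)) :=
  H.frame.mulR1_T1_eq a c b
lemma mulL2_U (a b c : A) : mulL2 c (H.TΔ1 (a ⊗ₜ b)) = mulR1 b (H.T2Δ (c ⊗ₜ a)) :=
  H.frame.mulL2_W a b c
lemma mulL1_U (a b c : A) : mulL1 c (H.TΔ1 (a ⊗ₜ b)) = mulR1 b (H.T1Δ (c ⊗ₜ a)) :=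
  H.frame.mulL1_W a b c
lemma mulL1_Q (a b c : A) : mulL1 c (H.T2Δ (a ⊗ₜ b)) = mulL2 a (H.T1Δ (c ⊗ₜ b)) :=
  (H.self.mulL1_T2 b c a).trans (H.self.mulL2_V b c a).symm

lemma exists_mul_ne_zero (H : RegularMultiplierHopfAlgebra k A) : ∃ a b : A, a * b ≠ 0 := by
  obtain ⟨a, ha⟩ := (@exists_ne A H.nontrivial 0)
  by_contra! h
  exact ha (H.nondegenerate.left a fun b => h a b)

/-- The counit must satisfy ε(b) c = m(T⁻¹(b ⊗ c)) for T = `TΔ2`; call the right-hand side `E c b`.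
Coassociativity gives (ι ⊗ E c)((a ⊗ 1)Δ(b)) = ab ⊗ c. Since the elements (a ⊗ 1)Δ(b) span A ⊗ A,
all values of ι ⊗ E c have the form · ⊗ c, with a first leg independent of c. Hence `E c b` is a
multiple of c, and the factor is ε(b). -/
theorem exists_counit : ∃ ε : A →ₙₐ[k] k, H.IsCounit ε := by
  let E : A → A →ₗ[k] A := fun c => LinearMap.mul' k A ∘ₗ H.TΔ2.symm.toLinearMap ∘ₗ
    (TensorProduct.mk k A A).flip c
  have h1 : ∀ (a : A) (s : A ⊗[k] A), (LinearMap.mul' k A).lTensor A (H.self.gV a s) =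
      mulL1 a (H.TΔ2 s) := by
    intro a s
    induction s with
    | zero => simp
    | add a b ha hb => simp only [map_add, ha, hb]
    | tmul p q =>
      rw [mulL1_T, PreFrame.gV_tmul]
      change _ = mulR2 q (H.self.V (a ⊗ₜ p))
      generalize H.self.V (a ⊗ₜ[k] p) = t
      induction t with
      | zero => simp
      | add a b ha hb => simp only [map_add, TensorProduct.add_tmul, ha, hb]
      | tmul a b => simp
  have h2 : ∀ a b c : A, (E c).lTensor A (H.T1Δ (a ⊗ₜ b)) = (a * b) ⊗ₜ c := by
    intro a b c
    have h3 := H.self.gV_T1 a (H.TΔ2.symm (b ⊗ₜ c))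
    have h4 := congrArg (H.TΔ2.symm.toLinearMap.lTensor A) h3
    rw [← LinearMap.comp_apply (H.TΔ2.symm.toLinearMap.lTensor A) (H.TΔ2.toLinearMap.lTensor A),
      ← LinearMap.lTensor_comp, LinearEquiv.symm_comp, LinearMap.lTensor_id,
      LinearMap.id_apply] at h4
    have h5 := congrArg ((LinearMap.mul' k A).lTensor A) h4
    rw [h1, LinearEquiv.apply_symm_apply, mulL1_tmul] at h5
    rw [← h5, show H.self.T1 (H.TΔ2.symm (b ⊗ₜ c)) = b ⊗ₜ c from H.TΔ2.apply_symm_apply _,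
      PreFrame.gV_tmul]
    change _ = LinearMap.lTensor _ _ (LinearMap.lTensor _ _
      (TensorProduct.assoc k A A A (H.T1Δ (a ⊗ₜ[k] b) ⊗ₜ[k] c)))
    generalize H.T1Δ (a ⊗ₜ[k] b) = t
    induction t with
    | zero => simp
    | add a b ha hb => simp only [map_add, TensorProduct.add_tmul, ha, hb]
    | tmul a b => simp [E]
  have h3 : ∀ (c : A) (t : A ⊗[k] A), (E c).lTensor A t =
      LinearMap.mul' k A (H.T1Δ.symm t) ⊗ₜ c := by
    intro c t
    obtain ⟨t, rfl⟩ := H.T1Δ.surjective t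
    induction t with
    | zero => simp
    | add a b ha hb => simp only [map_add, TensorProduct.add_tmul, ha, hb]
    | tmul a b => simp [h2]
  obtain ⟨a₀, ha₀⟩ := (@exists_ne A H.nontrivial 0)
  obtain ⟨f, hf⟩ := exists_dual_eq_one (k := k) ha₀
  let e : A →ₗ[k] k := f ∘ₗ LinearMap.mul' k A ∘ₗ H.T1Δ.symm.toLinearMap ∘ₗ
    TensorProduct.mk k A A a₀
  have h4 : ∀ b c, E c b = e b • c := by
    intro b c
    simpa [hf, e] using congrArg (sliceL f) (h3 c (a₀ ⊗ₜ b))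
  have hL : ∀ t, LinearMap.mul' k A t = sliceL e (H.TΔ2 t) := by
    intro t
    obtain ⟨t, rfl⟩ := H.TΔ2.symm.surjective t
    rw [LinearEquiv.apply_symm_apply]
    induction t with
    | zero => simp
    | add a b ha hb => simp only [map_add, ha, hb]
    | tmul a b => simpa [E] using h4 a b
  have hR : ∀ t, LinearMap.mul' k A t = sliceR e (H.T1Δ t) := by
    intro t
    obtain ⟨t, rfl⟩ := H.T1Δ.symm.surjective t
    rw [LinearEquiv.apply_symm_apply]
    induction t with
    | zero => simp
    | add a b ha hb => simp only [map_add, ha, hb]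
    | tmul a b =>
      have h5 := h3 a₀ (a ⊗ₜ b)
      rw [LinearMap.lTensor_tmul, h4, ← TensorProduct.smul_tmul] at h5
      simpa using (tmul_left_cancel ha₀ h5).symm
  -- Multiplicativity of ε comes from (ε ⊗ ι)(Δ(a)s) = a (ε ⊗ ι)(s), applied to Δ(a)(b ⊗ c), which
  -- is also Δ(a)(1 ⊗ c) multiplied by b ⊗ 1 on the right.
  have hl : ∀ (a : A) (s : A ⊗[k] A), sliceL e ((H.comul a).lmul s) = a * sliceL e s := by
    intro a s
    obtain ⟨s, rfl⟩ := H.TΔ2.surjective s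
    induction s with
    | zero => simp
    | add a b ha hb => simp only [map_add, ha, hb, mul_add]
    | tmul b c =>
      rw [show (H.comul a).lmul (H.TΔ2 (b ⊗ₜ c)) = H.TΔ2 ((a * b) ⊗ₜ c) from
        H.self.lmul_T1 a b c, ← hL, ← hL]
      simp [mul_assoc]
  have hmul : ∀ (b : A) (t : A ⊗[k] A), sliceL e (mulR1 b t) = e b • sliceL e t := by
    intro b t
    obtain ⟨t, rfl⟩ := H.TΔ2.surjective t
    induction t with
    | zero => simp
    | add a b ha hb => simp only [map_add, ha, hb, smul_add]
    | tmul a c =>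
      rw [show mulR1 b (H.TΔ2 (a ⊗ₜ c)) = (H.comul a).lmul (b ⊗ₜ c) from H.self.mulR1_T1 a b c,
        hl, ← hL]
      simp [mul_smul_comm]
  refine ⟨{ toFun := e
            map_smul' := map_smul e
            map_add' := map_add e
            map_mul' := ?_
            map_zero' := map_zero e }, ?_, ?_⟩
  · intro a b
    have := hmul b (a ⊗ₜ a₀)
    simp only [mulR1_tmul, sliceL_tmul, ← mul_smul] at this
    have h6 := congrArg f this
    simpa [hf, mul_comm] using h6
  · intro a b
    exact (hL (a ⊗ₜ b)).symm
  · intro a b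
    exact (hR (a ⊗ₜ b)).symm

variable {H}

namespace IsCounit

variable {ε : A →ₙₐ[k] k}

lemma left_apply (hε : H.IsCounit ε) (t : A ⊗[k] A) :
    sliceL (ε : A →ₗ[k] k) (H.TΔ2 t) = LinearMap.mul' k A t :=
  tensor_ext (f := sliceL (ε : A →ₗ[k] k) ∘ₗ H.TΔ2.toLinearMap) (by simpa using hε.left) t

lemma exists_eq_one (hε : H.IsCounit ε) : ∃ a, ε a = 1 := by
  obtain ⟨a, b, hab⟩ := H.exists_mul_ne_zero
  have h : (ε : A →ₗ[k] k) ≠ 0 := by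
    intro h
    apply hab
    rw [← hε.left, h]
    simp [sliceL]
  exact exists_eq_one_of_ne_zero h

lemma sliceL_U (hε : H.IsCounit ε) (a b : A) :
    sliceL (ε : A →ₗ[k] k) (H.TΔ1 (a ⊗ₜ b)) = ε b • a := by
  apply H.nondegenerate.eq_of_mul_right
  intro c
  rw [← sliceL_mulR2, ← mulR1_T, sliceL_char_mulR1, hε.left, smul_mul_assoc]

lemma sliceL_Q (hε : H.IsCounit ε) (a b : A) : sliceL (ε : A →ₗ[k] k) (H.T2Δ (a ⊗ₜ b)) = a * b := by
  apply H.nondegenerate.eq_of_mul_right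
  intro c
  rw [← sliceL_mulR2, ← mulL2_T, sliceL_mulL2, hε.left, mul_assoc]

lemma sliceR_T (hε : H.IsCounit ε) (a b : A) :
    sliceR (ε : A →ₗ[k] k) (H.TΔ2 (a ⊗ₜ b)) = ε b • a := by
  apply H.nondegenerate.eq_of_mul_left
  intro c
  rw [← sliceR_mulL1, mulL1_T, sliceR_char_mulR2, hε.right, mul_smul_comm]

end IsCounit

variable {φ : Module.Dual k A}

lemma IsLeftInvariant.sliceR_P (hφ : H.IsLeftInvariant φ) (c d : A) :
    sliceR φ (H.T1Δ (c ⊗ₜ d)) = φ d • c := by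
  apply H.nondegenerate.eq_of_mul_right
  intro b
  rw [← sliceR_mulR1, ← mulL1_U, sliceR_mulL1, hφ, mul_smul_comm, smul_mul_assoc]

/-- `Σ T(T_φ(a, q) ⊗ p) = T_φ(a, b) ⊗ c` for `Σ p ⊗ q = Δ(b)(c ⊗ 1)`. -/
lemma IsLeftInvariant.T_slice (hφ : H.IsLeftInvariant φ) (a b c : A) :
    H.TΔ2 ((sliceR φ ∘ₗ H.TΔ2.toLinearMap ∘ₗ TensorProduct.mk k A A a).rTensor A
      (TensorProduct.comm k A A (H.TΔ1 (b ⊗ₜ c)))) = sliceR φ (H.TΔ2 (a ⊗ₜ b)) ⊗ₜ c := by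
  have h : ∀ s : A ⊗[k] A, H.TΔ2 ((sliceR φ ∘ₗ H.TΔ2.toLinearMap ∘ₗ
      TensorProduct.mk k A A a).rTensor A (TensorProduct.comm k A A s)) =
      (sliceR φ).lTensor A (H.self.dbl a s) := by
    intro s
    induction s with
    | zero => simp
    | add a b ha hb => simp only [map_add, ha, hb]
    | tmul p q =>
      rw [PreFrame.dbl_tmul, lTensor_sliceR_assoc, sliceR_rTensor]
      rfl
  rw [h, show H.self.dbl a (H.TΔ1 (b ⊗ₜ[k] c)) = _ from H.frame.dbl_U a b c,
    ← LinearMap.comp_apply, ← LinearMap.lTensor_comp]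
  exact lTensor_smul_const φ c _ (fun n => hφ n c) _

/-- `Σ Q(p ⊗ Q_φ(q, b)) = Q_φ(a, b) ⊗ c` for `Σ p ⊗ q = (c ⊗ 1)Δ(a)`. -/
lemma IsLeftInvariant.Q_slice (hφ : H.IsLeftInvariant φ) (a b c : A) :
    H.T2Δ ((sliceR φ ∘ₗ H.T2Δ.toLinearMap ∘ₗ (TensorProduct.mk k A A).flip b).lTensor A
      (H.T1Δ (c ⊗ₜ a))) = sliceR φ (H.T2Δ (a ⊗ₜ b)) ⊗ₜ c := by
  have h : ∀ s : A ⊗[k] A, H.T2Δ ((sliceR φ ∘ₗ H.T2Δ.toLinearMap ∘ₗ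
      (TensorProduct.mk k A A).flip b).lTensor A s) =
      (sliceR φ).lTensor A (H.self.dbl2 b s) := by
    intro s
    induction s with
    | zero => simp
    | add a b ha hb => simp only [map_add, ha, hb]
    | tmul p q =>
      rw [PreFrame.dbl2_tmul, lTensor_sliceR_assoc, sliceR_rTensor]
      rfl
  rw [h, PreFrame.dbl2_P, ← LinearMap.comp_apply, ← LinearMap.lTensor_comp]
  exact lTensor_smul_const φ c _ (fun n => hφ.sliceR_P c n) _

/-- Strong left invariance, with S(a)c replaced by the expression (ε ⊗ ι)T⁻¹(a ⊗ c) that it must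
equal. Established before S exists, it makes the definition of S by slices consistent. -/
lemma IsLeftInvariant.sliceL_T_symm (hφ : H.IsLeftInvariant φ) {ε : A →ₙₐ[k] k}
    (hε : H.IsCounit ε) (t : A ⊗[k] A) (c : A) :
    sliceL (ε : A →ₗ[k] k) (H.TΔ2.symm (sliceR φ (H.TΔ2 t) ⊗ₜ c)) = sliceR φ (H.T2Δ t) * c := by
  induction t with
  | zero => simp
  | add a b ha hb => simp only [map_add, TensorProduct.add_tmul, ha, hb, add_mul]
  | tmul a b =>
    rw [← hφ.T_slice, LinearEquiv.symm_apply_apply, sliceL_rTensor, ← sliceR_mulR1, ← mulL2_U]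
    generalize H.TΔ1 (b ⊗ₜ c) = s
    induction s with
    | zero => simp
    | add a b ha hb => simp only [map_add, ha, hb]
    | tmul p q =>
      simp only [TensorProduct.comm_tmul, sliceL_tmul, LinearMap.comp_apply, mulL2_tmul,
        sliceR_tmul, TensorProduct.mk_apply]
      rw [apply_sliceR, LinearEquiv.coe_coe, hε.left]

/-- The mirror image of `sliceL_T_symm`: it recovers the slice of `TΔ2` from that of `T2Δ`, which
yields injectivity of the antipode. -/
lemma IsLeftInvariant.sliceR_Q_symm (hφ : H.IsLeftInvariant φ) {ε : A →ₙₐ[k] k}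
    (hε : H.IsCounit ε) (t : A ⊗[k] A) (c : A) :
    sliceR (ε : A →ₗ[k] k) (H.T2Δ.symm (sliceR φ (H.T2Δ t) ⊗ₜ c)) = c * sliceR φ (H.TΔ2 t) := by
  induction t with
  | zero => simp
  | add a b ha hb => simp only [map_add, TensorProduct.add_tmul, ha, hb, mul_add]
  | tmul a b =>
    rw [← hφ.Q_slice, LinearEquiv.symm_apply_apply, sliceR_lTensor, ← sliceR_mulL1, mulL1_T]
    generalize H.T1Δ (c ⊗ₜ a) = s
    induction s with
    | zero => simp
    | add a b ha hb => simp only [map_add, ha, hb]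
    | tmul p q =>
      simp only [sliceR_tmul, LinearMap.comp_apply, mulR2_tmul,
        TensorProduct.mk_apply, LinearMap.flip_apply]
      rw [apply_sliceR, LinearEquiv.coe_coe, hε.sliceL_Q]

end RegularMultiplierHopfAlgebra

/-- A counit and an antipode. -/
structure HopfMaps (H : RegularMultiplierHopfAlgebra k A) where
  ε : A →ₙₐ[k] k
  counit : H.IsCounit ε
  S : A ≃ₗ[k] A
  antipode : H.IsAntipode ε S

-- The antipode is defined by S((ι ⊗ φ)(Δ(a)(1 ⊗ b))) = (ι ⊗ φ)((1 ⊗ a)Δ(b)). As φ ≠ 0, the slices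
-- on either side exhaust A. The map is well defined by `sliceL_T_symm` and injective by
-- `sliceR_Q_symm`.
open RegularMultiplierHopfAlgebra in
theorem exists_hopfMaps {φ : Module.Dual k A} (hφ : H.IsLeftInvariant φ) (hφ0 : φ ≠ 0) :
    Nonempty (HopfMaps H) := by
  obtain ⟨ε, hε⟩ := H.exists_counit
  have hTsurj : Function.Surjective (sliceR φ ∘ₗ H.TΔ2.toLinearMap) :=
    (sliceR_surjective hφ0).comp H.TΔ2.surjective
  have hQsurj : Function.Surjective (sliceR φ ∘ₗ H.T2Δ.toLinearMap) :=
    (sliceR_surjective hφ0).comp H.T2Δ.surjective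
  obtain ⟨S, hS⟩ := exists_factor_of_ker_le (sliceR φ ∘ₗ H.TΔ2.toLinearMap) hTsurj
    (sliceR φ ∘ₗ H.T2Δ.toLinearMap) (by
      intro t ht
      apply H.nondegenerate.left
      intro c
      change sliceR φ (H.T2Δ t) * c = 0
      rw [← hφ.sliceL_T_symm hε, show sliceR φ (H.TΔ2 t) = 0 from ht]
      simp)
  have hSc : ∀ a c, S a * c = sliceL (ε : A →ₗ[k] k) (H.TΔ2.symm (a ⊗ₜ c)) := by
    intro a c
    obtain ⟨t, rfl⟩ := hTsurj a
    rw [hS]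
    exact (hφ.sliceL_T_symm hε t c).symm
  have hinj : Function.Injective S := by
    rw [← LinearMap.ker_eq_bot, LinearMap.ker_eq_bot']
    intro a ha
    obtain ⟨t, rfl⟩ := hTsurj a
    rw [hS] at ha
    apply H.nondegenerate.right
    intro c
    change c * sliceR φ (H.TΔ2 t) = 0
    rw [← hφ.sliceR_Q_symm hε, show sliceR φ (H.T2Δ t) = 0 from ha]
    simp
  have hsurj : Function.Surjective S := by
    intro a
    obtain ⟨t, rfl⟩ := hQsurj a
    exact ⟨_, hS t⟩
  refine ⟨⟨ε, hε, LinearEquiv.ofBijective S ⟨hinj, hsurj⟩, ⟨?_, ?_, ?_⟩⟩⟩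
  · intro a b
    change S (a * b) = S b * S a
    apply H.nondegenerate.eq_of_mul_right
    intro c
    rw [mul_assoc, hSc a c]
    -- Since Δ(p)T(r ⊗ s) = T(pr ⊗ s), one has Δ(p)(b ⊗ q) = T((p ⊗ 1)T⁻¹(b ⊗ q)). With T⁻¹(a ⊗ c) =
    -- Σ p ⊗ q this computes T⁻¹(ab ⊗ c), and ε on the first leg gives S(b)S(a)c.
    have h1 : ∀ s : A ⊗[k] A, mulR1 b (H.TΔ2 s) = H.TΔ2 (TensorProduct.lift
        ((LinearMap.rTensorHom A ∘ₗ LinearMap.mul k A).compl₂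
          (H.TΔ2.symm.toLinearMap ∘ₗ TensorProduct.mk k A A b)) s) := by
      intro s
      induction s with
      | zero => simp
      | add a b ha hb => simp only [map_add, ha, hb]
      | tmul p q =>
        rw [TensorProduct.lift.tmul]
        change _ = H.TΔ2 ((LinearMap.mulLeft k p).rTensor A (H.TΔ2.symm (b ⊗ₜ q)))
        have h2 : ∀ s, H.TΔ2 ((LinearMap.mulLeft k p).rTensor A s) =
            (H.comul p).lmul (H.TΔ2 s) := by
          intro s
          induction s with
          | zero => simp
          | add a b ha hb => simp only [map_add, ha, hb]
          | tmul r s => exact (H.self.lmul_T1 p r s).symm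
        rw [h2, LinearEquiv.apply_symm_apply]
        exact H.self.mulR1_T1 p b q
    have h3 := h1 (H.TΔ2.symm (a ⊗ₜ c))
    rw [LinearEquiv.apply_symm_apply, mulR1_tmul] at h3
    rw [hSc, h3, LinearEquiv.symm_apply_apply]
    generalize H.TΔ2.symm (a ⊗ₜ[k] c) = s
    induction s with
    | zero => simp
    | add a b ha hb => simp only [map_add, ha, hb, mul_add]
    | tmul p q =>
      rw [TensorProduct.lift.tmul, sliceL_tmul, mul_smul_comm, hSc]
      exact sliceL_char_mulL1 ε p _
  · intro a b
    have h1 : ∀ t, LinearMap.mul' k A (S.rTensor A t) =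
        sliceL (ε : A →ₗ[k] k) (H.TΔ2.symm t) := by
      intro t
      induction t with
      | zero => simp
      | add a b ha hb => simp only [map_add, ha, hb]
      | tmul p q => simp [hSc]
    refine (h1 _).trans ?_
    simp
  · intro a b
    apply H.nondegenerate.eq_of_mul_right
    intro c
    have h1 : ∀ t : A ⊗[k] A, LinearMap.mul' k A (S.lTensor A t) * c =
        LinearMap.mul' k A ((sliceL (ε : A →ₗ[k] k)).lTensor A
          (H.TΔ2.symm.toLinearMap.lTensor A (TensorProduct.assoc k A A A (t ⊗ₜ c)))) := by
      intro t
      induction t with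
      | zero => simp
      | add a b ha hb => simp only [map_add, TensorProduct.add_tmul, ha, hb, add_mul]
      | tmul p q => simp [hSc, mul_assoc]
    refine (h1 _).trans ?_
    have h3 := H.self.gV_T1 a (H.TΔ2.symm (b ⊗ₜ c))
    have h4 := congrArg (H.TΔ2.symm.toLinearMap.lTensor A) h3
    rw [← LinearMap.comp_apply (H.TΔ2.symm.toLinearMap.lTensor A) (H.TΔ2.toLinearMap.lTensor A),
      ← LinearMap.lTensor_comp, LinearEquiv.symm_comp, LinearMap.lTensor_id,
      LinearMap.id_apply, show H.self.T1 (H.TΔ2.symm (b ⊗ₜ c)) = b ⊗ₜ c from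
      H.TΔ2.apply_symm_apply _, PreFrame.gV_tmul] at h4
    refine (congrArg _ (congrArg _ h4)).trans ?_
    have h5 : ∀ s : A ⊗[k] A, LinearMap.mul' k A ((sliceL (ε : A →ₗ[k] k)).lTensor A
        (H.self.gV a s)) = a * LinearMap.mul' k A s := by
      intro s
      induction s with
      | zero => simp
      | add a b ha hb => simp only [map_add, ha, hb, mul_add]
      | tmul p q =>
        rw [PreFrame.gV_tmul, lTensor_sliceL_assoc, LinearMap.rTensor_tmul,
          show sliceR (ε : A →ₗ[k] k) (H.self.V (a ⊗ₜ p)) = a * p from hε.right a p]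
        simp [mul_assoc]
    rw [h5, ← hε.left_apply, LinearEquiv.apply_symm_apply]
    simp [mul_smul_comm, smul_mul_assoc]

end

end GaloisReflection

open scoped TensorProduct

namespace GaloisReflection

noncomputable section

set_option linter.unusedSectionVars false

/-! ### The antipode and the Galois maps -/

variable {k : Type*} [Field k] {A : Type*} [NonUnitalRing A] [Module k A]
  [IsScalarTower k A A] [SMulCommClass k A A] {X : Type*} [NonUnitalRing X] [Module k X]
  [IsScalarTower k X X] [SMulCommClass k X X] {H : RegularMultiplierHopfAlgebra k A}

open RegularMultiplierHopfAlgebra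

/-- The modular automorphism of a faithful functional. -/
theorem exists_modular {f : Module.Dual k X} (hl : ∀ x, (∀ y, f (x * y) = 0) → x = 0)
    (hr : ∀ x, (∀ y, f (y * x) = 0) → x = 0)
    (h1 : ∀ a, ∃ a', ∀ b, f (a * b) = f (b * a')) (h2 : ∀ a', ∃ a, ∀ b, f (a * b) = f (b * a')) :
    ∃ σ : X ≃ₗ[k] X, (∀ x y, σ (x * y) = σ x * σ y) ∧ ∀ x y, f (y * σ x) = f (x * y) := by
  choose s hs using h1
  have hr' : ∀ x x', (∀ y, f (y * x) = f (y * x')) → x = x' := by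
    intro x x' h
    rw [← sub_eq_zero]
    exact hr _ fun y => by rw [mul_sub, map_sub, h, sub_self]
  have hl' : ∀ x x', (∀ y, f (x * y) = f (x' * y)) → x = x' := by
    intro x x' h
    rw [← sub_eq_zero]
    exact hl _ fun y => by rw [sub_mul, map_sub, h, sub_self]
  let σ : X →ₗ[k] X :=
    { toFun := s
      map_add' := fun a b => hr' _ _ fun y => by
        rw [← hs (a + b), mul_add, add_mul, map_add, map_add, hs a, hs b]
      map_smul' := fun c a => hr' _ _ fun y => by
        rw [← hs (c • a), RingHom.id_apply, mul_smul_comm, smul_mul_assoc, map_smul, map_smul, hs a] }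
  refine ⟨LinearEquiv.ofBijective σ ⟨?_, ?_⟩, ?_, ?_⟩
  · intro a b hab
    apply hl'
    intro y
    rw [hs a, hs b]
    exact congrArg (fun z => f (y * z)) hab
  · intro a
    obtain ⟨b, hb⟩ := h2 a
    refine ⟨b, hr' _ _ fun y => ?_⟩
    rw [← hb]
    exact (hs b y).symm
  · intro a b
    apply hr'
    intro y
    change f (y * s (a * b)) = f (y * (s a * s b))
    rw [← hs, ← mul_assoc, ← hs, ← mul_assoc, mul_assoc, hs, mul_assoc]
  · intro x y
    exact (hs x y).symm

section Leg

variable (S : A →ₗ[k] A) (hS : ∀ a b, S (a * b) = S b * S a)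

lemma mul_mulLTensor (c : A) (t : A ⊗[k] A) : c * LinearMap.mul' k A (S.lTensor A t) =
    LinearMap.mul' k A (S.lTensor A (mulL1 c t)) := by
  induction t with
  | zero => simp
  | add a b ha hb => simp only [map_add, mul_add, ha, hb]
  | tmul a b => simp [mul_assoc]

lemma mulRTensor_mul (c : A) (t : A ⊗[k] A) : LinearMap.mul' k A (S.rTensor A t) * c =
    LinearMap.mul' k A (S.rTensor A (mulR2 c t)) := by
  induction t with
  | zero => simp
  | add a b ha hb => simp only [map_add, add_mul, ha, hb]
  | tmul a b => simp [mul_assoc]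

lemma mulLTensor_mulL2 (hS : ∀ a b, S (a * b) = S b * S a) (c : A) (t : A ⊗[k] A) :
    LinearMap.mul' k A (S.lTensor A (mulL2 c t)) = LinearMap.mul' k A (S.lTensor A t) * S c := by
  induction t with
  | zero => simp
  | add a b ha hb => simp only [map_add, add_mul, ha, hb]
  | tmul a b => simp [hS, mul_assoc]

lemma mulRTensor_mulR1 (hS : ∀ a b, S (a * b) = S b * S a) (c : A) (t : A ⊗[k] A) :
    LinearMap.mul' k A (S.rTensor A (mulR1 c t)) = S c * LinearMap.mul' k A (S.rTensor A t) := by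
  induction t with
  | zero => simp
  | add a b ha hb => simp only [map_add, mul_add, ha, hb]
  | tmul a b => simp [hS, mul_assoc]

end Leg

namespace HopfMaps

variable (C : HopfMaps H)

lemma S_mul (a b : A) : C.S (a * b) = C.S b * C.S a := C.antipode.map_mul a b

lemma Ssymm_mul (a b : A) : C.S.symm (a * b) = C.S.symm b * C.S.symm a := by
  apply C.S.injective
  simp [S_mul]

lemma S_left (t : A ⊗[k] A) : LinearMap.mul' k A (C.S.toLinearMap.rTensor A (H.TΔ2 t)) =
    sliceL (C.ε : A →ₗ[k] k) t :=
  tensor_ext (f := LinearMap.mul' k A ∘ₗ C.S.toLinearMap.rTensor A ∘ₗ H.TΔ2.toLinearMap)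
    (by simpa using C.antipode.left) t

lemma S_mul_eq (a c : A) : C.S a * c = sliceL (C.ε : A →ₗ[k] k) (H.TΔ2.symm (a ⊗ₜ c)) := by
  rw [← S_left, LinearEquiv.apply_symm_apply]
  simp

/-- Strong left invariance. -/
lemma S_slice {φ : Module.Dual k A} (hφ : H.IsLeftInvariant φ) (t : A ⊗[k] A) :
    C.S (sliceR φ (H.TΔ2 t)) = sliceR φ (H.T2Δ t) := by
  apply H.nondegenerate.eq_of_mul_right
  intro c
  rw [S_mul_eq, hφ.sliceL_T_symm C.counit]

lemma mul_S_Q (a b : A) : LinearMap.mul' k A (C.S.toLinearMap.lTensor A (H.T2Δ (b ⊗ₜ a))) =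
    C.ε a • C.S b := by
  apply H.nondegenerate.eq_of_mul_left
  intro c
  rw [mul_mulLTensor, mulL1_Q, mulLTensor_mulL2 _ C.antipode.map_mul, C.antipode.right,
    mul_smul_comm, smul_mul_assoc]
  rfl

lemma mul_S_U (b c : A) : LinearMap.mul' k A (C.S.toLinearMap.rTensor A (H.TΔ1 (b ⊗ₜ c))) =
    C.ε b • C.S c := by
  apply H.nondegenerate.eq_of_mul_right
  intro e
  rw [mulRTensor_mul, ← mulR1_T, mulRTensor_mulR1 _ C.antipode.map_mul, C.antipode.left,
    mul_smul_comm, smul_mul_assoc]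
  rfl

lemma mul_Ssymm_T (a b : A) : LinearMap.mul' k A (TensorProduct.comm k A A
    (C.S.symm.toLinearMap.lTensor A (H.TΔ2 (a ⊗ₜ b)))) = C.ε a • C.S.symm b := by
  apply C.S.injective
  rw [map_smul, LinearEquiv.apply_symm_apply, ← C.antipode.left]
  generalize H.TΔ2 (a ⊗ₜ b) = t
  induction t with
  | zero => simp
  | add a b ha hb => simp only [map_add, ha, hb]
  | tmul a b => simp [S_mul]

lemma mul_Ssymm_P (c a : A) : LinearMap.mul' k A (TensorProduct.comm k A A
    (C.S.symm.toLinearMap.rTensor A (H.T1Δ (c ⊗ₜ a)))) = C.ε a • C.S.symm c := by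
  apply C.S.injective
  rw [map_smul, LinearEquiv.apply_symm_apply, ← C.antipode.right]
  generalize H.T1Δ (c ⊗ₜ a) = t
  induction t with
  | zero => simp
  | add a b ha hb => simp only [map_add, ha, hb]
  | tmul a b => simp [S_mul]

section PreFrame

variable (F : PreFrame H X)

/-- The counit law of a coaction is not assumed: coassociativity and the counit of A give both sides
the same image under V(y ⊗ ·), and V is injective. -/
lemma sliceR_T1 (x : X) (q : A) : sliceR (C.ε : A →ₗ[k] k) (F.T1 (x ⊗ₜ q)) = C.ε q • x := by
  obtain ⟨y, hy⟩ := @exists_ne X F.nontrivial 0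
  have h := congrArg ((sliceR (C.ε : A →ₗ[k] k)).lTensor X) (F.gV_T1 y (x ⊗ₜ q))
  rw [PreFrame.gV, LinearMap.comp_apply, LinearEquiv.coe_coe, lTensor_sliceR_assoc, sliceR_rTensor,
    ← PreFrame.gV, ← LinearMap.comp_apply (LinearMap.lTensor X _), ← LinearMap.lTensor_comp,
    PreFrame.gV_tmul] at h
  have h2 : ∀ t : X ⊗[k] A, (sliceR (C.ε : A →ₗ[k] k) ∘ₗ H.TΔ2.toLinearMap).lTensor X
      (TensorProduct.assoc k X A A (t ⊗ₜ q)) = C.ε q • t := by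
    intro t
    induction t with
    | zero => simp
    | add a b ha hb => simp only [map_add, TensorProduct.add_tmul, ha, hb, smul_add]
    | tmul a b => simp [C.counit.sliceR_T]
  rw [h2, LinearMap.comp_apply, ← map_smul] at h
  have h3 := F.V.injective h
  rw [TensorProduct.mk_apply, ← TensorProduct.tmul_smul] at h3
  exact tmul_right_cancel hy h3

lemma sliceR_V (y x : X) : sliceR (C.ε : A →ₗ[k] k) (F.V (y ⊗ₜ x)) = y * x := by
  obtain ⟨a, ha⟩ := C.counit.exists_eq_one
  have h := congrArg (sliceR (C.ε : A →ₗ[k] k)) (F.mulL1_T1 x y a)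
  rw [sliceR_char_mulR2, sliceR_mulL1, sliceR_T1, ha, one_smul, one_smul] at h
  exact h.symm

lemma exists_mul' (C : HopfMaps H) (F : PreFrame H X) (x : X) :
    ∃ t : X ⊗[k] X, LinearMap.mul' k X t = x := by
  have hε : (C.ε : A →ₗ[k] k) ≠ 0 := by
    obtain ⟨a, ha⟩ := C.counit.exists_eq_one
    intro h
    have := LinearMap.congr_fun h a
    simp [ha] at this
  obtain ⟨t, ht⟩ := sliceR_surjective (M := X) hε x
  refine ⟨F.V.symm t, ?_⟩
  rw [← ht]
  obtain ⟨s, rfl⟩ := F.V.surjective t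
  rw [LinearEquiv.symm_apply_apply]
  exact tensor_ext (f := LinearMap.mul' k X)
    (g := sliceR (C.ε : A →ₗ[k] k) ∘ₗ F.V.toLinearMap) (by simp [sliceR_V]) s

/-- In Sweedler notation x₍₀₎ ⊗ x₍₁₎S(x₍₂₎)S(b) = x ⊗ S(b). With `T2_Ssymm_T1` it shows that (ι ⊗
S)T2(ι ⊗ S⁻¹) is inverse to T1. -/
lemma T1_S_T2 (x : X) (b : A) :
    F.T1 (C.S.toLinearMap.lTensor X (F.T2 (x ⊗ₜ b))) = x ⊗ₜ C.S b := by
  apply eq_of_mulL1 F.nondegenerate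
  intro y
  have h : ∀ t : X ⊗[k] A, mulL1 y (F.T1 (C.S.toLinearMap.lTensor X t)) =
      (LinearMap.mul' k A ∘ₗ C.S.toLinearMap.lTensor A).lTensor X (F.gV y t) := by
    intro t
    induction t with
    | zero => simp
    | add a b ha hb => simp only [map_add, ha, hb]
    | tmul w d =>
      rw [LinearMap.lTensor_tmul, F.mulL1_T1, F.gV_tmul]
      generalize F.V (y ⊗ₜ w) = s
      induction s with
      | zero => simp
      | add a b ha hb => simp only [map_add, TensorProduct.add_tmul, ha, hb]
      | tmul a b => simp
  rw [h, show F.gV y (F.T2 (x ⊗ₜ b)) = _ from F.coassoc_T2 x y b, ← LinearMap.comp_apply,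
    ← LinearMap.lTensor_comp, lTensor_smul_const (C.ε : A →ₗ[k] k) (C.S b), sliceR_V, mulL1_tmul]
  intro a
  exact C.mul_S_Q a b

lemma T2_Ssymm_T1 (x : X) (b : A) :
    F.T2 (C.S.symm.toLinearMap.lTensor X (F.T1 (x ⊗ₜ b))) = x ⊗ₜ C.S.symm b := by
  apply eq_of_mulL1 F.nondegenerate
  intro y
  have h : ∀ t : X ⊗[k] A, mulL1 y (F.T2 (C.S.symm.toLinearMap.lTensor X t)) =
      (LinearMap.mul' k A ∘ₗ (TensorProduct.comm k A A).toLinearMap ∘ₗ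
        C.S.symm.toLinearMap.lTensor A).lTensor X (F.gV y t) := by
    intro t
    induction t with
    | zero => simp
    | add a b ha hb => simp only [map_add, ha, hb]
    | tmul w d =>
      rw [LinearMap.lTensor_tmul, F.mulL1_T2, ← F.mulL2_V, F.gV_tmul]
      generalize F.V (y ⊗ₜ w) = s
      induction s with
      | zero => simp
      | add a b ha hb => simp only [map_add, TensorProduct.add_tmul, ha, hb]
      | tmul a b => simp
  rw [h, show F.gV y (F.T1 (x ⊗ₜ b)) = _ from F.coassoc x y b, ← LinearMap.comp_apply,
    ← LinearMap.lTensor_comp, lTensor_smul_const (C.ε : A →ₗ[k] k) (C.S.symm b), sliceR_V,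
    mulL1_tmul]
  intro a
  exact C.mul_Ssymm_T a b

lemma T1_bijective (C : HopfMaps H) : Function.Bijective F.T1 := by
  have h1 : ∀ t, F.T1 (C.S.toLinearMap.lTensor X (F.T2 (C.S.symm.toLinearMap.lTensor X t))) =
      t := by
    intro t
    induction t with
    | zero => simp
    | add a b ha hb => simp only [map_add, ha, hb]
    | tmul x a => simp [T1_S_T2]
  have h2 : ∀ t, C.S.toLinearMap.lTensor X (F.T2 (C.S.symm.toLinearMap.lTensor X (F.T1 t))) =
      t := by
    intro t
    induction t with
    | zero => simp
    | add a b ha hb => simp only [map_add, ha, hb]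
    | tmul x a => simp [T2_Ssymm_T1]
  exact ⟨fun s t h => by rw [← h2 s, h, h2], fun t => ⟨_, h1 t⟩⟩

/-- All canonical maps of a coaction with bijective Galois map are bijective. -/
def frame : Frame H X where
  toPreFrame := F
  T1_bijective := C.T1_bijective F
  -- From x₍₀₎y₍₀₎ ⊗ x₍₁₎y₍₁₎S(y₍₂₎) = x₍₀₎y ⊗ x₍₁₎: the map W is T1(ι ⊗ S)V, a composite of
  -- bijections.
  W := (F.V.trans (LinearEquiv.lTensor X C.S)).trans
    (LinearEquiv.ofBijective F.T1 (C.T1_bijective F))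
  W_spec x y := by
    change Mult.of k (F.T1 (C.S.toLinearMap.lTensor X (F.V (x ⊗ₜ y)))) = _
    have h1 : ∀ a, mulR2 a (F.T1 (C.S.toLinearMap.lTensor X (F.V (x ⊗ₜ y)))) =
        (F.α x).lmul (y ⊗ₜ a) := by
      intro a
      obtain ⟨a, rfl⟩ := C.S.surjective a
      have h2 : ∀ t, mulR2 (C.S a) (F.T1 (C.S.toLinearMap.lTensor X t)) =
          F.T1 (C.S.toLinearMap.lTensor X (mulL2 a t)) := by
        intro t
        induction t with
        | zero => simp
        | add a b ha hb => simp only [map_add, ha, hb]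
        | tmul w d => simp [S_mul, F.T1_mul]
      have h3 : ∀ t, F.T1 (C.S.toLinearMap.lTensor X (mulL1 x t)) =
          (F.α x).lmul (F.T1 (C.S.toLinearMap.lTensor X t)) := by
        intro t
        induction t with
        | zero => simp
        | add a b ha hb => simp only [map_add, ha, hb]
        | tmul w d => simp [F.lmul_T1]
      rw [h2, F.mulL2_V, ← F.mulL1_T2, h3, T1_S_T2]
    apply Mult.ext_lmul F.ndXA
    intro t
    induction t with
    | zero => simp
    | add a b ha hb => rw [map_add, map_add, ha, hb]
    | tmul z c =>
      rw [Mult.lmul_of, mul_tmul_eq, ← mulR1_mulR2, h1, ← F.lmul_mulR1, mulR1_tmul]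
      simp

end PreFrame

section Frame

variable (F : Frame H X)

lemma W_eq (s : X ⊗[k] X) : F.W s = F.T1 (C.S.toLinearMap.lTensor X (F.V s)) := by
  induction s with
  | zero => simp
  | add a b ha hb => simp only [map_add, ha, hb]
  | tmul x y =>
    apply Mult.of_injective (k := k) F.ndXA
    rw [F.W_spec]
    exact ((C.frame F.toPreFrame).W_spec x y).symm

/-- Relates the inverses of the two Galois maps. It is behind the compatibility of the two halves of
β(a) and behind the expression of `J` as a slice of the coaction. -/
lemma W_symm_S (v : X) (a : A) : F.W.symm (v ⊗ₜ C.S a) = F.V.symm (F.T2 (v ⊗ₜ a)) := by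
  rw [LinearEquiv.symm_apply_eq, C.W_eq, LinearEquiv.apply_symm_apply, T1_S_T2]

/-- For an invariant functional, `(ψ ⊗ ι)(α(x)(y ⊗ 1)) = S((ψ ⊗ ι)((x ⊗ 1)α(y)))`. -/
lemma sliceL_W {ψ : Module.Dual k X} (hψ : ∀ x a, sliceL ψ (F.T1 (x ⊗ₜ a)) = ψ x • a)
    (s : X ⊗[k] X) : sliceL ψ (F.W s) = C.S (sliceL ψ (F.V s)) := by
  rw [C.W_eq, ← LinearEquiv.coe_coe C.S, ← sliceL_lTensor]
  exact tensor_ext (f := sliceL ψ ∘ₗ F.T1) (g := sliceL ψ) (by simp [hψ]) _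

end Frame

/-- In Sweedler notation S(b₍₁₎c)b₍₂₎ ⊗ b₍₃₎ = S(c)S(b₍₁₎)b₍₂₎ ⊗ b₍₃₎ = S(c) ⊗ b. -/
lemma P_S_U (b c : A) :
    H.T1Δ (C.S.toLinearMap.rTensor A (H.TΔ1 (b ⊗ₜ c))) = C.S c ⊗ₜ b := by
  apply eq_of_mulR2 H.nondegenerate
  intro d
  have h : ∀ t : A ⊗[k] A, mulR2 d (H.T1Δ (C.S.toLinearMap.rTensor A t)) =
      (LinearMap.mul' k A ∘ₗ C.S.toLinearMap.rTensor A).rTensor A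
        ((TensorProduct.assoc k A A A).symm
          ((H.TΔ2.toLinearMap ∘ₗ (TensorProduct.mk k A A).flip d).lTensor A t)) := by
    intro t
    induction t with
    | zero => simp
    | add a b ha hb => simp only [map_add, ha, hb]
    | tmul p q =>
      rw [LinearMap.rTensor_tmul, ← mulL1_T]
      simp only [LinearMap.lTensor_tmul, LinearMap.comp_apply, TensorProduct.mk_apply,
        LinearMap.flip_apply, LinearEquiv.coe_coe]
      generalize H.TΔ2 (q ⊗ₜ d) = s
      induction s with
      | zero => simp
      | add a b ha hb => simp only [map_add, TensorProduct.tmul_add, ha, hb]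
      | tmul a b => simp
  have h2 : (H.TΔ2.toLinearMap ∘ₗ (TensorProduct.mk k A A).flip d).lTensor A
      (H.TΔ1 (b ⊗ₜ[k] c)) = H.frame.gW c (H.TΔ2 (b ⊗ₜ d)) := by
    refine Eq.trans ?_ (H.frame.gW_T1 c (b ⊗ₜ d)).symm
    rw [Frame.gW_tmul]
    change _ = LinearMap.lTensor _ _ (TensorProduct.assoc k A A A (H.TΔ1 (b ⊗ₜ[k] c) ⊗ₜ[k] d))
    generalize H.TΔ1 (b ⊗ₜ[k] c) = t
    induction t with
    | zero => simp
    | add a b ha hb => simp only [map_add, TensorProduct.add_tmul, ha, hb]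
    | tmul a b => simp
  rw [h, h2, Frame.gW, LinearMap.comp_apply, LinearEquiv.coe_coe, LinearEquiv.symm_apply_apply,
    ← LinearMap.comp_apply, ← LinearMap.rTensor_comp,
    rTensor_smul_const (C.ε : A →ₗ[k] k) (C.S c), C.counit.left, mulR2_tmul]
  intro a
  exact C.mul_S_U a c

lemma sliceR_Q_P {φ : Module.Dual k A} (a c q : A) :
    H.T1Δ (c ⊗ₜ sliceR φ (H.T2Δ (a ⊗ₜ q))) =
      (sliceR φ ∘ₗ H.T2Δ.toLinearMap ∘ₗ TensorProduct.mk k A A a).lTensor A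
        (H.T1Δ (c ⊗ₜ q)) := by
  have h := congrArg ((sliceR φ).lTensor A) (H.self.coassoc_T2 q c a)
  rw [lTensor_sliceR_assoc, sliceR_rTensor, ← LinearMap.comp_apply (LinearMap.lTensor A _),
    ← LinearMap.lTensor_comp] at h
  exact h

/-- The antipode is anti-comultiplicative. -/
lemma P_S_S {φ : Module.Dual k A} (hφ : H.IsLeftInvariant φ) (hφ0 : φ ≠ 0) (a b : A) :
    H.T1Δ (C.S b ⊗ₜ C.S a) =
      TensorProduct.map C.S.toLinearMap C.S.toLinearMap
        (TensorProduct.comm k A A (H.TΔ2 (a ⊗ₜ b))) := by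
  obtain ⟨t, ht⟩ := ((sliceR_surjective (M := A) hφ0).comp H.TΔ2.surjective) a
  rw [← ht, Function.comp_apply]
  clear ht
  induction t with
  | zero => simp
  | add a b ha hb => simp only [map_add, TensorProduct.tmul_add, TensorProduct.add_tmul, ha, hb]
  | tmul a q =>
    rw [C.S_slice hφ]
    -- Both sides are linear in b ⊗ q, so b ⊗ q may be replaced by Δ(b)(c ⊗ 1), where `P_S_U`
    -- evaluates one side and `T_slice` the other.
    have key : ∀ s : A ⊗[k] A, TensorProduct.lift
        ((H.T1Δ.toLinearMap.compRight k ∘ₗ TensorProduct.mk k A A ∘ₗ C.S.toLinearMap).compl₂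
          (sliceR φ ∘ₗ H.T2Δ.toLinearMap ∘ₗ TensorProduct.mk k A A a)) s =
        TensorProduct.map C.S.toLinearMap C.S.toLinearMap (TensorProduct.comm k A A
        (H.TΔ2 ((sliceR φ ∘ₗ H.TΔ2.toLinearMap ∘ₗ TensorProduct.mk k A A a).rTensor A
          (TensorProduct.comm k A A s)))) := by
      intro s
      obtain ⟨s, rfl⟩ := H.TΔ1.surjective s
      induction s with
      | zero => simp
      | add a b ha hb => simp only [map_add, ha, hb]
      | tmul b c =>
        have h1 : ∀ s : A ⊗[k] A, TensorProduct.lift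
            ((H.T1Δ.toLinearMap.compRight k ∘ₗ TensorProduct.mk k A A ∘ₗ C.S.toLinearMap).compl₂
            (sliceR φ ∘ₗ H.T2Δ.toLinearMap ∘ₗ TensorProduct.mk k A A a)) s =
            (sliceR φ ∘ₗ H.T2Δ.toLinearMap ∘ₗ TensorProduct.mk k A A a).lTensor A
              (H.T1Δ (C.S.toLinearMap.rTensor A s)) := by
          intro s
          induction s with
          | zero => simp
          | add a b ha hb => simp only [map_add, ha, hb]
          | tmul p q => exact sliceR_Q_P a (C.S p) q
        rw [h1, P_S_U, hφ.T_slice, TensorProduct.comm_tmul, TensorProduct.map_tmul]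
        simp [C.S_slice hφ]
    exact key (b ⊗ₜ q)

variable {φ : Module.Dual k A}

lemma T_S_S (hφ : H.IsLeftInvariant φ) (hφ0 : φ ≠ 0) (a c : A) :
    H.TΔ2 (C.S a ⊗ₜ C.S c) =
      TensorProduct.map C.S.toLinearMap C.S.toLinearMap
        (TensorProduct.comm k A A (H.T1Δ (c ⊗ₜ a))) := by
  apply eq_of_mulL1 H.nondegenerate
  intro b
  obtain ⟨b, rfl⟩ := C.S.surjective b
  have h1 : ∀ t : A ⊗[k] A, mulL1 (C.S b) (TensorProduct.map C.S.toLinearMap C.S.toLinearMap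
      (TensorProduct.comm k A A t)) = TensorProduct.map C.S.toLinearMap C.S.toLinearMap
      (TensorProduct.comm k A A (mulR2 b t)) := by
    intro t
    induction t with
    | zero => simp
    | add a b ha hb => simp only [map_add, ha, hb]
    | tmul p q => simp [S_mul]
  have h2 : ∀ t : A ⊗[k] A, mulR2 (C.S c) (TensorProduct.map C.S.toLinearMap C.S.toLinearMap
      (TensorProduct.comm k A A t)) = TensorProduct.map C.S.toLinearMap C.S.toLinearMap
      (TensorProduct.comm k A A (mulL1 c t)) := by
    intro t
    induction t with
    | zero => simp
    | add a b ha hb => simp only [map_add, ha, hb]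
    | tmul p q => simp [S_mul]
  rw [mulL1_T, C.P_S_S hφ hφ0, h1, h2, mulL1_T]

/-- `φ ∘ S` is right invariant. -/
lemma right_invariant (hφ : H.IsLeftInvariant φ) (hφ0 : φ ≠ 0) (a b : A) :
    sliceL (φ ∘ₗ C.S.toLinearMap) (H.TΔ2 (a ⊗ₜ b)) = φ (C.S a) • b := by
  apply C.S.injective
  rw [map_smul, ← hφ.sliceR_P, C.P_S_S hφ hφ0]
  generalize H.TΔ2 (a ⊗ₜ b) = t
  induction t with
  | zero => simp
  | add a b ha hb => simp only [map_add, ha, hb]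
  | tmul p q => simp

lemma eq_zero_of_forall_mul (C : HopfMaps H) (hφ0 : φ ≠ 0) {c : k} (h : ∀ a b, c * φ (a * b) = 0) :
    c = 0 := by
  by_contra hc
  apply hφ0
  ext a
  obtain ⟨t, rfl⟩ := C.exists_mul' H.self a
  induction t with
  | zero => simp
  | add a b ha hb => rw [map_add, map_add, ha, hb]; simp
  | tmul a b => simpa [hc] using h a b

lemma faithful_right (C : HopfMaps H) (hφ : H.IsLeftInvariant φ) (hφ0 : φ ≠ 0) (a : A) (ha : ∀ b, φ (b * a) = 0) :
    a = 0 := by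
  have hU : ∀ a, (∀ b, φ (b * a) = 0) → ∀ b c,
      sliceR (φ ∘ₗ LinearMap.mulLeft k b) (H.TΔ1 (a ⊗ₜ c)) = 0 := by
    intro a ha b c
    have h1 : sliceR φ (H.TΔ2 (b ⊗ₜ a)) = 0 := by
      apply H.nondegenerate.right
      intro c
      rw [← sliceR_mulL1, mulL1_T]
      generalize H.T1Δ (c ⊗ₜ b) = t
      induction t with
      | zero => simp
      | add a b ha hb => simp only [map_add, ha, hb, add_zero]
      | tmul p q => simp [ha]
    rw [← sliceR_lTensor]
    change sliceR φ (mulL2 b _) = 0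
    rw [mulL2_U, sliceR_mulR1, ← C.S_slice hφ, h1]
    simp
  have hε : ∀ a, (∀ b, φ (b * a) = 0) → C.ε a = 0 := by
    intro a ha
    apply C.eq_zero_of_forall_mul hφ0
    intro b c
    obtain ⟨c, rfl⟩ := C.S.surjective c
    have h2 := lTensor_eq_zero_of_family (M := A) (fun b => φ ∘ₗ LinearMap.mulLeft k b)
      (rightTwist φ) (fun n hn => LinearMap.ext fun b => hn b) (fun b => hU a ha b c)
    have h3 : ∀ t : A ⊗[k] A, φ (b * LinearMap.mul' k A (C.S.toLinearMap.rTensor A t)) =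
        TensorProduct.lift ((LinearMap.applyₗ (R := k)) ∘ₗ LinearMap.mulLeft k b ∘ₗ
          C.S.toLinearMap) ((rightTwist φ).lTensor A t) := by
      intro t
      induction t with
      | zero => simp
      | add a b ha hb => simp only [map_add, mul_add, ha, hb]
      | tmul p q => simp [rightTwist, mul_assoc]
    have h4 := h3 (H.TΔ1 (a ⊗ₜ c))
    rw [h2, map_zero, mul_S_U, mul_smul_comm, map_smul] at h4
    exact h4
  apply H.nondegenerate.right
  intro c
  rw [← C.counit.right]
  have h5 : ∀ b, sliceR (φ ∘ₗ LinearMap.mulLeft k b) (H.T1Δ (c ⊗ₜ a)) = 0 := by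
    intro b
    apply H.nondegenerate.left
    intro d
    rw [← sliceR_mulR1, ← mulL1_U, sliceR_mulL1, hU a ha, mul_zero]
  have h6 := lTensor_eq_zero_of_family (M := A) (fun b => φ ∘ₗ LinearMap.mulLeft k b)
      (C.ε : A →ₗ[k] k) (fun n hn => hε n hn) h5
  rw [sliceR, LinearMap.comp_apply, h6, map_zero]

lemma faithful_left (C : HopfMaps H) (hφ : H.IsLeftInvariant φ) (hφ0 : φ ≠ 0) (a : A) (ha : ∀ b, φ (a * b) = 0) :
    a = 0 := by
  have hP : ∀ a, (∀ b, φ (a * b) = 0) → ∀ b c,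
      sliceR (φ ∘ₗ LinearMap.mulRight k b) (H.T1Δ (c ⊗ₜ a)) = 0 := by
    intro a ha b c
    have h1 : sliceR φ (H.T2Δ (a ⊗ₜ b)) = 0 := by
      apply H.nondegenerate.left
      intro c
      rw [← sliceR_mulR1, ← mulL2_U]
      generalize H.TΔ1 (b ⊗ₜ c) = t
      induction t with
      | zero => simp
      | add a b ha hb => simp only [map_add, ha, hb, add_zero]
      | tmul p q => simp [ha]
    rw [← C.S_slice hφ, LinearEquiv.map_eq_zero_iff] at h1
    rw [← sliceR_lTensor]
    change sliceR φ (mulR2 b _) = 0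
    rw [← mulL1_T, sliceR_mulL1, h1, mul_zero]
  have hε : ∀ a, (∀ b, φ (a * b) = 0) → C.ε a = 0 := by
    intro a ha
    apply C.eq_zero_of_forall_mul hφ0
    intro c b
    obtain ⟨c, rfl⟩ := C.S.symm.surjective c
    have h2 := lTensor_eq_zero_of_family (M := A) (fun b => φ ∘ₗ LinearMap.mulRight k b)
      (rightTwist φ).flip (fun n hn => LinearMap.ext fun b => hn b) (fun b => hP a ha b c)
    have h3 : ∀ t : A ⊗[k] A, φ (LinearMap.mul' k A (TensorProduct.comm k A A
        (C.S.symm.toLinearMap.rTensor A t)) * b) =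
        TensorProduct.lift ((LinearMap.applyₗ (R := k)) ∘ₗ LinearMap.mulRight k b ∘ₗ
          C.S.symm.toLinearMap) ((rightTwist φ).flip.lTensor A t) := by
      intro t
      induction t with
      | zero => simp
      | add a b ha hb => simp only [map_add, add_mul, ha, hb]
      | tmul p q => simp [rightTwist, mul_assoc]
    have h4 := h3 (H.T1Δ (c ⊗ₜ a))
    rw [h2, map_zero, mul_Ssymm_P, smul_mul_assoc, map_smul] at h4
    exact h4
  apply H.nondegenerate.right
  intro c
  rw [← C.counit.right]
  have h6 := lTensor_eq_zero_of_family (M := A) (fun b => φ ∘ₗ LinearMap.mulRight k b)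
      (C.ε : A →ₗ[k] k) (fun n hn => hε n hn) (fun b => hP a ha b c)
  rw [sliceR, LinearMap.comp_apply, h6, map_zero]

end HopfMaps

namespace Frame

variable (F : Frame H X) {φ : Module.Dual k A} {φX ψX : Module.Dual k X}

/-- Together with `invariant_T1` this evaluates (ψ_X ⊗ φ)(α(x)t) in two ways: for t = W(s) by the
property of φ, for t = T1(s) by invariance of ψ_X. As W and T1 are onto, functionals φ_X(· y) and
ψ_X(· y') can be compared. -/
lemma invariant_W (hφX : ∀ x z, sliceR φ (F.W (x ⊗ₜ z)) = φX x • z) (x : X) (s : X ⊗[k] X) :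
    ψX (sliceR φ ((F.α x).lmul (F.W s))) = φX (x * sliceR ψX s) := by
  induction s with
  | zero => simp
  | add a b ha hb => simp only [map_add, mul_add, ha, hb]
  | tmul y z => rw [F.lmul_W, hφX]; simp [mul_smul_comm, mul_comm]

lemma invariant_T1 (hψX : ∀ x a, sliceL ψX (F.T1 (x ⊗ₜ a)) = ψX x • a) (x : X) (s : X ⊗[k] A) :
    ψX (sliceR φ ((F.α x).lmul (F.T1 s))) = ψX (x * sliceR φ s) := by
  induction s with
  | zero => simp
  | add a b ha hb => simp only [map_add, mul_add, ha, hb]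
  | tmul y z => rw [F.lmul_T1, apply_sliceR, hψX]; simp [mul_smul_comm, mul_comm]

/-- Every `φ_X(· y)` is of the form `ψ_X(· y')`. -/
lemma exists_twist (hφX : ∀ x z, sliceR φ (F.W (x ⊗ₜ z)) = φX x • z)
    (hψX : ∀ x a, sliceL ψX (F.T1 (x ⊗ₜ a)) = ψX x • a) (hψ0 : ψX ≠ 0) (y : X) :
    ∃ y', ∀ x, φX (x * y) = ψX (x * y') := by
  obtain ⟨s, rfl⟩ := sliceR_surjective (M := X) hψ0 y
  obtain ⟨s', hs'⟩ := F.T1_bijective.2 (F.W s)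
  refine ⟨sliceR φ s', fun x => ?_⟩
  rw [← F.invariant_W hφX, ← hs', F.invariant_T1 hψX]

/-- Every `ψ_X(· y')` is of the form `φ_X(· y)`. -/
lemma exists_twist' (hφX : ∀ x z, sliceR φ (F.W (x ⊗ₜ z)) = φX x • z)
    (hψX : ∀ x a, sliceL ψX (F.T1 (x ⊗ₜ a)) = ψX x • a) (hφ0 : φ ≠ 0) (y' : X) :
    ∃ y, ∀ x, φX (x * y) = ψX (x * y') := by
  obtain ⟨s', rfl⟩ := sliceR_surjective (M := X) hφ0 y'
  obtain ⟨s, hs⟩ := F.W.surjective (F.T1 s')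
  refine ⟨sliceR ψX s, fun x => ?_⟩
  rw [← F.invariant_W hφX, hs, F.invariant_T1 hψX]

end Frame

namespace HopfMaps

variable (C : HopfMaps H) {φ : Module.Dual k A}

lemma comp_S_ne_zero (hφ0 : φ ≠ 0) : φ ∘ₗ C.S.toLinearMap ≠ 0 := by
  intro h
  apply hφ0
  ext a
  simpa using LinearMap.congr_fun h (C.S.symm a)

/-- With `ψ = φ ∘ S`: `φ((ψS ⊗ ι)((c ⊗ 1)Δ(a)) b) = ψ(b (ι ⊗ ψ)(Δ(Sc)(1 ⊗ S⁻¹a)))`. -/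
lemma twist_exchange (hφ : H.IsLeftInvariant φ) (hφ0 : φ ≠ 0) (a b c : A) :
    φ (sliceL (φ ∘ₗ C.S.toLinearMap ∘ₗ C.S.toLinearMap) (H.T1Δ (c ⊗ₜ a)) * b) =
      φ (C.S (b * sliceR (φ ∘ₗ C.S.toLinearMap) (H.TΔ2 (C.S c ⊗ₜ C.S.symm a)))) := by
  have e1 : φ (sliceL (φ ∘ₗ C.S.toLinearMap ∘ₗ C.S.toLinearMap) (H.T1Δ (c ⊗ₜ a)) * b) =
      φ (C.S (sliceR φ (H.T2Δ (a ⊗ₜ b)) * C.S c)) := by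
    rw [← C.S_slice hφ, ← S_mul, ← sliceR_mulL1, mulL1_T, ← sliceL_mulR2]
    generalize mulR2 b (H.T1Δ (c ⊗ₜ a)) = t
    exact (apply_sliceR (φ ∘ₗ C.S.toLinearMap ∘ₗ C.S.toLinearMap) φ t).symm
  have e2 : φ (C.S (b * sliceR (φ ∘ₗ C.S.toLinearMap) (H.TΔ2 (C.S c ⊗ₜ C.S.symm a)))) =
      φ (C.S (sliceR φ (H.T2Δ (a ⊗ₜ b)) * C.S c)) := by
    have h1 := C.sliceL_W H.frame (C.right_invariant hφ hφ0) (b ⊗ₜ C.S c)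
    have h2 : φ (C.S (sliceR φ (H.T2Δ (a ⊗ₜ b)) * C.S c)) =
        φ (a * sliceL (φ ∘ₗ C.S.toLinearMap) (H.TΔ1 (b ⊗ₜ C.S c))) := by
      rw [← sliceR_mulR1, ← mulL2_U, ← sliceL_mulL2]
      exact apply_sliceR (φ ∘ₗ C.S.toLinearMap) φ _
    rw [h2, show sliceL (φ ∘ₗ C.S.toLinearMap) (H.TΔ1 (b ⊗ₜ C.S c)) = _ from h1,
      ← sliceR_mulL1, mulL1_T]
    change (φ ∘ₗ C.S.toLinearMap) _ = _
    rw [apply_sliceR, sliceL_mulR2, LinearMap.comp_apply, LinearEquiv.coe_coe, S_mul,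
      LinearEquiv.apply_symm_apply]
    rfl
  rw [e1, e2]

/-- By `twist_exchange` a functional φ(a ·) has the form ψ(· b) with ψ = φ ∘ S, and `exists_twist'`
turns ψ(· b) into φ(· a'). For the converse direction the slices that occur are surjective. -/
theorem exists_sigma (C : HopfMaps H) (hφ : H.IsLeftInvariant φ) (hφ0 : φ ≠ 0) :
    ∃ σ : A ≃ₗ[k] A, (∀ x y, σ (x * y) = σ x * σ y) ∧ ∀ x y, φ (y * σ x) = φ (x * y) := by
  have hψ0 := C.comp_S_ne_zero hφ0
  have hψ0' : φ ∘ₗ C.S.toLinearMap ∘ₗ C.S.toLinearMap ≠ 0 := C.comp_S_ne_zero hψ0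
  have key : ∀ (t : A ⊗[k] A) (b : A),
      φ (sliceL (φ ∘ₗ C.S.toLinearMap ∘ₗ C.S.toLinearMap) (H.T1Δ t) * b) =
      φ (C.S (b * sliceR (φ ∘ₗ C.S.toLinearMap) (H.TΔ2
        (TensorProduct.map C.S.toLinearMap C.S.symm.toLinearMap t)))) := by
    intro t b
    induction t with
    | zero => simp
    | add x y hx hy => simp only [map_add, mul_add, add_mul, hx, hy]
    | tmul c a => exact C.twist_exchange hφ hφ0 a b c
  apply exists_modular (C.faithful_left hφ hφ0) (C.faithful_right hφ hφ0)
  · intro a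
    obtain ⟨t, ht⟩ := sliceL_surjective (N := A) hψ0' a
    obtain ⟨s, rfl⟩ := H.T1Δ.surjective t
    obtain ⟨y, hy⟩ := H.frame.exists_twist' (φX := φ) hφ (C.right_invariant hφ hφ0) hφ0
      (sliceR (φ ∘ₗ C.S.toLinearMap) (H.TΔ2
        (TensorProduct.map C.S.toLinearMap C.S.symm.toLinearMap s)))
    refine ⟨y, fun b => ?_⟩
    rw [hy, ← ht, key]
    rfl
  · intro a'
    obtain ⟨y', hy'⟩ := H.frame.exists_twist (φX := φ) hφ (C.right_invariant hφ hφ0) hψ0 a'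
    obtain ⟨t, ht⟩ := sliceR_surjective (M := A) hψ0 y'
    obtain ⟨t, rfl⟩ := H.TΔ2.surjective t
    obtain ⟨s, rfl⟩ := (TensorProduct.congr C.S C.S.symm).surjective t
    refine ⟨sliceL (φ ∘ₗ C.S.toLinearMap ∘ₗ C.S.toLinearMap) (H.T1Δ s), fun b => ?_⟩
    rw [hy', ← ht, key]
    rfl

/-- Left invariant functionals are unique up to scalars. -/
theorem left_invariant_unique (C : HopfMaps H) (hφ : H.IsLeftInvariant φ) (hφ0 : φ ≠ 0) {φ' : Module.Dual k A}
    (hφ' : H.IsLeftInvariant φ') : ∃ c : k, φ' = c • φ := by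
  obtain ⟨r, hr⟩ := exists_eq_one_of_ne_zero hφ0
  refine ⟨φ' r, ?_⟩
  let ψ := φ ∘ₗ C.S.toLinearMap
  have hψ : ∀ a b, sliceL ψ (H.frame.T1 (a ⊗ₜ b)) = ψ a • b := C.right_invariant hφ hφ0
  -- For φ and φ' alike, φ(x μ(s)) = ψ(x (ι ⊗ φ)(s)). Faithfulness of φ makes μ(s) depend on (ι ⊗
  -- φ)(s) only, so s may be replaced by (ι ⊗ φ)(s) ⊗ r with φ(r) = 1; the identity for φ' then
  -- yields the factor φ'(r). The elements x μ(s) span A.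
  let μ : A ⊗[k] A → A := fun s => sliceR ψ (H.frame.W.symm (H.frame.T1 s))
  have h1 : ∀ s x, φ (x * μ s) = ψ (x * sliceR φ s) := by
    intro s x
    rw [← H.frame.invariant_T1 hψ, ← H.frame.invariant_W (φ := φ) hφ,
      LinearEquiv.apply_symm_apply]
  have h2 : ∀ s x, φ' (x * μ s) = ψ (x * sliceR φ' s) := by
    intro s x
    rw [← H.frame.invariant_T1 hψ, ← H.frame.invariant_W (φ := φ') hφ',
      LinearEquiv.apply_symm_apply]
  have h3 : ∀ s, μ s = μ (sliceR φ s ⊗ₜ r) := by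
    intro s
    rw [← sub_eq_zero]
    apply C.faithful_right hφ hφ0
    intro x
    rw [mul_sub, map_sub, h1, h1]
    simp [hr]
  ext a
  obtain ⟨t, rfl⟩ := C.exists_mul' H.self a
  induction t with
  | zero => simp
  | add a b ha hb => rw [map_add, map_add, ha, hb, map_add]
  | tmul x y =>
    obtain ⟨t, rfl⟩ := sliceR_surjective (M := A) (C.comp_S_ne_zero hφ0) y
    obtain ⟨t, rfl⟩ := H.frame.W.symm.surjective t
    obtain ⟨s, rfl⟩ := H.frame.T1_bijective.2 t
    change φ' (x * μ s) = φ' r * φ (x * μ s)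
    rw [h3, h1, h2]
    simp [hr, mul_smul_comm]

end HopfMaps

/-! ### Modular data of an algebraic quantum group -/

/-- Two functionals with the same right translates are related by a linear bijection. -/
theorem exists_twist_equiv {f g : Module.Dual k X} (hf : ∀ x, (∀ y, f (y * x) = 0) → x = 0)
    (hg : ∀ x, (∀ y, g (y * x) = 0) → x = 0)
    (h1 : ∀ y, ∃ y', ∀ x, f (x * y) = g (x * y')) (h2 : ∀ y', ∃ y, ∀ x, f (x * y) = g (x * y')) :
    ∃ ρ : X ≃ₗ[k] X, ∀ x y, g (x * y) = f (x * ρ y) := by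
  choose s hs using h2
  have hf' : ∀ x x', (∀ y, f (y * x) = f (y * x')) → x = x' := by
    intro x x' h
    rw [← sub_eq_zero]
    exact hf _ fun y => by rw [mul_sub, map_sub, h, sub_self]
  have hg' : ∀ x x', (∀ y, g (y * x) = g (y * x')) → x = x' := by
    intro x x' h
    rw [← sub_eq_zero]
    exact hg _ fun y => by rw [mul_sub, map_sub, h, sub_self]
  let ρ : X →ₗ[k] X :=
    { toFun := s
      map_add' := fun a b => hf' _ _ fun y => by
        rw [hs (a + b), mul_add, mul_add, map_add, map_add, hs a, hs b]
      map_smul' := fun c a => hf' _ _ fun y => by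
        rw [hs (c • a), RingHom.id_apply, mul_smul_comm, mul_smul_comm, map_smul, map_smul,
          hs a] }
  refine ⟨LinearEquiv.ofBijective ρ ⟨?_, ?_⟩, ?_⟩
  · intro a b hab
    apply hg'
    intro y
    rw [← hs a, ← hs b]
    exact congrArg (fun z => f (y * z)) hab
  · intro a
    obtain ⟨b, hb⟩ := h1 a
    refine ⟨b, hf' _ _ fun y => ?_⟩
    rw [hb]
    exact hs b y
  · intro x y
    exact (hs y x).symm

/-- A left invariant functional with a counit, an antipode and its modular automorphism. -/
structure Integral (H : RegularMultiplierHopfAlgebra k A) (φ : Module.Dual k A)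
    extends HopfMaps H where
  inv : H.IsLeftInvariant φ
  ne_zero : φ ≠ 0
  σ : A ≃ₗ[k] A
  σ_mul : ∀ x y, σ (x * y) = σ x * σ y
  σ_spec : ∀ x y, φ (y * σ x) = φ (x * y)

theorem exists_integral {φ : Module.Dual k A} (hφ : H.IsLeftInvariant φ) (hφ0 : φ ≠ 0) :
    Nonempty (Integral H φ) := by
  obtain ⟨C⟩ := exists_hopfMaps hφ hφ0
  obtain ⟨σ, h1, h2⟩ := C.exists_sigma hφ hφ0
  exact ⟨⟨C, hφ, hφ0, σ, h1, h2⟩⟩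

lemma isLeftInvariant_of_P {φ : Module.Dual k A}
    (h : ∀ c d, sliceR φ (H.T1Δ (c ⊗ₜ d)) = φ d • c) : H.IsLeftInvariant φ := by
  intro a b
  apply H.nondegenerate.eq_of_mul_left
  intro c
  rw [← sliceR_mulL1, mulL1_U, sliceR_mulR1, h, mul_smul_comm, smul_mul_assoc]

namespace Integral

variable {φ : Module.Dual k A} (I : Integral H φ)

lemma faithful_right (I : Integral H φ) {a a' : A} (h : ∀ b, φ (b * a) = φ (b * a')) :
    a = a' := by
  rw [← sub_eq_zero]
  exact I.toHopfMaps.faithful_right I.inv I.ne_zero _ fun b => by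
    rw [mul_sub, map_sub, h, sub_self]

lemma faithful_left (I : Integral H φ) {a a' : A} (h : ∀ b, φ (a * b) = φ (a' * b)) :
    a = a' := by
  rw [← sub_eq_zero]
  exact I.toHopfMaps.faithful_left I.inv I.ne_zero _ fun b => by
    rw [sub_mul, map_sub, h, sub_self]

/-- The square of the antipode commutes with the modular automorphism. -/
lemma σ_S_S (a : A) : I.σ (I.S (I.S a)) = I.S (I.S (I.σ a)) := by
  have hP : ∀ b a, H.T1Δ (I.S (I.S b) ⊗ₜ I.S (I.S a)) =
      TensorProduct.map (I.S.toLinearMap ∘ₗ I.S.toLinearMap) (I.S.toLinearMap ∘ₗ I.S.toLinearMap)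
        (H.T1Δ (b ⊗ₜ a)) := by
    intro b a
    rw [I.P_S_S I.inv I.ne_zero, I.T_S_S I.inv I.ne_zero]
    generalize H.T1Δ (b ⊗ₜ a) = t
    induction t with
    | zero => simp
    | add a b ha hb => simp only [map_add, ha, hb]
    | tmul a b => simp
  -- The antipode being anti-comultiplicative, S² respects Δ. So φ ∘ S² is again left invariant,
  -- hence cφ, and c drops out of the relation defining σ.
  have hinv : H.IsLeftInvariant (φ ∘ₗ I.S.toLinearMap ∘ₗ I.S.toLinearMap) := by
    apply isLeftInvariant_of_P
    intro c d
    apply (I.S.trans I.S).injective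
    rw [map_smul]
    change I.S (I.S _) = φ (I.S (I.S d)) • I.S (I.S c)
    rw [← I.inv.sliceR_P, hP]
    generalize H.T1Δ (c ⊗ₜ d) = t
    induction t with
    | zero => simp
    | add a b ha hb => simp only [map_add, ha, hb]
    | tmul a b => simp
  obtain ⟨c, hc⟩ := I.left_invariant_unique I.inv I.ne_zero hinv
  have hc' : ∀ x, φ (I.S (I.S x)) = c * φ x := fun x => LinearMap.congr_fun hc x
  apply I.faithful_right
  intro b
  obtain ⟨b, rfl⟩ := I.S.surjective b
  obtain ⟨b, rfl⟩ := I.S.surjective b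
  rw [I.σ_spec, ← I.S_mul, ← I.S_mul, ← I.S_mul, ← I.S_mul, hc', hc', I.σ_spec]

/-- The automorphism `κ` with `ψ(x a) = ψ(κ(a) x)`, where `ψ = φ ∘ S`. -/
def κ : A ≃ₗ[k] A := (I.S.trans I.σ).trans I.S.symm

lemma κ_apply (a : A) : I.κ a = I.S.symm (I.σ (I.S a)) := rfl

lemma κ_mul (a b : A) : I.κ (a * b) = I.κ a * I.κ b := by
  simp [κ_apply, I.S_mul, I.σ_mul, I.Ssymm_mul]

lemma psi_mul (a x : A) : φ (I.S (x * a)) = φ (I.S (I.κ a * x)) := by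
  rw [I.S_mul, I.S_mul, κ_apply, LinearEquiv.apply_symm_apply, I.σ_spec]

/-- The modular element of the dual, as a character of `A`. -/
def δ : A →ₙₐ[k] k where
  toFun a := I.ε (I.κ a)
  map_smul' c a := by simp
  map_zero' := by simp
  map_add' a b := by simp
  map_mul' a b := by simp [κ_mul]

lemma δ_apply (a : A) : I.δ a = I.ε (I.κ a) := rfl

lemma exists_δ_eq_one : ∃ a, I.δ a = 1 := by
  obtain ⟨a, ha⟩ := I.counit.exists_eq_one
  exact ⟨I.κ.symm a, by simp [δ_apply, ha]⟩

/-- `λ(a) = δ̂(a₍₁₎) a₍₂₎`. -/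
def lam : A →ₗ[k] A := I.S.symm.toLinearMap ∘ₗ I.S.symm.toLinearMap ∘ₗ I.κ.toLinearMap

lemma S_S_lam (a : A) : I.S (I.S (I.lam a)) = I.κ a := by simp [lam]

lemma right_inv (a b : A) : sliceL (φ ∘ₗ I.S.toLinearMap) (H.TΔ2 (a ⊗ₜ b)) = φ (I.S a) • b :=
  I.right_invariant I.inv I.ne_zero a b

lemma sliceL_psi_U (t : A ⊗[k] A) : sliceL (φ ∘ₗ I.S.toLinearMap) (H.TΔ1 t) =
    I.S (sliceL (φ ∘ₗ I.S.toLinearMap) (H.T1Δ t)) :=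
  I.sliceL_W H.frame I.right_inv t

lemma psi_faithful_left {a a' : A} (h : ∀ b, φ (I.S (a * b)) = φ (I.S (a' * b))) : a = a' := by
  apply I.S.injective
  apply I.faithful_right
  intro b
  obtain ⟨b, rfl⟩ := I.S.surjective b
  rw [← I.S_mul, ← I.S_mul, h]

lemma psi_faithful_right {a a' : A} (h : ∀ b, φ (I.S (b * a)) = φ (I.S (b * a'))) : a = a' := by
  apply I.S.injective
  apply I.faithful_left
  intro b
  obtain ⟨b, rfl⟩ := I.S.surjective b
  rw [← I.S_mul, ← I.S_mul, h]

/-- The first leg is tested with ψ(· y). Right invariance exchanges the two factors of (ψ ⊗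
ι)(Δ(a)(z ⊗ 1)) at the price of S, `psi_mul` carries κ(a) around ψ as a, and a second exchange
produces S². Applying ε to the first leg then gives δ̂(a₍₁₎)S²(a₍₂₎) = κ(a). -/
lemma U_κ (a x : A) : H.TΔ1 (I.κ a ⊗ₜ I.κ x) =
    TensorProduct.map I.κ.toLinearMap (I.S.toLinearMap ∘ₗ I.S.toLinearMap) (H.TΔ1 (a ⊗ₜ x)) := by
  apply eq_of_sliceL_family (fun y : A => φ ∘ₗ I.S.toLinearMap ∘ₗ LinearMap.mulRight k y)
  · intro n hn
    apply I.psi_faithful_left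
    intro b
    simpa using hn b
  intro y
  have e1 : sliceL (φ ∘ₗ I.S.toLinearMap ∘ₗ LinearMap.mulRight k y) (H.TΔ1 (I.κ a ⊗ₜ I.κ x)) =
      sliceL (φ ∘ₗ I.S.toLinearMap) (H.TΔ1 (I.κ a ⊗ₜ (I.κ x * y))) := by
    rw [show H.TΔ1 (I.κ a ⊗ₜ (I.κ x * y)) = mulR1 y (H.TΔ1 (I.κ a ⊗ₜ I.κ x)) from
      H.frame.W_mul _ _ _, mulR1, sliceL_rTensor]
    rfl
  have e2 : ∀ z, sliceL (φ ∘ₗ I.S.toLinearMap) (H.TΔ1 (I.κ a ⊗ₜ z)) =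
      I.S (I.S (sliceL (φ ∘ₗ I.S.toLinearMap) (H.T1Δ (z ⊗ₜ a)))) := by
    intro z
    rw [sliceL_psi_U]
    congr 1
    rw [← sliceL_psi_U]
    apply H.nondegenerate.eq_of_mul_right
    intro c
    rw [← sliceL_mulR2, ← sliceL_mulR2, ← mulR1_T, ← mulL1_T]
    generalize H.TΔ2 (z ⊗ₜ c) = t
    induction t with
    | zero => simp
    | add a b ha hb => simp only [map_add, ha, hb]
    | tmul p q => simp [I.psi_mul a p]
  rw [e1, e2, show H.T1Δ ((I.κ x * y) ⊗ₜ a) = mulL1 (I.κ x) (H.T1Δ (y ⊗ₜ a)) from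
    H.self.V_mul _ _ _]
  have e3 : ∀ t : A ⊗[k] A, sliceL (φ ∘ₗ I.S.toLinearMap) (mulL1 (I.κ x) t) =
      sliceL (φ ∘ₗ I.S.toLinearMap) (mulR1 x t) := by
    intro t
    induction t with
    | zero => simp
    | add a b ha hb => simp only [map_add, ha, hb]
    | tmul p q => simp [I.psi_mul x p]
  rw [e3, ← mulL1_U]
  generalize H.TΔ1 (a ⊗ₜ x) = t
  induction t with
  | zero => simp
  | add a b ha hb => simp only [map_add, ha, hb]
  | tmul p q => simp [I.psi_mul p y]

lemma sliceL_δ_U (a x : A) : sliceL (I.δ : A →ₗ[k] k) (H.TΔ1 (a ⊗ₜ x)) = I.δ x • I.lam a := by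
  apply (I.S.trans I.S).injective
  rw [map_smul]
  change I.S (I.S _) = _ • I.S (I.S _)
  rw [S_S_lam, δ_apply, ← I.counit.sliceL_U, U_κ]
  generalize H.TΔ1 (a ⊗ₜ x) = t
  induction t with
  | zero => simp
  | add a b ha hb => simp only [map_add, ha, hb]
  | tmul p q => simp [I.δ_apply]

lemma sliceL_δ_T (a b : A) : sliceL (I.δ : A →ₗ[k] k) (H.TΔ2 (a ⊗ₜ b)) = I.lam a * b := by
  obtain ⟨c, hc⟩ := I.exists_δ_eq_one
  have h := sliceL_char_mulR1 I.δ c (H.TΔ2 (a ⊗ₜ b))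
  rw [hc, one_smul, mulR1_T, sliceL_mulR2, sliceL_δ_U, hc, one_smul] at h
  exact h.symm

lemma mul_Ssymm_U (a c : A) : LinearMap.mul' k A (TensorProduct.comm k A A
    (I.S.symm.toLinearMap.lTensor A (H.TΔ1 (a ⊗ₜ c)))) = I.ε a • c := by
  apply I.S.injective
  rw [map_smul, ← I.mul_S_U]
  generalize H.TΔ1 (a ⊗ₜ c) = t
  induction t with
  | zero => simp
  | add a b ha hb => simp only [map_add, ha, hb]
  | tmul a b => simp [I.S_mul]

/-- `φ(a₍₁₎ c S(λ(a₍₂₎))) = ε(a) φ(c)`. -/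
lemma phi_U_lam (a c : A) : φ (LinearMap.mul' k A
    ((I.S.toLinearMap ∘ₗ I.lam).lTensor A (H.TΔ1 (a ⊗ₜ c)))) = I.ε a * φ c := by
  rw [← smul_eq_mul, ← map_smul, ← mul_Ssymm_U]
  -- As S² commutes with σ, S ∘ λ = σ ∘ S⁻¹. The last factor can therefore be carried to the front
  -- of φ, where S⁻¹(a₍₂₎)a₍₁₎ collapses to ε(a).
  have h : ∀ q, I.S (I.lam q) = I.σ (I.S.symm q) := by
    intro q
    apply I.S.injective
    rw [S_S_lam, κ_apply]
    apply I.S.injective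
    rw [LinearEquiv.apply_symm_apply, ← I.σ_S_S, LinearEquiv.apply_symm_apply]
  generalize H.TΔ1 (a ⊗ₜ c) = t
  induction t with
  | zero => simp
  | add a b ha hb => simp only [map_add, ha, hb]
  | tmul a b => simp [h, I.σ_spec]

theorem exists_psiHat : ∃ e : A ≃ₗ[k] A, ∀ c x, φ (I.S (e c * x)) = φ (x * c) := by
  obtain ⟨ρ, hρ⟩ := exists_twist_equiv (f := φ) (g := φ ∘ₗ I.S.toLinearMap)
    (I.toHopfMaps.faithful_right I.inv I.ne_zero)
    (fun a ha => I.psi_faithful_right fun b => by simpa using ha b)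
    (H.frame.exists_twist (φX := φ) I.inv I.right_inv (I.comp_S_ne_zero I.ne_zero))
    (H.frame.exists_twist' (φX := φ) I.inv I.right_inv I.ne_zero)
  refine ⟨ρ.symm.trans I.κ, fun c x => ?_⟩
  have := hρ x (ρ.symm c)
  rw [LinearEquiv.apply_symm_apply] at this
  rw [← this, LinearEquiv.trans_apply, ← I.psi_mul]
  rfl

/-- The bijection `c ↦ η(c)` with `ψ(η(c) ·) = φ(· c)`. -/
def η : A ≃ₗ[k] A := I.exists_psiHat.choose

lemma η_spec (c x : A) : φ (I.S (I.η c * x)) = φ (x * c) := I.exists_psiHat.choose_spec c x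

/-- This identifies the modular element of the dual: φ̂ sends φ(· c) to ε(η(c)), so φ̂(φ(· ac)) =
ε(κ(a)) φ̂(φ(· c)), and ε ∘ κ is `δ`. -/
lemma η_mul (a c : A) : I.η (a * c) = I.κ a * I.η c := by
  apply I.psi_faithful_left
  intro x
  rw [I.η_spec, mul_assoc, ← I.psi_mul, mul_assoc, I.η_spec, mul_assoc]

/-- The character δ̂ ∘ S is the convolution inverse of δ̂; `δ_S_left` is the other half. Hence δ̂
acts bijectively on X. -/
lemma δ_S_right (a c : A) :
    I.δ (sliceR ((I.δ : A →ₗ[k] k) ∘ₗ I.S.toLinearMap) (H.TΔ2 (a ⊗ₜ c))) =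
      I.ε a * I.δ (I.S c) := by
  obtain ⟨b, hb⟩ := I.exists_δ_eq_one
  have h1 : ∀ t : A ⊗[k] A, I.δ (b * sliceR ((I.δ : A →ₗ[k] k) ∘ₗ I.S.toLinearMap) t) =
      I.δ (sliceR ((I.δ : A →ₗ[k] k) ∘ₗ I.S.toLinearMap) t) := by
    intro t
    rw [map_mul, hb, one_mul]
  rw [← h1, ← sliceR_mulL1, mulL1_T]
  have h2 := congrArg I.δ (I.antipode.right b a)
  rw [map_smul, hb, smul_eq_mul, mul_one] at h2
  rw [← h2]
  generalize H.T1Δ (b ⊗ₜ a) = t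
  induction t with
  | zero => simp
  | add a b ha hb => simp only [map_add, ha, hb, add_mul]
  | tmul p q => simp [I.S_mul]; ring

lemma δ_S_left (a c : A) :
    I.δ (sliceL ((I.δ : A →ₗ[k] k) ∘ₗ I.S.toLinearMap) (H.TΔ2 (a ⊗ₜ c))) =
      I.ε a * I.δ c := by
  have h2 := congrArg I.δ (I.antipode.left a c)
  rw [map_smul, smul_eq_mul] at h2
  rw [← h2]
  generalize H.TΔ2 (a ⊗ₜ c) = t
  induction t with
  | zero => simp
  | add a b ha hb => simp only [map_add, ha, hb]
  | tmul p q => simp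

end Integral

/-! ### Invariant functionals on a Galois object -/

namespace PreFrame

variable (F : PreFrame H X)

lemma V_mul_eq (x y : X) (t : X ⊗[k] A) : F.V (x ⊗ₜ y) * t = mulL1 x ((F.α y).lmul t) := by
  rw [← Mult.lmul_of (k := k), F.V_spec]
  rfl

/-- `V` intertwines slices of `T1`. -/
lemma V_slice_T1 (g : Module.Dual k A) (z x : X) (c : A) :
    F.V (z ⊗ₜ sliceR g (F.T1 (x ⊗ₜ c))) =
      (sliceR g ∘ₗ H.TΔ2.toLinearMap ∘ₗ (TensorProduct.mk k A A).flip c).lTensor X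
        (F.V (z ⊗ₜ x)) := by
  have h := congrArg ((sliceR g).lTensor X) (F.coassoc x z c)
  rw [lTensor_sliceR_assoc, sliceR_rTensor, ← LinearMap.comp_apply (LinearMap.lTensor X _),
    ← LinearMap.lTensor_comp] at h
  exact h

lemma gV_mulR2 (y : X) (e : A) (t : X ⊗[k] A) :
    (mulR2 (k := k) (M := A) e).lTensor X (F.gV y t) = F.gV y (mulR2 e t) := by
  induction t with
  | zero => simp
  | add a b ha hb => simp only [map_add, ha, hb]
  | tmul a b =>
    rw [mulR2_tmul, gV_tmul, gV_tmul]
    generalize F.V (y ⊗ₜ[k] a) = s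
    induction s with
    | zero => simp
    | add a b ha hb => simp only [map_add, TensorProduct.add_tmul, ha, hb]
    | tmul a b => simp

/-- `z ⊗ a ↦ (z ⊗ Δ(a)) (α(y) ⊗ 1)`, with the legs of `α(y)` in the places one and two. -/
def mixV (y : X) : X ⊗[k] A →ₗ[k] X ⊗[k] (A ⊗[k] A) :=
  TensorProduct.lift ((LinearMap.lTensorHom X ∘ₗ TensorProduct.curry H.TΔ1.toLinearMap).flip ∘ₗ
    F.V.toLinearMap ∘ₗ (TensorProduct.mk k X X).flip y)

lemma mixV_tmul (y z : X) (a : A) : F.mixV y (z ⊗ₜ a) =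
    (H.TΔ1.toLinearMap ∘ₗ TensorProduct.mk k A A a).lTensor X (F.V (z ⊗ₜ y)) := rfl

end PreFrame

namespace Frame

variable (F : Frame H X)

lemma W_slice_T1 (g : Module.Dual k A) (x z : X) (c : A) :
    F.W (sliceR g (F.T1 (x ⊗ₜ c)) ⊗ₜ z) =
      (sliceR g ∘ₗ H.TΔ2.toLinearMap ∘ₗ (TensorProduct.mk k A A).flip c).lTensor X
        (F.W (x ⊗ₜ z)) := by
  apply eq_of_mulL1 F.nondegenerate
  intro y
  rw [mulL1_lTensor, F.mulL1_W, F.mulL1_W, F.V_slice_T1, mulR1_lTensor]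

/-- `y ⊗ a ↦ (α ⊗ ι)(α(x)) (y ⊗ a ⊗ 1)`. -/
def mix (x : X) : X ⊗[k] A →ₗ[k] X ⊗[k] (A ⊗[k] A) :=
  TensorProduct.lift ((LinearMap.lTensorHom X ∘ₗ
    (TensorProduct.curry H.TΔ1.toLinearMap).flip).flip ∘ₗ
      F.W.toLinearMap ∘ₗ TensorProduct.mk k X X x)

lemma mix_tmul (x y : X) (a : A) : F.mix x (y ⊗ₜ a) =
    (H.TΔ1.toLinearMap ∘ₗ (TensorProduct.mk k A A).flip a).lTensor X (F.W (x ⊗ₜ y)) := rfl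

lemma assoc_lα (x : X) (e : A) (t : X ⊗[k] A) :
    TensorProduct.assoc k X A A ((F.lα t).rTensor A (F.T1 (x ⊗ₜ e))) =
      (mulR2 (k := k) (M := A) e).lTensor X (F.mix x t) := by
  induction t with
  | zero => simp
  | add a b ha hb => simp only [map_add, LinearMap.rTensor_add, LinearMap.add_apply, ha, hb]
  | tmul y a =>
    have h1 : ∀ s : X ⊗[k] A, TensorProduct.assoc k X A A ((F.lα (y ⊗ₜ a)).rTensor A s) =
        (mulR1 (k := k) a).lTensor X (F.gW y s) := by
      intro s
      induction s with
      | zero => simp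
      | add a b ha hb => simp only [map_add, ha, hb]
      | tmul r b =>
        rw [LinearMap.rTensor_tmul, gW_tmul, show F.lα (y ⊗ₜ a) r = _ from (F.mulR2_W r y a).symm]
        generalize F.W (r ⊗ₜ y) = s
        induction s with
        | zero => simp
        | add a b ha hb => simp only [map_add, TensorProduct.add_tmul, ha, hb]
        | tmul a b => simp
    rw [h1, gW_T1, gW_tmul, mix_tmul]
    generalize F.W (x ⊗ₜ y) = s
    induction s with
    | zero => simp
    | add a b ha hb => simp only [map_add, TensorProduct.add_tmul, ha, hb]
    | tmul r b => simp [mulR1_T]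

/-- Multiplicativity of α and coassociativity: (α ⊗ ι)(α(x)(y ⊗ 1)) = (ι ⊗ Δ)(α(x)) (α(y) ⊗ 1).
Sliced by φ on the last leg it makes (ι ⊗ φ)α(x) coinvariant. -/
lemma T1_W (x y : X) (a : A) :
    TensorProduct.assoc k X A A
      ((F.T1 ∘ₗ (TensorProduct.mk k X A).flip a).rTensor A (F.W (x ⊗ₜ y))) =
      F.mix x (F.T1 (y ⊗ₜ a)) := by
  apply eq_of_lTensor (fun e : A => mulR2 (k := k) (M := A) e)
    (fun n n' h => eq_of_mulR2 H.nondegenerate h)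
  intro e
  rw [← assoc_lα]
  have h1 : ∀ s : X ⊗[k] A, (mulR2 (k := k) (M := A) e).lTensor X (TensorProduct.assoc k X A A
      ((F.T1 ∘ₗ (TensorProduct.mk k X A).flip a).rTensor A s)) =
      TensorProduct.assoc k X A A
      ((F.T1 ∘ₗ (TensorProduct.mk k X A).flip a).rTensor A (mulR2 e s)) := by
    intro s
    induction s with
    | zero => simp
    | add a b ha hb => simp only [map_add, ha, hb]
    | tmul r b =>
      simp only [LinearMap.rTensor_tmul, mulR2_tmul]
      generalize (F.T1 ∘ₗ (TensorProduct.mk k X A).flip a) r = s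
      induction s with
      | zero => simp
      | add a b ha hb => simp only [map_add, TensorProduct.add_tmul, ha, hb]
      | tmul r b => simp
  rw [h1, ← F.mulR1_T1_eq]
  congr 1
  generalize F.T1 (x ⊗ₜ e) = s
  induction s with
  | zero => simp
  | add a b ha hb => simp only [map_add, ha, hb]
  | tmul r b =>
    simp only [mulR1_tmul, LinearMap.rTensor_tmul]
    congr 1
    exact (F.lmul_T1 r y a).symm

/-- In Sweedler notation both sides are z w₍₀₎y₍₀₎ ⊗ w₍₁₎y₍₁₎ ⊗ w₍₂₎. -/
lemma gV_W (z w y : X) : F.gV z (F.W (w ⊗ₜ y)) = F.mixV y (F.V (z ⊗ₜ w)) := by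
  apply eq_of_lTensor (fun e : A => mulR2 (k := k) (M := A) e)
    (fun n n' h => eq_of_mulR2 H.nondegenerate h)
  intro e
  rw [F.gV_mulR2, ← F.mulR1_T1_eq]
  let R : X ⊗[k] (A ⊗[k] A) →ₗ[k] X ⊗[k] (A ⊗[k] A) :=
    (TensorProduct.assoc k X A A).toLinearMap ∘ₗ (F.α y).rmul.rTensor A ∘ₗ
      (TensorProduct.assoc k X A A).symm.toLinearMap
  have h1 : ∀ s : X ⊗[k] A, F.gV z (mulR1 y s) = R (F.gV z s) := by
    intro s
    induction s with
    | zero => simp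
    | add a b ha hb => simp only [map_add, ha, hb]
    | tmul r b =>
      rw [mulR1_tmul, F.gV_tmul, F.gV_tmul, ← F.rmul_V]
      simp [R]
  have h2 : ∀ (z' : X) (t : A ⊗[k] A), R (z' ⊗ₜ t) = ((LinearMap.rTensorHom A ∘ₗ
        (LinearMap.mul k A).flip).flip t).lTensor X (F.V (z' ⊗ₜ y)) := by
    intro z' t
    induction t with
    | zero => simp
    | add a b ha hb =>
      simp only [map_add, TensorProduct.tmul_add, ha, hb, LinearMap.lTensor_add,
        LinearMap.add_apply]
    | tmul r s =>
      simp only [R, LinearMap.comp_apply, LinearEquiv.coe_coe, TensorProduct.assoc_symm_tmul,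
        LinearMap.rTensor_tmul]
      rw [← F.mulL2_V]
      generalize F.V (z' ⊗ₜ y) = t
      induction t with
      | zero => simp
      | add a b ha hb => simp only [map_add, TensorProduct.add_tmul, ha, hb]
      | tmul a b => simp
  rw [h1, F.gV_T1, F.gV_tmul]
  generalize F.V (z ⊗ₜ w) = s
  induction s with
  | zero => simp
  | add a b ha hb => simp only [map_add, TensorProduct.add_tmul, ha, hb]
  | tmul r b =>
    rw [TensorProduct.assoc_tmul, LinearMap.lTensor_tmul, h2, F.mixV_tmul]
    generalize F.V (r ⊗ₜ y) = t
    induction t with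
    | zero => simp
    | add a b ha hb => simp only [map_add, ha, hb]
    | tmul p q =>
      simp only [LinearMap.lTensor_tmul, LinearMap.comp_apply,
        TensorProduct.mk_apply, LinearEquiv.coe_coe]
      congr 1
      exact H.mulR1_T b e q

/-! ### Characters of A acting on X -/

section CharAct

variable (χ : A →ₙₐ[k] k) (c : A)

/-- The action of a character `χ` on `X`; here `χ(c) = 1`. -/
def charAct : X →ₗ[k] X := sliceR (χ : A →ₗ[k] k) ∘ₗ F.T1 ∘ₗ (TensorProduct.mk k X A).flip c

lemma charAct_apply (x : X) : F.charAct χ c x = sliceR (χ : A →ₗ[k] k) (F.T1 (x ⊗ₜ c)) := rfl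

variable {χ c}

lemma mul_charAct (hc : χ c = 1) (z x : X) :
    z * F.charAct χ c x = sliceR (χ : A →ₗ[k] k) (F.V (z ⊗ₜ x)) := by
  rw [charAct_apply, ← sliceR_mulL1, F.mulL1_T1, sliceR_char_mulR2, hc, one_smul]

lemma charAct_mul (hc : χ c = 1) (z x : X) :
    F.charAct χ c x * z = sliceR (χ : A →ₗ[k] k) (F.W (x ⊗ₜ z)) := by
  apply F.nondegenerate.eq_of_mul_left
  intro y
  rw [← mul_assoc, F.mul_charAct hc, ← sliceR_mulR1, ← sliceR_mulL1, F.mulL1_W]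

lemma charAct_map_mul (hc : χ c = 1) (x y : X) :
    F.charAct χ c (x * y) = F.charAct χ c x * F.charAct χ c y := by
  apply F.nondegenerate.eq_of_mul_left
  intro z
  rw [← mul_assoc, F.mul_charAct hc z (x * y), F.mul_charAct hc z x, ← F.rmul_V]
  generalize F.V (z ⊗ₜ x) = t
  induction t with
  | zero => simp
  | add a b ha hb => simp only [map_add, ha, hb, add_mul]
  | tmul w a =>
    rw [← F.mulL2_V, sliceR_char_mulL2, sliceR_tmul, smul_mul_assoc, F.mul_charAct hc]
    rfl

lemma charAct_charAct (C : HopfMaps H) {χ' : A →ₙₐ[k] k} {c' : A} (hc : χ c = 1)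
    (h : ∀ a, χ (sliceR (χ' : A →ₗ[k] k) (H.TΔ2 (a ⊗ₜ c'))) = C.ε a) (x : X) :
    F.charAct χ c (F.charAct χ' c' x) = x := by
  apply F.nondegenerate.eq_of_mul_left
  intro z
  rw [F.mul_charAct hc, F.charAct_apply χ', F.V_slice_T1, sliceR_lTensor, ← C.sliceR_V F.toPreFrame]
  congr 2
  ext a
  exact h a

end CharAct

/-! ### Faithfulness and modular automorphism of φ_X -/

section Integral

variable {F} {φ : Module.Dual k A} {φX : Module.Dual k X}

/-- Because W is onto, this evaluates (ι ⊗ φ)(α(x)t) for every t. Statements about φ_X are reduced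
to statements about φ through it. -/
lemma phi_lmul_W (hW : ∀ x z, sliceR φ (F.W (x ⊗ₜ z)) = φX x • z) (x q r : X) :
    sliceR φ ((F.α x).lmul (F.W (q ⊗ₜ r))) = φX (x * q) • r := by
  rw [F.lmul_W, hW]

lemma phi_rmul_V (hV : ∀ x z, sliceR φ (F.V (z ⊗ₜ x)) = φX x • z) (x q r : X) :
    sliceR φ ((F.α x).rmul (F.V (q ⊗ₜ r))) = φX (r * x) • q := by
  rw [F.rmul_V, hV]

lemma sliceR_V_symm (hV : ∀ x z, sliceR φ (F.V (z ⊗ₜ x)) = φX x • z) (t : X ⊗[k] A) :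
    sliceR φX (F.V.symm t) = sliceR φ t := by
  obtain ⟨s, rfl⟩ := F.V.surjective t
  rw [LinearEquiv.symm_apply_apply]
  exact tensor_ext (f := sliceR φX) (g := sliceR φ ∘ₗ F.V.toLinearMap) (by simp [hV]) s

lemma phiX_mul_slice (hW : ∀ x z, sliceR φ (F.W (x ⊗ₜ z)) = φX x • z) (x : X) (t : X ⊗[k] A) :
    φX (x * sliceR φX (F.W.symm t)) = φX (sliceR φ ((F.α x).lmul t)) := by
  obtain ⟨s, rfl⟩ := F.W.surjective t
  rw [LinearEquiv.symm_apply_apply]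
  induction s with
  | zero => simp
  | add a b ha hb => simp only [map_add, mul_add, ha, hb]
  | tmul q r => rw [phi_lmul_W hW]; simp [mul_smul_comm, mul_comm]

/-- The slice `J` of β(a) becomes an ordinary slice of the coaction. Later computations with β go
through this form. -/
lemma sliceR_W_symm_S (C : HopfMaps H) (hV : ∀ x z, sliceR φ (F.V (z ⊗ₜ x)) = φX x • z) (u : X)
    (a : A) : sliceR φX (F.W.symm (u ⊗ₜ C.S a)) = sliceR φ (F.T2 (u ⊗ₜ a)) := by
  rw [C.W_symm_S, sliceR_V_symm hV]

/-- If φ_X(· x) = 0 then (ι ⊗ φ)(t α(x)) = 0 for all t, since V is onto. Faithfulness of φ then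
kills V(z ⊗ x). -/
lemma phiX_faithful_right (I : Integral H φ) (hV : ∀ x z, sliceR φ (F.V (z ⊗ₜ x)) = φX x • z)
    (x : X) (h : ∀ y, φX (y * x) = 0) : x = 0 := by
  have h1 : ∀ t : X ⊗[k] A, sliceR φ ((F.α x).rmul t) = 0 := by
    intro t
    obtain ⟨s, rfl⟩ := F.V.surjective t
    induction s with
    | zero => simp
    | add a b ha hb => simp only [map_add, ha, hb, add_zero]
    | tmul q r => rw [phi_rmul_V hV, h, zero_smul]
  obtain ⟨z, hz⟩ := @exists_ne X F.nontrivial 0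
  have h2 : F.V (z ⊗ₜ x) = F.V (z ⊗ₜ 0) := by
    apply eq_of_sliceR_family (fun a : A => φ ∘ₗ LinearMap.mulLeft k a)
    · intro n hn
      exact I.toHopfMaps.faithful_right I.inv I.ne_zero n hn
    intro a
    rw [← sliceR_lTensor, TensorProduct.tmul_zero, map_zero, map_zero]
    change sliceR φ (mulL2 a _) = 0
    rw [F.mulL2_V, h1]
  exact tmul_right_cancel hz (F.V.injective h2)

lemma phiX_faithful_left (I : Integral H φ) (hW : ∀ x z, sliceR φ (F.W (x ⊗ₜ z)) = φX x • z)
    (x : X) (h : ∀ y, φX (x * y) = 0) : x = 0 := by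
  have h1 : ∀ t : X ⊗[k] A, sliceR φ ((F.α x).lmul t) = 0 := by
    intro t
    obtain ⟨s, rfl⟩ := F.W.surjective t
    induction s with
    | zero => simp
    | add a b ha hb => simp only [map_add, ha, hb, add_zero]
    | tmul q r => rw [phi_lmul_W hW, h, zero_smul]
  obtain ⟨z, hz⟩ := @exists_ne X F.nontrivial 0
  have h2 : F.W (x ⊗ₜ z) = F.W (0 ⊗ₜ z) := by
    apply eq_of_sliceR_family (fun a : A => φ ∘ₗ LinearMap.mulRight k a)
    · intro n hn
      exact I.toHopfMaps.faithful_left I.inv I.ne_zero n hn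
    intro a
    rw [← sliceR_lTensor, TensorProduct.zero_tmul, map_zero, map_zero]
    change sliceR φ (mulR2 a _) = 0
    rw [F.mulR2_W, h1]
  exact tmul_left_cancel hz (F.W.injective h2)

/-- `(ι ⊗ φ)(((x ⊗ 1)α(y)) (α(v)(u ⊗ 1))) = φ_X(y v) x u`. -/
lemma slice_V_mul_W (hW : ∀ x z, sliceR φ (F.W (x ⊗ₜ z)) = φX x • z) (x y v u : X) :
    sliceR φ (F.V (x ⊗ₜ y) * F.W (v ⊗ₜ u)) = φX (y * v) • (x * u) := by
  rw [F.V_mul_eq, sliceR_mulL1, phi_lmul_W hW, mul_smul_comm]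

/-- With f(zz') = 1, the number φ_X(xy) is f((ι ⊗ φ)(V(z ⊗ x)W(y ⊗ z'))). When V(z ⊗ x) is replaced
by w ⊗ a, the factor a passes to the right of φ as σ(a), is absorbed in α(y)(z' ⊗ σ(a)), and
`phi_lmul_W` shows that the result has the form φ_X(y x'). The other direction is symmetric. -/
lemma exists_sigmaX (I : Integral H φ) (hW : ∀ x z, sliceR φ (F.W (x ⊗ₜ z)) = φX x • z)
    (hV : ∀ x z, sliceR φ (F.V (z ⊗ₜ x)) = φX x • z) :
    ∃ σ : X ≃ₗ[k] X, (∀ x y, σ (x * y) = σ x * σ y) ∧ ∀ x y, φX (y * σ x) = φX (x * y) := by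
  obtain ⟨z, z', hz⟩ : ∃ z z' : X, z * z' ≠ 0 := by
    obtain ⟨a, ha⟩ := @exists_ne X F.nontrivial 0
    by_contra! h
    exact ha (F.nondegenerate.left a fun b => h a b)
  obtain ⟨f, hf⟩ := exists_dual_eq_one (k := k) hz
  apply exists_modular (phiX_faithful_left I hW) (phiX_faithful_right I hV)
  · intro x
    have h1 : ∀ t : X ⊗[k] A, ∃ x', ∀ y, f (sliceR φ (t * F.W (y ⊗ₜ z'))) = φX (y * x') := by
      intro t
      induction t with
      | zero => exact ⟨0, by simp⟩
      | add s t hs ht =>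
        obtain ⟨x₁, h₁⟩ := hs
        obtain ⟨x₂, h₂⟩ := ht
        exact ⟨x₁ + x₂, fun y => by simp only [add_mul, mul_add, map_add, h₁, h₂]⟩
      | tmul w a =>
        have h2 : ∀ s : X ⊗[k] X, ∃ x', ∀ y,
            f (w * sliceR φ ((F.α y).lmul (F.W s))) = φX (y * x') := by
          intro s
          induction s with
          | zero => exact ⟨0, by simp⟩
          | add s t hs ht =>
            obtain ⟨x₁, h₁⟩ := hs
            obtain ⟨x₂, h₂⟩ := ht
            exact ⟨x₁ + x₂, fun y => by simp only [mul_add, map_add, h₁, h₂]⟩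
          | tmul q r =>
            refine ⟨f (w * r) • q, fun y => ?_⟩
            rw [phi_lmul_W hW, mul_smul_comm, mul_smul_comm, map_smul, map_smul, smul_eq_mul,
              smul_eq_mul, mul_comm]
        obtain ⟨x', hx'⟩ := h2 (F.W.symm (z' ⊗ₜ I.σ a))
        refine ⟨x', fun y => ?_⟩
        rw [← hx', LinearEquiv.apply_symm_apply, ← F.mulR2_W, tmul_mul_eq, ← mulL1_mulL2,
          sliceR_mulL1]
        congr 2
        generalize F.W (y ⊗ₜ z') = s
        induction s with
        | zero => simp
        | add a b ha hb => simp only [map_add, ha, hb]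
        | tmul p q => simp [I.σ_spec]
    obtain ⟨x', hx'⟩ := h1 (F.V (z ⊗ₜ x))
    refine ⟨x', fun y => ?_⟩
    rw [← hx', slice_V_mul_W hW, map_smul, hf, smul_eq_mul, mul_one]
  · intro x
    have h1 : ∀ t : X ⊗[k] A, ∃ x', ∀ y, φX (x' * y) = f (sliceR φ (F.V (z ⊗ₜ y) * t)) := by
      intro t
      induction t with
      | zero => exact ⟨0, by simp⟩
      | add s t hs ht =>
        obtain ⟨x₁, h₁⟩ := hs
        obtain ⟨x₂, h₂⟩ := ht
        exact ⟨x₁ + x₂, fun y => by simp only [add_mul, mul_add, map_add, h₁, h₂]⟩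
      | tmul w a =>
        have h2 : ∀ s : X ⊗[k] X, ∃ x', ∀ y,
            φX (x' * y) = f (sliceR φ ((F.α y).rmul (F.V s)) * w) := by
          intro s
          induction s with
          | zero => exact ⟨0, by simp⟩
          | add s t hs ht =>
            obtain ⟨x₁, h₁⟩ := hs
            obtain ⟨x₂, h₂⟩ := ht
            exact ⟨x₁ + x₂, fun y => by simp only [add_mul, map_add, h₁, h₂]⟩
          | tmul q r =>
            refine ⟨f (q * w) • r, fun y => ?_⟩
            rw [phi_rmul_V hV, smul_mul_assoc, smul_mul_assoc, map_smul, map_smul, smul_eq_mul,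
              smul_eq_mul, mul_comm]
        obtain ⟨x', hx'⟩ := h2 (F.V.symm (z ⊗ₜ I.σ.symm a))
        refine ⟨x', fun y => ?_⟩
        rw [hx', LinearEquiv.apply_symm_apply, ← F.mulL2_V, mul_tmul_eq, ← mulR1_mulR2,
          sliceR_mulR1]
        congr 2
        generalize F.V (z ⊗ₜ y) = s
        induction s with
        | zero => simp
        | add a b ha hb => simp only [map_add, ha, hb]
        | tmul p q =>
          have := I.σ_spec (I.σ.symm a) q
          rw [LinearEquiv.apply_symm_apply] at this
          simp [this]
    obtain ⟨x', hx'⟩ := h1 (F.W (x ⊗ₜ z'))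
    refine ⟨x', fun y => ?_⟩
    rw [hx', slice_V_mul_W hW, map_smul, hf, smul_eq_mul, mul_one]

/-- `Σ (ι ⊗ φ)(α(wᵢ)(1 ⊗ S(λ(bᵢ)))) = φ_X(y) w` for `Σ wᵢ ⊗ bᵢ = α(w)(y ⊗ 1)`. -/
lemma slice_T1_lam (I : Integral H φ) (hV : ∀ x z, sliceR φ (F.V (z ⊗ₜ x)) = φX x • z) (w y : X) :
    sliceR φ (F.T1 ((I.S.toLinearMap ∘ₗ I.lam).lTensor X (F.W (w ⊗ₜ y)))) = φX y • w := by
  apply F.nondegenerate.eq_of_mul_left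
  intro z
  have h1 : ∀ t : X ⊗[k] A, z * sliceR φ (F.T1 ((I.S.toLinearMap ∘ₗ I.lam).lTensor X t)) =
      sliceR (φ ∘ₗ LinearMap.mul' k A ∘ₗ (I.S.toLinearMap ∘ₗ I.lam).lTensor A) (F.gV z t) := by
    intro t
    induction t with
    | zero => simp
    | add a b ha hb => simp only [map_add, mul_add, ha, hb]
    | tmul r b =>
      rw [← sliceR_mulL1, LinearMap.lTensor_tmul, F.mulL1_T1, F.gV_tmul]
      generalize F.V (z ⊗ₜ r) = s
      induction s with
      | zero => simp
      | add a b ha hb => simp only [map_add, TensorProduct.add_tmul, ha, hb]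
      | tmul a b => simp
  have h2 : ∀ t : X ⊗[k] A,
      sliceR (φ ∘ₗ LinearMap.mul' k A ∘ₗ (I.S.toLinearMap ∘ₗ I.lam).lTensor A) (F.mixV y t) =
      φX y • sliceR (I.ε : A →ₗ[k] k) t := by
    intro t
    induction t with
    | zero => simp
    | add a b ha hb => simp only [map_add, smul_add, ha, hb]
    | tmul r b =>
      rw [F.mixV_tmul, sliceR_lTensor, sliceR_tmul, show (φ ∘ₗ LinearMap.mul' k A ∘ₗ
        (I.S.toLinearMap ∘ₗ I.lam).lTensor A) ∘ₗ H.TΔ1.toLinearMap ∘ₗ TensorProduct.mk k A A b =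
        I.ε b • φ from LinearMap.ext fun c => I.phi_U_lam b c]
      rw [smul_comm, ← hV]
      generalize F.V (r ⊗ₜ y) = s
      induction s with
      | zero => simp
      | add a b ha hb => simp only [map_add, smul_add, ha, hb]
      | tmul p q => simp [mul_smul]
  rw [h1, F.gV_W, h2, I.sliceR_V F.toPreFrame, mul_smul_comm]

/-- `θ_X((ι ⊗ φ)(α(w)(1 ⊗ a))) = (ι ⊗ φ)((1 ⊗ a)α(σ_X(w)))`. -/
lemma theta_slice (I : Integral H φ) (hW : ∀ x z, sliceR φ (F.W (x ⊗ₜ z)) = φX x • z)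
    (hV : ∀ x z, sliceR φ (F.V (z ⊗ₜ x)) = φX x • z) {σX : X → X}
    (hσ : ∀ x y, φX (y * σX x) = φX (x * y)) {c : A} (hc : I.δ c = 1) (w : X) (a : A) :
    σX (F.charAct I.δ c (sliceR φ (F.T1 (w ⊗ₜ a)))) = sliceR φ (F.T2 (σX w ⊗ₜ a)) := by
  -- Paired with φ_X(r ·), the two sides become functionals f1 and f2 of r ⊗ a. They are compared at
  -- V(r ⊗ q), where both equal φ_X(r)φ_X(wq). For f1 this rests on `slice_T1_lam`, after r is
  -- written as a sum of products r₁r₂.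
  let g : A →ₗ[k] A →ₗ[k] k := ((LinearMap.mul k A).compr₂ φ).flip.compl₂ I.lam
  let f1 : X ⊗[k] A →ₗ[k] k := TensorProduct.lift
    ((((LinearMap.lcomp k k
      (F.W.toLinearMap ∘ₗ TensorProduct.mk k X X w)) ∘ₗ (LinearMap.llcomp k (X ⊗[k] A) X k φX) ∘ₗ
      (TensorProduct.rid k X).toLinearMap.compRight k ∘ₗ LinearMap.lTensorHom X) ∘ₗ g).flip)
  have f1_tmul : ∀ r a, f1 (r ⊗ₜ a) = φX (sliceR (g a) (F.W (w ⊗ₜ r))) := fun r a => rfl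
  let f2 : X ⊗[k] A →ₗ[k] k := φX ∘ₗ sliceR φ ∘ₗ (F.α (σX w)).rmul
  have e1 : ∀ r, φX (r * σX (F.charAct I.δ c (sliceR φ (F.T1 (w ⊗ₜ a))))) = f1 (r ⊗ₜ a) := by
    intro r
    rw [hσ, F.charAct_mul hc, F.W_slice_T1, sliceR_lTensor, f1_tmul]
    congr 3
    ext b
    change I.δ (sliceR φ (H.TΔ2 (b ⊗ₜ a))) = φ (I.lam b * a)
    rw [← I.sliceL_δ_T]
    exact apply_sliceR (I.δ : A →ₗ[k] k) φ _
  have e2 : ∀ r, φX (r * sliceR φ (F.T2 (σX w ⊗ₜ a))) = f2 (r ⊗ₜ a) := by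
    intro r
    rw [← sliceR_mulL1, F.mulL1_T2]
    rfl
  have e3 : ∀ r₁ r₂ q, f1 (F.V ((r₁ * r₂) ⊗ₜ q)) = φX (r₁ * r₂) * φX (w * q) := by
    intro r₁ r₂ q
    have h1 : ∀ t : X ⊗[k] A, f1 (mulL1 r₁ t) =
        φX (sliceR φ (I.lam.lTensor X (F.W (w ⊗ₜ r₁)) * t)) := by
      intro t
      induction t with
      | zero => simp
      | add a b ha hb => simp only [map_add, mul_add, ha, hb]
      | tmul p a =>
        rw [mulL1_tmul, f1_tmul, F.W_mul]
        generalize F.W (w ⊗ₜ r₁) = s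
        induction s with
        | zero => simp
        | add a b ha hb => simp only [map_add, add_mul, ha, hb]
        | tmul w b => simp [g]
    have h2 : ∀ s : X ⊗[k] A, φX (sliceR φ (I.lam.lTensor X s * F.V (r₂ ⊗ₜ q))) =
        φX (sliceR φ (F.T1 ((I.S.toLinearMap ∘ₗ I.lam).lTensor X (mulR1 r₂ s))) * q) := by
      intro s
      induction s with
      | zero => simp
      | add a b ha hb => simp only [map_add, add_mul, ha, hb]
      | tmul w b =>
        rw [LinearMap.lTensor_tmul, tmul_mul_eq, mulR1_tmul, LinearMap.lTensor_tmul,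
          ← sliceR_mulR1, F.mulR1_T1, ← phiX_mul_slice hW]
        change _ = φX (w * r₂ * sliceR φX (F.W.symm (q ⊗ₜ I.S (I.lam b))))
        rw [sliceR_W_symm_S I.toHopfMaps hV, ← mulL1_mulL2, F.mulL2_V, ← F.mulL1_T2,
          sliceR_mulL1, sliceR_mulL1, mul_assoc]
    rw [F.V_mul, h1, h2, ← F.W_mul, slice_T1_lam I hV, smul_mul_assoc, map_smul, smul_eq_mul]
  have e4 : f1 = f2 := by
    refine LinearMap.ext fun t => ?_
    obtain ⟨s, rfl⟩ := F.V.surjective t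
    induction s with
    | zero => simp
    | add a b ha hb => simp only [map_add, ha, hb]
    | tmul r q =>
      change _ = φX (sliceR φ ((F.α (σX w)).rmul (F.V (r ⊗ₜ q))))
      rw [phi_rmul_V hV, hσ, map_smul, smul_eq_mul]
      obtain ⟨t, rfl⟩ := I.exists_mul' F.toPreFrame r
      induction t with
      | zero => simp
      | add a b ha hb => simp only [map_add, TensorProduct.add_tmul, mul_add, ha, hb]
      | tmul r₁ r₂ => rw [LinearMap.mul'_apply, e3, mul_comm]
  rw [← sub_eq_zero]
  apply phiX_faithful_right I hV
  intro r
  rw [mul_sub, map_sub, e1, e2, e4, sub_self]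

end Integral

end Frame

/-! ### Existence of the structure maps -/

namespace RestrictedDual

@[simp] lemma mk_apply (f : Module.Dual k X) (u x : X) : mk f u x = f (x * u) := rfl

lemma ext {f : Module.Dual k X} {ω ω' : RestrictedDual f} (h : ∀ x, ω x = ω' x) : ω = ω' :=
  Subtype.ext (LinearMap.ext h)

lemma mk_surjective (f : Module.Dual k X) : Function.Surjective (mk f) :=
  (rightTwist f).surjective_rangeRestrict

/-- `u ↦ f(· u)` as a bijection, for faithful `f`. -/
def mkEquiv {f : Module.Dual k X} (hf : ∀ x, (∀ y, f (y * x) = 0) → x = 0) :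
    X ≃ₗ[k] RestrictedDual f :=
  LinearEquiv.ofBijective (mk f) ⟨by
    rw [← LinearMap.ker_eq_bot, LinearMap.ker_eq_bot']
    intro x hx
    apply hf
    intro y
    rw [← mk_apply, hx]
    rfl, mk_surjective f⟩

end RestrictedDual

/-! ### Existence of φ_X from coinvariance -/

section PhiX

variable {φ : Module.Dual k A} (G : GaloisObject H X) (F : Frame H X)

/-- The multiplier `(ι ⊗ φ)α(x)` of `X`. -/
def Frame.sliceMult (φ : Module.Dual k A) (x : X) : Mult k X :=
  ⟨(sliceR φ ∘ₗ F.W.toLinearMap ∘ₗ TensorProduct.mk k X X x,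
    MulOpposite.op (sliceR φ ∘ₗ F.V.toLinearMap ∘ₗ (TensorProduct.mk k X X).flip x)), by
    intro a b
    change a * sliceR φ (F.W (x ⊗ₜ b)) = sliceR φ (F.V (a ⊗ₜ x)) * b
    rw [← sliceR_mulL1, F.mulL1_W, sliceR_mulR1]⟩

lemma Frame.T1_sliceMult (hφ : H.IsLeftInvariant φ) (x y : X) (a : A) :
    F.T1 ((F.sliceMult φ x).lmul y ⊗ₜ a) =
      (F.sliceMult φ x).lmul.rTensor A (F.T1 (y ⊗ₜ a)) := by
  have h := congrArg ((sliceR φ).lTensor X) (F.T1_W x y a)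
  rw [lTensor_sliceR_assoc, sliceR_rTensor] at h
  refine Eq.trans h ?_
  generalize F.T1 (y ⊗ₜ a) = t
  induction t with
  | zero => simp
  | add a b ha hb => simp only [map_add, ha, hb]
  | tmul y' a' =>
    rw [F.mix_tmul, ← LinearMap.comp_apply, ← LinearMap.lTensor_comp,
      lTensor_smul_const φ a' _ (fun n => hφ n a')]
    rfl

lemma Frame.alpha_sliceMult_lmul (hφ : H.IsLeftInvariant φ) (x y : X) :
    F.α ((F.sliceMult φ x).lmul y) = Mult.tmul (F.sliceMult φ x) 1 * F.α y := by
  apply Mult.ext_lmul F.ndXA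
  intro t
  induction t with
  | zero => simp
  | add a b ha hb => rw [map_add, map_add, ha, hb]
  | tmul v a =>
    rw [Mult.lmul_mul_apply, ← F.mulR1_T1, ← F.mulR1_T1, F.T1_sliceMult hφ]
    generalize F.T1 (y ⊗ₜ a) = t
    induction t with
    | zero => simp
    | add a b ha hb => simp only [map_add, ha, hb]
    | tmul y' a' =>
      simp [Mult.lmul_mul_right F.nondegenerate]

/-- The right half follows from the left half: with m the multiplier, α(ym)α(z) = α(y)α(mz), and the
elements T1(zz' ⊗ a) = α(z)T1(z' ⊗ a) span X ⊗ A. -/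
lemma Frame.alpha_sliceMult_rmul (C : HopfMaps H) (hφ : H.IsLeftInvariant φ) (x y : X) :
    F.α ((F.sliceMult φ x).rmul y) = F.α y * Mult.tmul (F.sliceMult φ x) 1 := by
  apply Mult.ext_lmul F.ndXA
  intro t
  obtain ⟨s, rfl⟩ := F.T1_bijective.2 t
  induction s with
  | zero => simp
  | add a b ha hb => simp only [map_add, ha, hb]
  | tmul z a =>
    obtain ⟨t, rfl⟩ := C.exists_mul' F.toPreFrame z
    induction t with
    | zero => simp
    | add a b ha hb => simp only [map_add, TensorProduct.add_tmul, ha, hb]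
    | tmul z z' =>
      rw [LinearMap.mul'_apply, ← F.lmul_T1, ← Mult.lmul_mul_apply, ← map_mul, ← Mult.mul_lmul,
        ← Mult.lmul_mul_apply, mul_assoc, ← F.alpha_sliceMult_lmul hφ, map_mul]

/-- Left invariance of φ makes the multiplier (ι ⊗ φ)α(x) coinvariant, so it is a scalar by the
Galois hypothesis. -/
theorem exists_phiX (C : HopfMaps H) (hφ : H.IsLeftInvariant φ) (hF : F.toPreFrame = G.toPreFrame) :
    ∃ φX : Module.Dual k X, (∀ x z, sliceR φ (F.W (x ⊗ₜ z)) = φX x • z) ∧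
      ∀ x z, sliceR φ (F.V (z ⊗ₜ x)) = φX x • z := by
  have hα : F.α = G.α := by rw [hF]; rfl
  obtain ⟨z₀, hz₀⟩ := @exists_ne X F.nontrivial 0
  obtain ⟨f, hf⟩ := exists_dual_eq_one (k := k) hz₀
  let φX : Module.Dual k X := f ∘ₗ sliceR φ ∘ₗ F.W.toLinearMap ∘ₗ (TensorProduct.mk k X X).flip z₀
  have key : ∀ x, F.sliceMult φ x = algebraMap k (Mult k X) (φX x) := by
    intro x
    obtain ⟨c, hc⟩ := G.coinvariant_scalar (F.sliceMult φ x) (fun y => by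
      rw [← hα]
      exact ⟨F.alpha_sliceMult_lmul hφ x y, F.alpha_sliceMult_rmul C hφ x y⟩)
    have h1 : φX x = c := by
      have h2 := congrArg (fun m => f (Mult.lmul m z₀)) hc
      refine h2.trans ?_
      change f (c • z₀) = c
      rw [map_smul, hf, smul_eq_mul, mul_one]
    rw [h1, hc]
  refine ⟨φX, fun x z => ?_, fun x z => ?_⟩
  · exact congrArg (fun m => Mult.lmul m z) (key x)
  · exact congrArg (fun m => Mult.rmul m z) (key x)

end PhiX

/-! ### The multipliers β(a) -/

section Beta

variable (C : HopfMaps H) (F : Frame H X)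

lemma Frame.V_mulL1 (x : X) (s : X ⊗[k] X) : F.V (mulL1 x s) = mulL1 x (F.V s) :=
  tensor_ext (f := F.V.toLinearMap ∘ₗ mulL1 x) (g := mulL1 x ∘ₗ F.V.toLinearMap)
    (fun y z => by simpa using F.V_mul z y x) s

lemma Frame.V_mulR2 (x : X) (s : X ⊗[k] X) : F.V (mulR2 x s) = (F.α x).rmul (F.V s) :=
  tensor_ext (f := F.V.toLinearMap ∘ₗ mulR2 x) (g := (F.α x).rmul ∘ₗ F.V.toLinearMap)
    (fun y z => by simpa using (F.rmul_V x z y).symm) s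

lemma Frame.W_mulR2 (x : X) (s : X ⊗[k] X) : F.W (mulR2 x s) = mulR1 x (F.W s) :=
  tensor_ext (f := F.W.toLinearMap ∘ₗ mulR2 x) (g := mulR1 x ∘ₗ F.W.toLinearMap)
    (fun y z => by simpa using F.W_mul y z x) s

/-- Here (x ⊗ 1)β(a)(1 ⊗ y) is computed from both sides; this is the condition for the two
prescriptions for β(a) to form a multiplier. -/
lemma HopfMaps.mulL1_W_symm (x y : X) (a : A) :
    mulL1 x (F.W.symm (y ⊗ₜ C.S a)) = mulR2 y (F.V.symm (x ⊗ₜ a)) := by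
  apply F.V.injective
  rw [F.V_mulL1, C.W_symm_S, LinearEquiv.apply_symm_apply, F.V_mulR2, LinearEquiv.apply_symm_apply,
    F.mulL1_T2]

/-- The multiplier `β(a)` of `X ⊗ X`. -/
def HopfMaps.beta : A →ₗ[k] Mult k (X ⊗[k] X) where
  toFun a := ⟨(TensorProduct.lift ((LinearMap.rTensorHom X ∘ₗ (LinearMap.mul k X).flip).compl₂
      (F.W.symm.toLinearMap ∘ₗ (TensorProduct.mk k X A).flip (C.S a))),
      MulOpposite.op (TensorProduct.lift ((LinearMap.lTensorHom X ∘ₗ LinearMap.mul k X).compl₂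
      (F.V.symm.toLinearMap ∘ₗ (TensorProduct.mk k X A).flip a)).flip)), by
    intro s t
    rw [MulOpposite.unop_op]
    induction s with
    | zero => simp
    | add s s' hs hs' => rw [map_add, add_mul, add_mul, hs, hs']
    | tmul x y =>
      induction t with
      | zero => simp
      | add s s' hs hs' => rw [map_add, mul_add, mul_add, hs, hs']
      | tmul x' y' =>
        change (x ⊗ₜ y) * mulR1 x' (F.W.symm (y' ⊗ₜ C.S a)) =
          mulL2 y (F.V.symm (x ⊗ₜ a)) * (x' ⊗ₜ y')
        rw [tmul_mul_eq, mul_tmul_eq, mulL1_mulR1, C.mulL1_W_symm, ← mulR1_mulL2, mulL2_mulR2,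
          mulR1_mulR2]⟩
  map_add' a b := by
    apply Mult.ext'
    · ext x y
      change mulR1 x (F.W.symm (y ⊗ₜ C.S (a + b))) = mulR1 x (F.W.symm (y ⊗ₜ C.S a)) +
        mulR1 x (F.W.symm (y ⊗ₜ C.S b))
      simp only [map_add, TensorProduct.tmul_add]
    · ext x y
      change mulL2 y (F.V.symm (x ⊗ₜ (a + b))) = mulL2 y (F.V.symm (x ⊗ₜ a)) +
        mulL2 y (F.V.symm (x ⊗ₜ b))
      simp only [map_add, TensorProduct.tmul_add]
  map_smul' c a := by
    apply Mult.ext'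
    · ext x y
      change mulR1 x (F.W.symm (y ⊗ₜ C.S (c • a))) = c • mulR1 x (F.W.symm (y ⊗ₜ C.S a))
      simp only [map_smul, TensorProduct.tmul_smul]
    · ext x y
      change mulL2 y (F.V.symm (x ⊗ₜ (c • a))) = c • mulL2 y (F.V.symm (x ⊗ₜ a))
      simp only [map_smul, TensorProduct.tmul_smul]

lemma HopfMaps.beta_lmul (a : A) (x y : X) :
    (C.beta F a).lmul (x ⊗ₜ y) = mulR1 x (F.W.symm (y ⊗ₜ C.S a)) := rfl

lemma HopfMaps.beta_left (x : X) (a : A) :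
    Mult.tmul (Mult.of k x) 1 * C.beta F a = Mult.of k (F.V.symm (x ⊗ₜ a)) := by
  apply Mult.ext_lmul (F.nondegenerate.tensor F.nondegenerate)
  intro t
  induction t with
  | zero => simp
  | add a b ha hb => rw [map_add, map_add, ha, hb]
  | tmul x' y' =>
    rw [Mult.lmul_mul_apply, C.beta_lmul, Mult.lmul_of, mul_tmul_eq, ← mulR1_mulR2,
      ← C.mulL1_W_symm, ← mulL1_mulR1]
    rfl

lemma HopfMaps.beta_right (y : X) (a : A) :
    C.beta F a * Mult.tmul 1 (Mult.of k y) = Mult.of k (F.W.symm (y ⊗ₜ C.S a)) := by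
  apply Mult.ext_lmul (F.nondegenerate.tensor F.nondegenerate)
  intro t
  induction t with
  | zero => simp
  | add a b ha hb => rw [map_add, map_add, ha, hb]
  | tmul x' y' =>
    rw [Mult.lmul_mul_apply, Mult.lmul_of, mul_tmul_eq, ← mulR1_mulR2]
    change mulR1 x' (F.W.symm ((y * y') ⊗ₜ C.S a)) = _
    congr 1
    rw [LinearEquiv.symm_apply_eq, F.W_mulR2, LinearEquiv.apply_symm_apply, mulR1_tmul]

end Beta

/-! ### The modular element of the dual acting on X -/

namespace Integral

variable {φ : Module.Dual k A} (I : Integral H φ)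

/-- The character `δ̂ ∘ S`. -/
def δS : A →ₙₐ[k] k where
  toFun a := I.δ (I.S a)
  map_smul' c a := by simp
  map_zero' := by simp
  map_add' a b := by simp
  map_mul' a b := by simp [I.S_mul, mul_comm]

lemma exists_δS_eq_one : ∃ a, I.δS a = 1 := by
  obtain ⟨a, ha⟩ := I.exists_δ_eq_one
  exact ⟨I.S.symm a, by simpa [δS] using ha⟩

/-- The action of the modular element of the dual is bijective. -/
lemma exists_δact_equiv (F : Frame H X) {c : A} (hc : I.δ c = 1) :
    ∃ e : X ≃ₗ[k] X, ∀ x, e x = F.charAct I.δ c x := by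
  obtain ⟨c', hc'⟩ := I.exists_δS_eq_one
  refine ⟨LinearEquiv.ofLinearMap (F.charAct I.δ c) (F.charAct I.δS c') ?_ ?_, fun x => rfl⟩
  · ext x
    apply F.charAct_charAct I.toHopfMaps hc
    intro a
    have h := I.δ_S_right a c'
    rw [show I.δ (I.S c') = 1 from hc', mul_one] at h
    exact h
  · ext x
    apply F.charAct_charAct I.toHopfMaps hc'
    intro a
    have h := I.δ_S_left a c
    rw [hc, mul_one] at h
    rw [← h]
    exact apply_sliceR (I.δS : A →ₗ[k] k) (I.δ : A →ₗ[k] k) _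

lemma slice_charAct (F : Frame H X) (c : A) (z x : X) :
    sliceR φ (F.V (z ⊗ₜ F.charAct I.δ c x)) =
      sliceR (φ ∘ₗ H.frame.charAct I.δ c) (F.V (z ⊗ₜ x)) := by
  rw [F.charAct_apply, F.V_slice_T1, sliceR_lTensor]
  rfl

/-- Acting by δ̂ before φ gives a left invariant functional again, so uniqueness supplies the
scalar. The same scalar serves for φ_X. -/
lemma exists_phi_charAct (c : A) :
    ∃ τ : k, φ ∘ₗ H.frame.charAct I.δ c = τ • φ := by
  apply I.left_invariant_unique I.inv I.ne_zero
  apply isLeftInvariant_of_P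
  intro z a
  rw [show sliceR (φ ∘ₗ H.frame.charAct I.δ c) (H.T1Δ (z ⊗ₜ a)) = _ from
    (I.slice_charAct H.frame c z a).symm]
  exact I.inv.sliceR_P z _

lemma exists_phiX_charAct (F : Frame H X) (c : A) {φX : Module.Dual k X}
    (hV : ∀ x z, sliceR φ (F.V (z ⊗ₜ x)) = φX x • z) :
    ∃ τ : k, ∀ x, φX (F.charAct I.δ c x) = τ * φX x := by
  obtain ⟨τ, hτ⟩ := I.exists_phi_charAct c
  refine ⟨τ, fun x => ?_⟩
  obtain ⟨z, hz⟩ := @exists_ne X F.nontrivial 0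
  obtain ⟨f, hf⟩ := exists_dual_eq_one (k := k) hz
  have h := I.slice_charAct F c z x
  have h2 : ∀ t : X ⊗[k] A, sliceR (τ • φ) t = τ • sliceR φ t := by
    intro t
    induction t with
    | zero => simp
    | add a b ha hb => simp only [map_add, smul_add, ha, hb]
    | tmul p q => simp [mul_smul]
  rw [hτ, hV, h2, hV] at h
  simpa [hf] using congrArg f h

end Integral

theorem exists_structureMaps {φ : Module.Dual k A} (hφ : H.IsLeftInvariant φ) (hφ0 : φ ≠ 0)
    (G : GaloisObject H X) : ∃ D : StructureMaps G φ,
      (∀ w a, D.θX (sliceR φ (G.T1 (w ⊗ₜ a))) = D.J (D.σX w) a) ∧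
      ∃ θhat : D.Xhat ≃ₗ[k] D.Xhat, ∀ (ω : D.Xhat) (x : X), θhat ω x = ω (D.θX x) := by
  obtain ⟨I⟩ := exists_integral hφ hφ0
  let F : Frame H X := I.toHopfMaps.frame G.toPreFrame
  obtain ⟨φX, hW, hV⟩ := exists_phiX G F I.toHopfMaps hφ rfl
  obtain ⟨σX, hσm, hσ⟩ := Frame.exists_sigmaX I hW hV
  obtain ⟨c, hc⟩ := I.exists_δ_eq_one
  have hfr := Frame.phiX_faithful_right I hV
  have hfl := Frame.phiX_faithful_left I hW
  have hA : ∀ a : A, (∀ b, φ (b * a) = 0) → a = 0 := I.toHopfMaps.faithful_right hφ hφ0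
  let D : StructureMaps G φ :=
    { ε := I.ε
      counit := I.counit
      S := I.S
      antipode := I.antipode
      W := F.W
      W_spec := F.W_spec
      β := I.beta F
      β_left := I.beta_left F
      β_right := I.beta_right F
      φX := φX
      φX_left := hW
      φX_right := hV
      φX_faithful_left := hfl
      φX_faithful_right := hfr
      σX := σX
      σX_mul := hσm
      σX_spec := hσ
      psiHat := I.η.symm.trans (RestrictedDual.mkEquiv hA)
      psiHat_spec := fun b x => by
        change φ (x * I.η.symm b) = _
        rw [← I.η_spec, LinearEquiv.apply_symm_apply]
      δhat := (I.δ : A →ₗ[k] k)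
      δhat_spec := fun a c => by
        have h : ∀ c, (I.η.symm.trans (RestrictedDual.mkEquiv hA)).symm (toAhat φ c) = I.η c := by
          intro c
          rw [LinearEquiv.symm_apply_eq, LinearEquiv.trans_apply, LinearEquiv.symm_apply_apply]
          rfl
        rw [h, h, I.η_mul, map_mul, mul_comm]
        rfl
      δact := F.charAct I.δ c
      δact_spec := F.mul_charAct hc }
  refine ⟨D, fun w a => ?_, ?_⟩
  · refine (Frame.theta_slice I hW hV hσ hc w a).trans ?_
    exact (Frame.sliceR_W_symm_S I.toHopfMaps hV (σX w) a).symm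
  · obtain ⟨e, he⟩ := I.exists_δact_equiv F hc
    obtain ⟨τ, hτ⟩ := I.exists_phiX_charAct F c hV
    have hτ0 : τ ≠ 0 := by
      rintro rfl
      obtain ⟨x, hx⟩ := @exists_ne X F.nontrivial 0
      apply hx
      apply hfr
      intro y
      rw [← e.apply_symm_apply (y * x), he, hτ, zero_mul]
    let E : X ≃ₗ[k] D.Xhat := RestrictedDual.mkEquiv hfr
    -- The transpose of θ_X in coordinates sends p = σ_X(δ̂ · p') to τp': modularity and
    -- multiplicativity give φ_X(σ_X(δ̂ · x)p) = φ_X(δ̂ · (xp')) = τφ_X(xp').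
    refine ⟨E.symm.trans (((σX.symm.trans e.symm).trans
      (LinearEquiv.smulOfNeZero k X τ hτ0)).trans E), fun ω x => ?_⟩
    obtain ⟨p, rfl⟩ := E.surjective ω
    obtain ⟨p, rfl⟩ := σX.surjective p
    obtain ⟨p, rfl⟩ := e.surjective p
    simp only [LinearEquiv.trans_apply, LinearEquiv.symm_apply_apply]
    change φX (x * τ • p) = φX (σX (F.charAct I.δ c x) * σX (e p))
    rw [hσ, hσ, he, ← F.charAct_map_mul hc, hτ, mul_smul_comm, map_smul, smul_eq_mul]

end

end GaloisReflection

/-! ### Multiplier Hopf algebras from left multiplications -/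

open scoped TensorProduct

namespace GaloisReflection

noncomputable section

set_option linter.unusedSectionVars false

variable {k : Type*} [Field k] {B : Type*} [NonUnitalRing B] [Module k B]
  [IsScalarTower k B B] [SMulCommClass k B B]

open RegularMultiplierHopfAlgebra

/-- A comultiplication given by its left multiplications, with counit and antipode. The maps `T`
and `U` are `a ⊗ b ↦ Δ(a)(1 ⊗ b)` and `a ⊗ b ↦ Δ(a)(b ⊗ 1)`. -/
structure LeftHopfData (k : Type*) [Field k] (B : Type*) [NonUnitalRing B] [Module k B]
    [IsScalarTower k B B] [SMulCommClass k B B] where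
  nontrivial : Nontrivial B
  nondegenerate : IsNondegenerate B
  L : B →ₗ[k] Module.End k (B ⊗[k] B)
  L_mul : ∀ a b t, L (a * b) t = L a (L b t)
  T : B ⊗[k] B →ₗ[k] B ⊗[k] B
  U : B ⊗[k] B →ₗ[k] B ⊗[k] B
  mulR1_T : ∀ a b c, mulR1 c (T (a ⊗ₜ b)) = L a (c ⊗ₜ b)
  mulR2_U : ∀ a b c, mulR2 b (U (a ⊗ₜ c)) = L a (c ⊗ₜ b)
  T_surjective : Function.Surjective T
  U_surjective : Function.Surjective U
  coassoc : ∀ a b c, TensorProduct.assoc k B B B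
      ((U ∘ₗ (TensorProduct.mk k B B).flip c).rTensor B (T (a ⊗ₜ b))) =
    (T ∘ₗ (TensorProduct.mk k B B).flip b).lTensor B (U (a ⊗ₜ c))
  ε : B →ₙₐ[k] k
  counit_T : ∀ a b, sliceL (ε : B →ₗ[k] k) (T (a ⊗ₜ b)) = a * b
  counit_U : ∀ a b, sliceR (ε : B →ₗ[k] k) (U (a ⊗ₜ b)) = a * b
  S : B ≃ₗ[k] B
  S_mul : ∀ a b, S (a * b) = S b * S a
  antipode_T : ∀ a b, LinearMap.mul' k B (S.toLinearMap.rTensor B (T (a ⊗ₜ b))) = ε a • b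

namespace LeftHopfData

variable (Z : LeftHopfData k B)

lemma T_mul (a b c : B) : Z.T (a ⊗ₜ (b * c)) = mulR2 c (Z.T (a ⊗ₜ b)) := by
  apply eq_of_mulR1 Z.nondegenerate
  intro d
  rw [Z.mulR1_T, ← Z.mulR2_U, mulR2_mul, Z.mulR2_U, ← Z.mulR1_T, mulR1_mulR2]

lemma U_mul (a b c : B) : Z.U (a ⊗ₜ (b * c)) = mulR1 c (Z.U (a ⊗ₜ b)) := by
  apply eq_of_mulR2 Z.nondegenerate
  intro d
  rw [Z.mulR2_U, ← Z.mulR1_T, mulR1_mul, Z.mulR1_T, ← Z.mulR2_U, mulR1_mulR2]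

lemma antipode_U (a c : B) :
    LinearMap.mul' k B (Z.S.toLinearMap.rTensor B (Z.U (a ⊗ₜ c))) = Z.ε a • Z.S c := by
  apply Z.nondegenerate.eq_of_mul_right
  intro b
  rw [mulRTensor_mul, Z.mulR2_U, ← Z.mulR1_T,
    mulRTensor_mulR1 Z.S.toLinearMap Z.S_mul, Z.antipode_T, mul_smul_comm, smul_mul_assoc]
  rfl

/-- `x ⊗ y ↦ x₁ c ⊗ S(x₂) y`. -/
def invT (c : B) : B ⊗[k] B →ₗ[k] B ⊗[k] B :=
  (LinearMap.mul' k B ∘ₗ Z.S.toLinearMap.rTensor B).lTensor B ∘ₗ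
    (TensorProduct.assoc k B B B).toLinearMap ∘ₗ
      (Z.U ∘ₗ (TensorProduct.mk k B B).flip c).rTensor B

/-- In Sweedler notation a₍₁₎c ⊗ S(a₍₂₎)a₍₃₎b = ac ⊗ b: a left inverse of T up to right
multiplication by c, which is enough for injectivity. -/
lemma invT_T (c : B) (t : B ⊗[k] B) : Z.invT c (Z.T t) = mulR1 c t := by
  refine tensor_ext (f := Z.invT c ∘ₗ Z.T) (g := mulR1 c) (fun a b => ?_) t
  simp only [invT, LinearMap.comp_apply, LinearEquiv.coe_coe]
  rw [Z.coassoc, ← LinearMap.comp_apply, ← LinearMap.lTensor_comp,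
    lTensor_smul_const (Z.ε : B →ₗ[k] k) b _ (fun n => by simpa using Z.antipode_T n b),
    Z.counit_U, mulR1_tmul]

lemma T_bijective : Function.Bijective Z.T := by
  refine ⟨?_, Z.T_surjective⟩
  intro s t h
  apply eq_of_mulR1 Z.nondegenerate
  intro c
  rw [← Z.invT_T, h, Z.invT_T]

/-- `x ⊗ y ↦ S(x) y₁ ⊗ y₂ b`. -/
def invU (b : B) : B ⊗[k] B →ₗ[k] B ⊗[k] B :=
  (LinearMap.mul' k B ∘ₗ Z.S.toLinearMap.rTensor B).rTensor B ∘ₗ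
    (TensorProduct.assoc k B B B).symm.toLinearMap ∘ₗ
      (Z.T ∘ₗ (TensorProduct.mk k B B).flip b).lTensor B

lemma invU_tmul (b x y : B) : Z.invU b (x ⊗ₜ y) = mulL1 (Z.S x) (Z.T (y ⊗ₜ b)) := by
  simp only [invU, LinearMap.comp_apply, LinearMap.lTensor_tmul, LinearMap.flip_apply,
    TensorProduct.mk_apply, LinearEquiv.coe_coe]
  generalize Z.T (y ⊗ₜ b) = t
  induction t with
  | zero => simp
  | add s t hs ht => simp only [TensorProduct.tmul_add, map_add, hs, ht]
  | tmul p q => simp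

/-- In Sweedler notation S(a₍₁₎c)a₍₂₎ ⊗ a₍₃₎b = S(c) ⊗ ab. Both the injectivity of U and the
description of (c ⊗ 1)Δ(a) follow from it. -/
lemma invU_U (b a c : B) : Z.invU b (Z.U (a ⊗ₜ c)) = Z.S c ⊗ₜ (a * b) := by
  simp only [invU, LinearMap.comp_apply, LinearEquiv.coe_coe]
  rw [← Z.coassoc, LinearEquiv.symm_apply_apply, ← LinearMap.comp_apply, ← LinearMap.rTensor_comp,
    rTensor_smul_const (Z.ε : B →ₗ[k] k) (Z.S c) _ (fun n => by simpa using Z.antipode_U n c),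
    Z.counit_T]

lemma invU_U_apply (b : B) (t : B ⊗[k] B) : Z.invU b (Z.U t) =
    mulR2 b (Z.S.toLinearMap.rTensor B (TensorProduct.comm k B B t)) :=
  tensor_ext (f := Z.invU b ∘ₗ Z.U) (g := mulR2 b ∘ₗ Z.S.toLinearMap.rTensor B ∘ₗ
    (TensorProduct.comm k B B).toLinearMap) (fun a c => by simpa using Z.invU_U b a c) t

lemma U_bijective : Function.Bijective Z.U := by
  refine ⟨?_, Z.U_surjective⟩
  intro s t h
  apply (TensorProduct.comm k B B).injective
  apply (Z.S.rTensor B).injective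
  apply eq_of_mulR2 Z.nondegenerate
  intro c
  have := Z.invU_U_apply c s
  rw [h, Z.invU_U_apply] at this
  exact this.symm

/-- `T` as a bijection. -/
def Teq : B ⊗[k] B ≃ₗ[k] B ⊗[k] B := LinearEquiv.ofBijective Z.T Z.T_bijective

/-- `U` as a bijection. -/
def Ueq : B ⊗[k] B ≃ₗ[k] B ⊗[k] B := LinearEquiv.ofBijective Z.U Z.U_bijective

@[simp] lemma Teq_apply (t : B ⊗[k] B) : Z.Teq t = Z.T t := rfl

@[simp] lemma Ueq_apply (t : B ⊗[k] B) : Z.Ueq t = Z.U t := rfl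

/-- `c ⊗ a ↦ (c ⊗ 1)Δ(a)`. -/
def Peq : B ⊗[k] B ≃ₗ[k] B ⊗[k] B :=
  (Z.S.symm.rTensor B).trans (Z.Ueq.symm.trans
    ((TensorProduct.comm k B B).trans (Z.S.rTensor B)))

/-- `c ⊗ a ↦ (1 ⊗ c)Δ(a)`. -/
def Qeq : B ⊗[k] B ≃ₗ[k] B ⊗[k] B :=
  (TensorProduct.comm k B B).trans ((Z.S.lTensor B).trans
    (Z.Teq.symm.trans (Z.S.symm.lTensor B)))

/-- The product (c ⊗ 1)Δ(a) is not among the data. `Peq` is defined so as to satisfy S(a₍₁₎c)a₍₂₎ ⊗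
a₍₃₎ = S(c) ⊗ a, as (c ⊗ 1)Δ(a) does in a multiplier Hopf algebra; `mulR2_Peq` confirms that it is
the right map. -/
lemma Peq_U (t : B ⊗[k] B) : Z.Peq (Z.S.toLinearMap.rTensor B (Z.U t)) =
    Z.S.toLinearMap.rTensor B (TensorProduct.comm k B B t) := by
  have h : Z.S.symm.rTensor B (Z.S.rTensor B (Z.U t)) = Z.U t :=
    (Z.S.rTensor B).symm_apply_apply _
  change Z.S.rTensor B (TensorProduct.comm k B B (Z.Ueq.symm
    (Z.S.symm.rTensor B (Z.S.rTensor B (Z.U t))))) = _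
  rw [h, ← Ueq_apply, LinearEquiv.symm_apply_apply]
  rfl

lemma exists_eq_U (s : B ⊗[k] B) : ∃ t, s = Z.S.toLinearMap.rTensor B (Z.U t) := by
  obtain ⟨t, ht⟩ := Z.U_surjective ((Z.S.rTensor B).symm s)
  exact ⟨t, by rw [ht]; exact ((Z.S.rTensor B).apply_symm_apply s).symm⟩

lemma mulR2_Peq (c a d : B) : mulR2 d (Z.Peq (c ⊗ₜ a)) = mulL1 c (Z.T (a ⊗ₜ d)) := by
  have key : ∀ s : B ⊗[k] B, Z.invU d s = mulR2 d (Z.Peq (Z.S.toLinearMap.rTensor B s)) := by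
    intro s
    obtain ⟨t, rfl⟩ := Z.U_surjective s
    rw [Z.invU_U_apply, Z.Peq_U]
  have h := key (Z.S.symm c ⊗ₜ a)
  rw [Z.invU_tmul] at h
  simpa using h.symm

/-- Likewise `Qeq` is defined by T((ι ⊗ S)Q(c ⊗ a)) = a ⊗ S(c), and `invT` computes T⁻¹ after a
factor d has been multiplied in. -/
lemma mulR1_Qeq (c a d : B) : mulR1 d (Z.Qeq (c ⊗ₜ a)) = mulL2 c (Z.U (a ⊗ₜ d)) := by
  have h1 : Z.Qeq (c ⊗ₜ a) = Z.S.symm.toLinearMap.lTensor B (Z.Teq.symm (a ⊗ₜ Z.S c)) := by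
    simp [Qeq]
    rfl
  have h2 : mulR1 d (Z.Teq.symm (a ⊗ₜ Z.S c)) = Z.invT d (a ⊗ₜ Z.S c) := by
    rw [← Z.invT_T, ← Teq_apply, LinearEquiv.apply_symm_apply]
  rw [h1, mulR1_lTensor, h2]
  simp only [invT, LinearMap.comp_apply, LinearMap.rTensor_tmul, LinearMap.flip_apply,
    TensorProduct.mk_apply, LinearEquiv.coe_coe]
  generalize Z.U (a ⊗ₜ d) = t
  induction t with
  | zero => simp
  | add s t hs ht => simp only [TensorProduct.add_tmul, map_add, hs, ht]
  | tmul p q => simp [← Z.S_mul]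

/-- `s ↦ s Δ(a)`. -/
def R (a : B) : Module.End k (B ⊗[k] B) :=
  TensorProduct.lift ((LinearMap.lTensorHom B ∘ₗ LinearMap.mul k B).flip ∘ₗ
    (Z.Peq.toLinearMap ∘ₗ (TensorProduct.mk k B B).flip a))

lemma R_tmul (a c d : B) : Z.R a (c ⊗ₜ d) = mulL2 d (Z.Peq (c ⊗ₜ a)) := rfl

/-- The comultiplication. -/
def comul : B →ₙₐ[k] Mult k (B ⊗[k] B) where
  toFun a := ⟨(Z.L a, MulOpposite.op (Z.R a)), by
    intro s t
    rw [MulOpposite.unop_op]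
    induction s with
    | zero => simp
    | add s s' hs hs' => rw [add_mul, map_add, add_mul, hs, hs']
    | tmul c d =>
      induction t with
      | zero => simp
      | add t t' ht ht' => simp only [map_add, mul_add, ht, ht']
      | tmul e f =>
        rw [R_tmul, mul_tmul_eq, tmul_mul_eq, ← Z.mulR1_T, mulL1_mulR1, ← Z.mulR2_Peq, mulR1_mulR2,
          mulL2_mulR2, ← mulR1_mulL2]⟩
  map_smul' c a := by
    apply Mult.ext_lmul (Z.nondegenerate.tensor Z.nondegenerate)
    intro t
    change Z.L (c • a) t = c • Z.L a t
    simp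
  map_zero' := by
    apply Mult.ext_lmul (Z.nondegenerate.tensor Z.nondegenerate)
    intro t
    change Z.L 0 t = 0
    simp
  map_add' a b := by
    apply Mult.ext_lmul (Z.nondegenerate.tensor Z.nondegenerate)
    intro t
    change Z.L (a + b) t = Z.L a t + Z.L b t
    simp
  map_mul' a b := by
    apply Mult.ext_lmul (Z.nondegenerate.tensor Z.nondegenerate)
    intro t
    exact Z.L_mul a b t

lemma comul_lmul (a : B) (t : B ⊗[k] B) : (Z.comul a).lmul t = Z.L a t := rfl

lemma exists_eps_eq_one : ∃ a, Z.ε a = 1 := by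
  by_contra! h
  have h0 : ∀ a, Z.ε a = 0 := by
    intro a
    by_contra ha
    exact h ((Z.ε a)⁻¹ • a) (by simp [ha])
  obtain ⟨b, hb⟩ := @exists_ne B Z.nontrivial 0
  apply hb
  apply Z.nondegenerate.left
  intro c
  rw [← Z.counit_T]
  generalize Z.T (b ⊗ₜ c) = t
  induction t with
  | zero => simp
  | add s t hs ht => rw [map_add, hs, ht, add_zero]
  | tmul p q => simp [h0]

lemma mul_surjective (Z : LeftHopfData k B) (b : B) : ∃ t : B ⊗[k] B, LinearMap.mul' k B t = b := by
  obtain ⟨a, ha⟩ := Z.exists_eps_eq_one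
  obtain ⟨t, ht⟩ := Z.T_surjective (a ⊗ₜ b)
  refine ⟨t, ?_⟩
  have h := tensor_ext (f := sliceL (Z.ε : B →ₗ[k] k) ∘ₗ Z.T) (g := LinearMap.mul' k B)
    (fun a b => by simpa using Z.counit_T a b) t
  rw [← h, LinearMap.comp_apply, ht]
  simp [ha]

/-- The regular multiplier Hopf algebra determined by the data. -/
def toRegular : RegularMultiplierHopfAlgebra k B where
  nontrivial := Z.nontrivial
  nondegenerate := Z.nondegenerate
  comul := Z.comul
  comul_left := by
    rw [eq_top_iff]
    intro t _
    have h1 : ∀ (c : B) (s : B ⊗[k] B), mulR1 c (Z.T s) ∈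
        Submodule.span k {t | ∃ a s, t = (Z.comul a).lmul s} := by
      intro c s
      induction s with
      | zero => simp
      | add s t hs ht => simp only [map_add]; exact add_mem hs ht
      | tmul a b =>
        rw [Z.mulR1_T]
        exact Submodule.subset_span ⟨a, _, rfl⟩
    induction t with
    | zero => simp
    | add s t hs ht => exact add_mem (hs trivial) (ht trivial)
    | tmul x y =>
      obtain ⟨t, rfl⟩ := Z.mul_surjective x
      induction t with
      | zero => simp
      | add s t hs ht => simp only [map_add, TensorProduct.add_tmul]; exact add_mem (hs trivial) (ht trivial)
      | tmul p q =>
        obtain ⟨s, hs⟩ := Z.T_surjective (p ⊗ₜ y)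
        have := h1 q s
        rw [hs] at this
        simpa using this
  comul_right := by
    rw [eq_top_iff]
    intro t _
    have h1 : ∀ (c : B) (s : B ⊗[k] B), mulL2 c (Z.Peq s) ∈
        Submodule.span k {t | ∃ a s, t = (Z.comul a).rmul s} := by
      intro c s
      induction s with
      | zero => simp
      | add s t hs ht => simp only [map_add]; exact add_mem hs ht
      | tmul a b => exact Submodule.subset_span ⟨b, a ⊗ₜ c, rfl⟩
    induction t with
    | zero => simp
    | add s t hs ht => exact add_mem (hs trivial) (ht trivial)
    | tmul x y =>
      obtain ⟨t, rfl⟩ := Z.mul_surjective y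
      induction t with
      | zero => simp
      | add s t hs ht => simp only [map_add, TensorProduct.tmul_add]; exact add_mem (hs trivial) (ht trivial)
      | tmul p q =>
        have := h1 p (Z.Peq.symm (x ⊗ₜ q))
        simpa using this
  TΔ2 := Z.Teq
  TΔ2_spec a b := by
    apply Mult.ext_lmul (Z.nondegenerate.tensor Z.nondegenerate)
    intro t
    induction t with
    | zero => simp
    | add s t hs ht => rw [map_add, map_add, hs, ht]
    | tmul c d =>
      simp only [Mult.lmul_of, Mult.lmul_mul_apply, Mult.lmul_tmul, TensorProduct.map_tmul,
        Mult.lmul_one, comul_lmul, Teq_apply]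
      rw [mul_tmul_eq, ← Z.mulR1_T, Z.T_mul, mulR1_mulR2]
  T1Δ := Z.Peq
  T1Δ_spec a b := by
    apply Mult.ext_lmul (Z.nondegenerate.tensor Z.nondegenerate)
    intro t
    induction t with
    | zero => simp
    | add s t hs ht => rw [map_add, map_add, hs, ht]
    | tmul c d =>
      simp only [Mult.lmul_of, Mult.lmul_mul_apply, comul_lmul]
      rw [mul_tmul_eq, ← mulR1_mulR2, Z.mulR2_Peq, ← Z.mulR1_T, ← mulL1_mulR1]
      rfl
  TΔ1 := Z.Ueq
  TΔ1_spec a b := by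
    apply Mult.ext_lmul (Z.nondegenerate.tensor Z.nondegenerate)
    intro t
    induction t with
    | zero => simp
    | add s t hs ht => rw [map_add, map_add, hs, ht]
    | tmul c d =>
      simp only [Mult.lmul_of, Mult.lmul_mul_apply, Mult.lmul_tmul, TensorProduct.map_tmul,
        Mult.lmul_one, comul_lmul, Ueq_apply]
      rw [mul_tmul_eq, ← Z.mulR2_U, Z.U_mul]
  T2Δ := Z.Qeq
  T2Δ_spec a b := by
    apply Mult.ext_lmul (Z.nondegenerate.tensor Z.nondegenerate)
    intro t
    induction t with
    | zero => simp
    | add s t hs ht => rw [map_add, map_add, hs, ht]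
    | tmul c d =>
      simp only [Mult.lmul_of, Mult.lmul_mul_apply, comul_lmul]
      rw [mul_tmul_eq, Z.mulR1_Qeq, ← Z.mulR2_U, ← mulL2_mulR2]
      rfl
  coassoc a b c := by
    apply (TensorProduct.assoc k B B B).injective
    rw [LinearEquiv.apply_symm_apply]
    -- A factor d on the right of the first leg turns (a ⊗ 1)Δ into products with Δ(·)(d ⊗ 1), for
    -- which coassociativity is part of the data.
    apply eq_of_mulR1 Z.nondegenerate
    intro d
    have h1 : ∀ t : B ⊗[k] B, mulR1 d (TensorProduct.assoc k B B B
        (Z.Peq.toLinearMap.rTensor B ((TensorProduct.assoc k B B B).symm (a ⊗ₜ t)))) =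
        mulL1 a (TensorProduct.assoc k B B B
          ((Z.U ∘ₗ (TensorProduct.mk k B B).flip d).rTensor B t)) := by
      intro t
      induction t with
      | zero => simp
      | add s t hs ht => simp only [TensorProduct.tmul_add, map_add, hs, ht]
      | tmul p q =>
        simp only [TensorProduct.assoc_symm_tmul, LinearMap.rTensor_tmul, mulR1_assoc, mulL1_assoc,
          LinearEquiv.coe_coe, LinearMap.comp_apply, LinearMap.flip_apply, TensorProduct.mk_apply]
        congr 2
        apply eq_of_mulR2 Z.nondegenerate
        intro e
        rw [← mulR1_mulR2, Z.mulR2_Peq, ← mulL1_mulR1, Z.mulR1_T, ← Z.mulR2_U, mulL1_mulR2]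
    have h2 : ∀ t : B ⊗[k] B, Z.Teq.toLinearMap.lTensor B (TensorProduct.assoc k B B B (t ⊗ₜ c)) =
        (Z.T ∘ₗ (TensorProduct.mk k B B).flip c).lTensor B t := by
      intro t
      induction t with
      | zero => simp
      | add s t hs ht => simp only [TensorProduct.add_tmul, map_add, hs, ht]
      | tmul p q => simp
    rw [h1, h2, Teq_apply, Z.coassoc, mulR1_lTensor, mulL1_lTensor]
    congr 1
    apply eq_of_mulR2 Z.nondegenerate
    intro e
    rw [← mulR1_mulR2, Z.mulR2_Peq, ← mulL1_mulR1, Z.mulR1_T, ← Z.mulR2_U, mulL1_mulR2]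

lemma isCounit : Z.toRegular.IsCounit Z.ε where
  left := Z.counit_T
  right a b := by
    have key : ∀ s : B ⊗[k] B, sliceR (Z.ε : B →ₗ[k] k) (Z.Peq s) = LinearMap.mul' k B s := by
      intro s
      obtain ⟨t, rfl⟩ := Z.exists_eq_U s
      rw [Z.Peq_U]
      induction t with
      | zero => simp
      | add s t hs ht => simp only [map_add, hs, ht]
      | tmul p q => rw [Z.antipode_U]; simp
    exact key (a ⊗ₜ b)

lemma isAntipode : Z.toRegular.IsAntipode Z.ε Z.S where
  map_mul := Z.S_mul
  left := Z.antipode_T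
  right a b := by
    have key : ∀ s : B ⊗[k] B, LinearMap.mul' k B (Z.S.toLinearMap.lTensor B (Z.Peq s)) =
        sliceR (Z.ε : B →ₗ[k] k) s := by
      intro s
      obtain ⟨t, rfl⟩ := Z.exists_eq_U s
      rw [Z.Peq_U]
      induction t with
      | zero => simp
      | add s t hs ht => simp only [map_add, hs, ht]
      | tmul p q => rw [sliceR_rTensor, Z.counit_U]; simp [Z.S_mul]
    exact (key (a ⊗ₜ b)).trans (sliceR_tmul _ _ _)

end LeftHopfData

end

end GaloisReflection

open scoped TensorProduct

namespace GaloisReflection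

noncomputable section

set_option linter.unusedSectionVars false

/-! ### Pentagon relations -/

variable {k : Type*} [Field k] {A : Type*} [NonUnitalRing A] [Module k A]
  [IsScalarTower k A A] [SMulCommClass k A A] {X : Type*} [NonUnitalRing X] [Module k X]
  [IsScalarTower k X X] [SMulCommClass k X X] {H : RegularMultiplierHopfAlgebra k A}

open RegularMultiplierHopfAlgebra

namespace PreFrame

variable (F : PreFrame H X)

/-- `z x₍₀₎ y₍₀₎ ⊗ x₍₁₎ y₍₁₎ ⊗ y₍₂₎`, as a function of `(z ⊗ 1)α(x)`. -/
def pentV (y : X) : X ⊗[k] A →ₗ[k] X ⊗[k] (A ⊗[k] A) :=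
  TensorProduct.lift ((LinearMap.lTensorHom X ∘ₗ
    (TensorProduct.curry H.T1Δ.toLinearMap)).flip ∘ₗ
      (TensorProduct.curry F.V.toLinearMap).flip y)

lemma pentV_tmul (y z : X) (a : A) : F.pentV y (z ⊗ₜ a) =
    (H.T1Δ.toLinearMap ∘ₗ TensorProduct.mk k A A a).lTensor X (F.V (z ⊗ₜ y)) := rfl

lemma gV_V (z x y : X) : F.gV z (F.V (x ⊗ₜ y)) = F.pentV y (F.V (z ⊗ₜ x)) := by
  apply eq_of_lTensor (fun e : A => mulR2 (k := k) (M := A) e)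
    (fun n n' h => eq_of_mulR2 H.nondegenerate h)
  intro d
  rw [F.gV_mulR2, ← F.mulL1_T1]
  have h1 : ∀ t : X ⊗[k] A, F.gV z (mulL1 x t) =
      TensorProduct.assoc k X A A ((F.rα (F.V (z ⊗ₜ x))).rTensor A t) := by
    intro t
    induction t with
    | zero => simp
    | add a b ha hb => simp only [map_add, ha, hb]
    | tmul a b =>
      rw [mulL1_tmul, F.gV_tmul, ← F.rmul_V]
      rfl
  have h2 : ∀ s : X ⊗[k] A, TensorProduct.assoc k X A A ((F.rα s).rTensor A (F.T1 (y ⊗ₜ d))) =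
      (mulR2 (k := k) (M := A) d).lTensor X (F.pentV y s) := by
    intro s
    induction s with
    | zero => simp
    | add a b ha hb => simp only [map_add, LinearMap.rTensor_add, LinearMap.add_apply, ha, hb]
    | tmul a c =>
      have h3 : F.rα (a ⊗ₜ c) = mulL2 c ∘ₗ F.V.toLinearMap ∘ₗ TensorProduct.mk k X X a := by
        ext w
        exact (F.mulL2_V w a c).symm
      have h4 : ∀ t : (X ⊗[k] A) ⊗[k] A, TensorProduct.assoc k X A A ((mulL2 c).rTensor A t) =
          (mulL1 c).lTensor X (TensorProduct.assoc k X A A t) := by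
        intro t
        induction t with
        | zero => simp
        | add a b ha hb => simp only [map_add, ha, hb]
        | tmul t e =>
          induction t with
          | zero => simp
          | add a b ha hb => simp only [map_add, TensorProduct.add_tmul, ha, hb]
          | tmul a b => simp
      rw [h3, LinearMap.rTensor_comp, LinearMap.comp_apply, h4, F.coassoc, pentV_tmul,
        ← LinearMap.comp_apply, ← LinearMap.comp_apply, ← LinearMap.lTensor_comp,
        ← LinearMap.lTensor_comp]
      congr 2
      ext e
      exact H.mulL1_T e d c
  rw [h1, h2]

end PreFrame

namespace Frame

variable (F : Frame H X)

/-- `x₍₀₎ y ⊗ x₍₁₎ b₍₁₎ ⊗ b₍₂₎`, as a function of `y ⊗ b`. -/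
def pentW (x : X) : X ⊗[k] A →ₗ[k] X ⊗[k] (A ⊗[k] A) :=
  TensorProduct.lift ((LinearMap.lTensorHom X ∘ₗ
    (TensorProduct.curry H.T1Δ.toLinearMap).flip).flip ∘ₗ
      (TensorProduct.curry F.W.toLinearMap x))

lemma pentW_tmul (x y : X) (b : A) : F.pentW x (y ⊗ₜ b) =
    (H.T1Δ.toLinearMap ∘ₗ (TensorProduct.mk k A A).flip b).lTensor X (F.W (x ⊗ₜ y)) := rfl

/-- Exchange of the two ways of multiplying `z ⊗ c` and `y ⊗ b`. -/
lemma exchange (f : A ⊗[k] A →ₗ[k] A ⊗[k] A) (s t : X ⊗[k] A) :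
    TensorProduct.lift ((LinearMap.lTensorHom X ∘ₗ TensorProduct.curry f).flip ∘ₗ
        (LinearMap.rTensorHom A ∘ₗ LinearMap.mul k X).flip t) s =
      TensorProduct.lift ((LinearMap.lTensorHom X ∘ₗ (TensorProduct.curry f).flip).flip ∘ₗ
        (LinearMap.rTensorHom A ∘ₗ (LinearMap.mul k X).flip).flip s) t := by
  have hadd : ∀ (g h : X →ₗ[k] A →ₗ[k] X ⊗[k] (A ⊗[k] A)) (t : X ⊗[k] A),
      TensorProduct.lift (g + h) t = TensorProduct.lift g t + TensorProduct.lift h t := by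
    intro g h t
    exact tensor_ext (f := TensorProduct.lift (g + h))
      (g := TensorProduct.lift g + TensorProduct.lift h) (fun a b => by simp) t
  have hzero : ∀ t : X ⊗[k] A,
      TensorProduct.lift (0 : X →ₗ[k] A →ₗ[k] X ⊗[k] (A ⊗[k] A)) t = 0 := fun t =>
    tensor_ext (f := TensorProduct.lift 0) (g := 0) (fun a b => by simp) t
  induction s with
  | zero => simp [hzero]
  | add a b ha hb => simp only [map_add, LinearMap.comp_add, hadd, ha, hb]
  | tmul z c =>
    induction t with
    | zero => simp
    | add a b ha hb => simp only [map_add, LinearMap.comp_add, hadd, ha, hb]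
    | tmul y b => simp

/-- In Sweedler notation both sides are x₍₀₎y₍₀₎p ⊗ x₍₁₎y₍₁₎ ⊗ y₍₂₎. It is deduced from `gV_V` by
multiplying the first leg by z. -/
lemma gW_V (p x y : X) : F.gW p (F.V (x ⊗ₜ y)) = F.pentW x (F.W (y ⊗ₜ p)) := by
  apply eq_of_mulL1 F.nondegenerate
  intro z
  rw [F.mulL1_gW, F.gV_V]
  have h1 : ∀ s : X ⊗[k] A, mulR1 p (F.pentV y s) =
      TensorProduct.lift ((LinearMap.lTensorHom X ∘ₗ
        TensorProduct.curry H.T1Δ.toLinearMap).flip ∘ₗ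
        (LinearMap.rTensorHom A ∘ₗ LinearMap.mul k X).flip (F.W (y ⊗ₜ p))) s := by
    intro s
    induction s with
    | zero => simp
    | add a b ha hb => simp only [map_add, ha, hb]
    | tmul a c =>
      rw [F.pentV_tmul, mulR1_lTensor, ← F.mulL1_W]
      rfl
  have h2 : ∀ t : X ⊗[k] A, mulL1 z (F.pentW x t) =
      TensorProduct.lift ((LinearMap.lTensorHom X ∘ₗ
        (TensorProduct.curry H.T1Δ.toLinearMap).flip).flip ∘ₗ
        (LinearMap.rTensorHom A ∘ₗ (LinearMap.mul k X).flip).flip (F.V (z ⊗ₜ x))) t := by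
    intro t
    induction t with
    | zero => simp
    | add a b ha hb => simp only [map_add, ha, hb]
    | tmul a c =>
      rw [F.pentW_tmul, mulL1_lTensor, F.mulL1_W]
      rfl
  rw [h1, h2, exchange]

/-- The pentagon relation for G(u ⊗ v) = α(v)(u ⊗ 1): both sides are w₍₀₎v₍₀₎u ⊗ w₍₁₎v₍₁₎ ⊗ w₍₂₎.
Coassociativity of Δ_B rests on it. -/
lemma gW_W (u w v : X) : F.gW u (F.W (w ⊗ₜ v)) = F.mix w (F.W (v ⊗ₜ u)) := by
  apply eq_of_mulL1 F.nondegenerate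
  intro z
  rw [F.mulL1_gW, F.gV_W]
  have h1 : ∀ s : X ⊗[k] A, mulR1 u (F.mixV v s) =
      TensorProduct.lift ((LinearMap.lTensorHom X ∘ₗ
        TensorProduct.curry H.TΔ1.toLinearMap).flip ∘ₗ
        (LinearMap.rTensorHom A ∘ₗ LinearMap.mul k X).flip (F.W (v ⊗ₜ u))) s := by
    intro s
    induction s with
    | zero => simp
    | add a b ha hb => simp only [map_add, ha, hb]
    | tmul a c =>
      rw [F.mixV_tmul, mulR1_lTensor, ← F.mulL1_W]
      rfl
  have h2 : ∀ t : X ⊗[k] A, mulL1 z (F.mix w t) =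
      TensorProduct.lift ((LinearMap.lTensorHom X ∘ₗ
        (TensorProduct.curry H.TΔ1.toLinearMap).flip).flip ∘ₗ
        (LinearMap.rTensorHom A ∘ₗ (LinearMap.mul k X).flip).flip (F.V (z ⊗ₜ w))) t := by
    intro t
    induction t with
    | zero => simp
    | add a b ha hb => simp only [map_add, ha, hb]
    | tmul a c =>
      rw [F.mix_tmul, mulL1_lTensor, F.mulL1_W]
      rfl
  rw [h1, h2, exchange]

end Frame

/-! ### Galois objects with their invariant functional -/

/-- A Galois object with its invariant functional and the modular automorphism. -/
structure GaloisIntegral (H : RegularMultiplierHopfAlgebra k A) (X : Type*) [NonUnitalRing X]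
    [Module k X] [IsScalarTower k X X] [SMulCommClass k X X] (φ : Module.Dual k A)
    extends Integral H φ where
  F : Frame H X
  φX : Module.Dual k X
  φX_left : ∀ x z, sliceR φ (F.W (x ⊗ₜ z)) = φX x • z
  φX_right : ∀ x z, sliceR φ (F.V (z ⊗ₜ x)) = φX x • z
  σX : X ≃ₗ[k] X
  σX_mul : ∀ x y, σX (x * y) = σX x * σX y
  σX_spec : ∀ x y, φX (y * σX x) = φX (x * y)

namespace GaloisIntegral

variable {φ : Module.Dual k A} (Y : GaloisIntegral H X φ)

lemma eq_of_phiX_right (Y : GaloisIntegral H X φ) {u u' : X}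
    (h : ∀ x, Y.φX (x * u) = Y.φX (x * u')) : u = u' := by
  rw [← sub_eq_zero]
  apply Frame.phiX_faithful_right Y.toIntegral Y.φX_right
  intro x
  rw [mul_sub, map_sub, h, sub_self]

lemma eq_of_phiX_left (Y : GaloisIntegral H X φ) {u u' : X}
    (h : ∀ x, Y.φX (u * x) = Y.φX (u' * x)) : u = u' := by
  rw [← sub_eq_zero]
  apply Frame.phiX_faithful_left Y.toIntegral Y.φX_left
  intro x
  rw [sub_mul, map_sub, h, sub_self]

lemma φX_σX (x : X) : Y.φX (Y.σX x) = Y.φX x := by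
  obtain ⟨t, rfl⟩ := Y.toHopfMaps.exists_mul' Y.F.toPreFrame x
  induction t with
  | zero => simp
  | add a b ha hb => simp only [map_add, ha, hb]
  | tmul a b => rw [LinearMap.mul'_apply, Y.σX_mul, Y.σX_spec, Y.σX_spec]

/-- `φ_X(· p)` acted upon by `φ(· a)`, in coordinates. -/
def K : X ⊗[k] A →ₗ[k] X := sliceR Y.φX ∘ₗ Y.F.W.symm.toLinearMap

/-- The adjoint counterpart of `K`. -/
def K' : X ⊗[k] A →ₗ[k] X := sliceL Y.φX ∘ₗ Y.F.V.symm.toLinearMap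

/-- The product of the dual of `A`, in coordinates. -/
def KA : A ⊗[k] A →ₗ[k] A := sliceR φ ∘ₗ H.TΔ1.symm.toLinearMap

/-- `φ_X(q u₍₀₎) u₍₁₎`. -/
def μ : X →ₗ[k] X →ₗ[k] A :=
  (TensorProduct.mk k X X).compr₂ (sliceL Y.φX ∘ₗ Y.F.V.toLinearMap)

/-- `φ_X(x₍₀₎ p) x₍₁₎`. -/
def leg : X →ₗ[k] X →ₗ[k] A :=
  (TensorProduct.mk k X X).compr₂ (sliceL Y.φX ∘ₗ Y.F.W.toLinearMap)

lemma K_W (s : X ⊗[k] X) : Y.K (Y.F.W s) = sliceR Y.φX s := by simp [K]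

lemma K'_V (s : X ⊗[k] X) : Y.K' (Y.F.V s) = sliceL Y.φX s := by simp [K']

lemma μ_apply (q u : X) : Y.μ q u = sliceL Y.φX (Y.F.V (q ⊗ₜ u)) := rfl

lemma leg_apply (x p : X) : Y.leg x p = sliceL Y.φX (Y.F.W (x ⊗ₜ p)) := rfl

/-- This adjunction and its variants turn pairings with φ_X into pairings with φ in A. As φ_X is
faithful, K(p ⊗ a) is determined by them. -/
lemma φX_mul_K (x p : X) (a : A) : Y.φX (x * Y.K (p ⊗ₜ a)) = φ (Y.leg x p * a) := by
  have h := Frame.phiX_mul_slice Y.φX_left x (p ⊗ₜ a)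
  rw [← Y.F.mulR2_W, apply_sliceR, sliceL_mulR2] at h
  exact h

lemma φX_mul_K' (x p : X) (a : A) :
    Y.φX (x * Y.K (p ⊗ₜ a)) = Y.φX (sliceR φ (Y.F.T1 (x ⊗ₜ a)) * p) := by
  have h := Frame.phiX_mul_slice Y.φX_left x (p ⊗ₜ a)
  rw [← Y.F.mulR1_T1, sliceR_mulR1] at h
  exact h

lemma φX_slice_T1_mul (x p : X) (a : A) :
    Y.φX (sliceR φ (Y.F.T1 (x ⊗ₜ a)) * p) = φ (Y.leg x p * a) := by
  rw [← φX_mul_K', φX_mul_K]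

lemma φX_mul_slice_T1 (q x : X) (a : A) :
    Y.φX (q * sliceR φ (Y.F.T1 (x ⊗ₜ a))) = φ (Y.μ q x * a) := by
  rw [← sliceR_mulL1, Y.F.mulL1_T1, apply_sliceR, sliceL_mulR2]
  rfl

lemma φX_mul_slice_T2 (q x : X) (a : A) :
    Y.φX (q * sliceR φ (Y.F.T2 (x ⊗ₜ a))) = φ (a * Y.μ q x) := by
  rw [← sliceR_mulL1, Y.F.mulL1_T2, ← Y.F.mulL2_V, apply_sliceR, sliceL_mulL2]
  rfl

lemma φX_K'_mul (q u : X) (a : A) : Y.φX (Y.K' (q ⊗ₜ a) * u) = φ (a * Y.μ q u) := by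
  rw [μ_apply, ← sliceL_mulL2, Y.F.mulL2_V, ← apply_sliceR]
  obtain ⟨s, hs⟩ := Y.F.V.surjective (q ⊗ₜ a)
  rw [← hs, K'_V]
  clear hs
  induction s with
  | zero => simp
  | add a b ha hb => simp only [map_add, add_mul, ha, hb]
  | tmul a b =>
    rw [Frame.phi_rmul_V Y.φX_right]
    simp [smul_mul_assoc, mul_comm]

lemma φ_mul_KA (Y : GaloisIntegral H X φ) (b c a : A) :
    φ (b * KA (φ := φ) (H := H) (c ⊗ₜ a)) = φ (sliceR φ (H.TΔ2 (b ⊗ₜ a)) * c) := by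
  have h := Frame.phiX_mul_slice (F := H.frame) (φ := φ) (φX := φ) Y.inv b (c ⊗ₜ a)
  rw [← H.frame.mulR1_T1, sliceR_mulR1] at h
  exact h

/-- The pairing of `X ⊗ A` with itself is faithful. -/
lemma eq_of_pairing (Y : GaloisIntegral H X φ) {s t : X ⊗[k] A}
    (h : ∀ x y, Y.φX (sliceR φ (Y.F.V (x ⊗ₜ y) * s)) = Y.φX (sliceR φ (Y.F.V (x ⊗ₜ y) * t))) :
    s = t := by
  have h1 : ∀ r : X ⊗[k] A, Y.φX (sliceR φ (r * s)) = Y.φX (sliceR φ (r * t)) := by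
    intro r
    obtain ⟨r, rfl⟩ := Y.F.V.surjective r
    induction r with
    | zero => simp
    | add a b ha hb => simp only [map_add, add_mul, ha, hb]
    | tmul x y => exact h x y
  apply eq_of_sliceR_family (fun a : A => φ ∘ₗ LinearMap.mulLeft k a)
    (fun n hn => Y.toIntegral.faithful_right (fun b => by simpa using hn b))
  intro a
  apply Y.eq_of_phiX_right
  intro x
  have h2 := h1 (x ⊗ₜ a)
  simp only [tmul_mul_eq] at h2
  unfold mulL2 at h2
  rw [sliceR_lTensor, sliceR_lTensor, sliceR_mulL1, sliceR_mulL1] at h2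
  exact h2

lemma sliceR_V_slice_T1_mul (x y : X) (a : A) (s : X ⊗[k] A) :
    sliceR φ (Y.F.V (x ⊗ₜ sliceR φ (Y.F.T1 (y ⊗ₜ a))) * s) =
      sliceR φ (Y.F.V (x ⊗ₜ y) *
        (KA (φ := φ) (H := H) ∘ₗ (TensorProduct.mk k A A).flip a).lTensor X s) := by
  rw [Y.F.V_slice_T1]
  generalize Y.F.V (x ⊗ₜ y) = r
  induction r with
  | zero => simp
  | add a b ha hb => simp only [map_add, add_mul, ha, hb]
  | tmul x' b =>
    induction s with
    | zero => simp
    | add a b ha hb => simp only [map_add, mul_add, ha, hb]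
    | tmul z c => simp [Y.φ_mul_KA]

/-- It is enough to test against (x ⊗ 1)α(y), by `eq_of_pairing`. Translation by φ(· a) then moves
over to y, where coassociativity lets it pass through the coaction. -/
lemma W_K (r u : X) (a : A) : Y.F.W (Y.K (r ⊗ₜ a) ⊗ₜ u) =
    (KA (φ := φ) (H := H) ∘ₗ (TensorProduct.mk k A A).flip a).lTensor X (Y.F.W (r ⊗ₜ u)) := by
  apply Y.eq_of_pairing
  intro x y
  rw [← Y.sliceR_V_slice_T1_mul, Frame.slice_V_mul_W Y.φX_left, Frame.slice_V_mul_W Y.φX_left,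
    φX_mul_K']

lemma V_K (r q : X) (a : A) : Y.F.V (q ⊗ₜ Y.K (r ⊗ₜ a)) =
    (KA (φ := φ) (H := H) ∘ₗ (TensorProduct.mk k A A).flip a).lTensor X (Y.F.V (q ⊗ₜ r)) := by
  apply eq_of_mulR1 Y.F.nondegenerate
  intro u
  rw [← Y.F.mulL1_W, Y.W_K, mulL1_lTensor, Y.F.mulL1_W, mulR1_lTensor]

lemma μ_K (q r : X) (a : A) : Y.μ q (Y.K (r ⊗ₜ a)) = KA (φ := φ) (H := H) (Y.μ q r ⊗ₜ a) := by
  rw [μ_apply, V_K, sliceL_lTensor]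
  rfl

lemma leg_slice_T1 (x p : X) (d : A) : Y.leg (sliceR φ (Y.F.T1 (x ⊗ₜ d))) p =
    sliceR φ (H.TΔ2 (Y.leg x p ⊗ₜ d)) := by
  rw [leg_apply, Y.F.W_slice_T1, sliceL_lTensor]
  rfl

lemma K_KA (p : X) (a d : A) :
    Y.K (p ⊗ₜ KA (φ := φ) (H := H) (a ⊗ₜ d)) = Y.K (Y.K (p ⊗ₜ a) ⊗ₜ d) := by
  apply Y.eq_of_phiX_right
  intro x
  rw [φX_mul_K, Y.φ_mul_KA, φX_mul_K', φX_mul_K, leg_slice_T1]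

lemma φX_K (p : X) (a : A) : Y.φX (Y.K (p ⊗ₜ a)) = Y.φX p * φ a := by
  have key : ∀ t : X ⊗[k] A, Y.φX (Y.K t) = Y.φX (sliceR φ t) := by
    intro t
    obtain ⟨s, rfl⟩ := Y.F.W.surjective t
    rw [K_W]
    induction s with
    | zero => simp
    | add a b ha hb => simp only [map_add, ha, hb]
    | tmul a b => rw [Y.φX_left]; simp [mul_comm]
  rw [key]
  simp [mul_comm]

lemma φ_μ (q r : X) : φ (Y.μ q r) = Y.φX q * Y.φX r := by
  rw [μ_apply, ← apply_sliceR, Y.φX_right]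
  simp [mul_comm]

lemma leg_σX (x q : X) : Y.leg x (Y.σX q) = Y.μ q x := by
  apply H.nondegenerate.eq_of_mul_right
  intro a
  rw [leg_apply, μ_apply, ← sliceL_mulR2, ← sliceL_mulR2, ← Y.F.mulR1_T1_eq, ← Y.F.mulL1_T1]
  generalize Y.F.T1 (x ⊗ₜ a) = t
  induction t with
  | zero => simp
  | add a b ha hb => simp only [map_add, ha, hb]
  | tmul y b => simp [Y.σX_spec]

lemma μ_σX_symm (x q : X) : Y.μ (Y.σX.symm q) x = Y.leg x q := by
  rw [← leg_σX, LinearEquiv.apply_symm_apply]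

lemma σX_K' (p : X) (c : A) : Y.σX (Y.K' (p ⊗ₜ Y.σ.symm c)) = Y.K (Y.σX p ⊗ₜ c) := by
  apply Y.eq_of_phiX_right
  intro x
  rw [Y.σX_spec, φX_K'_mul, φX_mul_K, leg_σX, ← Y.σ_spec, LinearEquiv.apply_symm_apply]

/-- The operator `[φ_X(· p), φ_X(q ·)]`, in coordinates. -/
def op : X →ₗ[k] X →ₗ[k] Module.End k X :=
  LinearMap.mk₂ k (fun p q => Y.K ∘ₗ TensorProduct.mk k X A p ∘ₗ Y.μ q)
    (fun _ _ _ => by ext; simp)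
    (fun _ _ _ => by ext; simp)
    (fun _ _ _ => by ext; simp [TensorProduct.tmul_add])
    (fun _ _ _ => by ext; simp)

lemma op_apply (p q u : X) : Y.op p q u = Y.K (p ⊗ₜ Y.μ q u) := rfl

/-- The form is right linear over the dual of A in its second argument (`μ_K`), and the action is
associative (`K_KA`). -/
lemma op_op (p q r s u : X) : Y.op p q (Y.op r s u) = Y.op (Y.op p q r) s u := by
  simp only [op_apply, μ_K, K_KA]

lemma φX_mul_op (x p q u : X) : Y.φX (x * Y.op p q u) = φ (Y.leg x p * Y.μ q u) :=
  Y.φX_mul_K _ _ _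

lemma op_adjoint (x p q u : X) :
    Y.φX (x * Y.op p q u) = Y.φX (Y.K' (q ⊗ₜ Y.leg x p) * u) := by
  rw [φX_mul_op, φX_K'_mul]

lemma φX_op (p q r : X) : Y.φX (Y.op p q r) = Y.φX p * Y.φX q * Y.φX r := by
  rw [op_apply, φX_K, φ_μ, mul_assoc]

/-- `u ⊗ v ↦ α(v)(u ⊗ 1)`. -/
def Geq : X ⊗[k] X ≃ₗ[k] X ⊗[k] A := (TensorProduct.comm k X X).trans Y.F.W

lemma Geq_tmul (u v : X) : Y.Geq (u ⊗ₜ v) = Y.F.W (v ⊗ₜ u) := rfl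

/-- The operator `G⁻¹ (f ⊗ ι) G` on `X ⊗ X`. -/
def amp : Module.End k X →ₗ[k] Module.End k (X ⊗[k] X) :=
  LinearMap.llcomp k _ _ _ Y.Geq.symm.toLinearMap ∘ₗ
    LinearMap.lcomp k _ Y.Geq.toLinearMap ∘ₗ LinearMap.rTensorHom A

lemma amp_apply (f : Module.End k X) (t : X ⊗[k] X) :
    Y.amp f t = Y.Geq.symm (f.rTensor A (Y.Geq t)) := rfl

lemma Geq_amp (f : Module.End k X) (t : X ⊗[k] X) :
    Y.Geq (Y.amp f t) = f.rTensor A (Y.Geq t) := by rw [amp_apply, LinearEquiv.apply_symm_apply]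

lemma amp_mul (f g : Module.End k X) (t : X ⊗[k] X) :
    Y.amp (f * g) t = Y.amp f (Y.amp g t) := by
  apply Y.Geq.injective
  rw [Geq_amp, Geq_amp, Geq_amp, Module.End.mul_eq_comp, LinearMap.rTensor_comp,
    LinearMap.comp_apply]

/-- `u ⊗ v ↦ φ_X(x u) φ_X(y v)`. -/
def pair (x y : X) : Module.Dual k (X ⊗[k] X) :=
  Y.φX ∘ₗ LinearMap.mulLeft k x ∘ₗ sliceR (Y.φX ∘ₗ LinearMap.mulLeft k y)

@[simp] lemma pair_tmul (x y u v : X) : Y.pair x y (u ⊗ₜ v) = Y.φX (x * u) * Y.φX (y * v) := by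
  simp [pair, mul_comm]

lemma eq_of_pair {s t : X ⊗[k] X} (h : ∀ x y, Y.pair x y s = Y.pair x y t) : s = t := by
  apply eq_of_sliceR_family (fun y : X => Y.φX ∘ₗ LinearMap.mulLeft k y)
    (fun n hn => Y.eq_of_phiX_right (fun b => by simpa using hn b))
  intro y
  apply Y.eq_of_phiX_right
  intro x
  exact h x y

/-- The form φ_X ⊗ φ_X on X ⊗ X becomes φ_X ⊗ φ on X ⊗ A. Since `amp f` is f on one leg after G, its
matrix coefficients become accessible. -/
lemma pair_eq (x y : X) (t : X ⊗[k] X) :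
    Y.pair x y t = Y.φX (sliceR φ (Y.F.V (x ⊗ₜ y) * Y.Geq t)) := by
  induction t with
  | zero => simp
  | add a b ha hb => simp only [map_add, mul_add, ha, hb]
  | tmul u v => rw [Geq_tmul, Frame.slice_V_mul_W Y.φX_left]; simp [mul_comm]

/-- The relation `gW_V` sliced by φ_X. With `μ_rTensor_W` and `phi_P_mul_U` it eliminates V(x ⊗ y)
and G(u ⊗ v) from the matrix coefficients of `amp`. -/
lemma leg_rTensor_V (p x y : X) : (Y.leg.flip p).rTensor A (Y.F.V (x ⊗ₜ y)) =
    H.T1Δ ((Y.leg x).rTensor A (Y.F.W (y ⊗ₜ p))) := by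
  have h := congrArg (sliceL Y.φX) (Y.F.gW_V p x y)
  have h1 : ∀ t : X ⊗[k] A, sliceL Y.φX (Y.F.gW p t) = (Y.leg.flip p).rTensor A t := by
    intro t
    induction t with
    | zero => simp
    | add a b ha hb => simp only [map_add, ha, hb]
    | tmul a b => rw [Y.F.gW_tmul, sliceL_assoc]; rfl
  have h2 : ∀ t : X ⊗[k] A, sliceL Y.φX (Y.F.pentW x t) = H.T1Δ ((Y.leg x).rTensor A t) := by
    intro t
    induction t with
    | zero => simp
    | add a b ha hb => simp only [map_add, ha, hb]
    | tmul a b => rw [Y.F.pentW_tmul, sliceL_lTensor]; rfl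
  rw [← h1, h, h2]

lemma μ_rTensor_W (q v u : X) : (Y.μ q).rTensor A (Y.F.W (v ⊗ₜ u)) =
    H.TΔ1 (TensorProduct.comm k A A ((Y.μ.flip u).rTensor A (Y.F.V (q ⊗ₜ v)))) := by
  have h := congrArg (sliceL Y.φX) (Y.F.gV_W q v u)
  have h1 : ∀ t : X ⊗[k] A, sliceL Y.φX (Y.F.gV q t) = (Y.μ q).rTensor A t := by
    intro t
    induction t with
    | zero => simp
    | add a b ha hb => simp only [map_add, ha, hb]
    | tmul a b => rw [Y.F.gV_tmul, sliceL_assoc]; rfl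
  have h2 : ∀ t : X ⊗[k] A, sliceL Y.φX (Y.F.mixV u t) =
      H.TΔ1 (TensorProduct.comm k A A ((Y.μ.flip u).rTensor A t)) := by
    intro t
    induction t with
    | zero => simp
    | add a b ha hb => simp only [map_add, ha, hb]
    | tmul a b => rw [Y.F.mixV_tmul, sliceL_lTensor]; rfl
  rw [← h1, h, h2]

lemma phi_P_mul_U (I : Integral H φ) (s t : A ⊗[k] A) :
    φ (sliceR φ (H.T1Δ s * H.TΔ1 (TensorProduct.comm k A A t))) = φ (sliceR φ (s * t)) := by
  induction s with
  | zero => simp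
  | add a b ha hb => simp only [map_add, add_mul, ha, hb]
  | tmul a b =>
    induction t with
    | zero => simp
    | add a b ha hb => simp only [map_add, mul_add, ha, hb]
    | tmul c d =>
      have h := Frame.slice_V_mul_W (F := H.frame) (φ := φ) (φX := φ) I.inv a b d c
      have h' : sliceR φ (H.T1Δ (a ⊗ₜ b) * H.TΔ1 (d ⊗ₜ c)) = φ (b * d) • (a * c) := h
      simp [h']

/-- The operator of the comultiplication of `[φ_X(· p), φ_X(q ·)]`. -/
theorem pair_amp_op (x y p q u v : X) : Y.pair x y (Y.amp (Y.op p q) (u ⊗ₜ v)) =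
    φ (sliceR φ ((Y.leg x).rTensor A (Y.F.W (y ⊗ₜ p)) *
      (Y.μ.flip u).rTensor A (Y.F.V (q ⊗ₜ v)))) := by
  rw [pair_eq, Geq_amp, Geq_tmul, ← phi_P_mul_U Y.toIntegral, ← leg_rTensor_V, ← μ_rTensor_W]
  generalize Y.F.V (x ⊗ₜ y) = s
  generalize Y.F.W (v ⊗ₜ u) = t
  induction s with
  | zero => simp
  | add a b ha hb => simp only [map_add, add_mul, ha, hb]
  | tmul a b =>
    induction t with
    | zero => simp
    | add a b ha hb => simp only [map_add, mul_add, ha, hb]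
    | tmul c d => simp [φX_mul_op]

end GaloisIntegral

/-! ### Operators on `X ⊗ X` -/

namespace GaloisIntegral

variable {φ : Module.Dual k A} (Y : GaloisIntegral H X φ)

/-- Right translation by `φ(· a)`, in coordinates. -/
def Kr (a : A) : X →ₗ[k] X := Y.K ∘ₗ (TensorProduct.mk k X A).flip a

lemma Kr_apply (a : A) (p : X) : Y.Kr a p = Y.K (p ⊗ₜ a) := rfl

/-- Evaluates the coefficient of `pair_amp_op` when v lies in the image of an operator of B, so that
`KA` appears. The result is a pair of translations on the legs of W⁻¹(p ⊗ c), hence comes from B ⊗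
B. -/
lemma phi_leg_mul_KA (x y p : X) (m c a : A) :
    φ (sliceR φ ((Y.leg x).rTensor A (Y.F.W (y ⊗ₜ p)) * (m ⊗ₜ KA (φ := φ) (H := H) (c ⊗ₜ a)))) =
      Y.pair y x (TensorProduct.map (Y.Kr a) (Y.Kr m) (Y.F.W.symm (p ⊗ₜ c))) := by
  have h1 : sliceR φ ((Y.leg x).rTensor A (Y.F.W (y ⊗ₜ p)) *
        (m ⊗ₜ KA (φ := φ) (H := H) (c ⊗ₜ a))) =
      sliceR φ ((Y.leg x).rTensor A (Y.F.W (sliceR φ (Y.F.T1 (y ⊗ₜ a)) ⊗ₜ p)) * (m ⊗ₜ c)) := by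
    rw [Y.F.W_slice_T1]
    generalize Y.F.W (y ⊗ₜ p) = t
    induction t with
    | zero => simp
    | add a b ha hb => simp only [map_add, add_mul, ha, hb]
    | tmul z b => simp [Y.φ_mul_KA]
  have h2 : ∀ y', φ (sliceR φ ((Y.leg x).rTensor A (Y.F.W (y' ⊗ₜ p)) * (m ⊗ₜ c))) =
      Y.φX (sliceR φ (Y.F.T1 (x ⊗ₜ m)) * sliceR φ ((Y.F.α y').lmul (p ⊗ₜ c))) := by
    intro y'
    rw [← Y.F.mulR2_W]
    generalize Y.F.W (y' ⊗ₜ p) = t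
    induction t with
    | zero => simp
    | add a b ha hb => simp only [map_add, add_mul, mul_add, ha, hb]
    | tmul z b => simp [mul_smul_comm, Y.φX_slice_T1_mul]
  rw [h1, h2]
  obtain ⟨s, hs⟩ := Y.F.W.surjective (p ⊗ₜ c)
  rw [← hs, LinearEquiv.symm_apply_apply]
  clear hs
  induction s with
  | zero => simp
  | add a b ha hb => simp only [map_add, mul_add, ha, hb]
  | tmul q r =>
    rw [Frame.phi_lmul_W Y.φX_left]
    simp [mul_smul_comm, Kr_apply, φX_mul_K']

lemma leg_mul_σX (x z p : X) :
    Y.leg x (z * Y.σX p) = sliceL Y.φX (mulR1 z (Y.F.V (p ⊗ₜ x))) := by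
  rw [leg_apply, Y.F.W_mul, ← Y.F.mulL1_W]
  generalize Y.F.W (x ⊗ₜ z) = t
  induction t with
  | zero => simp
  | add a b ha hb => simp only [map_add, ha, hb]
  | tmul y b => simp [Y.σX_spec]

/-- Both sides are φ_X(p x₍₀₎y₍₀₎) x₍₁₎ ⊗ y₍₁₎. It rewrites the coefficients of `amp` so that an
operator of B applied to u, rather than to v, can be resolved. -/
lemma leg_W_σX (x y p : X) : (Y.leg x).rTensor A (Y.F.W (y ⊗ₜ Y.σX p)) =
    TensorProduct.comm k A A ((Y.μ.flip y).rTensor A (Y.F.V (p ⊗ₜ x))) := by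
  apply eq_of_mulR2 H.nondegenerate
  intro e
  let Φ : (X ⊗[k] A) ⊗[k] (X ⊗[k] A) →ₗ[k] A ⊗[k] A :=
    sliceL (Y.φX ∘ₗ LinearMap.mul' k X) ∘ₗ
      (TensorProduct.tensorTensorTensorComm k X A X A).toLinearMap
  have h1 : ∀ t : X ⊗[k] A, (Y.leg x).rTensor A (mulR1 (Y.σX p) t) =
      Φ (Y.F.V (p ⊗ₜ x) ⊗ₜ t) := by
    intro t
    induction t with
    | zero => simp
    | add a b ha hb => simp only [map_add, TensorProduct.tmul_add, ha, hb]
    | tmul z c =>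
      rw [mulR1_tmul, LinearMap.rTensor_tmul, leg_mul_σX]
      generalize Y.F.V (p ⊗ₜ x) = s
      induction s with
      | zero => simp
      | add a b ha hb => simp only [map_add, TensorProduct.add_tmul, ha, hb]
      | tmul a b => simp [Φ, TensorProduct.smul_tmul']
  have h2 : ∀ s : X ⊗[k] A, mulR2 e (TensorProduct.comm k A A ((Y.μ.flip y).rTensor A s)) =
      Φ (s ⊗ₜ Y.F.T1 (y ⊗ₜ e)) := by
    intro s
    induction s with
    | zero => simp
    | add a b ha hb => simp only [map_add, TensorProduct.add_tmul, ha, hb]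
    | tmul z c =>
      rw [LinearMap.rTensor_tmul, TensorProduct.comm_tmul, mulR2_tmul, LinearMap.flip_apply,
        μ_apply, ← sliceL_mulR2, ← Y.F.mulL1_T1]
      generalize Y.F.T1 (y ⊗ₜ e) = t
      induction t with
      | zero => simp
      | add a b ha hb => simp only [map_add, TensorProduct.tmul_add, ha, hb]
      | tmul a b => simp [Φ]
  rw [mulR2_rTensor, ← Y.F.mulR1_T1_eq, h1, h2]

lemma pair_amp_op_σX (x y p q u v : X) :
    Y.pair x y (Y.amp (Y.op (Y.σX p) (Y.σX.symm q)) (u ⊗ₜ v)) =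
      φ (sliceR φ ((Y.μ.flip y).rTensor A (Y.F.V (p ⊗ₜ x)) *
        (Y.leg v).rTensor A (Y.F.W (u ⊗ₜ q)))) := by
  have h := Y.leg_W_σX v u (Y.σX.symm q)
  rw [LinearEquiv.apply_symm_apply] at h
  rw [pair_amp_op, leg_W_σX, h]
  generalize (Y.μ.flip y).rTensor A (Y.F.V (p ⊗ₜ x)) = s
  generalize (Y.μ.flip u).rTensor A (Y.F.V (Y.σX.symm q ⊗ₜ v)) = t
  induction s with
  | zero => simp
  | add a b ha hb => simp only [map_add, add_mul, ha, hb]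
  | tmul a b =>
    induction t with
    | zero => simp
    | add a b ha hb => simp only [map_add, mul_add, ha, hb]
    | tmul c d => simp [mul_comm]

/-- The counterpart of `phi_leg_mul_KA` for Δ_B(a)(b ⊗ 1); the factor c is carried around φ as
σ⁻¹(c). -/
lemma phi_μ_mul_KA (x y p : X) (l c m : A) :
    φ (sliceR φ ((Y.μ.flip y).rTensor A (Y.F.V (p ⊗ₜ x)) *
        (l ⊗ₜ KA (φ := φ) (H := H) (c ⊗ₜ m)))) =
      Y.pair y x (TensorProduct.map (Y.Kr l ∘ₗ Y.σX.toLinearMap) (Y.Kr m ∘ₗ Y.σX.toLinearMap)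
        (Y.F.V.symm (p ⊗ₜ Y.σ.symm c))) := by
  have h1 : sliceR φ ((Y.μ.flip y).rTensor A (Y.F.V (p ⊗ₜ x)) *
        (l ⊗ₜ KA (φ := φ) (H := H) (c ⊗ₜ m))) =
      sliceR φ ((Y.μ.flip y).rTensor A (Y.F.V (p ⊗ₜ sliceR φ (Y.F.T1 (x ⊗ₜ m)))) * (l ⊗ₜ c)) := by
    rw [Y.F.V_slice_T1]
    generalize Y.F.V (p ⊗ₜ x) = t
    induction t with
    | zero => simp
    | add a b ha hb => simp only [map_add, add_mul, ha, hb]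
    | tmul z b => simp [Y.φ_mul_KA]
  have h2 : ∀ x', φ (sliceR φ ((Y.μ.flip y).rTensor A (Y.F.V (p ⊗ₜ x')) * (l ⊗ₜ c))) =
      φ (Y.μ (sliceR φ ((Y.F.α x').rmul (p ⊗ₜ Y.σ.symm c))) y * l) := by
    intro x'
    rw [← Y.F.mulL2_V]
    generalize Y.F.V (p ⊗ₜ x') = t
    induction t with
    | zero => simp
    | add a b ha hb => simp only [map_add, add_mul, LinearMap.add_apply, ha, hb]
    | tmul z b =>
      have h3 : φ (b * c) = φ (Y.σ.symm c * b) := by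
        rw [← Y.σ_spec (Y.σ.symm c) b, LinearEquiv.apply_symm_apply]
      simp [smul_mul_assoc, h3]
  rw [h1, h2]
  obtain ⟨s, hs⟩ := Y.F.V.surjective (p ⊗ₜ Y.σ.symm c)
  rw [← hs, LinearEquiv.symm_apply_apply]
  clear hs
  induction s with
  | zero => simp
  | add a b ha hb => simp only [map_add, add_mul, LinearMap.add_apply, ha, hb]
  | tmul r q =>
    rw [Frame.phi_rmul_V Y.φX_right]
    simp [smul_mul_assoc, Kr_apply, φX_mul_K, leg_σX, φX_mul_slice_T1, mul_comm]

lemma φX_ne_zero : Y.φX ≠ 0 := by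
  intro h
  obtain ⟨x, hx⟩ := @exists_ne X Y.F.nontrivial 0
  exact hx (Y.eq_of_phiX_right fun y => by simp [h])

lemma K_surjective : Function.Surjective Y.K :=
  (sliceR_surjective Y.φX_ne_zero).comp Y.F.W.symm.surjective

lemma μ_surjective (a : A) : ∃ t : X ⊗[k] X, TensorProduct.lift Y.μ t = a := by
  obtain ⟨s, hs⟩ := sliceL_surjective (N := A) Y.φX_ne_zero a
  refine ⟨Y.F.V.symm s, ?_⟩
  have h := tensor_ext (f := TensorProduct.lift Y.μ) (g := sliceL Y.φX ∘ₗ Y.F.V.toLinearMap)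
    (fun p q => rfl) (Y.F.V.symm s)
  rw [h]
  simpa using hs

/-- The vectors `[φ_X(· p), φ_X(q ·)] u` span `X`. -/
lemma op_span (N : Submodule k X) (h : ∀ p q u, Y.op p q u ∈ N) (x : X) : x ∈ N := by
  obtain ⟨t, rfl⟩ := Y.K_surjective x
  induction t with
  | zero => simp
  | add a b ha hb => rw [map_add]; exact add_mem ha hb
  | tmul p a =>
    obtain ⟨s, rfl⟩ := Y.μ_surjective a
    induction s with
    | zero => simp
    | add a b ha hb => rw [map_add, TensorProduct.tmul_add, map_add]; exact add_mem ha hb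
    | tmul q u => exact h p q u

/-- The bijection `G₁₂ G₂₃` of `X ⊗ X ⊗ X` with `X ⊗ A ⊗ A`. -/
def Geq₃ : X ⊗[k] (X ⊗[k] X) ≃ₗ[k] X ⊗[k] (A ⊗[k] A) :=
  (Y.Geq.lTensor X).trans ((TensorProduct.assoc k X X A).symm.trans
    ((Y.Geq.rTensor A).trans (TensorProduct.assoc k X A A)))

lemma Geq₃_tmul (m : X) (t : X ⊗[k] X) : Y.Geq₃ (m ⊗ₜ t) = Y.F.gW m (Y.Geq t) := by
  change TensorProduct.assoc k X A A (Y.Geq.rTensor A ((TensorProduct.assoc k X X A).symm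
    (Y.Geq.lTensor X (m ⊗ₜ t)))) = _
  rw [LinearEquiv.lTensor_tmul]
  generalize Y.Geq t = s
  induction s with
  | zero => simp
  | add a b ha hb => simp only [TensorProduct.tmul_add, map_add, ha, hb]
  | tmul a b => rfl

lemma Geq₃_assoc (r : X ⊗[k] X) (y : X) :
    Y.Geq₃ (TensorProduct.assoc k X X X (r ⊗ₜ y)) = Y.F.mix y (Y.Geq r) := by
  induction r with
  | zero => simp
  | add a b ha hb => simp only [map_add, TensorProduct.add_tmul, ha, hb]
  | tmul m n =>
    rw [TensorProduct.assoc_tmul, Geq₃_tmul, Geq_tmul, Y.F.gW_W]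
    rfl

end GaloisIntegral

/-! ### The reflected algebra as an algebra of operators on `X` -/

/-- An algebra `B` identified with the algebra spanned by the operators
`[φ_X(· p), φ_X(q ·)]`, and a linear bijection `τ` relating the two actions of the dual. -/
structure Reflection {φ : Module.Dual k A} (Y : GaloisIntegral H X φ) (B : Type*)
    [NonUnitalRing B] [Module k B] [IsScalarTower k B B] [SMulCommClass k B B] where
  coord : B →ₗ[k] Module.End k X
  coord_mul : ∀ a b, coord (a * b) = coord a * coord b
  coord_injective : Function.Injective coord
  bb : X →ₗ[k] X →ₗ[k] B
  coord_bb : ∀ p q, coord (bb p q) = Y.op p q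
  bb_span : ∀ b, ∃ t, TensorProduct.lift bb t = b
  τ : X ≃ₗ[k] X
  K_τ : ∀ q a, Y.K (τ q ⊗ₜ a) = Y.K' (q ⊗ₜ a)

namespace Reflection

variable {φ : Module.Dual k A} {Y : GaloisIntegral H X φ} {B : Type*} [NonUnitalRing B]
  [Module k B] [IsScalarTower k B B] [SMulCommClass k B B] (Z : Reflection Y B)

lemma coord_flip_injective (n n' : B) (h : ∀ u, Z.coord.flip u n = Z.coord.flip u n') : n = n' :=
  Z.coord_injective (LinearMap.ext h)

lemma K'_leg (q x p : X) : Y.K' (q ⊗ₜ Y.leg x p) = Y.op (Z.τ q) (Y.σX.symm p) x := by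
  rw [Y.op_apply, Z.K_τ, Y.μ_σX_symm]

lemma mul_bb (b : B) (r s : X) : b * Z.bb r s = Z.bb (Z.coord b r) s := by
  obtain ⟨t, rfl⟩ := Z.bb_span b
  induction t with
  | zero => simp
  | add a b ha hb => simp only [map_add, add_mul, LinearMap.add_apply, ha, hb]
  | tmul p q =>
    apply Z.coord_injective
    ext u
    rw [TensorProduct.lift.tmul, Z.coord_mul, Module.End.mul_apply, Z.coord_bb, Z.coord_bb,
      Z.coord_bb, Y.op_op]

/-- The action of `B ⊗ B` on `X ⊗ X`. -/
def act : B ⊗[k] B →ₗ[k] Module.End k (X ⊗[k] X) :=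
  TensorProduct.lift ((TensorProduct.mapBilinear (.id k) X X X X).compl₁₂ Z.coord Z.coord)

lemma act_tmul (a b : B) (u v : X) :
    Z.act (a ⊗ₜ b) (u ⊗ₜ v) = Z.coord a u ⊗ₜ Z.coord b v := rfl

lemma act_apply_tmul (t : B ⊗[k] B) (u v : X) : Z.act t (u ⊗ₜ v) =
    TensorProduct.map (Z.coord.flip u) (Z.coord.flip v) t := by
  induction t with
  | zero => simp
  | add a b ha hb => simp only [map_add, LinearMap.add_apply, ha, hb]
  | tmul a b => rfl

lemma act_injective : Function.Injective Z.act := by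
  intro s t h
  apply eq_of_rTensor (fun u => Z.coord.flip u) Z.coord_flip_injective
  intro u
  apply eq_of_lTensor (fun v => Z.coord.flip v) Z.coord_flip_injective
  intro v
  have h1 : ∀ t : B ⊗[k] B, (Z.coord.flip v).lTensor X ((Z.coord.flip u).rTensor B t) =
      Z.act t (u ⊗ₜ v) := by
    intro t
    rw [act_apply_tmul, ← LinearMap.comp_apply, LinearMap.lTensor_comp_rTensor]
  rw [h1, h1, h]

lemma act_mulR1 (b : B) (t : B ⊗[k] B) (s : X ⊗[k] X) :
    Z.act (mulR1 b t) s = Z.act t ((Z.coord b).rTensor X s) := by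
  induction t with
  | zero => simp
  | add a b ha hb => simp only [map_add, LinearMap.add_apply, ha, hb]
  | tmul a c =>
    refine tensor_ext (f := Z.act (mulR1 b (a ⊗ₜ c)))
      (g := Z.act (a ⊗ₜ c) ∘ₗ (Z.coord b).rTensor X) (fun u v => ?_) s
    simp [act_tmul, Z.coord_mul]

lemma act_mulR2 (b : B) (t : B ⊗[k] B) (s : X ⊗[k] X) :
    Z.act (mulR2 b t) s = Z.act t ((Z.coord b).lTensor X s) := by
  induction t with
  | zero => simp
  | add a b ha hb => simp only [map_add, LinearMap.add_apply, ha, hb]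
  | tmul a c =>
    refine tensor_ext (f := Z.act (mulR2 b (a ⊗ₜ c)))
      (g := Z.act (a ⊗ₜ c) ∘ₗ (Z.coord b).lTensor X) (fun u v => ?_) s
    simp [act_tmul, Z.coord_mul]

/-- A left inverse of the action. -/
def actInv : Module.End k (X ⊗[k] X) →ₗ[k] B ⊗[k] B :=
  (Z.act.exists_leftInverse_of_injective (LinearMap.ker_eq_bot.2 Z.act_injective)).choose

lemma actInv_act (t : B ⊗[k] B) : Z.actInv (Z.act t) = t :=
  LinearMap.congr_fun
    (Z.act.exists_leftInverse_of_injective (LinearMap.ker_eq_bot.2 Z.act_injective)).choose_spec t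

lemma tensor_bb_induction {P : B ⊗[k] B → Prop} (hz : P 0) (ha : ∀ s t, P s → P t → P (s + t))
    (h : ∀ p q r s, P (Z.bb p q ⊗ₜ Z.bb r s)) (t : B ⊗[k] B) : P t := by
  induction t with
  | zero => exact hz
  | add s t hs ht => exact ha s t hs ht
  | tmul a b =>
    obtain ⟨s, rfl⟩ := Z.bb_span a
    obtain ⟨t, rfl⟩ := Z.bb_span b
    induction s with
    | zero => simpa using hz
    | add s t hs ht => rw [map_add, TensorProduct.add_tmul]; exact ha _ _ hs ht
    | tmul p q =>
      induction t with
      | zero => simpa using hz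
      | add s t hs ht => rw [map_add, TensorProduct.tmul_add]; exact ha _ _ hs ht
      | tmul r s => exact h p q r s

/-- The operator of `Δ(a)(1 ⊗ b)`. -/
def opT : B ⊗[k] B →ₗ[k] Module.End k (X ⊗[k] X) :=
  TensorProduct.lift ((LinearMap.mul k (Module.End k (X ⊗[k] X))).compl₁₂
    (Y.amp ∘ₗ Z.coord) (LinearMap.lTensorHom X ∘ₗ Z.coord))

lemma opT_tmul (a b : B) (s : X ⊗[k] X) :
    Z.opT (a ⊗ₜ b) s = Y.amp (Z.coord a) ((Z.coord b).lTensor X s) := rfl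

/-- The operator of `Δ(a)(b ⊗ 1)`. -/
def opU : B ⊗[k] B →ₗ[k] Module.End k (X ⊗[k] X) :=
  TensorProduct.lift ((LinearMap.mul k (Module.End k (X ⊗[k] X))).compl₁₂
    (Y.amp ∘ₗ Z.coord) (LinearMap.rTensorHom X ∘ₗ Z.coord))

lemma opU_tmul (a b : B) (s : X ⊗[k] X) :
    Z.opU (a ⊗ₜ b) s = Y.amp (Z.coord a) ((Z.coord b).rTensor X s) := rfl

/-- `Δ([p, q])(1 ⊗ [r, s])` as a function of `(q ⊗ 1)α(r)`. -/
def liftT (p s : X) : X ⊗[k] A →ₗ[k] B ⊗[k] B :=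
  TensorProduct.lift (LinearMap.mk₂ k (fun z c => TensorProduct.comm k B B
    (TensorProduct.map (Z.bb.flip s) (Z.bb.flip z) (Y.F.W.symm (p ⊗ₜ c))))
    (fun z z' c => by simp [TensorProduct.map_add_right])
    (fun r z c => by simp [TensorProduct.map_smul_right])
    (fun z c c' => by simp [TensorProduct.tmul_add])
    (fun r z c => by simp))

lemma liftT_tmul (p s z : X) (c : A) : Z.liftT p s (z ⊗ₜ c) = TensorProduct.comm k B B
    (TensorProduct.map (Z.bb.flip s) (Z.bb.flip z) (Y.F.W.symm (p ⊗ₜ c))) := rfl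

/-- This puts Δ_B([p, q])(1 ⊗ [r, s]) in B ⊗ B. By `V_K` the vector [r, s]v enters through `KA`
only, and `phi_leg_mul_KA` distributes the coefficient over two legs. -/
lemma act_liftT (p q r s : X) :
    Z.act (Z.liftT p s (Y.F.V (q ⊗ₜ r))) = Z.opT (Z.bb p q ⊗ₜ Z.bb r s) := by
  refine LinearMap.ext fun w => tensor_ext (fun u v => ?_) w
  apply Y.eq_of_pair
  intro x y
  rw [opT_tmul, LinearMap.lTensor_tmul, Z.coord_bb, Z.coord_bb, Y.pair_amp_op, Y.op_apply, Y.V_K]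
  generalize Y.F.V (q ⊗ₜ r) = t
  induction t with
  | zero => simp
  | add a b ha hb => simp only [map_add, LinearMap.add_apply, mul_add, ha, hb]
  | tmul z c =>
    rw [liftT_tmul]
    simp only [LinearMap.lTensor_tmul, LinearMap.rTensor_tmul, LinearMap.comp_apply,
      LinearMap.flip_apply, TensorProduct.mk_apply]
    rw [Y.phi_leg_mul_KA]
    generalize Y.F.W.symm (p ⊗ₜ c) = t
    induction t with
    | zero => simp
    | add a b ha hb => simp only [map_add, LinearMap.add_apply, ha, hb]
    | tmul a b =>
      simp [act_tmul, Z.coord_bb, Y.op_apply, Y.Kr_apply, mul_comm]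

/-- `Δ([σ p, σ⁻¹ q])([r, s] ⊗ 1)` as a function of `α(r)(q ⊗ 1)`. -/
def liftU (p s : X) : X ⊗[k] A →ₗ[k] B ⊗[k] B :=
  TensorProduct.lift (LinearMap.mk₂ k (fun z c => TensorProduct.comm k B B
    (TensorProduct.map (Z.bb.flip (Y.σX.symm z) ∘ₗ Y.σX.toLinearMap)
      (Z.bb.flip s ∘ₗ Y.σX.toLinearMap) (Y.F.V.symm (p ⊗ₜ Y.σ.symm c))))
    (fun z z' c => by simp [TensorProduct.map_add_left, LinearMap.add_comp])
    (fun r z c => by simp [TensorProduct.map_smul_left, LinearMap.smul_comp])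
    (fun z c c' => by simp [TensorProduct.tmul_add])
    (fun r z c => by simp))

lemma liftU_tmul (p s z : X) (c : A) : Z.liftU p s (z ⊗ₜ c) = TensorProduct.comm k B B
    (TensorProduct.map (Z.bb.flip (Y.σX.symm z) ∘ₗ Y.σX.toLinearMap)
      (Z.bb.flip s ∘ₗ Y.σX.toLinearMap) (Y.F.V.symm (p ⊗ₜ Y.σ.symm c))) := rfl

lemma act_liftU (p q r s : X) : Z.act (Z.liftU p s (Y.F.W (r ⊗ₜ q))) =
    Z.opU (Z.bb (Y.σX p) (Y.σX.symm q) ⊗ₜ Z.bb r s) := by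
  refine LinearMap.ext fun w => tensor_ext (fun u v => ?_) w
  apply Y.eq_of_pair
  intro x y
  rw [opU_tmul, LinearMap.rTensor_tmul, Z.coord_bb, Z.coord_bb, Y.pair_amp_op_σX, Y.op_apply, Y.W_K]
  generalize Y.F.W (r ⊗ₜ q) = t
  induction t with
  | zero => simp
  | add a b ha hb => simp only [map_add, LinearMap.add_apply, mul_add, ha, hb]
  | tmul z c =>
    rw [liftU_tmul]
    simp only [LinearMap.lTensor_tmul, LinearMap.rTensor_tmul, LinearMap.comp_apply,
      LinearMap.flip_apply, TensorProduct.mk_apply]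
    rw [Y.phi_μ_mul_KA]
    generalize Y.F.V.symm (p ⊗ₜ Y.σ.symm c) = t
    induction t with
    | zero => simp
    | add a b ha hb => simp only [map_add, LinearMap.add_apply, ha, hb]
    | tmul a b =>
      simp [act_tmul, Z.coord_bb, Y.op_apply, Y.Kr_apply, mul_comm, Y.μ_σX_symm]

/-- `a ⊗ b ↦ Δ(a)(1 ⊗ b)`. -/
def T : B ⊗[k] B →ₗ[k] B ⊗[k] B := Z.actInv ∘ₗ Z.opT

/-- `a ⊗ b ↦ Δ(a)(b ⊗ 1)`. -/
def U : B ⊗[k] B →ₗ[k] B ⊗[k] B := Z.actInv ∘ₗ Z.opU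

lemma T_bb (p q r s : X) : Z.T (Z.bb p q ⊗ₜ Z.bb r s) = Z.liftT p s (Y.F.V (q ⊗ₜ r)) := by
  rw [T, LinearMap.comp_apply, ← act_liftT, actInv_act]

lemma U_bb (p q r s : X) : Z.U (Z.bb (Y.σX p) (Y.σX.symm q) ⊗ₜ Z.bb r s) =
    Z.liftU p s (Y.F.W (r ⊗ₜ q)) := by
  rw [U, LinearMap.comp_apply, ← act_liftU, actInv_act]

lemma U_bb' (p q r s : X) : Z.U (Z.bb p q ⊗ₜ Z.bb r s) =
    Z.liftU (Y.σX.symm p) s (Y.F.W (r ⊗ₜ Y.σX q)) := by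
  simpa using Z.U_bb (Y.σX.symm p) (Y.σX q) r s

/-- `T` is defined with an arbitrary linear left inverse of `act`. Since the operator lies in the
range of `act`, the choice does not matter. -/
lemma act_T (t : B ⊗[k] B) : Z.act (Z.T t) = Z.opT t := by
  refine Z.tensor_bb_induction (P := fun t => Z.act (Z.T t) = Z.opT t) (by simp) (fun s t hs ht => by simp only [map_add, hs, ht])
    (fun p q r s => ?_) t
  rw [T_bb, act_liftT]

lemma act_U (t : B ⊗[k] B) : Z.act (Z.U t) = Z.opU t := by
  refine Z.tensor_bb_induction (P := fun t => Z.act (Z.U t) = Z.opU t) (by simp) (fun s t hs ht => by simp only [map_add, hs, ht])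
    (fun p q r s => ?_) t
  rw [U_bb', act_liftU]
  simp

/-- Since V is onto, every value of `liftT` is reached. Combining the values for p ⊗ c into w = W(q
⊗ r) cancels W⁻¹ and leaves [r, z] ⊗ [q, s]. -/
lemma T_surjective : Function.Surjective Z.T := by
  intro t
  rw [← LinearMap.mem_range]
  have h1 : ∀ (p s : X) (w : X ⊗[k] A), Z.liftT p s w ∈ LinearMap.range Z.T := by
    intro p s w
    obtain ⟨w, rfl⟩ := Y.F.V.surjective w
    induction w with
    | zero => simp
    | add a b ha hb => simp only [map_add]; exact add_mem ha hb
    | tmul q r => exact ⟨_, Z.T_bb p q r s⟩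
  refine Z.tensor_bb_induction (P := fun t => t ∈ LinearMap.range Z.T) (zero_mem _)
    (fun s t => add_mem) (fun r z q s => ?_) t
  have h2 : ∀ w : X ⊗[k] A, TensorProduct.comm k B B
      (TensorProduct.map (Z.bb.flip s) (Z.bb.flip z) (Y.F.W.symm w)) ∈ LinearMap.range Z.T := by
    intro w
    induction w with
    | zero => simp
    | add a b ha hb => simp only [map_add]; exact add_mem ha hb
    | tmul p c => exact h1 p s (z ⊗ₜ c)
  simpa using h2 (Y.F.W (q ⊗ₜ r))

lemma U_surjective : Function.Surjective Z.U := by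
  intro t
  rw [← LinearMap.mem_range]
  have h1 : ∀ (p s : X) (w : X ⊗[k] A), Z.liftU p s w ∈ LinearMap.range Z.U := by
    intro p s w
    obtain ⟨w, rfl⟩ := Y.F.W.surjective w
    induction w with
    | zero => simp
    | add a b ha hb => simp only [map_add]; exact add_mem ha hb
    | tmul r q => exact ⟨_, Z.U_bb p q r s⟩
  refine Z.tensor_bb_induction (P := fun t => t ∈ LinearMap.range Z.U) (zero_mem _)
    (fun s t => add_mem) (fun a s b d => ?_) t
  have h2 : ∀ w : X ⊗[k] A, TensorProduct.comm k B B
      (TensorProduct.map (Z.bb.flip d ∘ₗ Y.σX.toLinearMap) (Z.bb.flip s ∘ₗ Y.σX.toLinearMap)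
        (Y.F.V.symm w)) ∈ LinearMap.range Z.U := by
    intro w
    induction w with
    | zero => simp
    | add a b ha hb => simp only [map_add]; exact add_mem ha hb
    | tmul p c =>
      have := h1 p s (Y.σX d ⊗ₜ Y.σ c)
      rw [liftU_tmul] at this
      simpa using this
  simpa using h2 (Y.F.V (Y.σX.symm b ⊗ₜ Y.σX.symm a))

/-- `t ↦ Δ(a) t`. -/
def L : B →ₗ[k] Module.End k (B ⊗[k] B) :=
  LinearMap.mk₂ k (fun a t => Z.actInv (Y.amp (Z.coord a) * Z.act t))
    (fun _ _ _ => by simp [add_mul]) (fun _ _ _ => by simp)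
    (fun _ _ _ => by simp [mul_add]) (fun _ _ _ => by simp)

lemma act_mulR1_T (a b c : B) :
    Z.act (mulR1 c (Z.T (a ⊗ₜ b))) = Y.amp (Z.coord a) * Z.act (c ⊗ₜ b) := by
  refine LinearMap.ext fun w => tensor_ext (fun u v => ?_) w
  rw [act_mulR1, act_T, opT_tmul]
  rfl

lemma act_mulR2_U (a b c : B) :
    Z.act (mulR2 b (Z.U (a ⊗ₜ c))) = Y.amp (Z.coord a) * Z.act (c ⊗ₜ b) := by
  refine LinearMap.ext fun w => tensor_ext (fun u v => ?_) w
  rw [act_mulR2, act_U, opU_tmul]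
  rfl

lemma mulR1_T (a b c : B) : mulR1 c (Z.T (a ⊗ₜ b)) = Z.L a (c ⊗ₜ b) := by
  rw [L, LinearMap.mk₂_apply, ← act_mulR1_T, actInv_act]

lemma mulR2_U (a b c : B) : mulR2 b (Z.U (a ⊗ₜ c)) = Z.L a (c ⊗ₜ b) := by
  rw [L, LinearMap.mk₂_apply, ← act_mulR2_U, actInv_act]

lemma act_L (a : B) (t : B ⊗[k] B) : Z.act (Z.L a t) = Y.amp (Z.coord a) * Z.act t := by
  induction t with
  | zero => simp
  | add s t hs ht => simp only [map_add, mul_add, hs, ht]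
  | tmul b c => rw [← mulR1_T, act_mulR1_T]

lemma L_mul (a b : B) (t : B ⊗[k] B) : Z.L (a * b) t = Z.L a (Z.L b t) := by
  apply Z.act_injective
  rw [act_L, act_L, act_L, ← mul_assoc]
  congr 1
  ext s
  rw [Z.coord_mul]
  exact Y.amp_mul _ _ _

/-- The action of `B ⊗ B ⊗ B` on a vector. -/
def act₃ (u v w : X) : B ⊗[k] (B ⊗[k] B) →ₗ[k] X ⊗[k] (X ⊗[k] X) :=
  TensorProduct.map (Z.coord.flip u) (TensorProduct.map (Z.coord.flip v) (Z.coord.flip w))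

lemma eq_of_act₃ {s t : B ⊗[k] (B ⊗[k] B)} (h : ∀ u v w, Z.act₃ u v w s = Z.act₃ u v w t) :
    s = t := by
  apply eq_of_rTensor (fun u => Z.coord.flip u) Z.coord_flip_injective
  intro u
  apply eq_of_lTensor (fun p : X × X => TensorProduct.map (Z.coord.flip p.1) (Z.coord.flip p.2))
  · intro n n' h
    apply Z.act_injective
    refine LinearMap.ext fun w => tensor_ext (fun u v => ?_) w
    rw [act_apply_tmul, act_apply_tmul]
    exact h (u, v)
  · intro p
    rw [← LinearMap.comp_apply, ← LinearMap.comp_apply, LinearMap.lTensor_comp_rTensor]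
    exact h u p.1 p.2

lemma Geq₃_act₃_U (c : B) (u v w : X) (t : B ⊗[k] B) :
    Y.Geq₃ (Z.act₃ u v w (TensorProduct.assoc k B B B
      ((Z.U ∘ₗ (TensorProduct.mk k B B).flip c).rTensor B t))) =
    H.TΔ1.toLinearMap.lTensor X (TensorProduct.assoc k X A A
      ((Y.Geq.toLinearMap ∘ₗ Z.act t ∘ₗ (TensorProduct.mk k X X).flip w).rTensor A
        (Y.F.W (v ⊗ₜ Z.coord c u)))) := by
  induction t with
  | zero => simp
  | add s t hs ht =>
    simp only [map_add, LinearMap.add_comp, LinearMap.comp_add, LinearMap.rTensor_add,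
      LinearMap.add_apply, hs, ht]
  | tmul a b =>
    have h1 : ∀ s : B ⊗[k] B, Z.act₃ u v w (TensorProduct.assoc k B B B (s ⊗ₜ b)) =
        TensorProduct.assoc k X X X (Z.act s (u ⊗ₜ v) ⊗ₜ Z.coord b w) := by
      intro s
      induction s with
      | zero => simp
      | add s t hs ht => simp only [map_add, TensorProduct.add_tmul, LinearMap.add_apply, hs, ht]
      | tmul p q => rfl
    rw [LinearMap.rTensor_tmul, h1, Y.Geq₃_assoc, LinearMap.comp_apply, LinearMap.flip_apply,
      TensorProduct.mk_apply, act_U, opU_tmul, Y.Geq_amp, LinearMap.rTensor_tmul, Y.Geq_tmul]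
    generalize Y.F.W (v ⊗ₜ Z.coord c u) = g
    induction g with
    | zero => simp
    | add s t hs ht => simp only [map_add, hs, ht]
    | tmul p d =>
      simp only [LinearMap.rTensor_tmul, LinearMap.comp_apply, LinearMap.flip_apply,
        TensorProduct.mk_apply, act_tmul, LinearEquiv.coe_coe, Y.Geq_tmul, Y.F.mix_tmul]
      generalize Y.F.W (Z.coord b w ⊗ₜ Z.coord a p) = g
      induction g with
      | zero => simp
      | add s t hs ht => simp only [map_add, TensorProduct.add_tmul, hs, ht]
      | tmul p d => rfl

lemma Geq₃_act₃_T (b : B) (u v w : X) (t : B ⊗[k] B) :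
    Y.Geq₃ (Z.act₃ u v w ((Z.T ∘ₗ (TensorProduct.mk k B B).flip b).lTensor B t)) =
      TensorProduct.assoc k X A A
        ((Y.Geq.toLinearMap ∘ₗ Z.act t ∘ₗ TensorProduct.mk k X X u).rTensor A
          (Y.F.W (Z.coord b w ⊗ₜ v))) := by
  induction t with
  | zero => simp
  | add s t hs ht =>
    simp only [map_add, LinearMap.add_comp, LinearMap.comp_add, LinearMap.rTensor_add,
      LinearMap.add_apply, hs, ht]
  | tmul a c =>
    rw [LinearMap.lTensor_tmul, act₃, TensorProduct.map_tmul, ← act_apply_tmul, Y.Geq₃_tmul,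
      LinearMap.comp_apply, act_T]
    simp only [LinearMap.flip_apply, TensorProduct.mk_apply]
    rw [opT_tmul, Y.Geq_amp, LinearMap.lTensor_tmul, Y.Geq_tmul]
    generalize Y.F.W (Z.coord b w ⊗ₜ v) = g
    induction g with
    | zero => simp
    | add s t hs ht => simp only [map_add, hs, ht]
    | tmul p d => rfl

/-- After applying G₁₂G₂₃ each side is a ⊗ ι ⊗ ι applied to a vector of X ⊗ A ⊗ A, and the two
vectors agree by `gW_W`. -/
lemma coassoc (a b c : B) : TensorProduct.assoc k B B B
      ((Z.U ∘ₗ (TensorProduct.mk k B B).flip c).rTensor B (Z.T (a ⊗ₜ b))) =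
    (Z.T ∘ₗ (TensorProduct.mk k B B).flip b).lTensor B (Z.U (a ⊗ₜ c)) := by
  apply Z.eq_of_act₃
  intro u v w
  apply Y.Geq₃.injective
  rw [Z.Geq₃_act₃_U, Z.Geq₃_act₃_T, act_T, act_U]
  have h1 : ∀ g : X ⊗[k] A, H.TΔ1.toLinearMap.lTensor X (TensorProduct.assoc k X A A
      ((Y.Geq.toLinearMap ∘ₗ Z.opT (a ⊗ₜ b) ∘ₗ (TensorProduct.mk k X X).flip w).rTensor A g)) =
      (Z.coord a).rTensor (A ⊗[k] A) (Y.F.mix (Z.coord b w) g) := by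
    intro g
    induction g with
    | zero => simp
    | add s t hs ht => simp only [map_add, hs, ht]
    | tmul p d =>
      simp only [LinearMap.rTensor_tmul, LinearMap.comp_apply, LinearMap.flip_apply,
        TensorProduct.mk_apply, opT_tmul, LinearEquiv.coe_coe, Y.Geq_amp, Y.Geq_tmul,
        LinearMap.lTensor_tmul, Y.F.mix_tmul]
      generalize Y.F.W (Z.coord b w ⊗ₜ p) = g
      induction g with
      | zero => simp
      | add s t hs ht => simp only [map_add, TensorProduct.add_tmul, hs, ht]
      | tmul p d => rfl
  have h2 : ∀ g : X ⊗[k] A, TensorProduct.assoc k X A A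
      ((Y.Geq.toLinearMap ∘ₗ Z.opU (a ⊗ₜ c) ∘ₗ TensorProduct.mk k X X u).rTensor A g) =
      (Z.coord a).rTensor (A ⊗[k] A) (Y.F.gW (Z.coord c u) g) := by
    intro g
    induction g with
    | zero => simp
    | add s t hs ht => simp only [map_add, hs, ht]
    | tmul p d =>
      simp only [LinearMap.rTensor_tmul, LinearMap.comp_apply,
        TensorProduct.mk_apply, opU_tmul, LinearEquiv.coe_coe, Y.Geq_amp, Y.Geq_tmul,
        Y.F.gW_tmul]
      generalize Y.F.W (p ⊗ₜ Z.coord c u) = g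
      induction g with
      | zero => simp
      | add s t hs ht => simp only [map_add, TensorProduct.add_tmul, hs, ht]
      | tmul p d => rfl
  rw [h1, h2, Y.F.gW_W]

lemma exists_bb_ne_zero : ∃ p q, Z.bb p q ≠ 0 := by
  by_contra! h
  obtain ⟨x, hx⟩ := @exists_ne X Y.F.nontrivial 0
  refine hx (Y.op_span ⊥ (fun p q u => ?_) x)
  rw [← Z.coord_bb, h]
  simp

/-- The antipode is the adjoint with respect to the invariant functional. -/
lemma exists_antipode : ∃ S : B ≃ₗ[k] B,
    (∀ p q, S (Z.bb p q) = Z.bb (Z.τ q) (Y.σX.symm p)) ∧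
    ∀ b x u, Y.φX (x * Z.coord b u) = Y.φX (Z.coord (S b) x * u) := by
  let g : X ⊗[k] X →ₗ[k] B := TensorProduct.lift Z.bb ∘ₗ
    (TensorProduct.comm k X X).toLinearMap ∘ₗ
      TensorProduct.map Y.σX.symm.toLinearMap Z.τ.toLinearMap
  have hadj : ∀ t x u, Y.φX (x * Z.coord (TensorProduct.lift Z.bb t) u) =
      Y.φX (Z.coord (g t) x * u) := by
    intro t x u
    induction t with
    | zero => simp
    | add s t hs ht => simp only [map_add, LinearMap.add_apply, mul_add, add_mul, hs, ht]
    | tmul p q =>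
      simp only [g, LinearMap.comp_apply, TensorProduct.map_tmul, LinearEquiv.coe_coe,
        TensorProduct.comm_tmul, TensorProduct.lift.tmul, Z.coord_bb]
      rw [Y.op_adjoint, Z.K'_leg]
  -- Adjoints are unique because φ_X is faithful, so a combination of brackets that vanishes in B
  -- has vanishing image under g.
  obtain ⟨S, hS⟩ := exists_factor_of_ker_le (TensorProduct.lift Z.bb) Z.bb_span g (by
    intro t ht
    apply Z.coord_injective
    ext x
    apply Y.eq_of_phiX_left
    intro u
    rw [← hadj, ht]
    simp)
  have hadj' : ∀ b x u, Y.φX (x * Z.coord b u) = Y.φX (Z.coord (S b) x * u) := by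
    intro b x u
    obtain ⟨t, rfl⟩ := Z.bb_span b
    rw [hadj, hS]
  have hbb : ∀ p q, S (Z.bb p q) = Z.bb (Z.τ q) (Y.σX.symm p) := fun p q => hS (p ⊗ₜ q)
  refine ⟨LinearEquiv.ofBijective S ⟨?_, ?_⟩, hbb, hadj'⟩
  · intro b b' h
    apply Z.coord_injective
    ext u
    apply Y.eq_of_phiX_right
    intro x
    rw [hadj', h, hadj']
  · intro b
    obtain ⟨t, rfl⟩ := Z.bb_span b
    induction t with
    | zero => exact ⟨0, by simp⟩
    | add s t hs ht =>
      obtain ⟨b, hb⟩ := hs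
      obtain ⟨c, hc⟩ := ht
      exact ⟨b + c, by simp only [map_add, hb, hc]⟩
    | tmul p q => exact ⟨Z.bb (Y.σX q) (Z.τ.symm p), by simp [hbb]⟩

/-- The antipode. -/
def S : B ≃ₗ[k] B := Z.exists_antipode.choose

lemma S_bb (p q : X) : Z.S (Z.bb p q) = Z.bb (Z.τ q) (Y.σX.symm p) :=
  Z.exists_antipode.choose_spec.1 p q

lemma S_adjoint (b : B) (x u : X) : Y.φX (x * Z.coord b u) = Y.φX (Z.coord (Z.S b) x * u) :=
  Z.exists_antipode.choose_spec.2 b x u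

lemma S_mul (a b : B) : Z.S (a * b) = Z.S b * Z.S a := by
  apply Z.coord_injective
  ext x
  apply Y.eq_of_phiX_left
  intro u
  rw [← S_adjoint, Z.coord_mul, Z.coord_mul, Module.End.mul_apply, Module.End.mul_apply,
    S_adjoint, S_adjoint]

lemma mem_of_coord (N : Submodule k X) (h : ∀ b u, Z.coord b u ∈ N) (x : X) : x ∈ N :=
  Y.op_span N (fun p q u => by rw [← Z.coord_bb]; exact h _ _) x

/-- The vectors bu span X and B acts faithfully, which settles left multiplication. For right
multiplication the adjoint moves the other factor to the left argument of φ_X. -/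
lemma nondegenerate (Z : Reflection Y B) : IsNondegenerate B where
  left a h := by
    apply Z.coord_injective
    ext x
    rw [map_zero, LinearMap.zero_apply]
    refine Z.mem_of_coord (LinearMap.ker (Z.coord a)) (fun b u => ?_) x
    rw [LinearMap.mem_ker, ← Module.End.mul_apply, ← Z.coord_mul, h, map_zero, LinearMap.zero_apply]
  right b h := by
    apply Z.coord_injective
    ext u
    rw [map_zero, LinearMap.zero_apply]
    apply Y.eq_of_phiX_right
    intro x
    rw [mul_zero, map_zero]
    refine Z.mem_of_coord (LinearMap.ker (Y.φX ∘ₗ LinearMap.mulRight k (Z.coord b u)))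
      (fun c w => ?_) x
    obtain ⟨c, rfl⟩ := Z.S.surjective c
    rw [LinearMap.mem_ker, LinearMap.comp_apply, LinearMap.mulRight_apply, ← S_adjoint,
      ← Module.End.mul_apply, ← Z.coord_mul, h]
    simp

/-- This precedes the counit: the left side depends only on the element [p, q] of B, so the scalar
φ_X(p)φ_X(q) does as well, and ε_B is well defined. -/
lemma antipode_T_bb (p q r s : X) :
    LinearMap.mul' k B (Z.S.toLinearMap.rTensor B (Z.T (Z.bb p q ⊗ₜ Z.bb r s))) =
      (Y.φX p * Y.φX q) • Z.bb r s := by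
  have h1 : ∀ w : X ⊗[k] A, LinearMap.mul' k B (Z.S.toLinearMap.rTensor B (Z.liftT p s w)) =
      Y.φX p • Z.bb (Y.K' w) s := by
    intro w
    induction w with
    | zero => simp
    | add a b ha hb => simp only [map_add, LinearMap.add_apply, smul_add, ha, hb]
    | tmul z c =>
      rw [liftT_tmul]
      have h2 : ∀ t : X ⊗[k] X, LinearMap.mul' k B (Z.S.toLinearMap.rTensor B
          (TensorProduct.comm k B B (TensorProduct.map (Z.bb.flip s) (Z.bb.flip z) t))) =
          Z.bb (Y.K' (z ⊗ₜ sliceL Y.φX (Y.F.W t))) s := by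
        intro t
        induction t with
        | zero => simp
        | add a b ha hb => simp only [map_add, TensorProduct.tmul_add, LinearMap.add_apply, ha, hb]
        | tmul a b =>
          simp only [TensorProduct.map_tmul, LinearMap.flip_apply, TensorProduct.comm_tmul,
            LinearMap.rTensor_tmul, LinearEquiv.coe_coe, LinearMap.mul'_apply]
          rw [S_bb, mul_bb, Z.coord_bb, ← Z.K'_leg]
          rfl
      rw [h2, LinearEquiv.apply_symm_apply]
      simp
  rw [T_bb, h1, Y.K'_V]
  simp [smul_smul]

lemma exists_eps : ∃ ε : B →ₗ[k] k, ∀ p q, ε (Z.bb p q) = Y.φX p * Y.φX q := by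
  let g : X ⊗[k] X →ₗ[k] k := LinearMap.mul' k k ∘ₗ TensorProduct.map Y.φX Y.φX
  obtain ⟨r, s, hrs⟩ := Z.exists_bb_ne_zero
  have h1 : ∀ t : X ⊗[k] X, LinearMap.mul' k B (Z.S.toLinearMap.rTensor B
      (Z.T (TensorProduct.lift Z.bb t ⊗ₜ Z.bb r s))) = g t • Z.bb r s := by
    intro t
    induction t with
    | zero => simp
    | add a b ha hb => simp only [map_add, TensorProduct.add_tmul, add_smul, ha, hb]
    | tmul p q => exact Z.antipode_T_bb p q r s
  obtain ⟨ε, hε⟩ := exists_factor_of_ker_le (TensorProduct.lift Z.bb) Z.bb_span g (by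
    intro t ht
    have h := h1 t
    rw [ht] at h
    simpa [hrs] using h.symm)
  exact ⟨ε, fun p q => hε (p ⊗ₜ q)⟩

/-- The counit. -/
def ε : B →ₙₐ[k] k where
  toFun := Z.exists_eps.choose
  map_smul' c a := by simp
  map_zero' := by simp
  map_add' a b := by simp
  map_mul' a b := by
    obtain ⟨t, rfl⟩ := Z.bb_span b
    induction t with
    | zero => simp
    | add s t hs ht => simp only [map_add, mul_add, hs, ht]
    | tmul r s =>
      obtain ⟨t, rfl⟩ := Z.bb_span a
      induction t with
      | zero => simp
      | add s t hs ht => simp only [map_add, add_mul, hs, ht]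
      | tmul p q =>
        have h := Z.exists_eps.choose_spec
        simp only [TensorProduct.lift.tmul]
        rw [mul_bb, Z.coord_bb, h, h, h, Y.φX_op]
        ring

lemma ε_bb (p q : X) : Z.ε (Z.bb p q) = Y.φX p * Y.φX q := Z.exists_eps.choose_spec p q

lemma bb_mul_induction {P : B → B → Prop} (hz : ∀ b, P b 0) (hz' : ∀ b, P 0 b)
    (h : ∀ p q r s, P (Z.bb p q) (Z.bb r s)) (ha : ∀ a b c, P a b → P a c → P a (b + c))
    (ha' : ∀ a b c, P a c → P b c → P (a + b) c) (a b : B) : P a b := by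
  obtain ⟨s, rfl⟩ := Z.bb_span a
  obtain ⟨t, rfl⟩ := Z.bb_span b
  induction s with
  | zero => simpa using hz' _
  | add s t hs ht => rw [map_add]; exact ha' _ _ _ hs ht
  | tmul p q =>
    induction t with
    | zero => simpa using hz _
    | add s t hs ht => rw [map_add]; exact ha _ _ _ hs ht
    | tmul r s => exact h p q r s

lemma antipode_T (a b : B) :
    LinearMap.mul' k B (Z.S.toLinearMap.rTensor B (Z.T (a ⊗ₜ b))) = Z.ε a • b := by
  refine Z.bb_mul_induction (P := fun a b => LinearMap.mul' k B (Z.S.toLinearMap.rTensor B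
    (Z.T (a ⊗ₜ b))) = Z.ε a • b) (by simp) (by simp) (fun p q r s => ?_) ?_ ?_ a b
  · rw [antipode_T_bb, ε_bb]
  · intro a b c h h'
    simp only [TensorProduct.tmul_add, map_add, smul_add, h, h']
  · intro a b c h h'
    simp only [TensorProduct.add_tmul, map_add, add_smul, h, h']

lemma counit_T (a b : B) : sliceL (Z.ε : B →ₗ[k] k) (Z.T (a ⊗ₜ b)) = a * b := by
  refine Z.bb_mul_induction (P := fun a b => sliceL (Z.ε : B →ₗ[k] k) (Z.T (a ⊗ₜ b)) = a * b)
    (by simp) (by simp) (fun p q r s => ?_) ?_ ?_ a b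
  · rw [T_bb, mul_bb, Z.coord_bb, Y.op_apply, Y.μ_apply]
    generalize Y.F.V (q ⊗ₜ r) = w
    induction w with
    | zero => simp
    | add a b ha hb => simp only [map_add, TensorProduct.tmul_add, LinearMap.add_apply, ha, hb]
    | tmul z c =>
      rw [liftT_tmul, sliceL_tmul, TensorProduct.tmul_smul, map_smul, GaloisIntegral.K,
        LinearMap.comp_apply, LinearEquiv.coe_coe]
      generalize Y.F.W.symm (p ⊗ₜ c) = t
      induction t with
      | zero => simp
      | add a b ha hb => simp only [map_add, smul_add, LinearMap.add_apply, ha, hb]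
      | tmul a b => simp [ε_bb, smul_smul, mul_comm]
  · intro a b c h h'
    simp only [TensorProduct.tmul_add, map_add, mul_add, h, h']
  · intro a b c h h'
    simp only [TensorProduct.add_tmul, map_add, add_mul, h, h']

lemma counit_U (a b : B) : sliceR (Z.ε : B →ₗ[k] k) (Z.U (a ⊗ₜ b)) = a * b := by
  refine Z.bb_mul_induction (P := fun a b => sliceR (Z.ε : B →ₗ[k] k) (Z.U (a ⊗ₜ b)) = a * b)
    (by simp) (by simp) (fun p q r s => ?_) ?_ ?_ a b
  · obtain ⟨p, rfl⟩ := Y.σX.surjective p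
    obtain ⟨q, rfl⟩ := Y.σX.symm.surjective q
    rw [U_bb, mul_bb, Z.coord_bb, Y.op_apply, Y.μ_σX_symm, Y.leg_apply]
    generalize Y.F.W (r ⊗ₜ q) = w
    induction w with
    | zero => simp
    | add a b ha hb => simp only [map_add, TensorProduct.tmul_add, LinearMap.add_apply, ha, hb]
    | tmul z c =>
      rw [liftU_tmul, sliceL_tmul, TensorProduct.tmul_smul, map_smul, ← Y.σX_K', GaloisIntegral.K',
        LinearMap.comp_apply, LinearEquiv.coe_coe]
      have hz : Y.φX (Y.σX.symm z) = Y.φX z := by rw [← Y.φX_σX, LinearEquiv.apply_symm_apply]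
      generalize Y.F.V.symm (p ⊗ₜ Y.σ.symm c) = t
      induction t with
      | zero => simp
      | add a b ha hb => simp only [map_add, smul_add, LinearMap.add_apply, ha, hb]
      | tmul a b => simp [ε_bb, smul_smul, mul_comm, Y.φX_σX, hz]
  · intro a b c h h'
    simp only [TensorProduct.tmul_add, map_add, mul_add, h, h']
  · intro a b c h h'
    simp only [TensorProduct.add_tmul, map_add, add_mul, h, h']

/-- The reflected multiplier Hopf algebra. -/
def hopfData : LeftHopfData k B where
  nontrivial := by
    obtain ⟨p, q, h⟩ := Z.exists_bb_ne_zero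
    exact ⟨_, _, h⟩
  nondegenerate := Z.nondegenerate
  L := Z.L
  L_mul := Z.L_mul
  T := Z.T
  U := Z.U
  mulR1_T := Z.mulR1_T
  mulR2_U := Z.mulR2_U
  T_surjective := Z.T_surjective
  U_surjective := Z.U_surjective
  coassoc := Z.coassoc
  ε := Z.ε
  counit_T := Z.counit_T
  counit_U := Z.counit_U
  S := Z.S
  S_mul := Z.S_mul
  antipode_T := Z.antipode_T

end Reflection

/-! ### Invariant functionals on `X` and on the reflected algebra -/

lemma PreFrame.V_slice_T2 (F : PreFrame H X) (g : Module.Dual k A) (z x : X) (c : A) :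
    F.V (z ⊗ₜ sliceR g (F.T2 (x ⊗ₜ c))) =
      (sliceR g ∘ₗ H.T2Δ.toLinearMap ∘ₗ TensorProduct.mk k A A c).lTensor X
        (F.V (z ⊗ₜ x)) := by
  have h := congrArg ((sliceR g).lTensor X) (F.coassoc_T2 x z c)
  rw [lTensor_sliceR_assoc, sliceR_rTensor, ← LinearMap.comp_apply (LinearMap.lTensor X _),
    ← LinearMap.lTensor_comp] at h
  exact h

lemma Frame.W_slice_T2 (F : Frame H X) (g : Module.Dual k A) (x z : X) (c : A) :
    F.W (sliceR g (F.T2 (x ⊗ₜ c)) ⊗ₜ z) =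
      (sliceR g ∘ₗ H.T2Δ.toLinearMap ∘ₗ TensorProduct.mk k A A c).lTensor X
        (F.W (x ⊗ₜ z)) := by
  apply eq_of_mulL1 F.nondegenerate
  intro y
  rw [mulL1_lTensor, F.mulL1_W, F.mulL1_W, F.V_slice_T2, mulR1_lTensor]

lemma HopfMaps.T2_surjective (C : HopfMaps H) (F : PreFrame H X) : Function.Surjective F.T2 := by
  intro t
  rw [← LinearMap.mem_range]
  induction t with
  | zero => simp
  | add a b ha hb => exact add_mem ha hb
  | tmul x b => exact ⟨_, by simpa using C.T2_Ssymm_T1 F x (C.S b)⟩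

lemma Integral.sliceL_psi_Q {φ : Module.Dual k A} (I : Integral H φ) (c a : A) :
    sliceL (φ ∘ₗ I.S.toLinearMap) (H.T2Δ (c ⊗ₜ a)) = φ (I.S a) • c := by
  apply H.nondegenerate.eq_of_mul_right
  intro b
  rw [← sliceL_mulR2, ← H.mulL2_T, sliceL_mulL2, I.right_inv, mul_smul_comm, smul_mul_assoc]

/-- A non-zero invariant functional on `X`. -/
theorem Integral.exists_invariant {φ : Module.Dual k A} (I : Integral H φ) (F : PreFrame H X) :
    ∃ ψX : Module.Dual k X, ψX ≠ 0 ∧ (∀ x a, sliceL ψX (F.T1 (x ⊗ₜ a)) = ψX x • a) ∧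
      ∀ x a, sliceL ψX (F.T2 (x ⊗ₜ a)) = ψX x • a := by
  let ψ : Module.Dual k A := φ ∘ₗ I.S.toLinearMap
  -- Each functional (ω ⊗ ψ)((z ⊗ 1)α(·)) is invariant, by coassociativity and right invariance of
  -- ψ. They cannot all vanish, because V is onto and ψ ≠ 0.
  let f (ω : Module.Dual k X) (z : X) : Module.Dual k X :=
    ω ∘ₗ sliceR ψ ∘ₗ F.V.toLinearMap ∘ₗ TensorProduct.mk k X X z
  have hslice : ∀ ω z (t : X ⊗[k] A), sliceL ψ (sliceL ω (TensorProduct.assoc k X A A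
      ((F.V.toLinearMap ∘ₗ TensorProduct.mk k X X z).rTensor A t))) = sliceL (f ω z) t := by
    intro ω z t
    induction t with
    | zero => simp
    | add a b ha hb => simp only [map_add, ha, hb]
    | tmul x a =>
      rw [LinearMap.rTensor_tmul, sliceL_assoc, LinearMap.rTensor_tmul, sliceL_tmul, sliceL_tmul,
        ← apply_sliceR]
      rfl
  have hf1 : ∀ ω z x a, sliceL (f ω z) (F.T1 (x ⊗ₜ a)) = f ω z x • a := by
    intro ω z x a
    rw [← hslice, F.coassoc, sliceL_lTensor]
    refine (I.right_inv _ _).trans ?_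
    congr 1
    exact (apply_sliceR ω ψ _).symm
  have hf2 : ∀ ω z x a, sliceL (f ω z) (F.T2 (x ⊗ₜ a)) = f ω z x • a := by
    intro ω z x a
    rw [← hslice, F.coassoc_T2, sliceL_lTensor]
    refine (I.sliceL_psi_Q _ _).trans ?_
    congr 1
    exact (apply_sliceR ω ψ _).symm
  have hne : ∃ ω z, f ω z ≠ 0 := by
    by_contra! h
    have h1 : ∀ t : X ⊗[k] A, sliceR ψ t = 0 := by
      intro t
      obtain ⟨s, rfl⟩ := F.V.surjective t
      induction s with
      | zero => simp
      | add a b ha hb => simp only [map_add, ha, hb, add_zero]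
      | tmul z x =>
        by_contra hne
        obtain ⟨ω, hω⟩ := exists_dual_eq_one (k := k) hne
        have h0 : f ω z x = 0 := by rw [h]; rfl
        exact one_ne_zero (hω.symm.trans h0)
    obtain ⟨x, hx⟩ := @exists_ne X F.nontrivial 0
    obtain ⟨t, ht⟩ := sliceR_surjective (M := X) (I.comp_S_ne_zero I.ne_zero) x
    exact hx (ht.symm.trans (h1 t))
  obtain ⟨ω, z, hz⟩ := hne
  exact ⟨f ω z, hz, hf1 ω z, hf2 ω z⟩

namespace GaloisIntegral

variable {φ : Module.Dual k A} (Y : GaloisIntegral H X φ)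

lemma leg_slice_T2 (x p : X) (d : A) : Y.leg (sliceR φ (Y.F.T2 (x ⊗ₜ d))) p =
    sliceR φ (H.T2Δ (d ⊗ₜ Y.leg x p)) := by
  rw [leg_apply, Y.F.W_slice_T2, sliceL_lTensor]
  rfl

lemma φX_slice_T2_mul (u p : X) (b : A) :
    Y.φX (sliceR φ (Y.F.T2 (u ⊗ₜ b)) * p) = φ (b * Y.leg u p) := by
  rw [← sliceR_mulR1, ← Y.F.mulL2_W, apply_sliceR, sliceL_mulL2]
  rfl

/-- The form is left linear over the dual of A: [ω₁ · ω, ω'] = ω₁[ω, ω'] with ω₁ = φ(· a) = Ŝ(φ(·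
a')). -/
lemma leg_K (u q : X) {a a' : A} (h : ∀ b, φ (Y.S b * a') = φ (b * a)) :
    Y.leg u (Y.K (q ⊗ₜ a')) = KA (φ := φ) (H := H) (a ⊗ₜ Y.leg u q) := by
  apply Y.toIntegral.faithful_right
  intro b
  rw [← φX_slice_T2_mul, φX_mul_K, leg_slice_T2, ← Y.toHopfMaps.S_slice Y.inv, h, Y.φ_mul_KA]

lemma phiX_slice_V_mul (s x v y p : X) :
    Y.φX (sliceR φ (Y.F.V (s ⊗ₜ x) * (v ⊗ₜ Y.S (Y.leg y p)))) =
      Y.φX (y * Y.op p x (v * Y.σX s)) := by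
  have h1 : ∀ w : X ⊗[k] X, Y.φX (sliceR φ (Y.F.V (s ⊗ₜ x) * Y.F.W w)) =
      Y.φX (x * sliceR Y.φX (mulR2 (Y.σX s) w)) := by
    intro w
    induction w with
    | zero => simp
    | add a b ha hb => simp only [map_add, mul_add, ha, hb]
    | tmul m n =>
      rw [Frame.slice_V_mul_W Y.φX_left]
      simp [mul_smul_comm, Y.σX_spec, mul_comm]
  have h2 : mulR2 (Y.σX s) (Y.F.W.symm (v ⊗ₜ Y.S (Y.leg y p))) =
      Y.F.W.symm ((v * Y.σX s) ⊗ₜ Y.S (Y.leg y p)) := by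
    rw [LinearEquiv.eq_symm_apply, Y.F.W_mulR2, LinearEquiv.apply_symm_apply, mulR1_tmul]
  have h3 := h1 (Y.F.W.symm (v ⊗ₜ Y.S (Y.leg y p)))
  rw [LinearEquiv.apply_symm_apply, h2, Frame.sliceR_W_symm_S Y.toHopfMaps Y.φX_right,
    φX_mul_slice_T2] at h3
  rw [h3, φX_mul_op]

/-- An invariant functional is faithful. -/
lemma invariant_faithful {ψX : Module.Dual k X} (hψ0 : ψX ≠ 0)
    (hψ : ∀ x a, sliceL ψX (Y.F.T1 (x ⊗ₜ a)) = ψX x • a) (n : X) (hn : ∀ y, ψX (y * n) = 0) :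
    n = 0 := by
  obtain ⟨y, hy⟩ := exists_eq_one_of_ne_zero hψ0
  apply Y.eq_of_phiX_right
  intro s
  -- Multiplying by (1 ⊗ c)α(x) replaces α(sn) by α(xsn); invariance applies there and ψ_X(xsn) = 0.
  -- Such elements span X ⊗ A, so (ψ_X ⊗ ι)((y ⊗ 1)α(sn)) = 0, and φ gives ψ_X(y)φ_X(sn) = 0.
  have h1 : ∀ (a : A) (r : X ⊗[k] A), sliceL ψX (r * Y.F.T1 ((s * n) ⊗ₜ a)) = 0 := by
    intro a r
    obtain ⟨r, rfl⟩ := Y.toHopfMaps.T2_surjective Y.F.toPreFrame r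
    induction r with
    | zero => simp
    | add a b ha hb => simp only [map_add, add_mul, ha, hb, add_zero]
    | tmul x c =>
      have h2 : Y.F.T2 (x ⊗ₜ c) * Y.F.T1 ((s * n) ⊗ₜ a) =
          mulL2 c (Y.F.T1 ((x * (s * n)) ⊗ₜ a)) := by
        apply Mult.of_injective (k := k) Y.F.ndXA
        rw [Mult.of_mul Y.F.ndXA, Y.F.T2_spec, mul_assoc, ← Mult.of_lmul Y.F.ndXA, Y.F.lmul_T1,
          Mult.of_mulL2 Y.F.nondegenerate H.nondegenerate]
      rw [h2, sliceL_mulL2, hψ, ← mul_assoc, hn, zero_smul, mul_zero]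
  have h3 : sliceL ψX (Y.F.V (y ⊗ₜ (s * n))) = 0 := by
    apply H.nondegenerate.left
    intro a
    rw [← sliceL_mulR2, ← Y.F.mulL1_T1]
    apply H.nondegenerate.right
    intro c
    rw [← sliceL_mulL2, ← tmul_mul_eq]
    exact h1 a _
  have h4 := apply_sliceR ψX φ (Y.F.V (y ⊗ₜ (s * n)))
  rw [h3, Y.φX_right] at h4
  simpa [hy] using h4

/-- The invariant functionals are related to `φ_X` by a bijective left module map. -/
lemma exists_ρ {ψX : Module.Dual k X} (hψ0 : ψX ≠ 0)
    (hψ : ∀ x a, sliceL ψX (Y.F.T1 (x ⊗ₜ a)) = ψX x • a) :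
    ∃ ρ : X ≃ₗ[k] X, ∀ x y, ψX (x * y) = Y.φX (x * ρ y) :=
  exists_twist_equiv (Frame.phiX_faithful_right Y.toIntegral Y.φX_right)
    (Y.invariant_faithful hψ0 hψ) (Y.F.exists_twist Y.φX_left hψ hψ0)
    (Y.F.exists_twist' Y.φX_left hψ Y.ne_zero)

lemma W_ρ {ρ : X →ₗ[k] X} (hρ : ∀ x y, ρ (x * y) = x * ρ y) (r x : X) :
    Y.F.W (r ⊗ₜ ρ x) = ρ.rTensor A (Y.F.W (r ⊗ₜ x)) := by
  apply eq_of_mulR2 H.nondegenerate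
  intro a
  rw [mulR2_rTensor, ← Y.F.mulR1_T1_eq, ← Y.F.mulR1_T1_eq]
  generalize Y.F.T1 (r ⊗ₜ a) = t
  induction t with
  | zero => simp
  | add a b ha hb => simp only [map_add, ha, hb]
  | tmul y b => simp [hρ]

/-- `z ⊗ c ↦ (φ_X(· z) ⊗ ι) V⁻¹(p ⊗ σ⁻¹(c))`. -/
def twistK (p : X) : X ⊗[k] A →ₗ[k] X :=
  TensorProduct.lift (LinearMap.mk₂ k (fun z c => TensorProduct.lid k X
    (TensorProduct.map (rightTwist Y.φX z) LinearMap.id (Y.F.V.symm (p ⊗ₜ Y.σ.symm c))))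
    (fun z z' c => by simp [TensorProduct.map_add_left])
    (fun r z c => by simp [TensorProduct.map_smul_left])
    (fun z c c' => by simp [TensorProduct.tmul_add])
    (fun r z c => by simp))

lemma twistK_tmul (p z : X) (c : A) : Y.twistK p (z ⊗ₜ c) =
    sliceL (rightTwist Y.φX z) (Y.F.V.symm (p ⊗ₜ Y.σ.symm c)) := rfl

/-- Paired with w, `twistK p t` gives φ_X(p (ι ⊗ φ)(α(w)t)). For t = W(r ⊗ x) the identity
`phi_lmul_W` separates the variables. -/
lemma twistK_W (p r x : X) : Y.twistK p (Y.F.W (r ⊗ₜ x)) = Y.φX (p * x) • Y.σX.symm r := by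
  apply Y.eq_of_phiX_left
  intro w
  have h1 : ∀ t : X ⊗[k] A, Y.φX (Y.twistK p t * w) =
      Y.φX (p * sliceR φ ((Y.F.α w).lmul t)) := by
    intro t
    induction t with
    | zero => simp
    | add a b ha hb => simp only [map_add, add_mul, mul_add, ha, hb]
    | tmul z c =>
      rw [twistK_tmul, ← Y.F.mulR2_W]
      have h2 : ∀ s : X ⊗[k] X, Y.φX (sliceL (rightTwist Y.φX z) s * w) =
          Y.φX (sliceR φ (Y.F.V s * Y.F.W (w ⊗ₜ z))) := by
        intro s
        induction s with
        | zero => simp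
        | add a b ha hb => simp only [map_add, add_mul, ha, hb]
        | tmul a b =>
          rw [Frame.slice_V_mul_W Y.φX_left]
          simp [rightTwist, smul_mul_assoc, mul_comm]
      rw [h2, LinearEquiv.apply_symm_apply]
      generalize Y.F.W (w ⊗ₜ z) = s
      induction s with
      | zero => simp
      | add a b ha hb => simp only [map_add, mul_add, ha, hb]
      | tmul a b =>
        have h3 : φ (b * c) = φ (Y.σ.symm c * b) := by
          rw [← Y.σ_spec (Y.σ.symm c) b, LinearEquiv.apply_symm_apply]
        simp [mul_smul_comm, h3]
  rw [h1, Frame.phi_lmul_W Y.φX_left, mul_smul_comm, smul_mul_assoc, map_smul, map_smul,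
    ← Y.σX_spec (Y.σX.symm r) w, LinearEquiv.apply_symm_apply, smul_eq_mul, smul_eq_mul, mul_comm]

end GaloisIntegral

/-- Left invariance of a functional on the reflected algebra. -/
lemma Reflection.isLeftInvariant {φ : Module.Dual k A} {Y : GaloisIntegral H X φ} {B : Type*}
    [NonUnitalRing B] [Module k B] [IsScalarTower k B B] [SMulCommClass k B B]
    (Z : Reflection Y B) {ρ : X ≃ₗ[k] X} (hρ : ∀ x y, ρ (x * y) = x * ρ y) {φB : Module.Dual k B}
    (hφB : ∀ p x, φB (Z.bb p (Y.σX.symm (ρ x))) = Y.φX (x * p)) :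
    Z.hopfData.toRegular.IsLeftInvariant φB := by
  intro a b
  change sliceR φB (Z.U (a ⊗ₜ b)) = φB a • b
  refine Z.bb_mul_induction (P := fun a b => sliceR φB (Z.U (a ⊗ₜ b)) = φB a • b)
    (by simp) (by simp) (fun p q r s => ?_) ?_ ?_ a b
  · obtain ⟨p, rfl⟩ := Y.σX.surjective p
    obtain ⟨q, rfl⟩ := Y.σX.symm.surjective q
    obtain ⟨x, rfl⟩ := ρ.surjective q
    -- The functional φ_B turns the second bracket into a value of φ_X and leaves `twistK` in the
    -- first. As ρ is a left module map, it can be pulled out of W(r ⊗ ρ(x)).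
    have h1 : ∀ w : X ⊗[k] A, sliceR φB (Z.liftU p s (ρ.toLinearMap.rTensor A w)) =
        Z.bb (Y.σX (Y.twistK p w)) s := by
      intro w
      induction w with
      | zero => simp
      | add a b ha hb => simp only [map_add, LinearMap.add_apply, ha, hb]
      | tmul z c =>
        rw [LinearMap.rTensor_tmul, Z.liftU_tmul, Y.twistK_tmul]
        generalize Y.F.V.symm (p ⊗ₜ Y.σ.symm c) = t
        induction t with
        | zero => simp
        | add a b ha hb => simp only [map_add, LinearMap.add_apply, ha, hb]
        | tmul a b => simp [hφB, rightTwist, Y.σX_spec]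
    rw [Z.U_bb, hφB]
    have h2 := Y.W_ρ (ρ := ρ.toLinearMap) hρ r x
    rw [LinearEquiv.coe_coe] at h2
    rw [h2, h1, Y.twistK_W, Y.σX_spec]
    simp
  · intro a b c h h'
    simp only [TensorProduct.tmul_add, map_add, smul_add, h, h']
  · intro a b c h h'
    simp only [TensorProduct.add_tmul, map_add, add_smul, h, h']

/-! ### The dual structure and the reflected algebra -/

namespace GaloisIntegral

variable {φ : Module.Dual k A} (Y : GaloisIntegral H X φ)

/-- `p ⊗ x ↦ φ_X(· p) · Ŝ(φ(· σ(x₍₁₎))) ⊗ φ_X(· σ_X(s x₍₀₎))`, in coordinates; here `lam` stands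
for `Ŝ`. -/
def balance (lam : A →ₗ[k] A) (s : X) : X ⊗[k] X →ₗ[k] X ⊗[k] X :=
  TensorProduct.lift (LinearMap.mk₂ k (fun p x => TensorProduct.comm k X X
    (TensorProduct.map Y.σX.toLinearMap (Y.K ∘ₗ TensorProduct.mk k X A p ∘ₗ lam ∘ₗ
      Y.σ.toLinearMap) (Y.F.V (s ⊗ₜ x))))
    (fun p p' x => by simp [TensorProduct.map_add_right, LinearMap.add_comp, LinearMap.comp_add])
    (fun r p x => by simp [TensorProduct.map_smul_right, LinearMap.smul_comp, LinearMap.comp_smul])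
    (fun p x x' => by simp [TensorProduct.tmul_add])
    (fun r p x => by simp))

lemma balance_tmul (lam : A →ₗ[k] A) (s p x : X) : Y.balance lam s (p ⊗ₜ x) =
    TensorProduct.comm k X X (TensorProduct.map Y.σX.toLinearMap
      (Y.K ∘ₗ TensorProduct.mk k X A p ∘ₗ lam ∘ₗ Y.σ.toLinearMap) (Y.F.V (s ⊗ₜ x))) := rfl

/-- The right side involves t only through its operator, so `balance` factors through operators.
This is the core of the injectivity of X̂ ⊗_Â X̂ → B. -/
lemma pair_balance {lam : A →ₗ[k] A} (hlam : ∀ b a, φ (Y.S b * a) = φ (b * lam a)) (s y v : X)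
    (t : X ⊗[k] X) : Y.pair y v (Y.balance lam s t) =
      Y.φX (y * TensorProduct.lift Y.op t (v * Y.σX s)) := by
  induction t with
  | zero => simp
  | add a b ha hb => simp only [map_add, LinearMap.add_apply, mul_add, ha, hb]
  | tmul p x =>
    rw [TensorProduct.lift.tmul, ← Y.phiX_slice_V_mul, balance_tmul]
    generalize Y.F.V (s ⊗ₜ x) = t
    induction t with
    | zero => simp
    | add a b ha hb => simp only [map_add, add_mul, ha, hb]
    | tmul w c => simp [Y.φX_mul_K, ← hlam, Y.σ_spec, Y.σX_spec]

lemma balance_eq_zero {lam : A →ₗ[k] A} (hlam : ∀ b a, φ (Y.S b * a) = φ (b * lam a)) (s : X)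
    {t : X ⊗[k] X} (ht : TensorProduct.lift Y.op t = 0) : Y.balance lam s t = 0 := by
  apply Y.eq_of_pair
  intro y v
  rw [Y.pair_balance hlam, ht]
  simp

end GaloisIntegral

namespace StructureMaps

variable {G : GaloisObject H X} {φ : Module.Dual k A} (D : StructureMaps G φ)
  (hφ : H.IsLeftInvariant φ) (hφ0 : φ ≠ 0)

/-- The counit and the antipode of `A`. -/
def hopfMaps : HopfMaps H := ⟨D.ε, D.counit, D.S, D.antipode⟩

/-- The data of the Galois object and its invariant functional. -/
def integral : GaloisIntegral H X φ where
  toHopfMaps := D.hopfMaps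
  inv := hφ
  ne_zero := hφ0
  σ := (D.hopfMaps.exists_sigma hφ hφ0).choose
  σ_mul := (D.hopfMaps.exists_sigma hφ hφ0).choose_spec.1
  σ_spec := (D.hopfMaps.exists_sigma hφ hφ0).choose_spec.2
  F :=
    { toPreFrame := G.toPreFrame
      T1_bijective := D.hopfMaps.T1_bijective G.toPreFrame
      W := D.W
      W_spec := D.W_spec }
  φX := D.φX
  φX_left := D.φX_left
  φX_right := D.φX_right
  σX := D.σX
  σX_mul := D.σX_mul
  σX_spec := D.σX_spec

/-- `u ↦ φ_X(· u)` as a bijection. -/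
def hatEquiv : X ≃ₗ[k] D.Xhat := RestrictedDual.mkEquiv D.φX_faithful_right

lemma hatEquiv_apply (u : X) : D.hatEquiv u = D.hat u := rfl

lemma hat_apply (u x : X) : D.hat u x = D.φX (x * u) := rfl

/-- `p ⊗ q ↦ φ_X(· p) ⊗ φ_X(· σ_X(q))`. -/
def hat₂ : X ⊗[k] X ≃ₗ[k] D.Xhat ⊗[k] D.Xhat :=
  TensorProduct.congr D.hatEquiv (D.σX.trans D.hatEquiv)

lemma J_eq (hφ : H.IsLeftInvariant φ) (hφ0 : φ ≠ 0) (u : X) (a : A) :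
    D.J u a = sliceR φ (G.T2 (u ⊗ₜ a)) :=
  Frame.sliceR_W_symm_S (F := (D.integral hφ hφ0).F) D.hopfMaps D.φX_right u a

/-- `a ↦ φ(· a)` as a bijection. -/
def toAhatEquiv (D : StructureMaps G φ) (hφ : H.IsLeftInvariant φ) (hφ0 : φ ≠ 0) :
    A ≃ₗ[k] Ahat φ :=
  RestrictedDual.mkEquiv (D.hopfMaps.faithful_right hφ hφ0)

lemma toAhatEquiv_apply (a : A) : D.toAhatEquiv hφ hφ0 a = toAhat φ a := rfl

/-- In coordinates where the second argument is φ_X(q ·) = φ_X(· σ_X(q)), the map τ is the transpose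
of θ_X. Its relation to K' is the transpose of `hJ`. -/
lemma exists_tau {θhat : D.Xhat ≃ₗ[k] D.Xhat} (hθ : ∀ (ω : D.Xhat) (x : X), θhat ω x = ω (D.θX x))
    (hJ : ∀ w a, D.θX (sliceR φ (G.T1 (w ⊗ₜ a))) = D.J (D.σX w) a) :
    ∃ τ : X ≃ₗ[k] X, (∀ q, D.hat (τ q) = θhat (D.hat (D.σX q))) ∧
      ∀ q a, (D.integral hφ hφ0).K (τ q ⊗ₜ a) = (D.integral hφ hφ0).K' (q ⊗ₜ a) := by
  let τ : X ≃ₗ[k] X := ((D.σX.trans D.hatEquiv).trans θhat).trans D.hatEquiv.symm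
  have hτ : ∀ q, D.hat (τ q) = θhat (D.hat (D.σX q)) := fun q =>
    D.hatEquiv.apply_symm_apply _
  refine ⟨τ, hτ, fun q a => ?_⟩
  apply (D.integral hφ hφ0).eq_of_phiX_right
  intro x
  rw [(D.integral hφ hφ0).φX_mul_K']
  change D.hat (τ q) (sliceR φ (G.T1 (x ⊗ₜ a))) = _
  rw [hτ, hθ, hJ, D.J_eq hφ hφ0, hat_apply, D.σX_spec]
  refine ((D.integral hφ hφ0).φX_mul_slice_T2 _ _ _).trans ?_
  rw [← (D.integral hφ hφ0).φX_K'_mul]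
  exact D.σX_spec _ _

theorem exists_dualStructure {θhat : D.Xhat ≃ₗ[k] D.Xhat}
    (hθ : ∀ (ω : D.Xhat) (x : X), θhat ω x = ω (D.θX x)) (hφ : H.IsLeftInvariant φ)
    (hφ0 : φ ≠ 0) : ∃ E : DualStructure D, E.θhat = θhat := by
  let Y := D.integral hφ hφ0
  refine ⟨{
    act := ((TensorProduct.mk k X A).compr₂ (D.hat ∘ₗ Y.K)).compl₁₂ D.hatEquiv.symm.toLinearMap
      (D.toAhatEquiv hφ hφ0).symm.toLinearMap
    act_spec := ?_
    form := (Y.leg.flip.compr₂ (toAhat φ)).compl₁₂ D.hatEquiv.symm.toLinearMap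
      D.hatEquiv.symm.toLinearMap
    form_spec := ?_
    -- From φ(S(x)a) = φ(S(S⁻¹(a)x)) = ψ(S⁻¹(a)x).
    Shat := ((D.toAhatEquiv hφ hφ0).symm.trans D.S.symm).trans D.psiHat
    Shat_spec := ?_
    θhat := θhat
    θhat_spec := hθ }, rfl⟩
  · intro ω a x
    obtain ⟨p, rfl⟩ := D.hatEquiv.surjective ω
    rw [← D.toAhatEquiv_apply hφ hφ0]
    simp only [LinearMap.compl₁₂_apply, LinearMap.compr₂_apply, LinearEquiv.coe_coe,
      LinearEquiv.symm_apply_apply]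
    exact Y.φX_mul_K' x p a
  · intro ω u a t ht
    obtain ⟨p, rfl⟩ := D.hatEquiv.surjective ω
    rw [D.β_right] at ht
    have h := Mult.of_injective (k := k) (G.nondegenerate.tensor G.nondegenerate) ht
    rw [h, ← D.hatEquiv_apply u]
    simp only [LinearMap.compl₁₂_apply, LinearMap.compr₂_apply, LinearEquiv.coe_coe,
      LinearEquiv.symm_apply_apply]
    change φ (a * Y.leg u p) = D.φX (D.J u a * p)
    rw [D.J_eq hφ hφ0]
    exact (Y.φX_slice_T2_mul u p a).symm
  · intro ω a
    obtain ⟨c, rfl⟩ := (D.toAhatEquiv hφ hφ0).surjective ω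
    simp only [LinearEquiv.trans_apply, LinearEquiv.symm_apply_apply]
    rw [D.psiHat_spec, D.antipode.map_mul, LinearEquiv.apply_symm_apply]
    rfl

end StructureMaps

namespace DualStructure

variable {G : GaloisObject H X} {φ : Module.Dual k A} {D : StructureMaps G φ}
  (E : DualStructure D) (hφ : H.IsLeftInvariant φ) (hφ0 : φ ≠ 0)

lemma act_hat (p : X) (a : A) :
    E.act (D.hat p) (toAhat φ a) = D.hat ((D.integral hφ hφ0).K (p ⊗ₜ a)) := by
  apply RestrictedDual.ext
  intro x
  rw [E.act_spec]
  exact ((D.integral hφ hφ0).φX_mul_K' x p a).symm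

lemma form_hat (p u : X) :
    E.form (D.hat p) (D.hat u) = toAhat φ ((D.integral hφ hφ0).leg u p) := by
  apply RestrictedDual.ext
  intro a
  rw [E.form_spec _ u a _ (D.β_right u a).symm]
  change D.φX (D.J u a * p) = _
  rw [D.J_eq hφ hφ0]
  exact (D.integral hφ hφ0).φX_slice_T2_mul u p a

/-- The antipode of the dual of `A`, in coordinates. -/
def lam : A ≃ₗ[k] A :=
  ((D.toAhatEquiv hφ hφ0).trans E.Shat).trans (D.toAhatEquiv hφ hφ0).symm

lemma toAhat_lam (a : A) : toAhat φ (E.lam hφ hφ0 a) = E.Shat (toAhat φ a) :=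
  (D.toAhatEquiv hφ hφ0).apply_symm_apply _

lemma phi_lam (b a : A) : φ (D.S b * a) = φ (b * E.lam hφ hφ0 a) := by
  have h := E.Shat_spec (toAhat φ a) b
  rw [← E.toAhat_lam hφ hφ0] at h
  exact h.symm

lemma leftAct_hat (q : X) (a : A) : E.leftAct (toAhat φ (E.lam hφ hφ0 a)) (D.hat q) =
    D.hat ((D.integral hφ hφ0).K (q ⊗ₜ a)) := by
  rw [leftAct, toAhat_lam, LinearEquiv.symm_apply_apply, E.act_hat hφ hφ0]

lemma bracket_hat (p q u : X) : E.bracket (D.hat p) (D.hat (D.σX q)) (D.hat u) =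
    D.hat ((D.integral hφ hφ0).op p q u) := by
  change E.act (D.hat p) (E.form (D.hat (D.σX q)) (D.hat u)) = _
  rw [E.form_hat hφ hφ0, E.act_hat hφ hφ0, GaloisIntegral.op_apply,
    ← (D.integral hφ hφ0).leg_σX]
  rfl

/-- The linear map `ω ⊗ ω' ↦ [ω, ω']_B`. -/
def bracketLin : D.Xhat ⊗[k] D.Xhat →ₗ[k] Module.End k D.Xhat :=
  TensorProduct.lift (LinearMap.mk₂ k E.bracket
    (fun _ _ _ => by simp [bracket, LinearMap.add_comp])
    (fun _ _ _ => by simp [bracket, LinearMap.smul_comp])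
    (fun _ _ _ => by simp [bracket, LinearMap.comp_add])
    (fun _ _ _ => by simp [bracket, LinearMap.comp_smul]))

lemma bracketLin_tmul (ω ω' : D.Xhat) : E.bracketLin (ω ⊗ₜ ω') = E.bracket ω ω' := rfl

lemma bracketLin_hat₂ (t : X ⊗[k] X) (u : X) : E.bracketLin (D.hat₂ t) (D.hat u) =
    D.hat (TensorProduct.lift (D.integral hφ hφ0).op t u) := by
  induction t with
  | zero => simp
  | add a b ha hb => simp only [map_add, LinearMap.add_apply, ha, hb]
  | tmul p q => exact E.bracket_hat hφ hφ0 p q u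

lemma balancing_le_ker (hφ : H.IsLeftInvariant φ) (hφ0 : φ ≠ 0) :
    E.balancing ≤ LinearMap.ker E.bracketLin := by
  rw [balancing, Submodule.span_le]
  rintro _ ⟨ω, ω', ω₁, rfl⟩
  obtain ⟨p, rfl⟩ := D.hatEquiv.surjective ω
  obtain ⟨q, rfl⟩ := D.hatEquiv.surjective ω'
  obtain ⟨a, rfl⟩ := (D.toAhatEquiv hφ hφ0).surjective ω₁
  obtain ⟨a, rfl⟩ := (E.lam hφ hφ0).surjective a
  rw [SetLike.mem_coe, LinearMap.mem_ker, map_sub, sub_eq_zero, bracketLin_tmul, bracketLin_tmul]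
  ext ω : 1
  obtain ⟨u, rfl⟩ := D.hatEquiv.surjective ω
  change E.act (E.act (D.hat p) (toAhat φ _)) (E.form (D.hat q) (D.hat u)) =
    E.act (D.hat p) (E.form (E.leftAct (toAhat φ _) (D.hat q)) (D.hat u))
  rw [E.leftAct_hat, E.form_hat hφ hφ0, E.form_hat hφ hφ0, E.act_hat hφ hφ0, E.act_hat hφ hφ0,
    E.act_hat hφ hφ0,
    (D.integral hφ hφ0).leg_K u q (a := E.lam hφ hφ0 a) (E.phi_lam hφ hφ0 · a),
    GaloisIntegral.K_KA]

/-- As φ_X(s) = 1, x = K'(V(s ⊗ x)), and σ_X turns K' into a translation by the dual of A. The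
balancing relations move this translation to the first factor, where it gives `balance`. -/
lemma hat₂_sub_balance_mem {s : X} (hs : D.φX s = 1) (t : X ⊗[k] X) : D.hat₂ t -
    TensorProduct.map D.hat D.hat ((D.integral hφ hφ0).balance (E.lam hφ hφ0).toLinearMap s t) ∈
      E.balancing := by
  induction t with
  | zero => simp
  | add a b ha hb => simp only [map_add, add_sub_add_comm]; exact add_mem ha hb
  | tmul p x =>
    have key : ∀ t : X ⊗[k] A, D.hat p ⊗ₜ D.hat (D.σX ((D.integral hφ hφ0).K' t)) -
        TensorProduct.map D.hat D.hat (TensorProduct.comm k X X (TensorProduct.map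
          D.σX.toLinearMap ((D.integral hφ hφ0).K ∘ₗ TensorProduct.mk k X A p ∘ₗ
            (E.lam hφ hφ0).toLinearMap ∘ₗ (D.integral hφ hφ0).σ.toLinearMap) t)) ∈
          E.balancing := by
      intro t
      induction t with
      | zero => simp
      | add a b ha hb =>
        simp only [map_add, TensorProduct.tmul_add, add_sub_add_comm]; exact add_mem ha hb
      | tmul w c =>
        have h := (D.integral hφ hφ0).σX_K' w ((D.integral hφ hφ0).σ c)
        rw [LinearEquiv.symm_apply_apply] at h
        change D.σX _ = (D.integral hφ hφ0).K (D.σX w ⊗ₜ _) at h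
        rw [h, ← E.leftAct_hat]
        simp only [TensorProduct.map_tmul, TensorProduct.comm_tmul, LinearMap.comp_apply,
          TensorProduct.mk_apply, LinearEquiv.coe_coe]
        rw [← E.act_hat hφ hφ0, ← neg_sub]
        exact neg_mem (Submodule.subset_span ⟨_, _, _, rfl⟩)
    have h := key (G.V (s ⊗ₜ x))
    have hK : (D.integral hφ hφ0).K' (G.V (s ⊗ₜ x)) = x := by
      refine ((D.integral hφ hφ0).K'_V _).trans ?_
      change sliceL D.φX _ = _
      rw [sliceL_tmul, hs, one_smul]
    rw [hK] at h
    exact h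

lemma ker_bracketLin (hφ : H.IsLeftInvariant φ) (hφ0 : φ ≠ 0) :
    LinearMap.ker E.bracketLin = E.balancing := by
  refine le_antisymm (fun ξ hξ => ?_) (E.balancing_le_ker hφ hφ0)
  obtain ⟨t, rfl⟩ := D.hat₂.surjective ξ
  have h0 : TensorProduct.lift (D.integral hφ hφ0).op t = 0 := by
    ext u
    apply D.hatEquiv.injective
    rw [D.hatEquiv_apply, ← E.bracketLin_hat₂ hφ hφ0, LinearMap.mem_ker.1 hξ]
    simp
  obtain ⟨s, hs⟩ := exists_eq_one_of_ne_zero (D.integral hφ hφ0).φX_ne_zero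
  have h := E.hat₂_sub_balance_mem hφ hφ0 hs t
  rwa [(D.integral hφ hφ0).balance_eq_zero (lam := (E.lam hφ hφ0).toLinearMap)
    (E.phi_lam hφ hφ0) s h0, map_zero, sub_zero] at h

lemma range_bracketLin : LinearMap.range E.bracketLin =
    Submodule.span k (Set.range fun p : D.Xhat × D.Xhat => E.bracket p.1 p.2) := by
  apply le_antisymm
  · rintro _ ⟨t, rfl⟩
    induction t with
    | zero => simp
    | add a b ha hb => rw [map_add]; exact add_mem ha hb
    | tmul ω ω' => exact Submodule.subset_span ⟨(ω, ω'), rfl⟩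
  · rw [Submodule.span_le]
    rintro _ ⟨p, rfl⟩
    exact ⟨p.1 ⊗ₜ p.2, rfl⟩

lemma bracketLin_mul_mem (hφ : H.IsLeftInvariant φ) (hφ0 : φ ≠ 0) (s t : D.Xhat ⊗[k] D.Xhat) :
    E.bracketLin s * E.bracketLin t ∈ LinearMap.range E.bracketLin := by
  obtain ⟨s, rfl⟩ := D.hat₂.surjective s
  obtain ⟨t, rfl⟩ := D.hat₂.surjective t
  induction t with
  | zero => simp
  | add a b ha hb => rw [map_add, map_add, mul_add]; exact add_mem ha hb
  | tmul p q =>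
    refine ⟨D.hat₂ (TensorProduct.lift (D.integral hφ hφ0).op s p ⊗ₜ q), ?_⟩
    ext ω : 1
    obtain ⟨u, rfl⟩ := D.hatEquiv.surjective ω
    rw [Module.End.mul_apply, D.hatEquiv_apply, E.bracketLin_hat₂ hφ hφ0,
      E.bracketLin_hat₂ hφ hφ0, E.bracketLin_hat₂ hφ hφ0]
    congr 1
    rw [TensorProduct.lift.tmul, TensorProduct.lift.tmul]
    induction s with
    | zero => simp
    | add a b ha hb => simp only [map_add, LinearMap.add_apply, ha, hb]
    | tmul r s => simp [GaloisIntegral.op_op]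

theorem exists_reflectedAlgebra (hφ : H.IsLeftInvariant φ) (hφ0 : φ ≠ 0) :
    Nonempty (ReflectedAlgebra E) := by
  let B : NonUnitalSubalgebra k (Module.End k D.Xhat) :=
    { LinearMap.range E.bracketLin with
      mul_mem' := by
        rintro _ _ ⟨s, rfl⟩ ⟨t, rfl⟩
        exact E.bracketLin_mul_mem hφ hφ0 s t }
  exact ⟨{
    B := B
    B_eq_span := E.range_bracketLin
    π := (Submodule.quotEquivOfEq _ _ (E.ker_bracketLin hφ hφ0).symm).trans
      E.bracketLin.quotKerEquivRange
    π_spec := fun ω ω' => rfl }⟩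

end DualStructure

/-! ### The reflected algebraic quantum group -/

namespace ReflectedAlgebra

variable {G : GaloisObject H X} {φ : Module.Dual k A} {D : StructureMaps G φ}
  {E : DualStructure D} (R : ReflectedAlgebra E) (hφ : H.IsLeftInvariant φ) (hφ0 : φ ≠ 0)

/-- The linear map `ω ⊗ ω' ↦ [ω, ω']_B` onto `B`. -/
def brLin : D.Xhat ⊗[k] D.Xhat →ₗ[k] R.B := R.π.toLinearMap ∘ₗ E.balancing.mkQ

lemma brLin_surjective : Function.Surjective R.brLin :=
  R.π.surjective.comp (Submodule.mkQ_surjective _)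

lemma incl_br (ω ω' : D.Xhat) : R.incl (R.br ω ω') = E.bracket ω ω' := R.π_spec ω ω'

/-- `B` as an algebra of operators on `X`. -/
def reflection {τ : X ≃ₗ[k] X}
    (hτ : ∀ q a, (D.integral hφ hφ0).K (τ q ⊗ₜ a) = (D.integral hφ hφ0).K' (q ⊗ₜ a)) :
    Reflection (D.integral hφ hφ0) R.B where
  coord := D.hatEquiv.symm.conj.toLinearMap ∘ₗ R.incl
  coord_mul a b := D.hatEquiv.symm.conj_comp (R.incl b) (R.incl a)
  coord_injective := D.hatEquiv.symm.conj.injective.comp Subtype.val_injective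
  bb := ((TensorProduct.mk k X X).compr₂ (R.brLin ∘ₗ D.hat₂.toLinearMap))
  coord_bb p q := by
    ext u
    change D.hatEquiv.symm (R.incl (R.br (D.hat p) (D.hat (D.σX q))) (D.hat u)) = _
    rw [R.incl_br, E.bracket_hat hφ hφ0, ← D.hatEquiv_apply, LinearEquiv.symm_apply_apply]
  bb_span b := by
    obtain ⟨t, rfl⟩ := R.brLin_surjective b
    obtain ⟨t, rfl⟩ := D.hat₂.surjective t
    exact ⟨t, tensor_ext (f := TensorProduct.lift ((TensorProduct.mk k X X).compr₂
      (R.brLin ∘ₗ D.hat₂.toLinearMap))) (g := R.brLin ∘ₗ D.hat₂.toLinearMap) (fun p q => rfl) t⟩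
  τ := τ
  K_τ := hτ

section

variable {τ : X ≃ₗ[k] X}
  (hτ : ∀ q a, (D.integral hφ hφ0).K (τ q ⊗ₜ a) = (D.integral hφ hφ0).K' (q ⊗ₜ a))

lemma reflection_bb (p q : X) :
    (R.reflection hφ hφ0 hτ).bb p q = R.br (D.hat p) (D.hat (D.σX q)) := rfl

lemma hat_coord (b : R.B) (u : X) :
    D.hat ((R.reflection hφ hφ0 hτ).coord b u) = R.incl b (D.hat u) :=
  D.hatEquiv.apply_symm_apply _

lemma act₂_hat (t : R.B ⊗[k] R.B) (s : X ⊗[k] X) :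
    R.act₂ t (TensorProduct.map D.hat D.hat s) =
      TensorProduct.map D.hat D.hat ((R.reflection hφ hφ0 hτ).act t s) := by
  induction t with
  | zero => simp
  | add a b ha hb => simp only [map_add, LinearMap.add_apply, ha, hb]
  | tmul a b =>
    induction s with
    | zero => simp
    | add a b ha hb => simp only [map_add, ha, hb]
    | tmul u v =>
      rw [Reflection.act_tmul, TensorProduct.map_tmul, TensorProduct.map_tmul, hat_coord,
        hat_coord]
      rfl

lemma eval₂_hat (s : X ⊗[k] X) (x y : X) :
    eval₂ D (TensorProduct.map D.hat D.hat s) x y = (D.integral hφ hφ0).pair x y s := by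
  induction s with
  | zero => simp [eval₂]
  | add a b ha hb => rw [map_add, map_add, ← ha, ← hb]; simp [eval₂]
  | tmul u v => rw [GaloisIntegral.pair_tmul]; rfl

/-- Links the stated formula with G⁻¹(b ⊗ 1)G: once `J` is written as a slice of the coaction, the
value is the one in `pair_amp_op`. -/
lemma comulValue_hat (p q u v x y : X) : D.comulValue p (D.hat (D.σX q)) u v x y =
    (D.integral hφ hφ0).pair x y
      ((D.integral hφ hφ0).amp ((D.integral hφ hφ0).op p q) (u ⊗ₜ v)) := by
  rw [GaloisIntegral.pair_amp_op, StructureMaps.comulValue]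
  change _ = φ (sliceR φ ((D.leg x).rTensor A (D.W (y ⊗ₜ p)) * _))
  generalize D.W (y ⊗ₜ p) = t
  induction t with
  | zero => simp
  | add a b ha hb => simp only [map_add, add_mul, ha, hb]
  | tmul z b =>
    rw [TensorProduct.lift.tmul, D.hat_apply, D.σX_spec]
    change D.φX (q * (D.J v b * D.J u (D.leg x z))) = _
    rw [← mul_assoc, D.J_eq hφ hφ0, D.J_eq hφ hφ0]
    refine ((D.integral hφ hφ0).φX_mul_slice_T2 _ _ _).trans ?_
    have h1 : q * sliceR φ (G.T2 (v ⊗ₜ b)) = sliceR φ (mulL2 b (G.V (q ⊗ₜ v))) := by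
      rw [← sliceR_mulL1]
      exact congrArg (sliceR φ) ((G.toPreFrame.mulL1_T2 v q b).trans
        (G.toPreFrame.mulL2_V v q b).symm)
    rw [h1]
    change _ = φ (sliceR φ (_ * ((D.integral hφ hφ0).μ.flip u).rTensor A (G.V (q ⊗ₜ v))))
    generalize G.V (q ⊗ₜ v) = s
    induction s with
    | zero => simp
    | add a b ha hb => simp only [map_add, LinearMap.add_apply, mul_add, ha, hb]
    | tmul m n => simp [mul_smul_comm]

lemma exists_end_hat (f : Module.End k (X ⊗[k] X)) :
    ∃ N : Module.End k (D.Xhat ⊗[k] D.Xhat), ∀ s,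
      N (TensorProduct.map D.hat D.hat s) = TensorProduct.map D.hat D.hat (f s) := by
  let e : X ⊗[k] X ≃ₗ[k] D.Xhat ⊗[k] D.Xhat := TensorProduct.congr D.hatEquiv D.hatEquiv
  refine ⟨e.conj f, fun s => ?_⟩
  change e.conj f (e s) = e (f s)
  rw [LinearEquiv.conj_apply_apply, LinearEquiv.symm_apply_apply]

lemma ext_hat {f g : Module.End k (D.Xhat ⊗[k] D.Xhat)}
    (h : ∀ s, f (TensorProduct.map D.hat D.hat s) = g (TensorProduct.map D.hat D.hat s)) :
    f = g := by
  refine LinearMap.ext fun ξ => ?_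
  obtain ⟨s, rfl⟩ := (TensorProduct.congr D.hatEquiv D.hatEquiv).surjective ξ
  exact h s

lemma act₂_L (p q : X) {N : Module.End k (D.Xhat ⊗[k] D.Xhat)}
    (hN : ∀ s, N (TensorProduct.map D.hat D.hat s) = TensorProduct.map D.hat D.hat
      ((D.integral hφ hφ0).amp ((D.integral hφ hφ0).op p q) s)) (t : R.B ⊗[k] R.B) :
    R.act₂ ((R.reflection hφ hφ0 hτ).L ((R.reflection hφ hφ0 hτ).bb p q) t) = N ∘ₗ R.act₂ t := by
  apply ext_hat
  intro s
  rw [R.act₂_hat hφ hφ0 hτ, Reflection.act_L, Reflection.coord_bb, LinearMap.comp_apply,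
    R.act₂_hat hφ hφ0 hτ, hN]
  rfl

lemma comulFormula : R.ComulFormula (R.reflection hφ hφ0 hτ).hopfData.toRegular := by
  intro p ω'
  obtain ⟨q, rfl⟩ := (D.σX.trans D.hatEquiv).surjective ω'
  obtain ⟨N, hN⟩ := exists_end_hat (D := D)
    ((D.integral hφ hφ0).amp ((D.integral hφ hφ0).op p q))
  refine ⟨N, R.act₂_L hφ hφ0 hτ p q hN, fun u v x y => ?_⟩
  rw [← TensorProduct.map_tmul, hN, eval₂_hat hφ hφ0]
  exact (comulValue_hat hφ hφ0 p q u v x y).symm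

lemma counit_br (p q : X) :
    (R.reflection hφ hφ0 hτ).ε (R.br (D.hat p) (D.hat q)) = D.φX p * D.φX q := by
  obtain ⟨q, rfl⟩ := D.σX.surjective q
  rw [← R.reflection_bb hφ hφ0 hτ, Reflection.ε_bb]
  exact congrArg (D.φX p * ·) ((D.integral hφ hφ0).φX_σX q).symm

lemma antipode_br (hτ' : ∀ q, D.hat (τ q) = E.θhat (D.hat (D.σX q))) (ω ω' : D.Xhat) :
    (R.reflection hφ hφ0 hτ).S (R.br ω ω') = R.br (E.θhat ω') ω := by
  obtain ⟨p, rfl⟩ := D.hatEquiv.surjective ω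
  obtain ⟨q, rfl⟩ := (D.σX.trans D.hatEquiv).surjective ω'
  refine ((R.reflection hφ hφ0 hτ).S_bb p q).trans ?_
  rw [reflection_bb]
  change R.br (D.hat (τ q)) (D.hat (D.σX (D.σX.symm p))) = _
  rw [hτ', LinearEquiv.apply_symm_apply]
  rfl

/-- Since ψ_X(· x) = φ_X(· ρ(x)), this describes the left action on such functionals: φ(· λ(a)) ·
ψ_X(· x) is ψ_X(· x') with x' a slice of α(x), where λ is Ŝ in coordinates. It makes φ_B compatible
with the balancing. -/
lemma K_ρ (E : DualStructure D) {ψX : Module.Dual k X}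
    (hψ : ∀ x a, sliceL ψX (G.T1 (x ⊗ₜ a)) = ψX x • a) {ρ : X ≃ₗ[k] X}
    (hρ : ∀ x y, ψX (x * y) = D.φX (x * ρ y)) (x : X) (a : A) :
    (D.integral hφ hφ0).K (ρ x ⊗ₜ a) = ρ (sliceR φ (G.T1 (x ⊗ₜ E.lam hφ hφ0 a))) := by
  let Y := D.integral hφ hφ0
  apply Y.eq_of_phiX_right
  intro y
  rw [Y.φX_mul_K']
  refine (hρ _ _).symm.trans (Eq.trans ?_ (hρ _ _))
  have h1 : Y.F.T1 = G.T1 := rfl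
  rw [← sliceR_mulR1, ← sliceR_mulL1, Y.F.mulR1_T1_eq, ← h1, Y.F.mulL1_T1, apply_sliceR,
    apply_sliceR, sliceL_mulR2, sliceL_mulR2, ← E.phi_lam hφ hφ0]
  congr 2
  exact D.hopfMaps.sliceL_W Y.F hψ _

theorem exists_invariant {ψX : Module.Dual k X} (hψ : G.IsInvariant ψX) (hψ0 : ψX ≠ 0) :
    ∃ (ψhat : X ≃ₗ[k] D.Xhat) (φB : Module.Dual k R.B),
      (∀ x y : X, ψhat x y = ψX (y * x)) ∧
      (∀ (ω' : D.Xhat) (x : X), φB (R.br ω' (ψhat x)) = ω' x) ∧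
      (R.reflection hφ hφ0 hτ).hopfData.toRegular.IsLeftInvariant φB ∧ φB ≠ 0 := by
  let Y := D.integral hφ hφ0
  have hψ1 : ∀ x a, sliceL ψX (G.T1 (x ⊗ₜ a)) = ψX x • a := fun x a => (hψ x a).1
  obtain ⟨ρ, hρ⟩ := Y.exists_ρ hψ0 hψ1
  change ∀ x y, ψX (x * y) = D.φX (x * ρ y) at hρ
  have hρmul : ∀ x y, ρ (x * y) = x * ρ y := by
    intro x y
    apply Y.eq_of_phiX_right
    intro z
    change D.φX _ = D.φX _
    rw [← hρ, ← mul_assoc, ← mul_assoc, ← hρ]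
  -- The prescribed value on ω ⊗ φ_X(· u) is ω(ρ⁻¹(u)). It descends to B once it vanishes on the
  -- balancing relations.
  let g : D.Xhat ⊗[k] D.Xhat →ₗ[k] k := TensorProduct.lift
    ((RestrictedDual.incl D.φX).compl₂ (ρ.symm.toLinearMap ∘ₗ D.hatEquiv.symm.toLinearMap))
  have hg : ∀ (ω : D.Xhat) x, g (ω ⊗ₜ D.hat (ρ x)) = ω x := by
    intro ω x
    change ω (ρ.symm (D.hatEquiv.symm (D.hatEquiv (ρ x)))) = _
    rw [LinearEquiv.symm_apply_apply, LinearEquiv.symm_apply_apply]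
  have hbal : E.balancing ≤ LinearMap.ker g := by
    rw [DualStructure.balancing, Submodule.span_le]
    rintro _ ⟨ω, ω', ω₁, rfl⟩
    obtain ⟨x, rfl⟩ := (ρ.trans D.hatEquiv).surjective ω'
    obtain ⟨a, rfl⟩ := (D.toAhatEquiv hφ hφ0).surjective ω₁
    obtain ⟨a, rfl⟩ := (E.lam hφ hφ0).surjective a
    rw [SetLike.mem_coe, LinearMap.mem_ker, map_sub, sub_eq_zero, LinearEquiv.trans_apply,
      D.hatEquiv_apply, D.toAhatEquiv_apply, E.leftAct_hat, K_ρ hφ hφ0 E hψ1 hρ, hg, hg,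
      E.act_spec]
  let φB : Module.Dual k R.B := E.balancing.liftQ g hbal ∘ₗ R.π.symm.toLinearMap
  have hφB : ∀ (ω : D.Xhat) x, φB (R.br ω (D.hat (ρ x))) = ω x := by
    intro ω x
    change E.balancing.liftQ g hbal (R.π.symm (R.π _)) = _
    rw [LinearEquiv.symm_apply_apply, ← hg]
    rfl
  refine ⟨ρ.trans D.hatEquiv, φB, fun x y => (hρ y x).symm, hφB, ?_, ?_⟩
  · refine Reflection.isLeftInvariant _ hρmul fun p x => ?_
    rw [reflection_bb]
    change φB (R.br (D.hat p) (D.hat (D.σX (D.σX.symm (ρ x))))) = _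
    rw [LinearEquiv.apply_symm_apply, hφB]
    rfl
  · intro h0
    obtain ⟨p, hp⟩ := @exists_ne X G.nontrivial 0
    refine hp (D.φX_faithful_right p fun y => ?_)
    rw [← D.hat_apply, ← hφB, h0]
    rfl

end

end ReflectedAlgebra

lemma StructureMaps.exists_isInvariant {G : GaloisObject H X} {φ : Module.Dual k A}
    (D : StructureMaps G φ) (hφ : H.IsLeftInvariant φ) (hφ0 : φ ≠ 0) :
    ∃ ψX : Module.Dual k X, G.IsInvariant ψX ∧ ψX ≠ 0 := by
  obtain ⟨ψX, h0, h1, h2⟩ := (D.integral hφ hφ0).exists_invariant G.toPreFrame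
  exact ⟨ψX, fun x a => ⟨h1 x a, h2 x a⟩, h0⟩

end

end GaloisReflection

open scoped TensorProduct in
open GaloisReflection in
theorem mainTheorem1 {k : Type*} [Field k]
    {A : Type*} [NonUnitalRing A] [Module k A] [IsScalarTower k A A] [SMulCommClass k A A]
    {X : Type*} [NonUnitalRing X] [Module k X] [IsScalarTower k X X] [SMulCommClass k X X]
    (H : RegularMultiplierHopfAlgebra k A)
    (φ : Module.Dual k A) (hφ : H.IsLeftInvariant φ) (hφ0 : φ ≠ 0)
    (G : GaloisObject H X) :
    ∃ (D : StructureMaps G φ) (E : DualStructure D) (R : ReflectedAlgebra E)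
      (HB : RegularMultiplierHopfAlgebra k R.B),
      HB.IsAlgebraicQuantumGroup ∧
      R.ComulFormula HB ∧
      (∃ (εB : R.B →ₙₐ[k] k) (SB : R.B ≃ₗ[k] R.B),
        HB.IsCounit εB ∧
        (∀ p q : X, εB (R.br (D.hat p) (D.hat q)) = D.φX p * D.φX q) ∧
        HB.IsAntipode εB SB ∧
        ∀ ω ω' : D.Xhat, SB (R.br ω ω') = R.br (E.θhat ω') ω) ∧
      (∃ ψX : Module.Dual k X, G.IsInvariant ψX ∧ ψX ≠ 0) ∧
      ∀ ψX : Module.Dual k X, G.IsInvariant ψX → ψX ≠ 0 →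
        ∃ (ψhat : X ≃ₗ[k] D.Xhat) (φB : Module.Dual k R.B),
          (∀ x y : X, ψhat x y = ψX (y * x)) ∧
          (∀ (ω' : D.Xhat) (x : X), φB (R.br ω' (ψhat x)) = ω' x) ∧
          HB.IsLeftInvariant φB ∧ φB ≠ 0 := by
  obtain ⟨D, hJ, θhat, hθ⟩ := exists_structureMaps hφ hφ0 G
  obtain ⟨E, rfl⟩ := D.exists_dualStructure hθ hφ hφ0
  obtain ⟨R⟩ := E.exists_reflectedAlgebra hφ hφ0
  obtain ⟨τ, hτ', hτ⟩ := D.exists_tau hφ hφ0 hθ hJ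
  obtain ⟨ψX, hψ, hψ0⟩ := D.exists_isInvariant hφ hφ0
  obtain ⟨-, φB, -, -, hφB, hφB0⟩ := R.exists_invariant hφ hφ0 hτ hψ hψ0
  exact ⟨D, E, R, (R.reflection hφ hφ0 hτ).hopfData.toRegular, ⟨φB, hφB0, hφB⟩,
    R.comulFormula hφ hφ0 hτ,
    ⟨_, _, (R.reflection hφ hφ0 hτ).hopfData.isCounit, R.counit_br hφ hφ0 hτ,
      (R.reflection hφ hφ0 hτ).hopfData.isAntipode, R.antipode_br hφ hφ0 hτ hτ'⟩,
    ⟨ψX, hψ, hψ0⟩, fun ψX hψ hψ0 => R.exists_invariant hφ hφ0 hτ hψ hψ0⟩
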